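/- Let $q\in\mathbb C^*$ be not a root of unity, fix a square root $q^{1/2}$, let $k_\pm\in\mathbb C^*$ and put $\rho=k_+k_-(q+q^{-1})^2$. Write $[X,Y]=XY-YX$ and $[X,Y]_q=qXY-q^{-1}YX$. **The algebras.** $\mathbb T$ is the $q$-Onsager algebra: the unital $\mathbb C$-algebra generated by $\mathsf A,\mathsf A^*$ with $[\mathsf A,[\mathsf A,[\mathsf A,\mathsf A^*]_q]_{q^{-1}}]=\rho[\mathsf A,\mathsf A^*]$ and $[\mathsf A^*,[\mathsf A^*,[\mathsf A^*,\mathsf A]_q]_{q^{-1}}]=\rho[\mathsf A^*,\mathsf A]$. $\mathcal A_q$ is the unital $\mathbb C$-algebra with generators $\mathcal W_{-k},\mathcal W_{k+1},\mathcal G_{k+1},\tilde{\mathcal G}_{k+1}$ ($k\ge 0$) and relations, for all $k,l\ge0$, $$[\mathcal W_0,\mathcal W_{k+1}]=[\mathcal W_{-k},\mathcal W_1]=\tfrac{1}{q+q^{-1}}(\tilde{\mathcal G}_{k+1}-\mathcal G_{k+1}),$$ $$[\mathcal W_0,\mathcal G_{k+1}]_q=[\tilde{\mathcal G}_{k+1},\mathcal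 W_0]_q=\rho\mathcal W_{-k-1}-\rho\mathcal W_{k+1},\qquad [\mathcal G_{k+1},\mathcal W_1]_q=[\mathcal W_1,\tilde{\mathcal G}_{k+1}]_q=\rho\mathcal W_{k+2}-\rho\mathcal W_{-k},$$ $$[\mathcal W_{-k},\mathcal W_{-l}]=[\mathcal W_{k+1},\mathcal W_{l+1}]=[\mathcal G_{k+1},\mathcal G_{l+1}]=[\tilde{\mathcal G}_{k+1},\tilde{\mathcal G}_{l+1}]=0,$$ and $[X_k,Y_l]+[Y_k,X_l]=0$ for $(X_k,Y_k)$ any one of $(\mathcal W_{-k},\mathcal W_{k+1})$, $(\mathcal W_{-k},\mathcal G_{k+1})$, $(\mathcal W_{-k},\tilde{\mathcal G}_{k+1})$, $(\mathcal W_{k+1},\mathcal G_{k+1})$, $(\mathcal W_{k+1},\tilde{\mathcal G}_{k+1})$, $(\tilde{\mathcal G}_{k+1},\mathcal G_{k+1})$. **Evaluation representation and coaction.** $U_q(\widehat{sl_2})$ is generated by $E_i,F_i,q^{\pm H_i/2}$ ($i=0,1$) with the usual relations for the Cartan matrix $a_{ii}=2$, $a_{ij}=-2$ ($i\ne j$),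 including $[E_i,F_j]=\delta_{ij}(q^{H_i}-q^{-H_i})/(q-q^{-1})$ and the $q$-Serre relations. For an invertible parameter $u$, $\pi_u$ is its representation on $\mathcal V_u=\mathbb C^2$ with $E_1\mapsto uq^{1/2}\sigma_+$, $E_0\mapsto uq^{1/2}\sigma_-$, $F_1\mapsto u^{-1}q^{-1/2}\sigma_-$, $F_0\mapsto u^{-1}q^{-1/2}\sigma_+$, $q^{H_1/2}\mapsto q^{\sigma_3/2}$, $q^{H_0/2}\mapsto q^{-\sigma_3/2}$. The coaction is the algebra homomorphism $\delta:\mathbb T\to U_q(\widehat{sl_2})\otimes\mathbb T$ with $$\delta(\mathsf A)=(k_+E_1q^{H_1/2}+k_-F_1q^{H_1/2})\otimes1+q^{H_1}\otimes\mathsf A,\qquad \delta(\mathsf A^*)=(k_-E_0q^{H_0/2}+k_+F_0q^{H_0/2})\otimes1+q^{H_0}\otimes\mathsf A^*.$$ **Intertwiners.** Let $u$ be a formal variable and let $W$ be a $\mathbb T$-module (a complex vector space of any dimension). An *intertwiner* $\mathcal V_u\otimes W\to\mathcal V_{u^{-1}}\otimes W$ is a $2\times2$ matrix $K(u)$ with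 entries in $\mathrm{End}(W)((u))$ such that $$K(u)\,(\pi_u\times\mathrm{id})[\delta(a)]=(\pi_{u^{-1}}\times\mathrm{id})[\delta(a)]\,K(u)\qquad\forall a\in\mathbb T,$$ where the second tensor factor acts on $W$. The *reflection equation* for $K$ is, in independent formal variables $u,v$, $$R(u/v)\,(K(u)\otimes I)\,R(uv)\,(I\otimes K(v))=(I\otimes K(v))\,R(uv)\,(K(u)\otimes I)\,R(u/v),$$ $$R(x)=\begin{pmatrix}xq-x^{-1}q^{-1}&0&0&0\\0&x-x^{-1}&q-q^{-1}&0\\0&q-q^{-1}&x-x^{-1}&0\\0&0&0&xq-x^{-1}q^{-1}\end{pmatrix}.$$ **Proposition.** There is an algebra homomorphism $\mathbb T\to\mathcal A_q$ with $\mathsf A\mapsto\mathcal W_0$, $\mathsf A^*\mapsto\mathcal W_1$. Let $W$ be a $\mathbb T$-module. 1. The $\mathbb T$-action on $W$ extends along this homomorphism to an action of $\mathcal A_q$ on $W$. 2. For every such extension, put $U=(qu^2+q^{-1}u^{-2})/(q+q^{-1})$ and, with $U^{-1}$ expanded as a power series in $u$, $$\mathcal W_+(u)=\sum_{k\ge0}\mathcal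 W_{-k}U^{-k-1},\quad \mathcal W_-(u)=\sum_{k\ge0}\mathcal W_{k+1}U^{-k-1},\quad \mathcal G_+(u)=\sum_{k\ge0}\mathcal G_{k+1}U^{-k-1},\quad \mathcal G_-(u)=\sum_{k\ge0}\tilde{\mathcal G}_{k+1}U^{-k-1}.$$ Then the matrix $K(u)=\begin{pmatrix}A(u)&B(u)\\C(u)&D(u)\end{pmatrix}$ with $$A(u)=uq\,\mathcal W_+(u)-u^{-1}q^{-1}\mathcal W_-(u),\qquad D(u)=uq\,\mathcal W_-(u)-u^{-1}q^{-1}\mathcal W_+(u),$$ $$B(u)=\frac{\mathcal G_+(u)}{k_-(q+q^{-1})}+\frac{k_+(q+q^{-1})}{q-q^{-1}},\qquad C(u)=\frac{\mathcal G_-(u)}{k_+(q+q^{-1})}+\frac{k_-(q+q^{-1})}{q-q^{-1}}$$ is an intertwiner $\mathcal V_u\otimes W\to\mathcal V_{u^{-1}}\otimes W$, it is non-zero if $W\neq0$, and it satisfies the reflection equation. 3. (Uniqueness.) The intertwiners $\mathcal V_u\otimes W\to\mathcal V_{u^{-1}}\otimes W$ are exactly the matrices $f(u)K(u)$, where $f(u)\in\mathrm{End}_{\mathbb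 T}(W)((u))$. If $W$ is irreducible, they are exactly the scalar multiples $c(u)K(u)$, $c(u)\in\mathbb C((u))$, and every intertwiner satisfies the reflection equation. -/

import Mathlib

open scoped TensorProduct Kronecker

noncomputable section

namespace QOns

/-- The `q`-commutator `[X, Y]_q = q X Y - q⁻¹ Y X`. -/
def qComm {S : Type*} [Ring S] [Algebra ℂ S] (q : ℂ) (X Y : S) : S :=
  q • (X * Y) - q⁻¹ • (Y * X)

/-! ### The quantum affine algebra -/

/-- Generators of `U_q(ŝl₂)`: `E i`, `F i`, and `K i = q^{H_i/2}`, `Kinv i = q^{-H_i/2}`,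
for `i = 0, 1`. -/
inductive AffGen
  | E (i : Fin 2)
  | F (i : Fin 2)
  | K (i : Fin 2)
  | Kinv (i : Fin 2)

namespace AffGen

/-- A generator as an element of the free algebra. -/
abbrev ι (g : AffGen) : FreeAlgebra ℂ AffGen := FreeAlgebra.ι ℂ g

end AffGen

open AffGen in
/-- Defining relations of `U_q(ŝl₂)` with Cartan matrix `a_ii = 2`, `a_ij = -2` (`i ≠ j`).
With `K i = q^{H_i/2}`, the relation `[H_i, E_j] = a_ij E_j` reads
`K i * E j = q^{a_ij/2} E j * K i`, and similarly for `F`. -/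
inductive AffRel (q : ℂ) : FreeAlgebra ℂ AffGen → FreeAlgebra ℂ AffGen → Prop
  | K_Kinv (i : Fin 2) : AffRel q (ι (K i) * ι (Kinv i)) 1
  | Kinv_K (i : Fin 2) : AffRel q (ι (Kinv i) * ι (K i)) 1
  | K_K (i j : Fin 2) : AffRel q (ι (K i) * ι (K j)) (ι (K j) * ι (K i))
  | K_E (i j : Fin 2) :
      AffRel q (ι (K i) * ι (E j)) ((if i = j then q else q⁻¹) • (ι (E j) * ι (K i)))
  | K_F (i j : Fin 2) :
      AffRel q (ι (K i) * ι (F j)) ((if i = j then q⁻¹ else q) • (ι (F j) * ι (K i)))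
  | E_F (i j : Fin 2) :
      AffRel q ⁅ι (E i), ι (F j)⁆
        (if i = j then
          (q - q⁻¹)⁻¹ • (ι (K i) * ι (K i) - ι (Kinv i) * ι (Kinv i)) else 0)
  | serre_E (i j : Fin 2) (hij : i ≠ j) :
      AffRel q ⁅ι (E i), qComm q⁻¹ (ι (E i)) (qComm q (ι (E i)) (ι (E j)))⁆ 0
  | serre_F (i j : Fin 2) (hij : i ≠ j) :
      AffRel q ⁅ι (F i), qComm q⁻¹ (ι (F i)) (qComm q (ι (F i)) (ι (F j)))⁆ 0

/-- The quantum affine algebra `U_q(ŝl₂)`. -/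
abbrev QAffine (q : ℂ) : Type := RingQuot (AffRel q)

namespace QAffine

/-- The image of a generator in `U_q(ŝl₂)`. -/
def gen (q : ℂ) (g : AffGen) : QAffine q := RingQuot.mkAlgHom ℂ (AffRel q) g.ι

end QAffine

/-! ### The `q`-Onsager algebra -/

/-- The standard generators `A`, `A*`. -/
inductive OnsGen
  | A
  | Astar

/-- The `q`-Dolan–Grady relations. -/
inductive OnsRel (q ρ : ℂ) : FreeAlgebra ℂ OnsGen → FreeAlgebra ℂ OnsGen → Prop
  | left : OnsRel q ρ
      ⁅FreeAlgebra.ι ℂ OnsGen.A, qComm q⁻¹ (FreeAlgebra.ι ℂ OnsGen.A)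
        (qComm q (FreeAlgebra.ι ℂ OnsGen.A) (FreeAlgebra.ι ℂ OnsGen.Astar))⁆
      (ρ • ⁅FreeAlgebra.ι ℂ OnsGen.A, FreeAlgebra.ι ℂ OnsGen.Astar⁆)
  | right : OnsRel q ρ
      ⁅FreeAlgebra.ι ℂ OnsGen.Astar, qComm q⁻¹ (FreeAlgebra.ι ℂ OnsGen.Astar)
        (qComm q (FreeAlgebra.ι ℂ OnsGen.Astar) (FreeAlgebra.ι ℂ OnsGen.A))⁆
      (ρ • ⁅FreeAlgebra.ι ℂ OnsGen.Astar, FreeAlgebra.ι ℂ OnsGen.A⁆)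

/-- The `q`-Onsager algebra `𝕋`. -/
abbrev QOnsager (q ρ : ℂ) : Type := RingQuot (OnsRel q ρ)

namespace QOnsager

/-- The standard generator `A`. -/
def A (q ρ : ℂ) : QOnsager q ρ := RingQuot.mkAlgHom ℂ (OnsRel q ρ) (FreeAlgebra.ι ℂ OnsGen.A)

/-- The standard generator `A*`. -/
def Astar (q ρ : ℂ) : QOnsager q ρ :=
  RingQuot.mkAlgHom ℂ (OnsRel q ρ) (FreeAlgebra.ι ℂ OnsGen.Astar)

end QOnsager

/-! ### The algebra `𝒜_q` -/

/-- Generators of `𝒜_q` for `k ≥ 0`: `Wneg k = W_{-k}`, `Wpos k = W_{k+1}`, `G k = G_{k+1}`,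
`Gt k = G̃_{k+1}`. -/
inductive CurGen
  | Wneg (k : ℕ)
  | Wpos (k : ℕ)
  | G (k : ℕ)
  | Gt (k : ℕ)

namespace CurGen

/-- A generator as an element of the free algebra. -/
abbrev ι (g : CurGen) : FreeAlgebra ℂ CurGen := FreeAlgebra.ι ℂ g

end CurGen

open CurGen in
/-- Defining relations of `𝒜_q`. -/
inductive CurRel (q ρ : ℂ) : FreeAlgebra ℂ CurGen → FreeAlgebra ℂ CurGen → Prop
  | W0_Wpos (k : ℕ) : CurRel q ρ ⁅ι (Wneg 0), ι (Wpos k)⁆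
      ((q + q⁻¹)⁻¹ • (ι (Gt k) - ι (G k)))
  | Wneg_W1 (k : ℕ) : CurRel q ρ ⁅ι (Wneg k), ι (Wpos 0)⁆
      ((q + q⁻¹)⁻¹ • (ι (Gt k) - ι (G k)))
  | W0_G (k : ℕ) : CurRel q ρ (qComm q (ι (Wneg 0)) (ι (G k)))
      (ρ • ι (Wneg (k + 1)) - ρ • ι (Wpos k))
  | Gt_W0 (k : ℕ) : CurRel q ρ (qComm q (ι (Gt k)) (ι (Wneg 0)))
      (ρ • ι (Wneg (k + 1)) - ρ • ι (Wpos k))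
  | G_W1 (k : ℕ) : CurRel q ρ (qComm q (ι (G k)) (ι (Wpos 0)))
      (ρ • ι (Wpos (k + 1)) - ρ • ι (Wneg k))
  | W1_Gt (k : ℕ) : CurRel q ρ (qComm q (ι (Wpos 0)) (ι (Gt k)))
      (ρ • ι (Wpos (k + 1)) - ρ • ι (Wneg k))
  | Wneg_Wneg (k l : ℕ) : CurRel q ρ ⁅ι (Wneg k), ι (Wneg l)⁆ 0
  | Wpos_Wpos (k l : ℕ) : CurRel q ρ ⁅ι (Wpos k), ι (Wpos l)⁆ 0
  | Wneg_Wpos (k l : ℕ) : CurRel q ρ (⁅ι (Wneg k), ι (Wpos l)⁆ + ⁅ι (Wpos k), ι (Wneg l)⁆) 0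
  | Wneg_G (k l : ℕ) : CurRel q ρ (⁅ι (Wneg k), ι (G l)⁆ + ⁅ι (G k), ι (Wneg l)⁆) 0
  | Wneg_Gt (k l : ℕ) : CurRel q ρ (⁅ι (Wneg k), ι (Gt l)⁆ + ⁅ι (Gt k), ι (Wneg l)⁆) 0
  | Wpos_G (k l : ℕ) : CurRel q ρ (⁅ι (Wpos k), ι (G l)⁆ + ⁅ι (G k), ι (Wpos l)⁆) 0
  | Wpos_Gt (k l : ℕ) : CurRel q ρ (⁅ι (Wpos k), ι (Gt l)⁆ + ⁅ι (Gt k), ι (Wpos l)⁆) 0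
  | G_G (k l : ℕ) : CurRel q ρ ⁅ι (G k), ι (G l)⁆ 0
  | Gt_Gt (k l : ℕ) : CurRel q ρ ⁅ι (Gt k), ι (Gt l)⁆ 0
  | Gt_G (k l : ℕ) : CurRel q ρ (⁅ι (Gt k), ι (G l)⁆ + ⁅ι (G k), ι (Gt l)⁆) 0

/-- The algebra `𝒜_q`. -/
abbrev Aq (q ρ : ℂ) : Type := RingQuot (CurRel q ρ)

namespace Aq

/-- The image of a generator in `𝒜_q`. -/
def gen (q ρ : ℂ) (g : CurGen) : Aq q ρ := RingQuot.mkAlgHom ℂ (CurRel q ρ) g.ι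

end Aq

/-! ### Parameters -/

/-- The parameters: `q ∈ ℂ*` not a root of unity, a chosen square root `s = q^{1/2}`, and
`k₊, k₋ ∈ ℂ*`. -/
structure Params where
  q : ℂ
  s : ℂ
  kp : ℂ
  km : ℂ
  s_sq : s ^ 2 = q
  q_ne_zero : q ≠ 0
  q_pow_ne_one : ∀ n : ℕ, 0 < n → q ^ n ≠ 1
  kp_ne_zero : kp ≠ 0
  km_ne_zero : km ≠ 0

namespace Params

/-- `ρ = k₊ k₋ (q + q⁻¹)²`. -/
def rho (p : Params) : ℂ := p.kp * p.km * (p.q + p.q⁻¹) ^ 2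

theorem s_ne_zero (p : Params) : p.s ≠ 0 := by
  intro h
  apply p.q_ne_zero
  rw [← p.s_sq, h]
  simp

theorem q_sq_sub_one_ne_zero (p : Params) : p.q ^ 2 - 1 ≠ 0 :=
  sub_ne_zero.mpr (p.q_pow_ne_one 2 (by norm_num))

end Params

/-! ### The coaction -/

section CoactionLemmas

variable {S : Type*} [Ring S] [Algebra ℂ S]

theorem lie_qComm_qComm {q : ℂ} (hq : q ≠ 0) (X Y : S) :
    ⁅X, qComm q⁻¹ X (qComm q X Y)⁆ = X * (X * (X * Y))
      - (q ^ 2 + 1 + (q⁻¹) ^ 2) • (X * (X * (Y * X)) - X * (Y * (X * X)))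
      - Y * (X * (X * X)) := by
  simp only [qComm, Ring.lie_def, mul_sub, sub_mul, smul_mul_assoc, mul_smul_comm, smul_sub,
    smul_smul, mul_assoc]
  match_scalars <;> field_simp <;> ring

set_option maxHeartbeats 1000000 in
theorem dolanGrady_aux₁ {q t : ℂ}
    (hq : q ≠ 0) (hq2 : q ^ 2 - 1 ≠ 0) {e f e' Q a : S}
    (Qe : Q * e = q ^ 2 • (e * Q)) (Qf : Q * f = (q⁻¹) ^ 2 • (f * Q))
    (Qe' : Q * e' = (q⁻¹) ^ 2 • (e' * Q))
    (fe : f * e = q ^ 2 • (e * f) - (t * (q ^ 2 * (q ^ 2 - 1)⁻¹)) • (Q * Q - 1))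
    (fe' : f * e' = (q⁻¹) ^ 2 • (e' * f))
    (Se : ⁅e, qComm q⁻¹ e (qComm q e e')⁆ = 0)
    (ae : a * e = e * a) (af : a * f = f * a) (ae' : a * e' = e' * a) (aQ : a * Q = Q * a) :
    ⁅e + f + Q * a, qComm q⁻¹ (e + f + Q * a) (qComm q (e + f + Q * a) e')⁆ =
      (t * (q + q⁻¹) ^ 2) • ⁅e + f + Q * a, e'⁆ := by
  have ext : ∀ {x y z : S}, x * y = z → ∀ w, x * (y * w) = z * w := by
    intro x y z h w; rw [← mul_assoc, h]
  rw [lie_qComm_qComm hq, sub_sub, sub_eq_zero] at Se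
  rw [← sub_eq_zero, lie_qComm_qComm hq]
  simp only [Ring.lie_def, mul_add, add_mul, mul_sub, sub_mul, smul_mul_assoc,
    mul_smul_comm, smul_add, smul_sub, smul_smul, mul_assoc, one_mul, mul_one,
    Qe, Qf, Qe', fe, fe', ae, af, ae', aQ,
    ext Qe, ext Qf, ext Qe', ext fe, ext fe', ext ae, ext af, ext ae', ext aQ]
  simp only [Se, smul_sub]
  match_scalars <;> field_simp <;> ring

set_option maxHeartbeats 1000000 in
theorem dolanGrady_aux₂ {q t : ℂ}
    (hq : q ≠ 0) (hq2 : q ^ 2 - 1 ≠ 0) {e f f' Q a : S}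
    (Qe : Q * e = q ^ 2 • (e * Q)) (Qf : Q * f = (q⁻¹) ^ 2 • (f * Q))
    (Qf' : Q * f' = q ^ 2 • (f' * Q))
    (fe : f * e = q ^ 2 • (e * f) - (t * (q ^ 2 * (q ^ 2 - 1)⁻¹)) • (Q * Q - 1))
    (fe' : f' * e = (q⁻¹) ^ 2 • (e * f'))
    (Sf : ⁅f, qComm q⁻¹ f (qComm q f f')⁆ = 0)
    (ae : a * e = e * a) (af : a * f = f * a) (af' : a * f' = f' * a) (aQ : a * Q = Q * a) :
    ⁅e + f + Q * a, qComm q⁻¹ (e + f + Q * a) (qComm q (e + f + Q * a) f')⁆ =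
      (t * (q + q⁻¹) ^ 2) • ⁅e + f + Q * a, f'⁆ := by
  have ext : ∀ {x y z : S}, x * y = z → ∀ w, x * (y * w) = z * w := by
    intro x y z h w; rw [← mul_assoc, h]
  rw [lie_qComm_qComm hq, sub_sub, sub_eq_zero] at Sf
  rw [← sub_eq_zero, lie_qComm_qComm hq]
  simp only [Ring.lie_def, mul_add, add_mul, mul_sub, sub_mul, smul_mul_assoc,
    mul_smul_comm, smul_add, smul_sub, smul_smul, mul_assoc, one_mul, mul_one,
    Qe, Qf, Qf', fe, fe', ae, af, af', aQ,
    ext Qe, ext Qf, ext Qf', ext fe, ext fe', ext ae, ext af, ext af', ext aQ]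
  simp only [Sf, smul_sub]
  match_scalars <;> field_simp <;> ring

set_option maxHeartbeats 1000000 in
theorem dolanGrady_aux₃ {q t : ℂ}
    (hq : q ≠ 0) (hq2 : q ^ 2 - 1 ≠ 0) {e f Q R a b : S}
    (Qe : Q * e = q ^ 2 • (e * Q)) (Qf : Q * f = (q⁻¹) ^ 2 • (f * Q))
    (Re : R * e = (q⁻¹) ^ 2 • (e * R)) (Rf : R * f = q ^ 2 • (f * R))
    (RQ : R * Q = Q * R)
    (fe : f * e = q ^ 2 • (e * f) - (t * (q ^ 2 * (q ^ 2 - 1)⁻¹)) • (Q * Q - 1))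
    (ae : a * e = e * a) (af : a * f = f * a) (aQ : a * Q = Q * a) (aR : a * R = R * a)
    (be : b * e = e * b) (bf : b * f = f * b) (bQ : b * Q = Q * b)
    (hab : ⁅a, qComm q⁻¹ a (qComm q a b)⁆ = (t * (q + q⁻¹) ^ 2) • ⁅a, b⁆) :
    ⁅e + f + Q * a, qComm q⁻¹ (e + f + Q * a) (qComm q (e + f + Q * a) (R * b))⁆ =
      (t * (q + q⁻¹) ^ 2) • ⁅e + f + Q * a, R * b⁆ := by
  have ext : ∀ {x y z : S}, x * y = z → ∀ w, x * (y * w) = z * w := by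
    intro x y z h w; rw [← mul_assoc, h]
  rw [lie_qComm_qComm hq, sub_sub, sub_eq_iff_eq_add, Ring.lie_def] at hab
  rw [← sub_eq_zero, lie_qComm_qComm hq]
  simp only [Ring.lie_def, mul_add, add_mul, mul_sub, sub_mul, smul_mul_assoc,
    mul_smul_comm, smul_add, smul_sub, smul_smul, mul_assoc, one_mul, mul_one,
    fe, ae, af, aQ, be, bf, bQ,
    ext Qe, ext Qf, ext Re, ext Rf, ext RQ, ext fe, ext ae, ext af, ext aQ,
    ext aR, ext be, ext bf, ext bQ]
  simp only [hab, smul_sub, mul_add, mul_sub, mul_smul_comm]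
  match_scalars <;> field_simp <;> ring

theorem dolanGrady_add {q c : ℂ} {X Y Z : S}
    (hY : ⁅X, qComm q⁻¹ X (qComm q X Y)⁆ = c • ⁅X, Y⁆)
    (hZ : ⁅X, qComm q⁻¹ X (qComm q X Z)⁆ = c • ⁅X, Z⁆) :
    ⁅X, qComm q⁻¹ X (qComm q X (Y + Z))⁆ = c • ⁅X, Y + Z⁆ := by
  have h : ∀ (r : ℂ) (Y Z : S), qComm r X (Y + Z) = qComm r X Y + qComm r X Z := by
    intro r Y Z
    simp only [qComm, mul_add, add_mul, smul_add]
    abel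
  have h2 : ∀ Y Z : S, ⁅X, Y + Z⁆ = ⁅X, Y⁆ + ⁅X, Z⁆ := by
    intro Y Z
    simp only [Ring.lie_def, mul_add, add_mul]
    abel
  rw [h, h, h2, h2, smul_add, hY, hZ]

end CoactionLemmas

namespace QAffine

open AffGen

variable (q : ℂ)

theorem K_E (i j : Fin 2) :
    gen q (K i) * gen q (E j) = (if i = j then q else q⁻¹) • (gen q (E j) * gen q (K i)) := by
  simpa only [gen, map_mul, map_smul] using RingQuot.mkAlgHom_rel ℂ (AffRel.K_E (q := q) i j)

theorem K_F (i j : Fin 2) :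
    gen q (K i) * gen q (F j) = (if i = j then q⁻¹ else q) • (gen q (F j) * gen q (K i)) := by
  simpa only [gen, map_mul, map_smul] using RingQuot.mkAlgHom_rel ℂ (AffRel.K_F (q := q) i j)

theorem K_K (i j : Fin 2) : gen q (K i) * gen q (K j) = gen q (K j) * gen q (K i) := by
  simpa [gen] using RingQuot.mkAlgHom_rel ℂ (AffRel.K_K (q := q) i j)

theorem Kinv_K (i : Fin 2) : gen q (Kinv i) * gen q (K i) = 1 := by
  simpa [gen] using RingQuot.mkAlgHom_rel ℂ (AffRel.Kinv_K (q := q) i)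

theorem E_F_self (i : Fin 2) :
    gen q (E i) * gen q (F i) - gen q (F i) * gen q (E i) =
      (q - q⁻¹)⁻¹ • (gen q (K i) * gen q (K i) - gen q (Kinv i) * gen q (Kinv i)) := by
  simpa [gen, Ring.lie_def] using RingQuot.mkAlgHom_rel ℂ (AffRel.E_F (q := q) i i)

theorem E_F_ne {i j : Fin 2} (hij : i ≠ j) :
    gen q (E i) * gen q (F j) = gen q (F j) * gen q (E i) := by
  simpa [gen, Ring.lie_def, hij, sub_eq_zero] using
    RingQuot.mkAlgHom_rel ℂ (AffRel.E_F (q := q) i j)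

theorem serre_E {i j : Fin 2} (hij : i ≠ j) :
    ⁅gen q (E i), qComm q⁻¹ (gen q (E i)) (qComm q (gen q (E i)) (gen q (E j)))⁆ = 0 := by
  simpa [gen, Ring.lie_def, qComm] using
    RingQuot.mkAlgHom_rel ℂ (AffRel.serre_E (q := q) i j hij)

theorem serre_F {i j : Fin 2} (hij : i ≠ j) :
    ⁅gen q (F i), qComm q⁻¹ (gen q (F i)) (qComm q (gen q (F i)) (gen q (F j)))⁆ = 0 := by
  simpa [gen, Ring.lie_def, qComm] using
    RingQuot.mkAlgHom_rel ℂ (AffRel.serre_F (q := q) i j hij)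

/-- The relations of `U_q(ŝl₂)` imply the `q`-Dolan–Grady relation for the coaction images. -/
theorem dolanGrady_coaction {S : Type*} [Ring S] [Algebra ℂ S] {q : ℂ} (hq : q ≠ 0)
    (hq2 : q ^ 2 - 1 ≠ 0) (g : QAffine q →ₐ[ℂ] S) {a b : S}
    (ha : ∀ x, a * g x = g x * a) (hb : ∀ x, b * g x = g x * b) {i j : Fin 2} (hij : i ≠ j)
    (k l : ℂ)
    (hab : ⁅a, qComm q⁻¹ a (qComm q a b)⁆ = (k * l * (q + q⁻¹) ^ 2) • ⁅a, b⁆) :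
    ⁅g (k • (gen q (E i) * gen q (K i))) + g (l • (gen q (F i) * gen q (K i)))
        + g (gen q (K i) * gen q (K i)) * a,
      qComm q⁻¹ (g (k • (gen q (E i) * gen q (K i))) + g (l • (gen q (F i) * gen q (K i)))
        + g (gen q (K i) * gen q (K i)) * a)
        (qComm q (g (k • (gen q (E i) * gen q (K i))) + g (l • (gen q (F i) * gen q (K i)))
          + g (gen q (K i) * gen q (K i)) * a)
          (g (l • (gen q (E j) * gen q (K j))) + g (k • (gen q (F j) * gen q (K j)))
            + g (gen q (K j) * gen q (K j)) * b))⁆ =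
    (k * l * (q + q⁻¹) ^ 2) • ⁅g (k • (gen q (E i) * gen q (K i)))
        + g (l • (gen q (F i) * gen q (K i))) + g (gen q (K i) * gen q (K i)) * a,
      g (l • (gen q (E j) * gen q (K j))) + g (k • (gen q (F j) * gen q (K j)))
        + g (gen q (K j) * gen q (K j)) * b⁆ := by
  have hji : j ≠ i := hij.symm
  have ext : ∀ {x y z : QAffine q}, x * y = z → ∀ w, x * (y * w) = z * w := by
    intro x y z h w; rw [← mul_assoc, h]
  have e1 := K_E q i i
  have e2 := K_E q i j
  have e3 := K_E q j i
  have e4 := K_E q j j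
  have f1 := K_F q i i
  have f2 := K_F q i j
  have f3 := K_F q j i
  have f4 := K_F q j j
  have kk := K_K q j i
  have c1 := (E_F_ne q hij).symm
  have c2 := (E_F_ne q hji).symm
  have inv := Kinv_K q i
  have c0 := E_F_self q i
  have sE := serre_E q hij
  have sF := serre_F q hij
  simp only [if_true, if_neg hij, if_neg hji] at e1 e2 e3 e4 f1 f2 f3 f4
  generalize gen q (E i) = Ei at *
  generalize gen q (E j) = Ej at *
  generalize gen q (F i) = Fi at *
  generalize gen q (F j) = Fj at *
  generalize gen q (K i) = Ki at *
  generalize gen q (K j) = Kj at *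
  generalize gen q (Kinv i) = Li at *
  have c0' : Fi * Ei = Ei * Fi - (q - q⁻¹)⁻¹ • (Ki * Ki - Li * Li) := by rw [← c0]; abel
  have inv2 : Li * (Ki * Ki) = Ki := by rw [← mul_assoc, inv, one_mul]
  have hq3 : (q - q⁻¹)⁻¹ = q * (q ^ 2 - 1)⁻¹ := by
    rw [show q - q⁻¹ = q⁻¹ * (q ^ 2 - 1) by field_simp, mul_inv, inv_inv]
  rw [hq3] at c0'
  rw [lie_qComm_qComm hq, sub_sub, sub_eq_zero] at sE sF
  have pushc : ∀ {x y z w : QAffine q} {c : ℂ}, x * y = c • (z * w) →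
      g x * g y = c • (g z * g w) := by
    intro x y z w c h
    rw [← map_mul, h, map_smul, map_mul]
  have Qe : g (Ki * Ki) * g (k • (Ei * Ki)) = q ^ 2 • (g (k • (Ei * Ki)) * g (Ki * Ki)) := by
    apply pushc
    simp only [mul_assoc, mul_smul_comm, smul_mul_assoc, smul_smul, ext e1]
    match_scalars; ring
  have Qf : g (Ki * Ki) * g (l • (Fi * Ki)) = q⁻¹ ^ 2 • (g (l • (Fi * Ki)) * g (Ki * Ki)) := by
    apply pushc
    simp only [mul_assoc, mul_smul_comm, smul_mul_assoc, smul_smul, ext f1]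
    match_scalars; ring
  have Qe' : g (Ki * Ki) * g (l • (Ej * Kj)) = q⁻¹ ^ 2 • (g (l • (Ej * Kj)) * g (Ki * Ki)) := by
    apply pushc
    simp only [mul_assoc, mul_smul_comm, smul_mul_assoc, smul_smul, ext e2, kk, ext kk]
    match_scalars; ring
  have Qf' : g (Ki * Ki) * g (k • (Fj * Kj)) = q ^ 2 • (g (k • (Fj * Kj)) * g (Ki * Ki)) := by
    apply pushc
    simp only [mul_assoc, mul_smul_comm, smul_mul_assoc, smul_smul, ext f2, kk, ext kk]
    match_scalars; ring
  have Re : g (Kj * Kj) * g (k • (Ei * Ki)) = q⁻¹ ^ 2 • (g (k • (Ei * Ki)) * g (Kj * Kj)) := by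
    apply pushc
    simp only [mul_assoc, mul_smul_comm, smul_mul_assoc, smul_smul, ext e3, kk, ext kk]
    match_scalars; ring
  have Rf : g (Kj * Kj) * g (l • (Fi * Ki)) = q ^ 2 • (g (l • (Fi * Ki)) * g (Kj * Kj)) := by
    apply pushc
    simp only [mul_assoc, mul_smul_comm, smul_mul_assoc, smul_smul, ext f3, kk, ext kk]
    match_scalars; ring
  have RQ : g (Kj * Kj) * g (Ki * Ki) = g (Ki * Ki) * g (Kj * Kj) := by
    rw [← map_mul, ← map_mul]
    simp only [mul_assoc, kk, ext kk]
  have fe : g (l • (Fi * Ki)) * g (k • (Ei * Ki)) =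
      q ^ 2 • (g (k • (Ei * Ki)) * g (l • (Fi * Ki))) -
        (k * l * (q ^ 2 * (q ^ 2 - 1)⁻¹)) • (g (Ki * Ki) * g (Ki * Ki) - 1) := by
    have : l • (Fi * Ki) * k • (Ei * Ki) =
      q ^ 2 • (k • (Ei * Ki) * l • (Fi * Ki)) -
        (k * l * (q ^ 2 * (q ^ 2 - 1)⁻¹)) • (Ki * Ki * (Ki * Ki) - 1) := by
      simp only [mul_assoc, mul_smul_comm, smul_mul_assoc, smul_smul, ext e1, ext f1, ext c0',
        sub_mul, smul_sub, inv2, inv]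
      match_scalars <;> field_simp
    rw [← map_mul, this]
    simp only [map_sub, map_smul, map_mul, map_one]
  have f'e : g (k • (Fj * Kj)) * g (k • (Ei * Ki)) =
      q⁻¹ ^ 2 • (g (k • (Ei * Ki)) * g (k • (Fj * Kj))) := by
    apply pushc
    simp only [mul_assoc, mul_smul_comm, smul_mul_assoc, smul_smul, ext e3, ext f2, ext c1, kk]
    match_scalars; field_simp
  have fe' : g (l • (Fi * Ki)) * g (l • (Ej * Kj)) =
      q⁻¹ ^ 2 • (g (l • (Ej * Kj)) * g (l • (Fi * Ki))) := by
    apply pushc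
    simp only [mul_assoc, mul_smul_comm, smul_mul_assoc, smul_smul, ext e2, ext f3, ext c2, kk]
    match_scalars; field_simp
  have Se : ⁅g (k • (Ei * Ki)), qComm q⁻¹ (g (k • (Ei * Ki)))
      (qComm q (g (k • (Ei * Ki))) (g (l • (Ej * Kj))))⁆ = 0 := by
    rw [lie_qComm_qComm hq]
    simp only [← map_mul, ← map_sub, ← map_smul]
    rw [← map_zero g]
    congr 1
    have sE' : ∀ w, Ei * (Ei * (Ei * (Ej * w))) = (q ^ 2 + 1 + (q⁻¹) ^ 2) •
        (Ei * (Ei * (Ej * (Ei * w))) - Ei * (Ej * (Ei * (Ei * w)))) +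
          Ej * (Ei * (Ei * (Ei * w))) := by
      intro w
      have := congrArg (· * w) sE
      simpa only [add_mul, sub_mul, smul_mul_assoc, mul_assoc] using this
    simp only [mul_assoc, mul_smul_comm, smul_mul_assoc, smul_smul, kk, ext e1,
      ext e2, ext e3, ext kk, smul_sub, smul_add, sE']
    match_scalars <;> field_simp <;> ring
  have Sf : ⁅g (l • (Fi * Ki)), qComm q⁻¹ (g (l • (Fi * Ki)))
      (qComm q (g (l • (Fi * Ki))) (g (k • (Fj * Kj))))⁆ = 0 := by
    rw [lie_qComm_qComm hq]
    simp only [← map_mul, ← map_sub, ← map_smul]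
    rw [← map_zero g]
    congr 1
    have sF' : ∀ w, Fi * (Fi * (Fi * (Fj * w))) = (q ^ 2 + 1 + (q⁻¹) ^ 2) •
        (Fi * (Fi * (Fj * (Fi * w))) - Fi * (Fj * (Fi * (Fi * w)))) +
          Fj * (Fi * (Fi * (Fi * w))) := by
      intro w
      have := congrArg (· * w) sF
      simpa only [add_mul, sub_mul, smul_mul_assoc, mul_assoc] using this
    simp only [mul_assoc, mul_smul_comm, smul_mul_assoc, smul_smul, kk, ext f1,
      ext f2, ext f3, ext kk, smul_sub, smul_add, sF']
    match_scalars <;> field_simp <;> ring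
  refine dolanGrady_add (dolanGrady_add ?_ ?_) ?_
  · exact dolanGrady_aux₁ hq hq2 Qe Qf Qe' fe fe' Se (ha _) (ha _) (ha _) (ha _)
  · exact dolanGrady_aux₂ hq hq2 Qe Qf Qf' fe f'e Sf (ha _) (ha _) (ha _) (ha _)
  · exact dolanGrady_aux₃ hq hq2 Qe Qf Re Rf RQ fe (ha _) (ha _) (ha _) (ha _) (hb _) (hb _)
      (hb _) hab

end QAffine

namespace QOnsager

variable (q ρ : ℂ)

theorem dolanGrady_left : ⁅A q ρ, qComm q⁻¹ (A q ρ) (qComm q (A q ρ) (Astar q ρ))⁆ =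
    ρ • ⁅A q ρ, Astar q ρ⁆ := by
  simpa only [A, Astar, Ring.lie_def, qComm, map_sub, map_mul, map_smul] using
    RingQuot.mkAlgHom_rel ℂ (OnsRel.left (q := q) (ρ := ρ))

theorem dolanGrady_right : ⁅Astar q ρ, qComm q⁻¹ (Astar q ρ) (qComm q (Astar q ρ) (A q ρ))⁆ =
    ρ • ⁅Astar q ρ, A q ρ⁆ := by
  simpa only [A, Astar, Ring.lie_def, qComm, map_sub, map_mul, map_smul] using
    RingQuot.mkAlgHom_rel ℂ (OnsRel.right (q := q) (ρ := ρ))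

end QOnsager

namespace Params

open AffGen QAffine

variable (p : Params)

/-- `δ(A) = (k₊ E₁ q^{H₁/2} + k₋ F₁ q^{H₁/2}) ⊗ 1 + q^{H₁} ⊗ A`. -/
def coactA : QAffine p.q ⊗[ℂ] QOnsager p.q p.rho :=
  (p.kp • (gen p.q (E 1) * gen p.q (K 1)) + p.km • (gen p.q (F 1) * gen p.q (K 1))) ⊗ₜ[ℂ] 1
    + (gen p.q (K 1) * gen p.q (K 1)) ⊗ₜ[ℂ] QOnsager.A p.q p.rho

/-- `δ(A*) = (k₋ E₀ q^{H₀/2} + k₊ F₀ q^{H₀/2}) ⊗ 1 + q^{H₀} ⊗ A*`. -/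
def coactAstar : QAffine p.q ⊗[ℂ] QOnsager p.q p.rho :=
  (p.km • (gen p.q (E 0) * gen p.q (K 0)) + p.kp • (gen p.q (F 0) * gen p.q (K 0))) ⊗ₜ[ℂ] 1
    + (gen p.q (K 0) * gen p.q (K 0)) ⊗ₜ[ℂ] QOnsager.Astar p.q p.rho

/-- The assignment of the standard generators under the coaction. -/
def coactGen : OnsGen → QAffine p.q ⊗[ℂ] QOnsager p.q p.rho
  | OnsGen.A => p.coactA
  | OnsGen.Astar => p.coactAstar

theorem coact_rel ⦃x y : FreeAlgebra ℂ OnsGen⦄ (h : OnsRel p.q p.rho x y) :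
    FreeAlgebra.lift ℂ p.coactGen x = FreeAlgebra.lift ℂ p.coactGen y := by
  let L : QAffine p.q →ₐ[ℂ] QAffine p.q ⊗[ℂ] QOnsager p.q p.rho :=
    Algebra.TensorProduct.includeLeft
  let R : QOnsager p.q p.rho →ₐ[ℂ] QAffine p.q ⊗[ℂ] QOnsager p.q p.rho :=
    Algebra.TensorProduct.includeRight
  have hA : p.coactA = L (p.kp • (gen p.q (E 1) * gen p.q (K 1)))
      + L (p.km • (gen p.q (F 1) * gen p.q (K 1)))
      + L (gen p.q (K 1) * gen p.q (K 1)) * R (QOnsager.A p.q p.rho) := by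
    simp only [L, R, coactA, Algebra.TensorProduct.includeLeft_apply,
      Algebra.TensorProduct.includeRight_apply, Algebra.TensorProduct.tmul_mul_tmul, mul_one,
      one_mul, TensorProduct.add_tmul]
  have hAs : p.coactAstar = L (p.km • (gen p.q (E 0) * gen p.q (K 0)))
      + L (p.kp • (gen p.q (F 0) * gen p.q (K 0)))
      + L (gen p.q (K 0) * gen p.q (K 0)) * R (QOnsager.Astar p.q p.rho) := by
    simp only [L, R, coactAstar, Algebra.TensorProduct.includeLeft_apply,
      Algebra.TensorProduct.includeRight_apply, Algebra.TensorProduct.tmul_mul_tmul, mul_one,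
      one_mul, TensorProduct.add_tmul]
  have hcomm : ∀ (t : QOnsager p.q p.rho) (x : QAffine p.q), R t * L x = L x * R t := by
    intro t x
    simp [L, R]
  have h1 : ⁅R (QOnsager.A p.q p.rho), qComm p.q⁻¹ (R (QOnsager.A p.q p.rho))
      (qComm p.q (R (QOnsager.A p.q p.rho)) (R (QOnsager.Astar p.q p.rho)))⁆ =
      p.rho • ⁅R (QOnsager.A p.q p.rho), R (QOnsager.Astar p.q p.rho)⁆ := by
    have := congrArg R (QOnsager.dolanGrady_left p.q p.rho)
    simpa only [Ring.lie_def, qComm, map_sub, map_mul, map_smul] using this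
  have h2 : ⁅R (QOnsager.Astar p.q p.rho), qComm p.q⁻¹ (R (QOnsager.Astar p.q p.rho))
      (qComm p.q (R (QOnsager.Astar p.q p.rho)) (R (QOnsager.A p.q p.rho)))⁆ =
      p.rho • ⁅R (QOnsager.Astar p.q p.rho), R (QOnsager.A p.q p.rho)⁆ := by
    have := congrArg R (QOnsager.dolanGrady_right p.q p.rho)
    simpa only [Ring.lie_def, qComm, map_sub, map_mul, map_smul] using this
  cases h with
  | left =>
    have := dolanGrady_coaction p.q_ne_zero p.q_sq_sub_one_ne_zero L
      (hcomm (QOnsager.A p.q p.rho)) (hcomm (QOnsager.Astar p.q p.rho))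
      (i := 1) (j := 0) (by decide) p.kp p.km h1
    rw [← hA, ← hAs, show p.kp * p.km * (p.q + p.q⁻¹) ^ 2 = p.rho from rfl] at this
    simpa only [qComm, Ring.lie_def, map_sub, map_mul, map_smul, FreeAlgebra.lift_ι_apply,
      coactGen] using this
  | right =>
    have := dolanGrady_coaction p.q_ne_zero p.q_sq_sub_one_ne_zero L
      (hcomm (QOnsager.Astar p.q p.rho)) (hcomm (QOnsager.A p.q p.rho))
      (i := 0) (j := 1) (by decide) p.km p.kp
      (by rw [mul_comm p.km]; exact h2)
    rw [← hA, ← hAs, mul_comm p.km,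
      show p.kp * p.km * (p.q + p.q⁻¹) ^ 2 = p.rho from rfl] at this
    simpa only [qComm, Ring.lie_def, map_sub, map_mul, map_smul, FreeAlgebra.lift_ι_apply,
      coactGen] using this

/-- The coaction `δ : 𝕋 → U_q(ŝl₂) ⊗ 𝕋`. -/
def coaction : QOnsager p.q p.rho →ₐ[ℂ] QAffine p.q ⊗[ℂ] QOnsager p.q p.rho :=
  RingQuot.liftAlgHom ℂ ⟨FreeAlgebra.lift ℂ p.coactGen, p.coact_rel⟩

theorem coaction_A : p.coaction (QOnsager.A p.q p.rho) = p.coactA := by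
  simp [coaction, QOnsager.A, coactGen]

theorem coaction_Astar : p.coaction (QOnsager.Astar p.q p.rho) = p.coactAstar := by
  simp [coaction, QOnsager.Astar, coactGen]

/-! ### The evaluation representation -/

section EvalRep

variable {S : Type*} [Ring S] [Algebra ℂ S] (u : Sˣ)

/-- The evaluation matrices, with `e₁, e₂` the standard basis of `ℂ²`:
`E₁ ↦ u q^{1/2} σ₊`, `E₀ ↦ u q^{1/2} σ₋`, `F₁ ↦ u⁻¹ q^{-1/2} σ₋`, `F₀ ↦ u⁻¹ q^{-1/2} σ₊`,
`q^{H₁/2} ↦ q^{σ₃/2}`, `q^{H₀/2} ↦ q^{-σ₃/2}`. -/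
def evalGen : AffGen → Matrix (Fin 2) (Fin 2) S
  | E 0 => !![0, 0; p.s • (u : S), 0]
  | E 1 => !![0, p.s • (u : S); 0, 0]
  | F 0 => !![0, p.s⁻¹ • ((u⁻¹ : Sˣ) : S); 0, 0]
  | F 1 => !![0, 0; p.s⁻¹ • ((u⁻¹ : Sˣ) : S), 0]
  | K 0 => !![algebraMap ℂ S p.s⁻¹, 0; 0, algebraMap ℂ S p.s]
  | K 1 => !![algebraMap ℂ S p.s, 0; 0, algebraMap ℂ S p.s⁻¹]
  | Kinv 0 => !![algebraMap ℂ S p.s, 0; 0, algebraMap ℂ S p.s⁻¹]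
  | Kinv 1 => !![algebraMap ℂ S p.s⁻¹, 0; 0, algebraMap ℂ S p.s]

theorem evalGen_rel ⦃x y : FreeAlgebra ℂ AffGen⦄ (h : AffRel p.q x y) :
    FreeAlgebra.lift ℂ (p.evalGen u) x = FreeAlgebra.lift ℂ (p.evalGen u) y := by
  have hs := p.s_ne_zero
  have hq := p.q_ne_zero
  have hq2 := p.q_sq_sub_one_ne_zero
  have hqq := p.s_sq
  have hs2 : (p.q - p.q⁻¹)⁻¹ * (p.q - p.q⁻¹) = 1 := by
    apply inv_mul_cancel₀
    rw [show p.q - p.q⁻¹ = p.q⁻¹ * (p.q ^ 2 - 1) by field_simp]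
    exact mul_ne_zero (inv_ne_zero hq) hq2
  have ss : p.s * p.s = p.q := by rw [← hqq, pow_two]
  have si : p.s⁻¹ * p.s⁻¹ = p.q⁻¹ := by rw [← mul_inv, ss]
  cases h with
  | K_Kinv i =>
    fin_cases i <;> ext a b <;> fin_cases a <;> fin_cases b <;>
      simp [evalGen, Matrix.mul_apply, Algebra.algebraMap_eq_smul_one, smul_smul, hs]
  | Kinv_K i =>
    fin_cases i <;> ext a b <;> fin_cases a <;> fin_cases b <;>
      simp [evalGen, Matrix.mul_apply, Algebra.algebraMap_eq_smul_one, smul_smul, hs]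
  | K_K i j =>
    fin_cases i <;> fin_cases j <;> ext a b <;> fin_cases a <;> fin_cases b <;>
      simp [evalGen, Matrix.mul_apply, Algebra.algebraMap_eq_smul_one, smul_smul, hs]
  | K_E i j =>
    fin_cases i <;> fin_cases j <;> ext a b <;> fin_cases a <;> fin_cases b <;>
      simp [evalGen, Matrix.mul_apply, ← hqq, Algebra.algebraMap_eq_smul_one, smul_smul]
    all_goals (congr 1; field_simp)
  | K_F i j =>
    fin_cases i <;> fin_cases j <;> ext a b <;> fin_cases a <;> fin_cases b <;>
      simp [evalGen, Matrix.mul_apply, ← hqq, Algebra.algebraMap_eq_smul_one, smul_smul]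
    all_goals (congr 1; field_simp)
  | E_F i j =>
    fin_cases i <;> fin_cases j <;> ext a b <;> fin_cases a <;> fin_cases b <;>
      simp [evalGen, Ring.lie_def, Algebra.algebraMap_eq_smul_one, smul_smul]
    all_goals
      simp only [ss, si, inv_mul_cancel₀ hs, mul_inv_cancel₀ hs, ← sub_smul, smul_smul, ← neg_smul]
      congr 1
      first | linear_combination -hs2 | linear_combination hs2
  | serre_E i j hij =>
    have h0 : p.evalGen u (E i) * p.evalGen u (E i) = 0 := by
      fin_cases i <;> ext a b <;> fin_cases a <;> fin_cases b <;>
        simp [evalGen, Matrix.mul_apply]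
    rw [map_zero]
    simp only [qComm, Ring.lie_def, map_sub, map_mul, map_smul, FreeAlgebra.lift_ι_apply]
    simp only [mul_sub, sub_mul, mul_smul_comm, smul_mul_assoc, mul_assoc, h0, mul_zero, smul_zero]
    simp only [← mul_assoc, h0, zero_mul, smul_zero, sub_zero, mul_zero]
  | serre_F i j hij =>
    have h0 : p.evalGen u (F i) * p.evalGen u (F i) = 0 := by
      fin_cases i <;> ext a b <;> fin_cases a <;> fin_cases b <;>
        simp [evalGen, Matrix.mul_apply]
    rw [map_zero]
    simp only [qComm, Ring.lie_def, map_sub, map_mul, map_smul, FreeAlgebra.lift_ι_apply]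
    simp only [mul_sub, sub_mul, mul_smul_comm, smul_mul_assoc, mul_assoc, h0, mul_zero, smul_zero]
    simp only [← mul_assoc, h0, zero_mul, smul_zero, sub_zero, mul_zero]

/-- The evaluation representation `π_u` on `𝒱_u = ℂ²`, with values in `2 × 2` matrices over a
`ℂ`-algebra containing the invertible parameter `u`. -/
def evalRep : QAffine p.q →ₐ[ℂ] Matrix (Fin 2) (Fin 2) S :=
  RingQuot.liftAlgHom ℂ ⟨FreeAlgebra.lift ℂ (p.evalGen u), p.evalGen_rel u⟩

theorem evalRep_gen (g : AffGen) : p.evalRep u (gen p.q g) = p.evalGen u g := by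
  simp [evalRep, gen]

end EvalRep

/-! ### Representations `𝒱_u ⊗ W` with a formal parameter `u` -/

section TensorAction

variable {S : Type*} [Ring S] [Algebra ℂ S]

theorem evalRep_commute (u : Sˣ) (ψ : QOnsager p.q p.rho →ₐ[ℂ] S)
    (hψ : ∀ t, Commute (u : S) (ψ t)) (x : QAffine p.q) (t : QOnsager p.q p.rho) :
    Commute (p.evalRep u x) (((Matrix.scalarAlgHom (Fin 2) ℂ).comp ψ) t) := by
  obtain ⟨x, rfl⟩ := RingQuot.mkAlgHom_surjective ℂ (AffRel p.q) x
  have hu := hψ t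
  have hu' : Commute ((u⁻¹ : Sˣ) : S) (ψ t) := hu.units_inv_left
  induction x using FreeAlgebra.induction with
  | grade0 r =>
    rw [AlgHom.commutes, AlgHom.commutes]
    exact Algebra.commutes _ _
  | grade1 g =>
    have h := p.evalRep_gen u g
    rw [gen] at h
    rw [h]
    change _ * Matrix.scalar (Fin 2) (ψ t) = Matrix.scalar (Fin 2) (ψ t) * _
    have h1 : ∀ r : ℂ, algebraMap ℂ S r * ψ t = ψ t * algebraMap ℂ S r :=
      fun r => Algebra.commutes _ _
    cases g with
    | _ i =>
      fin_cases i <;> ext a b <;> fin_cases a <;> fin_cases b <;>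
        simp [evalGen, h1, hu.eq, hu'.eq]
  | mul a b ha hb => rw [map_mul, map_mul]; exact ha.mul_left hb
  | add a b ha hb => rw [map_add, map_add]; exact ha.add_left hb

/-- `(π_u × id)[δ(a)]` as a `2 × 2` matrix: `𝕋` acts through `ψ : 𝕋 → S` on the second factor,
and `u` is an invertible parameter commuting with `ψ`. -/
def tensorAction (u : Sˣ) (ψ : QOnsager p.q p.rho →ₐ[ℂ] S) (hψ : ∀ t, Commute (u : S) (ψ t)) :
    QOnsager p.q p.rho →ₐ[ℂ] Matrix (Fin 2) (Fin 2) S :=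
  (Algebra.TensorProduct.lift (p.evalRep u) ((Matrix.scalarAlgHom (Fin 2) ℂ).comp ψ)
    (p.evalRep_commute u ψ hψ)).comp p.coaction

end TensorAction

end Params

/-! ### Formal series -/

/-- Formal Laurent series `S((u))` over a not necessarily commutative ring `S`. -/
abbrev Laurent (S : Type*) [Ring S] : Type _ := LaurentSeries S

/-- `2 × 2` matrices with entries in `S((u))`. For `S = End(W)` these are the formal Laurent
series in `u` with coefficients in `End(ℂ² ⊗ W)`. -/
abbrev LaurentMatrix (S : Type*) [Ring S] : Type _ := Matrix (Fin 2) (Fin 2) (Laurent S)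

/-- The formal variable `u` as a unit of the ring of formal Laurent series `S((u))`. -/
def formalVar (S : Type*) [Ring S] : (Laurent S)ˣ where
  val := HahnSeries.single 1 1
  inv := HahnSeries.single (-1) 1
  val_inv := by rw [HahnSeries.single_mul_single]; simp
  inv_val := by rw [HahnSeries.single_mul_single]; simp

theorem formalVar_commute_C {S : Type*} [Ring S] (x : S) :
    Commute (formalVar S : Laurent S) (HahnSeries.C x) := by
  change HahnSeries.single 1 1 * HahnSeries.single 0 x
    = HahnSeries.single 0 x * HahnSeries.single 1 1
  simp [HahnSeries.single_mul_single]

/-- Constants `S → S((u))`. -/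
def constHom (S : Type*) [Ring S] [Algebra ℂ S] : S →ₐ[ℂ] Laurent S :=
  { HahnSeries.C with commutes' := fun _ => rfl }

/-- `U = (q u² + q⁻¹ u⁻²) / (q + q⁻¹)` in the field `ℂ((u))`. -/
def symVar (q : ℂ) : LaurentSeries ℂ :=
  HahnSeries.single 2 (q / (q + q⁻¹)) + HahnSeries.single (-2) (q⁻¹ / (q + q⁻¹))

/-- The current `∑_{k ≥ 0} X_k U^{-k-1}`, expanded as a formal power series in `u`. Since
`U^{-k-1}` has order `2k + 2` in `u`, only `k ≤ n` contribute to the coefficient of `u^n`. -/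
def current {S : Type*} [Ring S] [Algebra ℂ S] (q : ℂ) (X : ℕ → S) : Laurent S :=
  HahnSeries.ofPowerSeries ℤ S (PowerSeries.mk fun n =>
    ∑ k ∈ Finset.range (n + 1), ((symVar q)⁻¹ ^ (k + 1)).coeff (n : ℤ) • X k)

/-- The terms left out in `current` vanish. -/
theorem coeff_symVar_inv_pow {q : ℂ} (hq : q ≠ 0) (hq' : q + q⁻¹ ≠ 0) (k : ℕ) {n : ℤ}
    (hn : n < 2 * (k + 1)) : ((symVar q)⁻¹ ^ (k + 1)).coeff n = 0 := by
  have hc : (symVar q).coeff (-2) ≠ 0 := by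
    simp [symVar, hq, hq']
  have h0 : symVar q ≠ 0 := by
    intro h
    rw [h] at hc
    exact hc rfl
  have ho : (symVar q).order = -2 := by
    apply le_antisymm (HahnSeries.order_le_of_coeff_ne_zero hc)
    by_contra! hlt
    apply (HahnSeries.coeff_order_eq_zero (x := symVar q)).not.mpr h0
    simp only [symVar, HahnSeries.coeff_add, HahnSeries.coeff_single] at hlt ⊢
    rw [if_neg (by omega), if_neg (by omega), add_zero]
  have hi : (symVar q)⁻¹.order = 2 := by
    have := HahnSeries.order_mul h0 (inv_ne_zero h0)
    rw [mul_inv_cancel₀ h0, HahnSeries.order_one, ho] at this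
    omega
  apply HahnSeries.coeff_eq_zero_of_lt_order
  rw [HahnSeries.order_pow, hi]
  simp only [nsmul_eq_mul]
  push_cast
  omega

/-! ### The `R`-matrix and the reflection equation -/

/-- The `R`-matrix `R(x)` in the basis `e₁⊗e₁, e₁⊗e₂, e₂⊗e₁, e₂⊗e₂` of `ℂ² ⊗ ℂ²`. -/
def RMatrix {S : Type*} [Ring S] [Algebra ℂ S] (q : ℂ) (x : Sˣ) :
    Matrix (Fin 2 × Fin 2) (Fin 2 × Fin 2) S :=
  let a : S := q • (x : S) - q⁻¹ • ((x⁻¹ : Sˣ) : S)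
  let b : S := (x : S) - ((x⁻¹ : Sˣ) : S)
  let c : S := algebraMap ℂ S (q - q⁻¹)
  Matrix.reindex finProdFinEquiv.symm finProdFinEquiv.symm
    !![a, 0, 0, 0;
       0, b, c, 0;
       0, c, b, 0;
       0, 0, 0, a]

/-- The reflection equation
`R₁₂(u/v) (K(u)⊗I) R₁₂(uv) (I⊗K(v)) = (I⊗K(v)) R₁₂(uv) (K(u)⊗I) R₁₂(u/v)`
for a matrix `K(u)` of formal Laurent series with coefficients in `S`. The two independent formal
variables live in `S((v))((u))`. -/
def ReflectionEquation {S : Type*} [Ring S] [Algebra ℂ S] (q : ℂ)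
    (K : LaurentMatrix S) : Prop :=
  let u : (Laurent (Laurent S))ˣ := formalVar (Laurent S)
  let v : (Laurent (Laurent S))ˣ :=
    Units.map (HahnSeries.C : Laurent S →+* Laurent (Laurent S)).toMonoidHom
      (formalVar S)
  let Ku : LaurentMatrix (Laurent S) :=
    K.map fun x => x.map (HahnSeries.C : S →+* Laurent S)
  let Kv : LaurentMatrix (Laurent S) :=
    K.map (HahnSeries.C : Laurent S →+* Laurent (Laurent S))
  RMatrix q (u * v⁻¹) * (Ku ⊗ₖ 1) * RMatrix q (u * v) * (1 ⊗ₖ Kv) =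
    (1 ⊗ₖ Kv) * RMatrix q (u * v) * (Ku ⊗ₖ 1) * RMatrix q (u * v⁻¹)

/-! ### Intertwiners -/

section Intertwiners

variable {S : Type*} [Ring S] [Algebra ℂ S]

namespace Params

variable (p : Params)

/-- The action `a ↦ (π_u × id)[δ(a)]` of `𝕋` on `𝒱_u ⊗ W`, with `u` formal, as a `2 × 2` matrix
with entries in `S((u))`; here `𝕋` acts on `W` through `φ : 𝕋 → S = End(W)`. -/
def actU (φ : QOnsager p.q p.rho →ₐ[ℂ] S) :
    QOnsager p.q p.rho →ₐ[ℂ] LaurentMatrix S :=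
  p.tensorAction (formalVar S) ((constHom S).comp φ)
    fun t => formalVar_commute_C (φ t)

/-- The action `a ↦ (π_{u⁻¹} × id)[δ(a)]` of `𝕋` on `𝒱_{u⁻¹} ⊗ W`. -/
def actUInv (φ : QOnsager p.q p.rho →ₐ[ℂ] S) :
    QOnsager p.q p.rho →ₐ[ℂ] LaurentMatrix S :=
  p.tensorAction (formalVar S)⁻¹ ((constHom S).comp φ)
    fun t => (formalVar_commute_C (φ t)).units_inv_left

/-- `K(u) : 𝒱_u ⊗ W → 𝒱_{u⁻¹} ⊗ W` intertwines the actions of `𝕋`. -/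
def IsIntertwiner (φ : QOnsager p.q p.rho →ₐ[ℂ] S)
    (K : LaurentMatrix S) : Prop :=
  ∀ a : QOnsager p.q p.rho, K * p.actU φ a = p.actUInv φ a * K

/-- The matrix `K(u)` with entries
`A(u) = u q W₊(u) - u⁻¹ q⁻¹ W₋(u)`, `D(u) = u q W₋(u) - u⁻¹ q⁻¹ W₊(u)`,
`B(u) = G₊(u) / (k₋ (q + q⁻¹)) + k₊ (q + q⁻¹) / (q - q⁻¹)`,
`C(u) = G₋(u) / (k₊ (q + q⁻¹)) + k₋ (q + q⁻¹) / (q - q⁻¹)`,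
where `W₊, W₋, G₊, G₋` are the currents of `W_{-k}, W_{k+1}, G_{k+1}, G̃_{k+1}` in `S = End(W)`
under `Φ`. -/
def KMatrix (Φ : Aq p.q p.rho →ₐ[ℂ] S) :
    LaurentMatrix S :=
  let u : (Laurent S)ˣ := formalVar S
  let Wp := current p.q fun k => Φ (Aq.gen p.q p.rho (CurGen.Wneg k))
  let Wm := current p.q fun k => Φ (Aq.gen p.q p.rho (CurGen.Wpos k))
  let Gp := current p.q fun k => Φ (Aq.gen p.q p.rho (CurGen.G k))
  let Gm := current p.q fun k => Φ (Aq.gen p.q p.rho (CurGen.Gt k))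
  !![p.q • ((u : Laurent S) * Wp)
        - p.q⁻¹ • (((u⁻¹ : (Laurent S)ˣ) :
            Laurent S) * Wm),
      (p.km * (p.q + p.q⁻¹))⁻¹ • Gp
        + algebraMap ℂ _ (p.kp * (p.q + p.q⁻¹) / (p.q - p.q⁻¹));
     (p.kp * (p.q + p.q⁻¹))⁻¹ • Gm
        + algebraMap ℂ _ (p.km * (p.q + p.q⁻¹) / (p.q - p.q⁻¹)),
      p.q • ((u : Laurent S) * Wm)
        - p.q⁻¹ • (((u⁻¹ : (Laurent S)ˣ) :
            Laurent S) * Wp)]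

end Params

/-- The representation `φ` of a `ℂ`-algebra on `W` is irreducible. -/
def IsIrreducible {T : Type*} [Ring T] [Algebra ℂ T] {W : Type*} [AddCommGroup W] [Module ℂ W]
    (φ : T →ₐ[ℂ] Module.End ℂ W) : Prop :=
  Nontrivial W ∧ ∀ N : Submodule ℂ W, (∀ t, ∀ w ∈ N, φ t w ∈ N) → N = ⊥ ∨ N = ⊤

end Intertwiners

end QOns
end

/-!
The proof has three parts: a pair of operators satisfying the `q`-Dolan–Grady relations is
extended to all modes of the currents; the intertwiner `K(u)` is shown to be unique; and the
reflection equation is deduced from uniqueness. The third part also yields most of the relations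
of `𝒜_q`.

*Root vectors.* Let `X`, `Y` be the images of `A`, `A*`. Reflecting one of the two elements in the
other (`reflect`, an analogue of Lusztig's braid group action) gives another pair satisfying the
relations: in words with three letters `B`, with polynomials in left and right multiplication by
`A` as weights, the multipliers that define the reflection of each letter combine to a multiplier
depending on the outermost variables only (`DolanGrady.reflect_right`). Iterating produces root
vectors `x_r`, `r ∈ ℤ`, whose `q`-commutator `h = [x_r, x_{r+1}]_q` does not depend on `r` and
which satisfy `[h, x_r] = c (x_{r+1} - x_{r-1})` (`exists_rootSeq`). The symmetrised quadratic
expressions `quadForm` in the root vectors depend on the difference of the indices only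
(`RootSeq.invUpTo`), and their values yield commuting imaginary root vectors
(`RootSeq.theta_commute`). Both facts are proved together, by induction on the level.

*Modes.* The inverse of the generating series of the imaginary root vectors factors, up to a
scalar, as `β(t / q) β(q t)`, and `β` inherits its exchange relation with the root vectors,
because the lowest coefficient of the defect satisfies a homogeneous linear equation with only the
trivial solution (`defect_eq_zero_of_scaleSeries_mul`, `RootSeq.exists_exchange`). The
coefficients of `β`, in the variable `t + t⁻¹`, play the role of the `𝒢_{k+1}`; their relations
with `X` and `Y` (`exists_genSeq`) make it possible to define the remaining modes recursively so
that all relations of `𝒜_q` involving `𝒲₀` or `𝒲₁` hold (`exists_isCurrentBase`). These relations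
say precisely that `K(u)` is an intertwiner (`IsCurrentBase.isSeqIntertwiner`).

*Uniqueness.* Comparing coefficients, the lowest coefficient of the upper right entry of an
intertwiner commutes with `X` and `Y`, and an intertwiner whose upper right entry vanishes is zero
(`IsSeqIntertwiner.lowest`, `IsSeqIntertwiner.eq_zero`). As the upper right entry of `K(u)` begins
with a non-zero scalar, every intertwiner is a multiple of `K(u)`
(`IsSeqIntertwiner.exists_eq_smul`). For irreducible `W` the multiplier is a scalar series by
Schur's lemma, which holds because the `q`-Onsager algebra has countable dimension
(`IsIrreducible.exists_eq_algebraMap`).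

*Reflection equation.* The difference of its two sides intertwines two actions on `𝒱_u ⊗ 𝒱_v ⊗ W`.
Applying the uniqueness argument twice, such a two-site intertwiner is determined by its corner
entry, which here is a multiple of a commutator of values of the upper right entry of `K` and
hence zero (`reflectionEquation_of_commute`). Conversely, the remaining relations of `𝒜_q` are
linear combinations of the entries of the reflection equation (`exchange_of_reflectionEquation`,
`IsCurrentBase.curRel`), so the modes constructed above do define a representation of `𝒜_q`.
-/

open scoped TensorProduct Kronecker

noncomputable section

namespace QOns

/-! ### Words with polynomial weights -/

section Words

open MvPolynomial

variable {S : Type*} [Ring S] [Algebra ℂ S]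

/-- The action of polynomials in two variables on `S`, the first variable being left
multiplication by `A` and the second being right multiplication by `A`. -/
def biAct (A B : S) : MvPolynomial (Fin 2) ℂ →ₗ[ℂ] S :=
  (basisMonomials (Fin 2) ℂ).constr ℂ fun e => A ^ e 0 * B * A ^ e 1

/-- The linear map sending the monomial `x₀ⁱ x₁ʲ x₂ᵏ x₃ˡ` to `Aⁱ B₁ Aʲ B₂ Aᵏ B₃ Aˡ`. -/
def triAct (A B₁ B₂ B₃ : S) : MvPolynomial (Fin 4) ℂ →ₗ[ℂ] S :=
  (basisMonomials (Fin 4) ℂ).constr ℂ fun e =>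
    A ^ e 0 * B₁ * A ^ e 1 * B₂ * A ^ e 2 * B₃ * A ^ e 3

theorem biAct_monomial (A B : S) (e : Fin 2 →₀ ℕ) (r : ℂ) :
    biAct A B (monomial e r) = r • (A ^ e 0 * B * A ^ e 1) := by
  have := (basisMonomials (Fin 2) ℂ).constr_basis ℂ (fun e => A ^ e 0 * B * A ^ e 1) e
  rw [coe_basisMonomials] at this
  rw [← this, ← map_smul, smul_monomial]
  simp [biAct]

theorem triAct_monomial (A B₁ B₂ B₃ : S) (e : Fin 4 →₀ ℕ) (r : ℂ) :
    triAct A B₁ B₂ B₃ (monomial e r) =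
      r • (A ^ e 0 * B₁ * A ^ e 1 * B₂ * A ^ e 2 * B₃ * A ^ e 3) := by
  have := (basisMonomials (Fin 4) ℂ).constr_basis ℂ
    (fun e => A ^ e 0 * B₁ * A ^ e 1 * B₂ * A ^ e 2 * B₃ * A ^ e 3) e
  rw [coe_basisMonomials] at this
  rw [← this, ← map_smul, smul_monomial]
  simp [triAct]

variable (A B B₁ B₂ B₃ : S)

theorem biAct_C (r : ℂ) : biAct A B (C r) = r • B := by
  rw [C_apply, biAct_monomial]; simp

theorem biAct_one : biAct A B 1 = B := by
  simpa using biAct_C A B 1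

theorem biAct_mul_X_zero (p : MvPolynomial (Fin 2) ℂ) :
    biAct A B (p * X 0) = A * biAct A B p := by
  induction p using MvPolynomial.induction_on' with
  | monomial e r =>
    rw [X, monomial_mul, biAct_monomial, biAct_monomial]
    simp [pow_succ', mul_assoc]
  | add p q hp hq => rw [add_mul, map_add, hp, hq, map_add, mul_add]

theorem biAct_mul_X_one (p : MvPolynomial (Fin 2) ℂ) :
    biAct A B (p * X 1) = biAct A B p * A := by
  induction p using MvPolynomial.induction_on' with
  | monomial e r =>
    rw [X, monomial_mul, biAct_monomial, biAct_monomial]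
    simp [pow_succ, mul_assoc]
  | add p q hp hq => rw [add_mul, map_add, hp, hq, map_add, add_mul]

theorem biAct_mul (p f : MvPolynomial (Fin 2) ℂ) :
    biAct A B (p * f) = biAct A (biAct A B p) f := by
  induction f using MvPolynomial.induction_on with
  | C r => rw [biAct_C, mul_comm, ← smul_eq_C_mul, map_smul]
  | add f g hf hg => rw [mul_add, map_add, hf, hg, map_add]
  | mul_X f i hf =>
    fin_cases i
    · simp only [Fin.zero_eta, ← mul_assoc, biAct_mul_X_zero, hf]
    · simp only [Fin.mk_one, ← mul_assoc, biAct_mul_X_one, hf]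

theorem biAct_smul_base (f : MvPolynomial (Fin 2) ℂ) (r : ℂ) :
    biAct A (r • B) f = r • biAct A B f := by
  induction f using MvPolynomial.induction_on' with
  | monomial e r' =>
    simp only [biAct_monomial, mul_smul_comm, smul_mul_assoc, smul_comm r]
  | add p q hp hq => simp only [map_add, hp, hq, smul_add]

theorem biAct_zero_base (f : MvPolynomial (Fin 2) ℂ) : biAct A 0 f = 0 := by
  simpa using biAct_smul_base A 0 f 0

section Slots

variable (p : MvPolynomial (Fin 4) ℂ)

theorem triAct_mul_X_zero : triAct A B₁ B₂ B₃ (p * X 0) = A * triAct A B₁ B₂ B₃ p := by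
  induction p using MvPolynomial.induction_on' with
  | monomial e r =>
    rw [X, monomial_mul, triAct_monomial, triAct_monomial]
    simp [pow_succ', mul_assoc]
  | add p q hp hq => rw [add_mul, map_add, hp, hq, map_add, mul_add]

theorem triAct_mul_X_three : triAct A B₁ B₂ B₃ (p * X 3) = triAct A B₁ B₂ B₃ p * A := by
  induction p using MvPolynomial.induction_on' with
  | monomial e r =>
    rw [X, monomial_mul, triAct_monomial, triAct_monomial]
    simp [pow_succ, mul_assoc]
  | add p q hp hq => rw [add_mul, map_add, hp, hq, map_add, add_mul]

theorem triAct_slot₁_zero : triAct A (A * B₁) B₂ B₃ p = triAct A B₁ B₂ B₃ (p * X 0) := by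
  induction p using MvPolynomial.induction_on' with
  | monomial e r =>
    rw [X, monomial_mul, triAct_monomial, triAct_monomial]
    simp [pow_succ, mul_assoc]
  | add p q hp hq => rw [add_mul, map_add, hp, hq, map_add]

theorem triAct_slot₁_one : triAct A (B₁ * A) B₂ B₃ p = triAct A B₁ B₂ B₃ (p * X 1) := by
  induction p using MvPolynomial.induction_on' with
  | monomial e r =>
    rw [X, monomial_mul, triAct_monomial, triAct_monomial]
    simp [pow_succ', mul_assoc]
  | add p q hp hq => rw [add_mul, map_add, hp, hq, map_add]

theorem triAct_slot₂_one : triAct A B₁ (A * B₂) B₃ p = triAct A B₁ B₂ B₃ (p * X 1) := by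
  induction p using MvPolynomial.induction_on' with
  | monomial e r =>
    rw [X, monomial_mul, triAct_monomial, triAct_monomial]
    simp [pow_succ, mul_assoc]
  | add p q hp hq => rw [add_mul, map_add, hp, hq, map_add]

theorem triAct_slot₂_two : triAct A B₁ (B₂ * A) B₃ p = triAct A B₁ B₂ B₃ (p * X 2) := by
  induction p using MvPolynomial.induction_on' with
  | monomial e r =>
    rw [X, monomial_mul, triAct_monomial, triAct_monomial]
    simp [pow_succ', mul_assoc]
  | add p q hp hq => rw [add_mul, map_add, hp, hq, map_add]

theorem triAct_slot₃_two : triAct A B₁ B₂ (A * B₃) p = triAct A B₁ B₂ B₃ (p * X 2) := by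
  induction p using MvPolynomial.induction_on' with
  | monomial e r =>
    rw [X, monomial_mul, triAct_monomial, triAct_monomial]
    simp [pow_succ, mul_assoc]
  | add p q hp hq => rw [add_mul, map_add, hp, hq, map_add]

theorem triAct_slot₃_three : triAct A B₁ B₂ (B₃ * A) p = triAct A B₁ B₂ B₃ (p * X 3) := by
  induction p using MvPolynomial.induction_on' with
  | monomial e r =>
    rw [X, monomial_mul, triAct_monomial, triAct_monomial]
    simp [pow_succ', mul_assoc]
  | add p q hp hq => rw [add_mul, map_add, hp, hq, map_add]

variable (f : MvPolynomial (Fin 2) ℂ)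

/-- A polynomial acting on the first letter of a word may be moved into the weight of the word; the
two variables become those to the left and to the right of that letter. -/
theorem triAct_slot₁ : triAct A (biAct A B₁ f) B₂ B₃ p =
    triAct A B₁ B₂ B₃ (p * aeval ![X 0, X 1] f) := by
  induction f using MvPolynomial.induction_on generalizing p with
  | C r =>
    rw [biAct_C, algHom_C, algebraMap_eq, mul_comm, ← smul_eq_C_mul, map_smul]
    induction p using MvPolynomial.induction_on' with
    | monomial e r' => simp only [triAct_monomial, mul_smul_comm, smul_mul_assoc, smul_comm r]
    | add p q hp hq => simp only [map_add, hp, hq, smul_add]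
  | add f g hf hg =>
    rw [map_add, map_add, mul_add, map_add, ← hf, ← hg]
    induction p using MvPolynomial.induction_on' with
    | monomial e r' => simp only [triAct_monomial, mul_add, add_mul, smul_add]
    | add p q hp hq => simp only [map_add, hp, hq]; abel
  | mul_X f i hf =>
    fin_cases i
    · simp only [Fin.zero_eta, biAct_mul_X_zero, triAct_slot₁_zero, hf, map_mul, aeval_X]
      exact congrArg _ (by simp; ring)
    · simp only [Fin.mk_one, biAct_mul_X_one, triAct_slot₁_one, hf, map_mul, aeval_X]
      exact congrArg _ (by simp; ring)

theorem triAct_slot₂ : triAct A B₁ (biAct A B₂ f) B₃ p =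
    triAct A B₁ B₂ B₃ (p * aeval ![X 1, X 2] f) := by
  induction f using MvPolynomial.induction_on generalizing p with
  | C r =>
    rw [biAct_C, algHom_C, algebraMap_eq, mul_comm, ← smul_eq_C_mul, map_smul]
    induction p using MvPolynomial.induction_on' with
    | monomial e r' => simp only [triAct_monomial, mul_smul_comm, smul_mul_assoc, smul_comm r]
    | add p q hp hq => simp only [map_add, hp, hq, smul_add]
  | add f g hf hg =>
    rw [map_add, map_add, mul_add, map_add, ← hf, ← hg]
    induction p using MvPolynomial.induction_on' with
    | monomial e r' => simp only [triAct_monomial, mul_add, add_mul, smul_add]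
    | add p q hp hq => simp only [map_add, hp, hq]; abel
  | mul_X f i hf =>
    fin_cases i
    · simp only [Fin.zero_eta, biAct_mul_X_zero, triAct_slot₂_one, hf, map_mul, aeval_X]
      exact congrArg _ (by simp; ring)
    · simp only [Fin.mk_one, biAct_mul_X_one, triAct_slot₂_two, hf, map_mul, aeval_X]
      exact congrArg _ (by simp; ring)

theorem triAct_slot₃ : triAct A B₁ B₂ (biAct A B₃ f) p =
    triAct A B₁ B₂ B₃ (p * aeval ![X 2, X 3] f) := by
  induction f using MvPolynomial.induction_on generalizing p with
  | C r =>
    rw [biAct_C, algHom_C, algebraMap_eq, mul_comm, ← smul_eq_C_mul, map_smul]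
    induction p using MvPolynomial.induction_on' with
    | monomial e r' => simp only [triAct_monomial, mul_smul_comm, smul_comm r, smul_mul_assoc]
    | add p q hp hq => simp only [map_add, hp, hq, smul_add]
  | add f g hf hg =>
    rw [map_add, map_add, mul_add, map_add, ← hf, ← hg]
    induction p using MvPolynomial.induction_on' with
    | monomial e r' => simp only [triAct_monomial, mul_add, add_mul, smul_add]
    | add p q hp hq => simp only [map_add, hp, hq]; abel
  | mul_X f i hf =>
    fin_cases i
    · simp only [Fin.zero_eta, biAct_mul_X_zero, triAct_slot₃_two, hf, map_mul, aeval_X]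
      exact congrArg _ (by simp; ring)
    · simp only [Fin.mk_one, biAct_mul_X_one, triAct_slot₃_three, hf, map_mul, aeval_X]
      exact congrArg _ (by simp; ring)

/-- Polynomials in the outermost variables act on words from outside. -/
theorem triAct_outer : triAct A B₁ B₂ B₃ (p * aeval ![X 0, X 3] f) =
    biAct A (triAct A B₁ B₂ B₃ p) f := by
  induction f using MvPolynomial.induction_on generalizing p with
  | C r => rw [biAct_C, algHom_C, algebraMap_eq, mul_comm, ← smul_eq_C_mul, map_smul]
  | add f g hf hg => rw [map_add, map_add, mul_add, map_add, ← hf, ← hg]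
  | mul_X f i hf =>
    fin_cases i
    · simp only [Fin.zero_eta, biAct_mul_X_zero, ← hf, ← triAct_mul_X_zero, map_mul, aeval_X]
      simp [mul_assoc]
    · simp only [Fin.mk_one, biAct_mul_X_one, ← hf, ← triAct_mul_X_three, map_mul, aeval_X]
      simp [mul_assoc]

end Slots

end Words

/-! ### Reflection of a pair satisfying the `q`-Dolan–Grady relations -/

section ReflectionPolynomials

variable {R : Type*} [CommRing R] (p k x y z w : R)

/-- Up to the factor `p = q²`, the quadratic polynomial that relates two neighbouring
eigenvalues of `A`. -/
def nbrPoly₁ : R := p * (x ^ 2 + y ^ 2) - (p ^ 2 + 1) * x * y + p * (p + 1) * k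

/-- The analogue of `nbrPoly₁` for eigenvalues of `A` at distance two. -/
def nbrPoly₂ : R :=
  p ^ 2 * (x ^ 2 + y ^ 2) - (p ^ 4 + 1) * x * y + k * (p + 1) * (p ^ 2 + 1) ^ 2

/-- The multiplier `f(x) / f(y)` of the reflection, on pairs of eigenvalues at distance at most
one. -/
def reflPoly₁ : R := k * p + (y - x) * (p * y - x)

/-- The multiplier of the reflection on pairs of eigenvalues at distance at most two. -/
def reflPoly₂ : R :=
  (p ^ 2 + 1) * (p ^ 2 + p + 1) * k * reflPoly₁ p k x y
    + (y - x) * nbrPoly₁ p k x y * (p ^ 2 * y - x)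

/-- The multiplier of the reflection on pairs of eigenvalues at distance at most three. -/
def reflPoly₃ : R :=
  k * ((p ^ 4 + p ^ 3 + p ^ 2 + p + 1) * (p ^ 4 + p ^ 2 + 1)) * reflPoly₂ p k x y
    + p * (y - x) * nbrPoly₁ p k x y * nbrPoly₂ p k x y * (p ^ 3 * y - x)

/-- Modulo the relations `(x - y) * nbrPoly₁ x y = 0` and `(y - z) * nbrPoly₁ y z = 0` the
multipliers of two consecutive steps multiply, up to a constant, to one that does not depend on the
intermediate eigenvalue `y`. The cofactors are found by polynomial division. -/
theorem reflPoly₂_congr : ∃ c₁ c₂ : R,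
    p * reflPoly₂ p k x z = (p ^ 2 + 1) * (p ^ 2 + p + 1) * reflPoly₁ p k x y * reflPoly₁ p k y z
      + c₁ * ((x - y) * nbrPoly₁ p k x y) + c₂ * ((y - z) * nbrPoly₁ p k y z) := by
  refine ⟨x * p + y * (p ^ 2 + p + 1) - z * (p ^ 3 + p ^ 2 + p + 1),
    x * (p ^ 4 + p ^ 3 + p ^ 2 + p) - y * (p ^ 4 + p ^ 3 + p ^ 2) - z * p ^ 3, ?_⟩
  simp only [reflPoly₂, reflPoly₁, nbrPoly₁]
  ring

/-- Two steps between neighbouring eigenvalues lead to eigenvalues at distance zero, one or two. -/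
theorem nbrPoly_congr : ∃ c₁ c₂ : R,
    p ^ 2 * ((x - z) * nbrPoly₁ p k x z * nbrPoly₂ p k x z)
      = c₁ * ((x - y) * nbrPoly₁ p k x y) + c₂ * ((y - z) * nbrPoly₁ p k y z) := by
  refine ⟨k * (p ^ 7 + p ^ 6 + 2 * p ^ 5 + 2 * p ^ 4 + p ^ 3 + p ^ 2) + x ^ 2 * p ^ 4
      + x * y * (p ^ 5 + p ^ 4 + p ^ 3) - x * z * (p ^ 6 + p ^ 5 + p ^ 4 + p ^ 3 + p ^ 2)
      + y ^ 2 * (p ^ 6 + p ^ 5 + 2 * p ^ 4 + p ^ 3 + p ^ 2) - y * z * (p ^ 7 + 2 * p ^ 6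
      + 3 * p ^ 5 + 3 * p ^ 4 + 3 * p ^ 3 + 2 * p ^ 2 + p) + z ^ 2 * (p ^ 7 + p ^ 6 + 2 * p ^ 5 + 2 * p ^ 4 + 2 * p ^ 3 + p ^ 2 + p),
    k * (p ^ 7 + p ^ 6 + 2 * p ^ 5 + 2 * p ^ 4 + p ^ 3 + p ^ 2) + x ^ 2 * (p ^ 7 + p ^ 6 + 2 * p
      ^ 5 + 2 * p ^ 4 + 2 * p ^ 3 + p ^ 2 + p) - x * y * (p ^ 7 + 2 * p ^ 6 + 3 * p ^ 5 + 3 * p ^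
      4 + 3 * p ^ 3 + 2 * p ^ 2 + p) - x * z * (p ^ 6 + p ^ 5 + p ^ 4 + p ^ 3 + p ^ 2) + y ^ 2 *
      (p ^ 6 + p ^ 5 + 2 * p ^ 4 + p ^ 3 + p ^ 2) + y * z * (p ^ 5 + p ^ 4 + p ^ 3) + z ^ 2 * p ^
      4, ?_⟩
  simp only [nbrPoly₂, nbrPoly₁]
  ring

/-- The analogue of `reflPoly₂_congr` for a double step followed by a single step. -/
theorem reflPoly₃_congr : ∃ c₁ c₂ : R,
    p * reflPoly₃ p k x w =
      (p ^ 4 + p ^ 3 + p ^ 2 + p + 1) * (p ^ 4 + p ^ 2 + 1) *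
        reflPoly₂ p k x z * reflPoly₁ p k z w
      + c₁ * ((x - z) * nbrPoly₁ p k x z * nbrPoly₂ p k x z)
      + c₂ * ((z - w) * nbrPoly₁ p k z w) := by
  refine ⟨x * p ^ 2 + z * (p ^ 4 + p ^ 3 + p ^ 2 + p + 1)
      - w * (p ^ 5 + p ^ 4 + p ^ 3 + p ^ 2 + p + 1),
    k * x * (p ^ 12 + 3 * p ^ 11 + 6 * p ^ 10 + 9 * p ^ 9 + 12 * p ^ 8 + 14 * p ^ 7 + 13 * p ^ 6
      + 12 * p ^ 5 + 9 * p ^ 4 + 5 * p ^ 3 + 3 * p ^ 2 + p) - k * z * (p ^ 12 + 3 * p ^ 11 + 6 * p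
      ^ 10 + 8 * p ^ 9 + 11 * p ^ 8 + 11 * p ^ 7 + 10 * p ^ 6 + 7 * p ^ 5 + 5 * p ^ 4 + 2 * p ^ 3
      + p ^ 2) - k * w * (p ^ 11 + 2 * p ^ 10 + 3 * p ^ 9 + 4 * p ^ 8 + 5 * p ^ 7 + 3 * p ^ 6 + 3
      * p ^ 5 + p ^ 4 + p ^ 3) + x ^ 3 * (p ^ 10 + p ^ 9 + 2 * p ^ 8 + 3 * p ^ 7 + 3 * p ^ 6 + 3 *
      p ^ 5 + 3 * p ^ 4 + 2 * p ^ 3 + p ^ 2 + p) - x ^ 2 * z * (p ^ 11 + 2 * p ^ 10 + 4 * p ^ 9 +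
      5 * p ^ 8 + 7 * p ^ 7 + 7 * p ^ 6 + 7 * p ^ 5 + 5 * p ^ 4 + 4 * p ^ 3 + 2 * p ^ 2 + p) - x ^
      2 * w * (p ^ 10 + p ^ 9 + 2 * p ^ 8 + 2 * p ^ 7 + 3 * p ^ 6 + 2 * p ^ 5 + 2 * p ^ 4 + p ^ 3
      + p ^ 2) + x * z ^ 2 * (p ^ 11 + 2 * p ^ 10 + 4 * p ^ 9 + 5 * p ^ 8 + 6 * p ^ 7 + 6 * p ^ 6
      + 5 * p ^ 5 + 4 * p ^ 4 + 2 * p ^ 3 + p ^ 2) + x * z * w * (p ^ 10 + 2 * p ^ 9 + 3 * p ^ 8 +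
      3 * p ^ 7 + 3 * p ^ 6 + 3 * p ^ 5 + 2 * p ^ 4 + p ^ 3) + x * w ^ 2 * (p ^ 9 + p ^ 8 + p ^ 7
      + p ^ 6 + p ^ 5 + p ^ 4) - z ^ 3 * (p ^ 10 + p ^ 9 + 2 * p ^ 8 + 2 * p ^ 7 + 2 * p ^ 6 + p ^
      5 + p ^ 4) - z ^ 2 * w * (p ^ 9 + p ^ 8 + 2 * p ^ 7 + p ^ 6 + p ^ 5) - z * w ^ 2 * (p ^ 8 +
      p ^ 7 + p ^ 6) - w ^ 3 * p ^ 7, ?_⟩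
  simp only [reflPoly₃, reflPoly₂, reflPoly₁, nbrPoly₂, nbrPoly₁]
  ring

end ReflectionPolynomials

section Reflect

open MvPolynomial

variable {S : Type*} [Ring S] [Algebra ℂ S]

/-- The `q`-Dolan–Grady relation of `B` with respect to `A`. -/
def DolanGrady (q ρ : ℂ) (A B : S) : Prop :=
  ⁅A, qComm q⁻¹ A (qComm q A B)⁆ = ρ • ⁅A, B⁆

/-- The reflection of `B` with respect to `A`. Formally it is the conjugate of `B` by a function
of `A`; the formula below does not refer to that function. -/
def reflect (q c : ℂ) (A B : S) : S := B + c⁻¹ • ⁅qComm q B A, A⁆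

variable {q c : ℂ} (A B : S)

/-- The Dolan–Grady relation says that the polynomial `(x - y) * nbrPoly₁ x y` annihilates `B`. -/
theorem biAct_nbrPoly₁ (hq : q ≠ 0) :
    biAct A B ((X 0 - X 1) * nbrPoly₁ (C (q ^ 2)) (C (q⁻¹ * c)) (X 0) (X 1)) =
      q ^ 2 • (⁅A, qComm q⁻¹ A (qComm q A B)⁆ - (-c * (q + q⁻¹)) • ⁅A, B⁆) := by
  have h : ((X 0 - X 1) * nbrPoly₁ (C (q ^ 2)) (C (q⁻¹ * c)) (X 0) (X 1) :
      MvPolynomial (Fin 2) ℂ) =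
      (q ^ 2) • (1 * X 0 * X 0 * X 0) - (q ^ 2 * (q ^ 2 + 1 + (q⁻¹) ^ 2)) • (1 * X 0 * X 0 * X 1)
        + (q ^ 2 * (q ^ 2 + 1 + (q⁻¹) ^ 2)) • (1 * X 0 * X 1 * X 1)
        - (q ^ 2) • (1 * X 1 * X 1 * X 1)
        + (q ^ 2 * (c * (q + q⁻¹))) • (1 * X 0 - 1 * X 1) := by
    have h1 : q ^ 2 * (q ^ 2 + 1 + (q⁻¹) ^ 2) = (q ^ 2) ^ 2 + q ^ 2 + 1 := by field_simp
    have h2 : q ^ 2 * (c * (q + q⁻¹)) = q ^ 2 * (q ^ 2 + 1) * (q⁻¹ * c) := by field_simp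
    rw [h1, h2]
    simp only [nbrPoly₁, smul_eq_C_mul, map_add, map_mul, map_pow, map_one]
    ring
  rw [h]
  simp only [map_add, map_sub, map_smul, biAct_mul_X_zero, biAct_mul_X_one, biAct_one]
  rw [lie_qComm_qComm hq, Ring.lie_def]
  simp only [smul_sub, smul_smul, mul_assoc]
  match_scalars <;> field_simp

/-- Up to a scalar, the reflection applies the multiplier `reflPoly₁` to `B`. -/
theorem biAct_reflPoly₁ (hq : q ≠ 0) (hc : c ≠ 0) :
    biAct A B (reflPoly₁ (C (q ^ 2)) (C (q⁻¹ * c)) (X 0) (X 1)) =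
      (q * c) • reflect q c A B := by
  have h : (reflPoly₁ (C (q ^ 2)) (C (q⁻¹ * c)) (X 0) (X 1) : MvPolynomial (Fin 2) ℂ) =
      (q * c) • 1 + q ^ 2 • (1 * X 1 * X 1) - (q ^ 2 + 1) • (1 * X 0 * X 1)
        + 1 * X 0 * X 0 := by
    have h1 : q * c = q⁻¹ * c * q ^ 2 := by field_simp
    rw [h1]
    simp only [reflPoly₁, smul_eq_C_mul, map_add, map_mul, map_pow, map_one]
    ring
  rw [h]
  simp only [map_add, map_sub, map_smul, biAct_mul_X_zero, biAct_mul_X_one, biAct_one]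
  simp only [reflect, qComm, Ring.lie_def, mul_sub, sub_mul, smul_mul_assoc, mul_smul_comm,
    smul_sub, smul_add, smul_smul, mul_assoc]
  match_scalars
  all_goals field_simp
  all_goals ring

variable {A B}

/-- Since the multiplier commutes with left and right multiplication by `A`, reflecting does not
affect the relation with respect to `A`. -/
theorem DolanGrady.reflect_left (hq : q ≠ 0) (hc : c ≠ 0)
    (h : DolanGrady q (-c * (q + q⁻¹)) A B) :
    DolanGrady q (-c * (q + q⁻¹)) A (reflect q c A B) := by
  have h1 := biAct_nbrPoly₁ (c := c) A B hq
  rw [sub_eq_zero.mpr h, smul_zero] at h1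
  have h2 := biAct_nbrPoly₁ (c := c) A ((q * c) • reflect q c A B) hq
  rw [← biAct_reflPoly₁ A B hq hc, ← biAct_mul, mul_comm, biAct_mul, h1, biAct_zero_base,
    biAct_reflPoly₁ A B hq hc] at h2
  have h3 : ∀ Z : S, ⁅A, (q * c) • Z⁆ = (q * c) • ⁅A, Z⁆ := by
    intro Z; simp only [Ring.lie_def, mul_smul_comm, smul_mul_assoc, smul_sub]
  have h4 : ∀ (r : ℂ) (Z : S), qComm r A ((q * c) • Z) = (q * c) • qComm r A Z := by
    intro r Z
    simp only [qComm, mul_smul_comm, smul_mul_assoc, smul_sub, smul_comm r (q * c),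
      smul_comm r⁻¹ (q * c)]
  rw [h4, h4, h3, h3, smul_comm _ (q * c), ← smul_sub, smul_smul, eq_comm,
    smul_eq_zero_iff_right (by simp [hq, hc])] at h2
  exact sub_eq_zero.mp h2

theorem triAct_one (B₁ B₂ B₃ : S) : triAct A B₁ B₂ B₃ 1 = B₁ * B₂ * B₃ := by
  have h : (1 : MvPolynomial (Fin 4) ℂ) = monomial 0 1 := rfl
  rw [h, triAct_monomial]
  simp

/-- Inside words in which `B` occurs three times, the product of the three consecutive multipliers
agrees with a multiplier depending on the outermost eigenvalues only. -/
theorem triAct_reflPoly₃ {p k : ℂ}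
    (hP : biAct A B ((X 0 - X 1) * nbrPoly₁ (C p) (C k) (X 0) (X 1)) = 0)
    (r : MvPolynomial (Fin 4) ℂ) :
    triAct A B B B (r * (C (p ^ 4) * aeval ![X 0, X 3] (reflPoly₃ (C p) (C k) (X 0) (X 1)))) =
      triAct A B B B (r * (C (p ^ 2 * (((p ^ 2 + 1) * (p ^ 2 + p + 1)) *
          ((p ^ 4 + p ^ 3 + p ^ 2 + p + 1) * (p ^ 4 + p ^ 2 + 1)))) *
        (aeval ![X 0, X 1] (reflPoly₁ (C p) (C k) (X 0) (X 1)) *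
          aeval ![X 1, X 2] (reflPoly₁ (C p) (C k) (X 0) (X 1)) *
          aeval ![X 2, X 3] (reflPoly₁ (C p) (C k) (X 0) (X 1))))) := by
  have hz : ∀ f : MvPolynomial (Fin 2) ℂ, biAct A (0 : S) f = 0 := biAct_zero_base A
  -- each of the three letters `B` makes its relation vanish in the weight of a word
  have k1 : ∀ r, triAct A B B B
      (r * ((X 0 - X 1) * nbrPoly₁ (C p) (C k) (X 0) (X 1))) = 0 := by
    intro r
    have := triAct_slot₁ A B B B r ((X 0 - X 1) * nbrPoly₁ (C p) (C k) (X 0) (X 1))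
    have h0 := triAct_slot₁ A (0 : S) B B r 0
    rw [hz, map_zero, mul_zero, map_zero] at h0
    rw [hP, h0] at this
    simpa [nbrPoly₁, algHom_C] using this.symm
  have k2 : ∀ r, triAct A B B B
      (r * ((X 1 - X 2) * nbrPoly₁ (C p) (C k) (X 1) (X 2))) = 0 := by
    intro r
    have := triAct_slot₂ A B B B r ((X 0 - X 1) * nbrPoly₁ (C p) (C k) (X 0) (X 1))
    have h0 := triAct_slot₂ A B (0 : S) B r 0
    rw [hz, map_zero, mul_zero, map_zero] at h0
    rw [hP, h0] at this
    simpa [nbrPoly₁, algHom_C] using this.symm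
  have k3 : ∀ r, triAct A B B B
      (r * ((X 2 - X 3) * nbrPoly₁ (C p) (C k) (X 2) (X 3))) = 0 := by
    intro r
    have := triAct_slot₃ A B B B r ((X 0 - X 1) * nbrPoly₁ (C p) (C k) (X 0) (X 1))
    have h0 := triAct_slot₃ A B B (0 : S) r 0
    rw [hz, map_zero, mul_zero, map_zero] at h0
    rw [hP, h0] at this
    simpa [nbrPoly₁, algHom_C] using this.symm
  have eg : ∀ i j : Fin 4, aeval ![(X i : MvPolynomial (Fin 4) ℂ), X j]
      (reflPoly₁ (C p) (C k) (X 0) (X 1)) = reflPoly₁ (C p) (C k) (X i) (X j) := by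
    intro i j; simp [reflPoly₁, algHom_C]
  have eG : ∀ i j : Fin 4, aeval ![(X i : MvPolynomial (Fin 4) ℂ), X j]
      (reflPoly₃ (C p) (C k) (X 0) (X 1)) = reflPoly₃ (C p) (C k) (X i) (X j) := by
    intro i j; simp [reflPoly₃, reflPoly₂, reflPoly₁, nbrPoly₁, nbrPoly₂, algHom_C]
  simp only [eg, eG]
  -- eliminate the two inner variables, first `X 1` and then `X 2`
  obtain ⟨c₁, c₂, e1⟩ := reflPoly₂_congr (C p) (C k) (X 0 : MvPolynomial (Fin 4) ℂ) (X 1) (X 2)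
  obtain ⟨d₁, d₂, e2⟩ := nbrPoly_congr (C p) (C k) (X 0 : MvPolynomial (Fin 4) ℂ) (X 1) (X 2)
  obtain ⟨f₁, f₂, e3⟩ := reflPoly₃_congr (C p) (C k) (X 0 : MvPolynomial (Fin 4) ℂ) (X 2) (X 3)
  rw [← sub_eq_zero, ← map_sub, ← mul_sub]
  generalize nbrPoly₁ (C p) (C k) (X 0 : MvPolynomial (Fin 4) ℂ) (X 1) = P₁ at *
  generalize nbrPoly₁ (C p) (C k) (X 1 : MvPolynomial (Fin 4) ℂ) (X 2) = P₂ at *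
  generalize nbrPoly₁ (C p) (C k) (X 2 : MvPolynomial (Fin 4) ℂ) (X 3) = P₃ at *
  generalize (X 0 - X 2 : MvPolynomial (Fin 4) ℂ) * nbrPoly₁ (C p) (C k) (X 0) (X 2) *
    nbrPoly₂ (C p) (C k) (X 0) (X 2) = Q at *
  generalize reflPoly₁ (C p) (C k) (X 0 : MvPolynomial (Fin 4) ℂ) (X 1) = g₁ at *
  generalize reflPoly₁ (C p) (C k) (X 1 : MvPolynomial (Fin 4) ℂ) (X 2) = g₂ at *
  generalize reflPoly₁ (C p) (C k) (X 2 : MvPolynomial (Fin 4) ℂ) (X 3) = g₃ at *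
  generalize reflPoly₃ (C p) (C k) (X 0 : MvPolynomial (Fin 4) ℂ) (X 3) = G at *
  generalize reflPoly₂ (C p) (C k) (X 0 : MvPolynomial (Fin 4) ℂ) (X 2) = G₂ at *
  have e : C (p ^ 4) * G - C (p ^ 2 * (((p ^ 2 + 1) * (p ^ 2 + p + 1)) *
          ((p ^ 4 + p ^ 3 + p ^ 2 + p + 1) * (p ^ 4 + p ^ 2 + 1)))) * (g₁ * g₂ * g₃) =
      (C p * f₁ * d₁ + C p ^ 2 * ((C p ^ 4 + C p ^ 3 + C p ^ 2 + C p + 1) *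
          (C p ^ 4 + C p ^ 2 + 1)) * g₃ * c₁) * ((X 0 - X 1) * P₁) +
      (C p * f₁ * d₂ + C p ^ 2 * ((C p ^ 4 + C p ^ 3 + C p ^ 2 + C p + 1) *
          (C p ^ 4 + C p ^ 2 + 1)) * g₃ * c₂) * ((X 1 - X 2) * P₂) +
      (C p ^ 3 * f₂) * ((X 2 - X 3) * P₃) := by
    simp only [map_add, map_mul, map_pow, map_one]
    linear_combination (C p ^ 3) * e3 + C p * f₁ * e2 + C p ^ 2 * ((C p ^ 4 + C p ^ 3 + C p ^ 2
        + C p + 1) * (C p ^ 4 + C p ^ 2 + 1)) * g₃ * e1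
  rw [e, mul_add, mul_add, map_add, map_add, ← mul_assoc, ← mul_assoc r, ← mul_assoc r, k1, k2, k3]
  simp

/-- The outer multiplier on words in which `B` occurs once. -/
theorem biAct_reflPoly₃ {p k : ℂ}
    (hP : biAct A B ((X 0 - X 1) * nbrPoly₁ (C p) (C k) (X 0) (X 1)) = 0) :
    biAct A B (C (p ^ 4) * (X 1 - X 0) * reflPoly₃ (C p) (C k) (X 0) (X 1)) =
      biAct A B (C (p ^ 2 * (((p ^ 2 + 1) * (p ^ 2 + p + 1)) *
          ((p ^ 4 + p ^ 3 + p ^ 2 + p + 1) * (p ^ 4 + p ^ 2 + 1))) * (k * p) ^ 2)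
        * (X 1 - X 0) * reflPoly₁ (C p) (C k) (X 0) (X 1)) := by
  rw [← sub_eq_zero, ← map_sub]
  have e : C (p ^ 4) * (X 1 - X 0) * reflPoly₃ (C p) (C k) (X 0) (X 1) -
      C (p ^ 2 * (((p ^ 2 + 1) * (p ^ 2 + p + 1)) *
          ((p ^ 4 + p ^ 3 + p ^ 2 + p + 1) * (p ^ 4 + p ^ 2 + 1))) * (k * p) ^ 2)
        * (X 1 - X 0) * reflPoly₁ (C p) (C k) (X 0) (X 1) =
      ((X 0 - X 1) * nbrPoly₁ (C p) (C k) (X 0) (X 1)) *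
      (-(C p ^ 4) * (X 1 - X 0) * (C k * ((C p ^ 4 + C p ^ 3 + C p ^ 2 + C p + 1) *
        (C p ^ 4 + C p ^ 2 + 1)) * (C p ^ 2 * X 1 - X 0)
        + C p * nbrPoly₂ (C p) (C k) (X 0) (X 1) * (C p ^ 3 * X 1 - X 0)) :
        MvPolynomial (Fin 2) ℂ) := by
    simp only [reflPoly₃, reflPoly₂, map_add, map_mul, map_pow, map_one]
    generalize nbrPoly₁ (C p) (C k) (X 0 : MvPolynomial (Fin 2) ℂ) (X 1) = P₁
    generalize nbrPoly₂ (C p) (C k) (X 0 : MvPolynomial (Fin 2) ℂ) (X 1) = P₂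
    generalize reflPoly₁ (C p) (C k) (X 0 : MvPolynomial (Fin 2) ℂ) (X 1) = g
    ring
  rw [e, biAct_mul, hP, biAct_zero_base]

/-- The Dolan–Grady expression with respect to `Z`, as a word sum with polynomial weight. -/
theorem triAct_cubic (hq : q ≠ 0) (A Z : S) :
    triAct A Z Z Z (1 * X 3 - (q ^ 2 + 1 + (q⁻¹) ^ 2) • (1 * X 2 - 1 * X 1) - 1 * X 0) =
      ⁅Z, qComm q⁻¹ Z (qComm q Z A)⁆ := by
  simp only [map_sub, map_smul]
  rw [triAct_mul_X_three, triAct_mul_X_zero, ← triAct_slot₂_two, ← triAct_slot₁_one,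
    lie_qComm_qComm hq, triAct_one, triAct_one, triAct_one]
  simp only [mul_assoc]

/-- Consecutive multipliers along a word in which `B` occurs three times multiply up to an outer
multiplier; so the cubic relation for `B` is carried to the one for its reflection. -/
theorem DolanGrady.reflect_right (hq : q ≠ 0) (hroot : ∀ n : ℕ, 0 < n → q ^ n ≠ 1) (hc : c ≠ 0)
    (h : DolanGrady q (-c * (q + q⁻¹)) A B) (h' : DolanGrady q (-c * (q + q⁻¹)) B A) :
    DolanGrady q (-c * (q + q⁻¹)) (reflect q c A B) A := by
  have hP := biAct_nbrPoly₁ (c := c) A B hq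
  rw [sub_eq_zero.mpr h, smul_zero] at hP
  have hB : biAct A B _ = (q * c) • reflect q c A B := biAct_reflPoly₁ A B hq hc
  have key := triAct_reflPoly₃ hP
  have key1 := biAct_reflPoly₃ hP
  have hkp : q⁻¹ * c * q ^ 2 = q * c := by field_simp
  rw [hkp] at key1
  -- the constant relating the multipliers is non-zero, as `q` is not a root of unity
  have hst0 : (((q ^ 2) ^ 2 + 1) * ((q ^ 2) ^ 2 + q ^ 2 + 1)) *
      (((q ^ 2) ^ 4 + (q ^ 2) ^ 3 + (q ^ 2) ^ 2 + q ^ 2 + 1) *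
        ((q ^ 2) ^ 4 + (q ^ 2) ^ 2 + 1)) ≠ 0 := by
    have e1 : (q ^ 2) ^ 2 + 1 ≠ 0 := fun h0 => hroot 8 (by norm_num) (by
      linear_combination (q ^ 4 - 1) * h0)
    have e2 : (q ^ 2) ^ 2 + q ^ 2 + 1 ≠ 0 := fun h0 => hroot 6 (by norm_num) (by
      linear_combination (q ^ 2 - 1) * h0)
    have e3 : (q ^ 2) ^ 4 + (q ^ 2) ^ 3 + (q ^ 2) ^ 2 + q ^ 2 + 1 ≠ 0 :=
      fun h0 => hroot 10 (by norm_num) (by linear_combination (q ^ 2 - 1) * h0)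
    have e4 : (q ^ 2) ^ 4 + (q ^ 2) ^ 2 + 1 ≠ 0 := fun h0 => hroot 12 (by norm_num) (by
      linear_combination (q ^ 4 - 1) * h0)
    exact mul_ne_zero (mul_ne_zero e1 e2) (mul_ne_zero e3 e4)
  generalize (((q ^ 2) ^ 2 + 1) * ((q ^ 2) ^ 2 + q ^ 2 + 1)) *
      (((q ^ 2) ^ 4 + (q ^ 2) ^ 3 + (q ^ 2) ^ 2 + q ^ 2 + 1) *
        ((q ^ 2) ^ 4 + (q ^ 2) ^ 2 + 1)) = st at key key1 hst0
  generalize reflPoly₃ (C (q ^ 2)) (C (q⁻¹ * c)) (X 0 : MvPolynomial (Fin 2) ℂ) (X 1) = G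
    at key key1
  generalize reflPoly₁ (C (q ^ 2)) (C (q⁻¹ * c)) (X 0 : MvPolynomial (Fin 2) ℂ) (X 1) = g
    at key key1 hB
  have hp2 : (q ^ 2) ^ 2 * st ≠ 0 := mul_ne_zero (pow_ne_zero _ (pow_ne_zero _ hq)) hst0
  have hqc : q * c ≠ 0 := mul_ne_zero hq hc
  have hlin : ∀ Z : S, biAct A Z ((-c * (q + q⁻¹)) • (1 * X 1 - 1 * X 0)) =
      (-c * (q + q⁻¹)) • ⁅Z, A⁆ := by
    intro Z
    simp only [map_smul, map_sub, biAct_mul_X_zero, biAct_mul_X_one, biAct_one, Ring.lie_def]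
  have hκB := triAct_cubic hq A B
  rw [show _ = _ from h', ← hlin B] at hκB
  have hκB' := triAct_cubic hq A ((q * c) • reflect q c A B)
  generalize (1 * X 3 - (q ^ 2 + 1 + (q⁻¹) ^ 2) • (1 * X 2 - 1 * X 1) - 1 * X 0 :
    MvPolynomial (Fin 4) ℂ) = κ at hκB hκB'
  -- the multipliers of the three reflected letters combine to one acting on the whole cubic
  -- expression, which the relation for `B` turns into a multiple of `⁅B, A⁆`
  have main : ((q ^ 2) ^ 2 * st) • ⁅(q * c) • reflect q c A B, qComm q⁻¹ ((q * c) • reflect q c A B)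
      (qComm q ((q * c) • reflect q c A B) A)⁆ = ((q ^ 2) ^ 2 * st) •
      ((q * c) ^ 2 • ((-c * (q + q⁻¹)) • ⁅(q * c) • reflect q c A B, A⁆)) := by
    rw [← hκB', ← hB, triAct_slot₁, triAct_slot₂, triAct_slot₃, ← map_smul]
    have e1 : ((q ^ 2) ^ 2 * st) • (κ * aeval ![X 0, X 1] g * aeval ![X 1, X 2] g *
        aeval ![X 2, X 3] g) = κ * (C ((q ^ 2) ^ 2 * st) * (aeval ![X 0, X 1] g *
        aeval ![X 1, X 2] g * aeval ![X 2, X 3] g)) := by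
      rw [smul_eq_C_mul]; ring
    rw [e1, ← key, mul_left_comm, ← smul_eq_C_mul, map_smul, triAct_outer, hκB, ← biAct_mul,
      ← hlin, ← map_smul, ← map_smul, ← map_smul, ← biAct_mul]
    have e2 : (q ^ 2) ^ 4 • ((-c * (q + q⁻¹)) • (1 * X 1 - 1 * X 0) * G) =
        (-c * (q + q⁻¹)) • (C ((q ^ 2) ^ 4) * (X 1 - X 0) * G) := by
      simp only [smul_eq_C_mul]; ring
    rw [e2, map_smul, key1, ← map_smul]
    congr 1
    simp only [smul_eq_C_mul, map_mul]
    ring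
  have main' := smul_right_injective S hp2 main
  apply smul_right_injective S (pow_ne_zero 3 hqc)
  have e1 : ∀ Z : S, ⁅(q * c) • Z, qComm q⁻¹ ((q * c) • Z) (qComm q ((q * c) • Z) A)⁆ =
      (q * c) ^ 3 • ⁅Z, qComm q⁻¹ Z (qComm q Z A)⁆ := by
    intro Z
    rw [lie_qComm_qComm hq, lie_qComm_qComm hq]
    simp only [mul_smul_comm, smul_mul_assoc, smul_smul, smul_sub]
    match_scalars <;> ring
  have e2 : ∀ Z : S, ⁅(q * c) • Z, A⁆ = (q * c) • ⁅Z, A⁆ := by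
    intro Z
    simp only [Ring.lie_def, mul_smul_comm, smul_mul_assoc, smul_sub]
  rw [e1, e2] at main'
  show (q * c) ^ 3 • _ = (q * c) ^ 3 • _
  rw [main']
  module

end Reflect

/-! ### Real root vectors -/

section RootSeq

variable {S : Type*} [Ring S] [Algebra ℂ S] {q c : ℂ}

theorem qComm_inv (A B : S) : qComm q⁻¹ A B = -qComm q B A := by
  simp only [qComm, inv_inv]; abel

theorem dolanGrady_inv (hq : q ≠ 0) {ρ : ℂ} {A B : S} :
    DolanGrady q⁻¹ ρ A B ↔ DolanGrady q ρ A B := by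
  have hq' : q⁻¹ ≠ 0 := inv_ne_zero hq
  unfold DolanGrady
  rw [lie_qComm_qComm hq', lie_qComm_qComm hq]
  have : q⁻¹ ^ 2 + 1 + q⁻¹⁻¹ ^ 2 = q ^ 2 + 1 + q⁻¹ ^ 2 := by rw [inv_inv]; ring
  rw [this]

/-- The reflection preserves the `q`-commutator of the pair. -/
theorem DolanGrady.qComm_reflect (hq : q ≠ 0) (hc : c ≠ 0) {A B : S}
    (h : DolanGrady q (-c * (q + q⁻¹)) A B) : qComm q A (reflect q c A B) = qComm q B A := by
  have e : qComm q A ⁅qComm q B A, A⁆ = ⁅A, qComm q⁻¹ A (qComm q A B)⁆ := by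
    rw [lie_qComm_qComm hq]
    simp only [qComm, Ring.lie_def, mul_sub, sub_mul, smul_mul_assoc, mul_smul_comm,
      smul_sub, smul_smul, mul_assoc]
    match_scalars <;> field_simp <;> ring
  have e2 : qComm q A (reflect q c A B) = qComm q A B + c⁻¹ • qComm q A ⁅qComm q B A, A⁆ := by
    simp only [reflect, qComm, mul_add, add_mul, mul_smul_comm, smul_mul_assoc, smul_add, smul_sub,
      smul_comm _ c⁻¹]
    abel
  rw [e2, e, show ⁅A, qComm q⁻¹ A (qComm q A B)⁆ = _ from h, smul_smul]
  simp only [qComm, Ring.lie_def]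
  match_scalars <;> field_simp <;> ring

variable (S) in
/-- Pairs satisfying the `q`-Dolan–Grady relations in both orders. -/
def DolanGradyPair (q c : ℂ) : Type _ :=
  {z : S × S // DolanGrady q (-c * (q + q⁻¹)) z.1 z.2 ∧ DolanGrady q (-c * (q + q⁻¹)) z.2 z.1}

/-- The shift `(x₀, x₁) ↦ (x₁, x₂)` on pairs, where `x₂` is the reflection of `x₀` in `x₁`; the
inverse is the reflection with `q` replaced by `q⁻¹`. -/
def pairShift (hq : q ≠ 0) (hroot : ∀ n : ℕ, 0 < n → q ^ n ≠ 1) (hc : c ≠ 0) :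
    Equiv.Perm (DolanGradyPair S q c) where
  toFun z := ⟨(z.1.2, reflect q c z.1.2 z.1.1), z.2.2.reflect_left hq hc,
    z.2.2.reflect_right hq hroot hc z.2.1⟩
  invFun z := ⟨(reflect q⁻¹ c z.1.1 z.1.2, z.1.1), by
    have hr : ∀ n : ℕ, 0 < n → q⁻¹ ^ n ≠ 1 := fun n hn h => hroot n hn (by
      rw [inv_pow] at h; simpa using h)
    have e : -c * (q + q⁻¹) = -c * (q⁻¹ + q⁻¹⁻¹) := by rw [inv_inv]; ring
    obtain ⟨⟨a, b⟩, h1, h2⟩ := z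
    change DolanGrady q _ (reflect q⁻¹ c a b) a ∧ DolanGrady q _ a (reflect q⁻¹ c a b)
    change DolanGrady q _ a b at h1
    change DolanGrady q _ b a at h2
    rw [e, ← dolanGrady_inv hq] at h1 h2
    rw [e, ← dolanGrady_inv hq, ← dolanGrady_inv hq]
    exact ⟨h1.reflect_right (inv_ne_zero hq) hr hc h2, h1.reflect_left (inv_ne_zero hq) hc⟩⟩
  left_inv z := by
    obtain ⟨⟨a, b⟩, h1, h2⟩ := z
    apply Subtype.ext
    refine Prod.ext ?_ rfl
    change reflect q⁻¹ c b (reflect q c b a) = a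
    rw [reflect, qComm_inv, h2.qComm_reflect hq hc, reflect]
    simp only [Ring.lie_def, neg_mul, mul_neg, smul_sub, smul_neg]
    abel
  right_inv z := by
    obtain ⟨⟨a, b⟩, h1, h2⟩ := z
    apply Subtype.ext
    refine Prod.ext rfl ?_
    change reflect q c a (reflect q⁻¹ c a b) = b
    have e : -c * (q + q⁻¹) = -c * (q⁻¹ + q⁻¹⁻¹) := by rw [inv_inv]; ring
    rw [e, ← dolanGrady_inv hq] at h1
    have := h1.qComm_reflect (inv_ne_zero hq) hc
    rw [qComm_inv] at this
    rw [reflect, ← neg_neg (qComm q _ _), this, reflect]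
    simp only [Ring.lie_def, neg_mul, mul_neg, smul_sub, smul_neg]
    abel

/-- A bi-infinite sequence of `q`-Onsager root vectors: consecutive terms have the same
`q`-commutator `h`, and `h` acts on them by a difference operator. -/
structure RootSeq (q c : ℂ) (x : ℤ → S) (h : S) : Prop where
  qComm_succ : ∀ r, qComm q (x r) (x (r + 1)) = h
  lie_eq : ∀ r, ⁅h, x r⁆ = c • (x (r + 1) - x (r - 1))

/-- Iterated reflection embeds a pair satisfying the `q`-Dolan–Grady relations in a bi-infinite
sequence of root vectors. -/
theorem exists_rootSeq (hq : q ≠ 0) (hroot : ∀ n : ℕ, 0 < n → q ^ n ≠ 1) (hc : c ≠ 0) {X Y : S}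
    (h1 : DolanGrady q (-c * (q + q⁻¹)) X Y) (h2 : DolanGrady q (-c * (q + q⁻¹)) Y X) :
    ∃ x : ℤ → S, x 0 = Y ∧ x 1 = X ∧ RootSeq q c x (qComm q Y X) := by
  let e := pairShift (S := S) hq hroot hc
  let p0 : DolanGradyPair S q c := ⟨(Y, X), h2, h1⟩
  let z : ℤ → DolanGradyPair S q c := fun r => (e ^ r) p0
  have z0 : z 0 = p0 := by simp [z, Equiv.Perm.one_apply]
  have hz : ∀ r, z (r + 1) = e (z r) := by
    intro r
    simp only [z, add_comm r 1, zpow_one_add, Equiv.Perm.mul_apply]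
  have h12 : ∀ r, (z (r + 1)).1.1 = (z r).1.2 := by
    intro r; rw [hz]; rfl
  have hh : ∀ r, qComm q (z (r + 1)).1.1 (z (r + 1)).1.2 = qComm q (z r).1.1 (z r).1.2 := by
    intro r
    rw [hz]
    exact (z r).2.2.qComm_reflect hq hc
  have hr : ∀ r, qComm q (z r).1.1 (z r).1.2 = qComm q Y X := by
    intro r
    induction r with
    | zero => rw [z0]
    | succ n ih => rw [hh, ih]
    | pred n ih => rw [← ih, ← hh, sub_add_cancel]
  refine ⟨fun r => (z r).1.1, by simp only [z0, p0], ?_, ?_, ?_⟩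
  · have := h12 0
    rw [z0] at this
    exact this
  · intro r
    simp only [h12, hr]
  · intro r
    obtain ⟨s, rfl⟩ : ∃ s, r = s + 1 := ⟨r - 1, by ring⟩
    have e1 : (z (s + 1 + 1)).1.1 = reflect q c (z s).1.2 (z s).1.1 := by
      rw [h12, hz]; rfl
    simp only [e1, add_sub_cancel_right, h12]
    rw [reflect, hr]
    simp [hc]

end RootSeq

/-! ### Imaginary root vectors -/

section SymShift

variable {M N : Type*} [AddCommGroup M] [AddCommGroup N]

/-- The symmetric difference operator `(Z f) n = f (n + 1) + f (n - 1)`. -/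
def symShift (f : ℤ → M) : ℤ → M := fun n => f (n + 1) + f (n - 1)

theorem symShift_iterate_map (g : M →+ N) (f : ℤ → M) (k : ℕ) (n : ℤ) :
    symShift^[k] (fun i => g (f i)) n = g (symShift^[k] f n) := by
  induction k generalizing f n with
  | zero => rfl
  | succ k ih =>
    rw [Function.iterate_succ_apply', Function.iterate_succ_apply', symShift, ih, ih, ← map_add]
    rfl

theorem symShift_iterate_congr {f g : ℤ → M} (k : ℕ) (n : ℤ)
    (h : ∀ i, n - k ≤ i → i ≤ n + k → f i = g i) : symShift^[k] f n = symShift^[k] g n := by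
  induction k generalizing n with
  | zero => exact h n (by simp) (by simp)
  | succ k ih =>
    rw [Function.iterate_succ_apply', Function.iterate_succ_apply', symShift, symShift,
      ih (n + 1) (fun i h1 h2 => h i (by push_cast; omega) (by push_cast; omega)),
      ih (n - 1) (fun i h1 h2 => h i (by push_cast; omega) (by push_cast; omega))]

theorem symShift_iterate_zero (k : ℕ) (n : ℤ) : symShift^[k] (fun _ => (0 : M)) n = 0 := by
  have := symShift_iterate_map (0 : M →+ M) (fun _ => 0) k n
  simpa using this

theorem symShift_iterate_eq_zero {f : ℤ → M} (k : ℕ) (n : ℤ)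
    (h : ∀ i, n - k ≤ i → i ≤ n + k → f i = 0) : symShift^[k] f n = 0 := by
  rw [symShift_iterate_congr k n h, symShift_iterate_zero]

/-- If `f` vanishes strictly between `n - k` and `n + k`, only the extreme terms of the
`k`-fold iterate survive. -/
theorem symShift_iterate_extreme {f : ℤ → M} (k : ℕ) (n : ℤ)
    (h : ∀ i, n - (k + 1) < i → i < n + (k + 1) → f i = 0) :
    symShift^[k + 1] f n = f (n + (k + 1)) + f (n - (k + 1)) := by
  induction k generalizing n with
  | zero => simp [symShift]
  | succ k ih =>
    rw [Function.iterate_succ_apply', symShift,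
      ih (n + 1) (fun i h1 h2 => h i (by push_cast; omega) (by push_cast; omega)),
      ih (n - 1) (fun i h1 h2 => h i (by push_cast; omega) (by push_cast; omega)),
      h (n + 1 - (k + 1)) (by push_cast; omega) (by push_cast; omega),
      h (n - 1 + (k + 1)) (by push_cast; omega) (by push_cast; omega), add_zero, zero_add]
    push_cast
    congr 2 <;> ring

/-- An even sequence with vanishing central iterates vanishes. -/
theorem eq_zero_of_symShift_iterate [Module ℂ M] {f : ℤ → M} (hf : ∀ n, f (-n) = f n) (m : ℕ)
    (h : ∀ k ≤ m, symShift^[k] f 0 = 0) : ∀ k ≤ m, f k = 0 := by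
  intro k
  induction k using Nat.strong_induction_on with
  | _ k ih =>
  intro hk
  have h0 : ∀ i : ℤ, -(k : ℤ) < i → i < k → f i = 0 := by
    intro i h1 h2
    rcases le_total 0 i with hi | hi
    · obtain ⟨j, rfl⟩ := Int.eq_ofNat_of_zero_le hi
      exact ih j (by omega) (by omega)
    · obtain ⟨j, hj⟩ := Int.eq_ofNat_of_zero_le (neg_nonneg.mpr hi)
      rw [← hf, hj]
      exact ih j (by omega) (by omega)
  cases k with
  | zero => exact h 0 hk
  | succ k =>
    have := h _ hk
    rw [symShift_iterate_extreme k 0 (fun i h1 h2 => h0 i (by push_cast; omega)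
      (by push_cast; omega)), zero_sub, hf, zero_add, ← two_nsmul] at this
    have h2 : (2 : ℂ) • f ((k : ℤ) + 1) = 0 := by rw [← this, ofNat_smul_eq_nsmul]
    exact_mod_cast (smul_eq_zero_iff_right (by norm_num : (2 : ℂ) ≠ 0)).mp h2

end SymShift

section Imaginary

variable {S : Type*} [Ring S] [Algebra ℂ S] (q c : ℂ) (x : ℤ → S)

/-- The symmetrised quadratic expressions in the root vectors whose translation invariance
produces the imaginary root vectors. -/
def quadForm (r s : ℤ) : S := qComm q (x r) (x (s + 1)) + qComm q (x s) (x (r + 1))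

theorem quadForm_comm (r s : ℤ) : quadForm q x r s = quadForm q x s r := add_comm _ _

/-- The even sequence of values of `quadForm` at `r = 0`. -/
def quadSeq (n : ℤ) : S := quadForm q x 0 |n|

/-- The imaginary root vectors: `θ₀` is the scalar `c / (q² - q⁻²)`, and `θ_{k+1}` is the value at
`0` of the `k`-th iterate of `symShift` on half the sequence `quadSeq`. -/
def theta : ℕ → S
  | 0 => algebraMap ℂ S (c / (q ^ 2 - q⁻¹ ^ 2))
  | k + 1 => (1 / 2 : ℂ) • symShift^[k] (quadSeq q x) 0

/-- The right-hand side of the exchange relations of imaginary with real root vectors. -/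
def exchange (k l : ℂ) (x : ℤ → S) (r : ℤ) : S →ₗ[ℂ] S where
  toFun b := k • (b * x (r + 1) - x (r - 1) * b) + l • (b * x (r - 1) - x (r + 1) * b)
  map_add' a b := by
    simp only [add_mul, mul_add, smul_sub, smul_add]; abel
  map_smul' a b := by
    simp only [smul_mul_assoc, mul_smul_comm, smul_sub, smul_add, smul_comm _ a, RingHom.id_apply]

theorem exchange_apply (k l : ℂ) (x : ℤ → S) (r : ℤ) (b : S) : exchange k l x r b =
    k • (b * x (r + 1) - x (r - 1) * b) + l • (b * x (r - 1) - x (r + 1) * b) := rfl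

/-- The commutator with `a` as a linear map. -/
def commL (a : S) : S →ₗ[ℂ] S := LinearMap.mulLeft ℂ a - LinearMap.mulRight ℂ a

theorem commL_apply (a b : S) : commL a b = a * b - b * a := rfl

theorem quadSeq_neg (n : ℤ) : quadSeq q x (-n) = quadSeq q x n := by simp [quadSeq]

/-- A cubic identity in the free algebra on `a₀, a₁, a₂, b₀, b₁, b₂`. -/
theorem cubic_identity {q : ℂ} (hq : q ≠ 0) (a₀ a₁ a₂ b₀ b₁ b₂ : S) :
    let B : S → S → S → S → S := fun a a' b b' => qComm q a b' + qComm q b a'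
    (q ^ 2 • (B a₀ a₁ a₀ a₁ * b₂) - (B a₁ a₂ a₀ a₁ + B a₀ a₁ a₁ a₂) * b₁ +
      q⁻¹ ^ 2 • (B a₁ a₂ a₁ a₂ * b₀) - (q ^ 2 • (b₀ * B a₁ a₂ a₁ a₂) -
        b₁ * (B a₁ a₂ a₀ a₁ + B a₀ a₁ a₁ a₂) + q⁻¹ ^ 2 • (b₂ * B a₀ a₁ a₀ a₁))) +
    (2 : ℂ) • (q ^ 2 • (B a₀ a₁ b₀ b₁ * a₂) - (B a₁ a₂ b₀ b₁ + B a₀ a₁ b₁ b₂) * a₁ +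
      q⁻¹ ^ 2 • (B a₁ a₂ b₁ b₂ * a₀) - (q ^ 2 • (a₀ * B a₁ a₂ b₁ b₂) -
        a₁ * (B a₁ a₂ b₀ b₁ + B a₀ a₁ b₁ b₂) + q⁻¹ ^ 2 • (a₂ * B a₀ a₁ b₀ b₁))) = 0 := by
  intro B
  simp only [B, qComm, mul_add, add_mul, mul_sub, sub_mul, smul_mul_assoc, mul_smul_comm, smul_sub,
    smul_add, smul_smul, mul_assoc]
  match_scalars <;> field_simp <;> ring

variable {q c x} {h : S}

theorem quadForm_self (H : RootSeq q c x h) (r : ℤ) : quadForm q x r r = (2 : ℂ) • h := by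
  rw [quadForm, H.qComm_succ, two_smul]

/-- The element `h` acts on the quadratic expressions as a derivation. -/
theorem lie_quadForm (H : RootSeq q c x h) (r s : ℤ) : commL h (quadForm q x r s) =
    c • (quadForm q x r (s + 1) + quadForm q x (r + 1) s - quadForm q x (r - 1) s
      - quadForm q x r (s - 1)) := by
  have e : ∀ a b : S, commL h (qComm q a b) = qComm q ⁅h, a⁆ b + qComm q a ⁅h, b⁆ := by
    intro a b
    simp only [commL_apply, qComm, Ring.lie_def, mul_sub, sub_mul, smul_mul_assoc, mul_smul_comm,
      smul_sub, mul_assoc]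
    abel
  have e1 : ∀ (k : ℂ) (a b d : S), qComm q (k • (a - b)) d = k • (qComm q a d - qComm q b d) := by
    intro k a b d
    simp only [qComm, sub_mul, mul_sub, smul_mul_assoc, mul_smul_comm, smul_sub, smul_comm _ k]
    abel
  have e2 : ∀ (k : ℂ) (a b d : S), qComm q d (k • (a - b)) = k • (qComm q d a - qComm q d b) := by
    intro k a b d
    simp only [qComm, sub_mul, mul_sub, smul_mul_assoc, mul_smul_comm, smul_sub, smul_comm _ k]
    abel
  simp only [quadForm, map_add, e, H.lie_eq, e1, e2, sub_add_cancel, add_sub_cancel_right]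
  rw [← smul_add, ← smul_add, ← smul_add]
  congr 1
  abel

/-- Translation invariance of the quadratic expressions up to level `n`: `quadForm q x r s` depends
on `s - r` only, as long as `|s - r| ≤ n`. -/
def InvUpTo (q : ℂ) (x : ℤ → S) (n : ℕ) : Prop :=
  ∀ r m : ℤ, |m| ≤ n → quadForm q x r (r + m) = quadSeq q x m

/-- The cubic identity turns translation invariance into an exchange relation. -/
theorem InvUpTo.exchange_eq (hq : q ≠ 0) {n : ℕ} (hn : InvUpTo q x (n + 1)) {m : ℤ}
    (hm : |m| ≤ n) (r : ℤ) :
    symShift (quadSeq q x) m * x r - x r * symShift (quadSeq q x) m =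
      exchange (q ^ 2) (q⁻¹ ^ 2) x r (quadSeq q x m) := by
  have key : ∀ r s : ℤ, _ := fun r s => cubic_identity hq (x r) (x (r + 1)) (x (r + 1 + 1)) (x s)
    (x (s + 1)) (x (s + 1 + 1))
  simp only at key
  have hm1 : ∀ (k : ℤ), |k| ≤ n → ∀ r s, s = r + k → quadForm q x r s = quadSeq q x k := by
    rintro k hk r s rfl
    exact hn r k (by push_cast; omega)
  have hm2 : ∀ (k : ℤ), |k| ≤ n + 1 → ∀ r s, s = r + k → quadForm q x r s = quadSeq q x k := by
    rintro k hk r s rfl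
    exact hn r k (by push_cast; omega)
  change ∀ r s : ℤ, (q ^ 2 • (quadForm q x r r * x (s + 1 + 1)) - (quadForm q x (r + 1) r
    + quadForm q x r (r + 1)) * x (s + 1) + q⁻¹ ^ 2 • (quadForm q x (r + 1) (r + 1) * x s)
    - (q ^ 2 • (x s * quadForm q x (r + 1) (r + 1)) - x (s + 1) * (quadForm q x (r + 1) r
    + quadForm q x r (r + 1)) + q⁻¹ ^ 2 • (x (s + 1 + 1) * quadForm q x r r))) +
    (2 : ℂ) • (q ^ 2 • (quadForm q x r s * x (r + 1 + 1)) - (quadForm q x (r + 1) s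
    + quadForm q x r (s + 1)) * x (r + 1) + q⁻¹ ^ 2 • (quadForm q x (r + 1) (s + 1) * x r)
    - (q ^ 2 • (x r * quadForm q x (r + 1) (s + 1)) - x (r + 1) * (quadForm q x (r + 1) s
    + quadForm q x r (s + 1)) + q⁻¹ ^ 2 • (x (r + 1 + 1) * quadForm q x r s))) = 0 at key
  -- the defect of the exchange relation at level `k`
  let e : ℤ → ℤ → S := fun k r => exchange (q ^ 2) (q⁻¹ ^ 2) x r (quadSeq q x k) -
    (symShift (quadSeq q x) k * x r - x r * symShift (quadSeq q x) k)
  have key2 : ∀ (r k : ℤ), |k| ≤ n → e 0 (r + k + 1) + (2 : ℂ) • e k (r + 1) = 0 := by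
    intro r k hk
    have ak1 : |k + 1| ≤ n + 1 := (abs_add_le k 1).trans (by simpa using hk)
    have ak2 : |k - 1| ≤ n + 1 := (abs_sub k 1).trans (by simpa using hk)
    have := key r (r + k)
    rw [hm1 0 (by simp) r r (by ring), hm1 0 (by simp) (r + 1) (r + 1) (by ring),
      hm2 (0 + 1) (by simp) r (r + 1) (by ring), hm2 (0 - 1) (by simp) (r + 1) r (by ring),
      hm1 k hk r (r + k) (by ring), hm1 k hk (r + 1) (r + k + 1) (by ring),
      hm2 (k + 1) ak1 r (r + k + 1) (by ring), hm2 (k - 1) ak2 (r + 1) (r + k) (by ring)] at this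
    rw [← this]
    simp only [e, exchange_apply, symShift, add_sub_cancel_right, smul_sub, smul_add, mul_add,
      add_mul]
    abel
  -- for `k = 0` both terms of `key2` are the same
  have e0 : ∀ r, e 0 r = 0 := by
    intro r
    have := key2 (r - 1) 0 (by simp)
    rw [add_zero, sub_add_cancel, show e 0 r + (2 : ℂ) • e 0 r = (3 : ℂ) • e 0 r by module] at this
    exact (smul_eq_zero_iff_right (by norm_num)).mp this
  have := key2 (r - 1) m hm
  rw [e0, zero_add, sub_add_cancel, smul_eq_zero_iff_right (by norm_num)] at this
  exact (sub_eq_zero.mp this).symm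

end Imaginary

/-! ### Commutativity of the imaginary root vectors -/

theorem symShift_iterate_add {M : Type*} [AddCommGroup M] (f g : ℤ → M) (k : ℕ) (n : ℤ) :
    symShift^[k] (fun i => f i + g i) n = symShift^[k] f n + symShift^[k] g n := by
  induction k generalizing n with
  | zero => rfl
  | succ k ih =>
    simp only [Function.iterate_succ_apply']
    simp only [symShift, ih]
    abel

/-- A sequence satisfying the recurrence of the `q²`-integers on an interval, vanishing at its left
end and antisymmetric with respect to its centre, is zero. -/
theorem eq_zero_of_recurrence {M : Type*} [AddCommGroup M] [Module ℂ M] {q : ℂ} (hq : q ≠ 0)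
    (hroot : ∀ n : ℕ, 0 < n → q ^ n ≠ 1) (f : ℕ → M) (N : ℕ) (h0 : f 0 = 0)
    (hrec : ∀ a, a + 3 ≤ N → f (a + 2) - (q ^ 2 + q⁻¹ ^ 2) • f (a + 1) + f a = 0)
    (hanti : 2 ≤ N → f (N - 1) = -f 1) : ∀ a, a < N → f a = 0 := by
  have step : ∀ a, a < N → (q ^ 2 - q⁻¹ ^ 2) • f a = (q ^ (2 * a) - q⁻¹ ^ (2 * a)) • f 1 := by
    intro a
    induction a using Nat.strong_induction_on with
    | _ a ih =>
    intro ha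
    match a with
    | 0 => simp [h0]
    | 1 => simp
    | a + 2 =>
      have h1 := ih a (by omega) (by omega)
      have h2 := ih (a + 1) (by omega) (by omega)
      have h3 := hrec a (by omega)
      have h4 : f (a + 2) = (q ^ 2 + q⁻¹ ^ 2) • f (a + 1) - f a := by
        rw [← sub_eq_zero, ← h3]; abel
      rw [h4, smul_sub, smul_comm, h1, h2, smul_smul, ← sub_smul]
      congr 1
      have e : q * q⁻¹ = 1 := mul_inv_cancel₀ hq
      linear_combination (q ^ (2 * a) * (q * q⁻¹ + 1) - q⁻¹ ^ (2 * a) * (q * q⁻¹ + 1)) * e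
  have hd : q ^ 2 - q⁻¹ ^ 2 ≠ 0 := by
    intro h
    apply hroot 4 (by norm_num)
    field_simp at h
    linear_combination h
  have h1 : 2 ≤ N → f 1 = 0 := by
    intro hN
    have h2 := step (N - 1) (by omega)
    rw [hanti hN, smul_neg, ← sub_eq_zero, ← neg_smul, ← sub_smul] at h2
    obtain ⟨m, rfl⟩ : ∃ m, N = m + 2 := ⟨N - 2, by omega⟩
    refine (smul_eq_zero_iff_right ?_).mp h2
    intro h3
    have e : q * q⁻¹ = 1 := mul_inv_cancel₀ hq
    have em : q ^ m * q⁻¹ ^ m = 1 := by rw [← mul_pow, e, one_pow]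
    have h4 : (q ^ (m + 2) - q⁻¹ ^ (m + 2)) * (q ^ m + q⁻¹ ^ m) = 0 := by
      rw [show m + 2 - 1 = m + 1 by omega] at h3
      linear_combination -h3 + (q ^ 2 - q⁻¹ ^ 2) * em
    have hi : ∀ k : ℕ, q ^ k * q⁻¹ ^ k = 1 := fun k => by rw [← mul_pow, e, one_pow]
    rcases mul_eq_zero.mp h4 with h5 | h5
    · apply hroot (2 * (m + 2)) (by omega)
      linear_combination q ^ (m + 2) * h5 + hi (m + 2)
    · rcases Nat.eq_zero_or_pos m with rfl | hm
      · norm_num at h5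
      · apply hroot (4 * m) (by omega)
        linear_combination q ^ (m) * (q ^ (2 * m) - 1) * h5 - (q ^ (2 * m) - 1) * hi m
  intro a ha
  match a with
  | 0 => exact h0
  | a + 1 =>
    refine (smul_eq_zero_iff_right hd).mp ?_
    rw [step _ ha, h1 (by omega), smul_zero]

section Imaginary

variable {S : Type*} [Ring S] [Algebra ℂ S] {q c : ℂ} {x : ℤ → S} {h : S}

theorem theta_one (H : RootSeq q c x h) : theta q c x 1 = h := by
  simp only [theta, Function.iterate_zero, id, quadSeq, abs_zero, quadForm_self H, smul_smul]
  norm_num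

theorem two_smul_theta (k : ℕ) :
    symShift^[k] (quadSeq q x) 0 = (2 : ℂ) • theta q c x (k + 1) := by
  rw [theta, smul_smul]; norm_num

theorem q_sq_sub_ne_zero (hq : q ≠ 0) (hroot : ∀ n : ℕ, 0 < n → q ^ n ≠ 1) :
    q ^ 2 - q⁻¹ ^ 2 ≠ 0 := by
  intro h
  apply hroot 4 (by norm_num)
  field_simp at h
  linear_combination h

/-- The exchange relations between imaginary and real root vectors, at the levels to which
translation invariance is known. -/
theorem InvUpTo.theta_exchange (hq : q ≠ 0) (hroot : ∀ n : ℕ, 0 < n → q ^ n ≠ 1)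
    (H : RootSeq q c x h) {n : ℕ} (hn : InvUpTo q x n) {l : ℕ} (hl : l ≤ n) (r : ℤ) :
    theta q c x (l + 1) * x r - x r * theta q c x (l + 1) =
      exchange (q ^ 2) (q⁻¹ ^ 2) x r (theta q c x l) := by
  cases l with
  | zero =>
    have e := H.lie_eq r
    rw [Ring.lie_def] at e
    have hd := q_sq_sub_ne_zero hq hroot
    rw [theta_one H, e, theta, exchange_apply]
    simp only [Algebra.algebraMap_eq_smul_one, smul_mul_assoc, mul_smul_comm, one_mul, mul_one,
      ← smul_sub, smul_smul]
    have hk := (div_mul_cancel₀ c hd).symm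
    generalize c / (q ^ 2 - q⁻¹ ^ 2) = k at hk ⊢
    subst hk
    module
  | succ l =>
    obtain ⟨m, rfl⟩ : ∃ m, n = m + 1 := ⟨n - 1, by omega⟩
    let g : S →ₗ[ℂ] S := LinearMap.mulRight ℂ (x r) - LinearMap.mulLeft ℂ (x r)
    have e1 := symShift_iterate_map g.toAddMonoidHom (symShift (quadSeq q x)) l 0
    have e2 := symShift_iterate_map (exchange (q ^ 2) (q⁻¹ ^ 2) x r).toAddMonoidHom
      (quadSeq q x) l 0
    rw [symShift_iterate_congr (f := fun i => g.toAddMonoidHom (symShift (quadSeq q x) i))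
      (g := fun i => (exchange (q ^ 2) (q⁻¹ ^ 2) x r).toAddMonoidHom (quadSeq q x i)) l 0
      (fun i h1 h2 => hn.exchange_eq hq (by rw [abs_le]; omega) r), e2,
      ← Function.iterate_succ_apply] at e1
    simp only [LinearMap.toAddMonoidHom_coe] at e1
    simp only [two_smul_theta (c := c), map_smul] at e1
    exact (smul_right_injective S (two_ne_zero (α := ℂ)) e1).symm

/-- Two steps of a rewriting rule moving `t₂`, `t₁`, `t₀` past `a`, combined with two steps moving
them past `b`. -/
theorem quadratic_exchange {R : Type*} [Ring R] {t₀ t₁ t₂ a M M' b N N' : R}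
    (h1 : t₂ * a - t₁ * M = a * t₂ - M' * t₁)
    (h2 : t₁ * a - t₀ * M = a * t₁ - M' * t₀) (h3 : t₂ * b - t₁ * N = b * t₂ - N' * t₁)
    (h4 : t₁ * b - t₀ * N = b * t₁ - N' * t₀) :
    t₂ * (a * b) - t₁ * (M * b + a * N) + t₀ * (M * N) -
      ((a * b) * t₂ - (M' * b + a * N') * t₁ + (M' * N') * t₀) = 0 := by
  have e1 : t₂ * (a * b) - t₁ * (M * b + a * N) + t₀ * (M * N) =
      (t₂ * a - t₁ * M) * b - (t₁ * a - t₀ * M) * N := by noncomm_ring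
  have e2 : (a * t₂ - M' * t₁) * b - (a * t₁ - M' * t₀) * N =
      a * (t₂ * b - t₁ * N) - M' * (t₁ * b - t₀ * N) := by noncomm_ring
  rw [e1, h1, h2, e2, h3, h4]
  noncomm_ring

/-- Two steps of the exchange relation, applied to both factors of the quadratic expressions. -/
theorem quadForm_exchange {t₀ t₁ t₂ : S}
    (h1 : ∀ r, t₁ * x r - x r * t₁ = exchange (q ^ 2) (q⁻¹ ^ 2) x r t₀)
    (h2 : ∀ r, t₂ * x r - x r * t₂ = exchange (q ^ 2) (q⁻¹ ^ 2) x r t₁) (r s : ℤ) :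
    let B := quadForm q x
    t₂ * B r s - t₁ * (q ^ 2 • B (r + 1) s + q⁻¹ ^ 2 • B (r - 1) s
        + (q ^ 2 • B r (s + 1) + q⁻¹ ^ 2 • B r (s - 1)))
      + t₀ * (q ^ 2 • (q ^ 2 • B (r + 1) (s + 1) + q⁻¹ ^ 2 • B (r + 1) (s - 1))
        + q⁻¹ ^ 2 • (q ^ 2 • B (r - 1) (s + 1) + q⁻¹ ^ 2 • B (r - 1) (s - 1)))
      - (B r s * t₂ - (q ^ 2 • B (r - 1) s + q⁻¹ ^ 2 • B (r + 1) s
        + (q ^ 2 • B r (s - 1) + q⁻¹ ^ 2 • B r (s + 1))) * t₁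
      + (q ^ 2 • (q ^ 2 • B (r - 1) (s - 1) + q⁻¹ ^ 2 • B (r - 1) (s + 1))
        + q⁻¹ ^ 2 • (q ^ 2 • B (r + 1) (s - 1) + q⁻¹ ^ 2 • B (r + 1) (s + 1))) * t₀) = 0 := by
  intro B
  have step : ∀ {t t' : S}, (∀ r, t' * x r - x r * t' = exchange (q ^ 2) (q⁻¹ ^ 2) x r t) → ∀ r,
      t' * x r - t * (q ^ 2 • x (r + 1) + q⁻¹ ^ 2 • x (r - 1)) =
        x r * t' - (q ^ 2 • x (r - 1) + q⁻¹ ^ 2 • x (r + 1)) * t := by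
    intro t t' ht r
    have := ht r
    rw [exchange_apply, sub_eq_iff_eq_add] at this
    rw [this]
    simp only [mul_add, add_mul, mul_smul_comm, smul_mul_assoc, smul_sub]
    abel
  have P := fun r s => quadratic_exchange (step h2 r) (step h1 r) (step h2 s) (step h1 s)
  have P1 := P r (s + 1)
  have P2 := P (s + 1) r
  have P3 := P s (r + 1)
  have P4 := P (r + 1) s
  simp only [add_sub_cancel_right] at P1 P2 P3 P4
  have e : ∀ z₁ z₂ z₃ z₄ : S, z₁ = 0 → z₂ = 0 → z₃ = 0 → z₄ = 0 →
      q • z₁ - q⁻¹ • z₂ + (q • z₃ - q⁻¹ • z₄) = 0 := by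
    intro z₁ z₂ z₃ z₄ e1 e2 e3 e4
    simp [e1, e2, e3, e4]
  rw [← e _ _ _ _ P1 P2 P3 P4]
  simp only [B, quadForm, qComm, sub_add_cancel, mul_add, add_mul, mul_sub, sub_mul,
    smul_mul_assoc, mul_smul_comm, smul_sub, smul_add, smul_smul, mul_assoc]
  match_scalars <;> ring

/-- A three-term relation between the commutators with the sequence `quadSeq`. The two outermost
quadratic expressions in `quadForm_exchange` have index difference `m ± 2`; either translation
invariance is known there, or `t₀` is a scalar and their contributions cancel. -/
theorem InvUpTo.comm_step (hq : q ≠ 0) {n : ℕ} (hn : InvUpTo q x n) {t₀ t₁ t₂ : S}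
    (h1 : ∀ r, t₁ * x r - x r * t₁ = exchange (q ^ 2) (q⁻¹ ^ 2) x r t₀)
    (h2 : ∀ r, t₂ * x r - x r * t₂ = exchange (q ^ 2) (q⁻¹ ^ 2) x r t₁) {m : ℤ} (hm : |m| + 1 ≤ n)
    (h0 : |m| + 2 ≤ n ∨ ∃ z : ℂ, t₀ = algebraMap ℂ S z) :
    commL t₂ (quadSeq q x m) + -(q ^ 2 + q⁻¹ ^ 2) • commL t₁ (symShift (quadSeq q x) m) +
      commL t₀ (symShift^[2] (quadSeq q x) m + (q ^ 4 + q⁻¹ ^ 4 - 2) • quadSeq q x m) = 0 := by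
  have hm' := abs_le.mp (by omega : |m| ≤ (n : ℤ) - 1)
  have key := quadForm_exchange h1 h2 0 m
  simp only at key
  have I : ∀ (k : ℤ), |k| ≤ n → ∀ r s, s = r + k → quadForm q x r s = quadSeq q x k := by
    rintro k hk r s rfl
    exact hn r k hk
  rw [I m (by rw [abs_le]; omega) 0 m (by ring), I (m - 1) (by rw [abs_le]; omega) _ m (by ring),
    I (m + 1) (by rw [abs_le]; omega) (0 - 1) m (by ring),
    I (m + 1) (by rw [abs_le]; omega) 0 (m + 1) (by ring),
    I (m - 1) (by rw [abs_le]; omega) 0 (m - 1) (by ring),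
    I m (by rw [abs_le]; omega) (0 + 1) (m + 1) (by ring),
    I m (by rw [abs_le]; omega) (0 - 1) (m - 1) (by ring)] at key
  have Z2 : symShift^[2] (quadSeq q x) m = quadSeq q x (m + 2) + (2 : ℂ) • quadSeq q x m
      + quadSeq q x (m - 2) := by
    change symShift (symShift (quadSeq q x)) m = _
    simp only [symShift, sub_add_cancel, add_sub_cancel_right, two_smul]
    rw [show m + 1 + 1 = m + 2 by ring, show m - 1 - 1 = m - 2 by ring]
    abel
  rw [Z2, ← key]
  simp only [symShift, commL_apply]
  rcases h0 with h0 | ⟨z, rfl⟩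
  · have hm' := abs_le.mp (by omega : |m| ≤ (n : ℤ) - 2)
    rw [I (m - 2) (by rw [abs_le]; omega) (0 + 1) (m - 1) (by ring),
      I (m + 2) (by rw [abs_le]; omega) (0 - 1) (m + 1) (by ring)]
    simp only [mul_add, add_mul, mul_smul_comm, smul_mul_assoc, smul_sub]
    match_scalars <;> field_simp <;> ring
  · simp only [Algebra.algebraMap_eq_smul_one, mul_add, add_mul, mul_smul_comm, smul_mul_assoc,
      smul_sub, one_mul, mul_one]
    match_scalars <;> ring

/-- The imaginary root vectors commute in low total degree. -/
theorem InvUpTo.theta_commute (hq : q ≠ 0) (hroot : ∀ n : ℕ, 0 < n → q ^ n ≠ 1)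
    (H : RootSeq q c x h) {n : ℕ} (hn : InvUpTo q x n) (N : ℕ) (hN : N ≤ n + 2) :
    ∀ a b, a + b = N → commL (theta q c x a) (theta q c x b) = 0 := by
  induction N using Nat.strong_induction_on with
  | _ N ih =>
  have hscal : ∀ b, commL (theta q c x 0) b = 0 := by
    intro b
    rw [commL_apply, theta, Algebra.commutes, sub_self]
  have hanti : ∀ a b : S, commL a b = -commL b a := by
    intro a b; rw [commL_apply, commL_apply]; abel
  -- on total degree `N` the commutators satisfy the recurrence of the `q²`-integers, and they are
  -- antisymmetric about the centre
  let f : ℕ → S := fun a => commL (theta q c x a) (theta q c x (N - a))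
  have hf : ∀ a, a < N → f a = 0 := by
    apply eq_zero_of_recurrence hq hroot f N (hscal _)
    · intro l hl
      obtain ⟨k, rfl⟩ : ∃ k, N = l + k + 3 := ⟨N - l - 3, by omega⟩
      have t1 := fun r => hn.theta_exchange hq hroot H (l := l) (by omega) r
      have t2 := fun r => hn.theta_exchange hq hroot H (l := l + 1) (by omega) r
      -- the central value of the `k`-th iterate of `symShift` on the relation of `comm_step`
      have e := symShift_iterate_congr (g := fun _ => (0 : S)) k 0 (fun m h1 h2 =>
        hn.comm_step hq t1 t2 (m := m) (by
          have : |m| ≤ k := abs_le.mpr (by omega)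
          omega) (by
          have : |m| ≤ k := abs_le.mpr (by omega)
          rcases Nat.eq_zero_or_pos l with rfl | hl
          · exact Or.inr ⟨_, rfl⟩
          · left; omega))
      rw [symShift_iterate_zero, symShift_iterate_add, symShift_iterate_add] at e
      have e1 := symShift_iterate_map (commL (theta q c x (l + 1 + 1))).toAddMonoidHom
        (quadSeq q x) k 0
      have e2 := symShift_iterate_map
        (-(q ^ 2 + q⁻¹ ^ 2) • commL (theta q c x (l + 1))).toAddMonoidHom
        (symShift (quadSeq q x)) k 0
      have e3 := symShift_iterate_map (commL (theta q c x l)).toAddMonoidHom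
        (fun i => symShift^[2] (quadSeq q x) i + (q ^ 4 + q⁻¹ ^ 4 - 2) • quadSeq q x i) k 0
      have e4 := symShift_iterate_map ((q ^ 4 + q⁻¹ ^ 4 - 2) • (LinearMap.id : S →ₗ[ℂ] S)
        ).toAddMonoidHom (quadSeq q x) k 0
      rw [symShift_iterate_add] at e3
      simp only [LinearMap.toAddMonoidHom_coe, LinearMap.smul_apply, LinearMap.id_apply]
        at e1 e2 e3 e4
      rw [e1, e2, e3, e4, ← Function.iterate_succ_apply, ← Function.iterate_add_apply] at e
      simp only [two_smul_theta (c := c), map_smul, map_add] at e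
      rw [ih (l + (k + 1)) (by omega) (by omega) l (k + 1) rfl, smul_zero, smul_zero, add_zero,
        smul_comm _ (2 : ℂ), ← smul_add, ← smul_add,
        smul_eq_zero_iff_right (two_ne_zero (α := ℂ))] at e
      simp only [f]
      rw [show l + k + 3 - (l + 2) = k + 1 by omega, show l + k + 3 - (l + 1) = k + 1 + 1 by omega,
        show l + k + 3 - l = k + 2 + 1 by omega, ← e, neg_smul]
      abel
    · intro hN
      simp only [f]
      rw [hanti, show N - (N - 1) = 1 by omega]
  intro a b hab
  rcases Nat.eq_zero_or_pos b with rfl | hb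
  · rw [hanti, hscal, neg_zero]
  · have := hf a (by omega)
    simp only [f] at this
    rwa [show N - a = b by omega] at this

/-- Translation invariance holds at all levels: it at level `n` gives commutation of `h` with the
`n`-th value of the quadratic expressions, and this gives invariance at level `n + 1`. -/
theorem RootSeq.invUpTo (hq : q ≠ 0) (hroot : ∀ n : ℕ, 0 < n → q ^ n ≠ 1) (hc : c ≠ 0)
    (H : RootSeq q c x h) (n : ℕ) : InvUpTo q x n := by
  induction n with
  | zero =>
    intro r m hm
    obtain rfl : m = 0 := by simpa using hm
    rw [add_zero, quadForm_self H, quadSeq, abs_zero, quadForm_self H]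
  | succ n ih =>
    -- `h = θ₁` commutes with `θ_{k+1}` for `k ≤ n`, hence with the `n`-th term of `quadSeq`
    have h1 : commL h (quadSeq q x n) = 0 := by
      refine eq_zero_of_symShift_iterate (f := fun i => commL h (quadSeq q x i))
        (fun i => by rw [quadSeq_neg]) n ?_ n le_rfl
      intro k hk
      have := symShift_iterate_map (commL h).toAddMonoidHom (quadSeq q x) k 0
      simp only [LinearMap.toAddMonoidHom_coe] at this
      rw [this, two_smul_theta (c := c), map_smul]
      have h2 := ih.theta_commute hq hroot H (1 + (k + 1)) (by omega) 1 (k + 1) rfl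
      rw [theta_one H] at h2
      rw [h2, smul_zero]
    -- so `lie_quadForm` relates the expressions of level `n + 1` to those of level `n - 1`
    have h2 : ∀ r, quadForm q x r (r + (n + 1)) = quadForm q x (r - 1) (r - 1 + (n + 1)) := by
      intro r
      have h3 := lie_quadForm H r (r + n)
      rw [ih r n (by simp), h1, eq_comm, smul_eq_zero_iff_right hc] at h3
      rw [show r - 1 + ((n : ℤ) + 1) = r + n by ring, ← sub_eq_zero]
      rcases Nat.eq_zero_or_pos n with rfl | hn
      · rw [Nat.cast_zero, add_zero, quadForm_comm q x (r + 1), quadForm_comm q x r (r - 1)] at h3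
        rw [Nat.cast_zero, add_zero, zero_add]
        refine (smul_eq_zero_iff_right (two_ne_zero (α := ℂ))).mp ?_
        rw [← h3]
        module
      · have e1 : |(n : ℤ) - 1| ≤ n := abs_le.mpr (by omega)
        have e2 := ih (r + 1) (n - 1) e1
        have e3 := ih r (n - 1) e1
        rw [show r + 1 + ((n : ℤ) - 1) = r + n by ring] at e2
        rw [show r + ((n : ℤ) - 1) = r + n - 1 by ring] at e3
        rw [e2, e3] at h3
        rw [← h3, ← add_assoc]
        abel
    have h4 : ∀ r, quadForm q x r (r + (n + 1)) = quadSeq q x (n + 1) := by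
      intro r
      induction r with
      | zero =>
        rw [zero_add, quadSeq, abs_of_nonneg (by omega)]
      | succ i hi => rw [h2, ← hi]; simp
      | pred i hi => rw [← h2, hi]
    intro r m hm
    rcases le_or_gt |m| n with hm' | hm'
    · exact ih r m hm'
    · have : |m| = n + 1 := by push_cast at hm; omega
      rcases abs_choice m with h5 | h5
      · rw [← h5, this, h4]
      · have h6 : m = -(n + 1) := by rw [← this, h5, neg_neg]
        have := h4 (r + m)
        rw [h6, quadSeq_neg, quadForm_comm]
        rwa [h6, neg_add_cancel_right] at this

/-- The imaginary root vectors commute. -/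
theorem RootSeq.theta_commute (hq : q ≠ 0) (hroot : ∀ n : ℕ, 0 < n → q ^ n ≠ 1) (hc : c ≠ 0)
    (H : RootSeq q c x h) (a b : ℕ) : Commute (theta q c x a) (theta q c x b) :=
  sub_eq_zero.mp ((H.invUpTo hq hroot hc (a + b)).theta_commute hq hroot H (a + b) (by omega)
    a b rfl)

end Imaginary

/-! ### Square root of the generating series of the imaginary root vectors -/

section ShiftOps

variable {R : Type*} [Ring R] [Algebra ℂ R]

/-- The operator `1 - a t w` on sequences, where `w` is the shift `r ↦ r + 1`. -/
def opP (t : R) (a : ℂ) (f : ℤ → R) : ℤ → R := fun r => f r - a • (f (r + 1) * t)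

/-- The operator `1 - a t w⁻¹` on sequences, where `w` is the shift `r ↦ r + 1`. -/
def opM (t : R) (a : ℂ) (f : ℤ → R) : ℤ → R := fun r => f r - a • (f (r - 1) * t)

theorem opP_sub (t : R) (a : ℂ) (f g : ℤ → R) : opP t a (f - g) = opP t a f - opP t a g := by
  funext r; simp only [opP, Pi.sub_apply, sub_mul, smul_sub]; abel

theorem opM_sub (t : R) (a : ℂ) (f g : ℤ → R) : opM t a (f - g) = opM t a f - opM t a g := by
  funext r; simp only [opM, Pi.sub_apply, sub_mul, smul_sub]; abel

theorem opP_mul_left (t : R) (a : ℂ) (f : ℤ → R) (y : R) :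
    opP t a (fun r => y * f r) = fun r => y * opP t a f r := by
  funext r; simp only [opP, mul_sub, mul_smul_comm, mul_assoc]

theorem opM_mul_left (t : R) (a : ℂ) (f : ℤ → R) (y : R) :
    opM t a (fun r => y * f r) = fun r => y * opM t a f r := by
  funext r; simp only [opM, mul_sub, mul_smul_comm, mul_assoc]

theorem opP_mul_right {t : R} (ht : ∀ y, Commute t y) (a : ℂ) (f : ℤ → R) (y : R) :
    opP t a (fun r => f r * y) = fun r => opP t a f r * y := by
  funext r; simp only [opP, sub_mul, smul_mul_assoc, mul_assoc, (ht y).eq]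

theorem opM_mul_right {t : R} (ht : ∀ y, Commute t y) (a : ℂ) (f : ℤ → R) (y : R) :
    opM t a (fun r => f r * y) = fun r => opM t a f r * y := by
  funext r; simp only [opM, sub_mul, smul_mul_assoc, mul_assoc, (ht y).eq]

theorem opP_opM (t : R) (a b : ℂ) (f : ℤ → R) : opP t a (opM t b f) = opM t b (opP t a f) := by
  funext r
  simp only [opP, opM, sub_mul, smul_mul_assoc, smul_sub, smul_smul, add_sub_cancel_right,
    sub_add_cancel, mul_comm a b]
  abel

theorem opP_opP (t : R) (a b : ℂ) (f : ℤ → R) : opP t a (opP t b f) = opP t b (opP t a f) := by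
  funext r
  simp only [opP, sub_mul, smul_mul_assoc, smul_sub, smul_smul, mul_comm a b]
  abel

theorem opM_opM (t : R) (a b : ℂ) (f : ℤ → R) : opM t a (opM t b f) = opM t b (opM t a f) := by
  funext r
  simp only [opM, sub_mul, smul_mul_assoc, smul_sub, smul_smul, mul_comm a b]
  abel

/-- The failure of the exchange relation `β d(x) = n(x) β`, where `d` and `n` are products of first
order operators with parameters `a`, `b` and `a'`, `b'`. -/
def defect (t : R) (x : ℤ → R) (y : R) (a b a' b' : ℂ) : ℤ → R :=
  (fun r => y * opP t a (opM t b x) r) - fun r => opP t a' (opM t b' x) r * y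

/-- The two factors of a series share the exchange defect of the product: the first order operators
common to both factors cancel. -/
theorem defect_mul {t : R} (ht : ∀ y, Commute t y) (x : ℤ → R) (y z : R) (a : ℂ) {b : ℂ}
    (h : defect t x (y * z) b a a b = 0) (r : ℤ) :
    opP t a (opM t 1 (defect t x y b 1 1 b)) r * z +
      y * opP t b (opM t 1 (defect t x z 1 a a 1)) r = 0 := by
  have h1 : opP t 1 (opM t 1 (defect t x (y * z) b a a b)) r = 0 := by
    rw [h]; simp [opP, opM]
  rw [← h1]
  simp only [defect, opM_sub, opP_sub, opP_mul_left, opM_mul_left, opP_mul_right ht,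
    opM_mul_right ht, Pi.sub_apply, sub_mul, mul_sub]
  simp only [← opP_opM, opP_opP t b a, opP_opP t a 1,
    opM_opM t 1 b, opP_opP t 1 b, mul_assoc]
  abel

end ShiftOps

section Scale

open PowerSeries

variable {S : Type*} [Ring S] [Algebra ℂ S]

theorem coeff_complex_smul (a : ℂ) (f : S⟦X⟧) (n : ℕ) : coeff n (a • f) = a • coeff n f := rfl

/-- Substitution `t ↦ a t` in a power series. -/
def scaleSeries (a : ℂ) (f : S⟦X⟧) : S⟦X⟧ := PowerSeries.mk fun n => a ^ n • coeff n f

theorem coeff_scaleSeries (a : ℂ) (f : S⟦X⟧) (n : ℕ) :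
    coeff n (scaleSeries a f) = a ^ n • coeff n f := coeff_mk _ _

theorem scaleSeries_mul (a : ℂ) (f g : S⟦X⟧) :
    scaleSeries a (f * g) = scaleSeries a f * scaleSeries a g := by
  ext n
  rw [coeff_scaleSeries, coeff_mul, coeff_mul, Finset.smul_sum]
  refine Finset.sum_congr rfl fun ij hij => ?_
  rw [Finset.HasAntidiagonal.mem_antidiagonal] at hij
  rw [coeff_scaleSeries, coeff_scaleSeries, smul_mul_smul_comm, ← pow_add, hij]

theorem scaleSeries_sub (a : ℂ) (f g : S⟦X⟧) :
    scaleSeries a (f - g) = scaleSeries a f - scaleSeries a g := by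
  ext n; simp [coeff_scaleSeries, smul_sub]

theorem scaleSeries_smul (a b : ℂ) (f : S⟦X⟧) :
    scaleSeries a (b • f) = b • scaleSeries a f := by
  ext n; simp [coeff_scaleSeries, smul_comm _ b]

theorem scaleSeries_C (a : ℂ) (s : S) : scaleSeries a (C s) = C s := by
  ext n
  rw [coeff_scaleSeries, coeff_C]
  split_ifs with h <;> simp [h]

theorem scaleSeries_X (a : ℂ) : scaleSeries a (X : S⟦X⟧) = a • X := by
  ext n
  rw [coeff_scaleSeries, coeff_complex_smul, coeff_X]
  split_ifs with h <;> simp [h]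

theorem scaleSeries_opP (a b : ℂ) (f : ℤ → S⟦X⟧) (r : ℤ) :
    scaleSeries a (opP X b f r) = opP X (a * b) (fun r => scaleSeries a (f r)) r := by
  simp only [opP, scaleSeries_sub, scaleSeries_smul, scaleSeries_mul, scaleSeries_X,
    mul_smul_comm, smul_smul, mul_comm a b]

theorem scaleSeries_opM (a b : ℂ) (f : ℤ → S⟦X⟧) (r : ℤ) :
    scaleSeries a (opM X b f r) = opM X (a * b) (fun r => scaleSeries a (f r)) r := by
  simp only [opM, scaleSeries_sub, scaleSeries_smul, scaleSeries_mul, scaleSeries_X,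
    mul_smul_comm, smul_smul, mul_comm a b]

theorem scaleSeries_defect (k : ℂ) (x : ℤ → S) (f : S⟦X⟧) (a b a' b' : ℂ) (r : ℤ) :
    scaleSeries k (defect X (fun r => C (x r)) f a b a' b' r) =
      defect X (fun r => C (x r)) (scaleSeries k f) (k * a) (k * b) (k * a') (k * b') r := by
  simp only [defect, Pi.sub_apply, scaleSeries_sub, scaleSeries_mul, scaleSeries_opP,
    scaleSeries_opM, scaleSeries_C]

/-- The coefficients of the solution `β` of `β(t / q) β(q t) = ψ(t)` with `β(0) = 1`. -/
def sqrtCoeff (q : ℂ) (ψ : ℕ → S) : ℕ → S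
  | 0 => 1
  | n + 1 => (q⁻¹ ^ (n + 1) + q ^ (n + 1))⁻¹ • (ψ (n + 1) - ∑ i : Fin n,
      (q⁻¹ ^ (i.1 + 1) * q ^ (n - i.1)) • (sqrtCoeff q ψ (i.1 + 1) * sqrtCoeff q ψ (n - i.1)))
termination_by n => n

/-- The series with coefficients `sqrtCoeff q ψ` solves `β(t / q) β(q t) = ψ(t)`. -/
theorem scaleSeries_mul_sqrtCoeff {q : ℂ} (hq : q ≠ 0) (hroot : ∀ n : ℕ, 0 < n → q ^ n ≠ 1)
    (ψ : ℕ → S) (h0 : ψ 0 = 1) :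
    scaleSeries q⁻¹ (PowerSeries.mk (sqrtCoeff q ψ)) * scaleSeries q (PowerSeries.mk
      (sqrtCoeff q ψ)) = PowerSeries.mk ψ := by
  ext n
  rw [coeff_mul, Finset.Nat.sum_antidiagonal_eq_sum_range_succ_mk]
  simp only [coeff_scaleSeries, coeff_mk, smul_mul_smul_comm]
  cases n with
  | zero => simp [sqrtCoeff, h0]
  | succ n =>
    have hn : q⁻¹ ^ (n + 1) + q ^ (n + 1) ≠ 0 := by
      intro h
      apply hroot (4 * (n + 1)) (by omega)
      have e : q ^ (n + 1) * q⁻¹ ^ (n + 1) = 1 := by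
        rw [← mul_pow, mul_inv_cancel₀ hq, one_pow]
      linear_combination q ^ (n + 1) * (q ^ (2 * (n + 1)) - 1) * h - (q ^ (2 * (n + 1)) - 1) * e
    rw [Finset.sum_range_succ, Finset.sum_range_succ', ← Fin.sum_univ_eq_sum_range
      (fun i => (q⁻¹ ^ (i + 1) * q ^ (n + 1 - (i + 1))) • (sqrtCoeff q ψ (i + 1) *
        sqrtCoeff q ψ (n + 1 - (i + 1)))) n]
    have e1 : sqrtCoeff q ψ (n + 1) = (q⁻¹ ^ (n + 1) + q ^ (n + 1))⁻¹ • (ψ (n + 1) - ∑ i : Fin n,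
      (q⁻¹ ^ (i.1 + 1) * q ^ (n - i.1)) • (sqrtCoeff q ψ (i.1 + 1) * sqrtCoeff q ψ (n - i.1))) := by
      rw [sqrtCoeff]
    have e2 : (q⁻¹ ^ (n + 1) + q ^ (n + 1)) • sqrtCoeff q ψ (n + 1) + ∑ i : Fin n,
      (q⁻¹ ^ (i.1 + 1) * q ^ (n - i.1)) • (sqrtCoeff q ψ (i.1 + 1) * sqrtCoeff q ψ (n - i.1)) =
        ψ (n + 1) := by
      rw [e1, smul_smul, mul_inv_cancel₀ hn, one_smul, sub_add_cancel]
    rw [← e2]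
    have e3 : sqrtCoeff q ψ 0 = 1 := by rw [sqrtCoeff]
    simp only [Nat.add_sub_add_right, e3, one_mul, mul_one, pow_zero, Nat.sub_self, Nat.sub_zero,
      add_smul]
    abel

theorem commute_sqrtCoeff (q : ℂ) (ψ : ℕ → S) (y : S) (h : ∀ n, Commute y (ψ n)) (n : ℕ) :
    Commute y (sqrtCoeff q ψ n) := by
  induction n using Nat.strong_induction_on with
  | _ n ih =>
  cases n with
  | zero => rw [sqrtCoeff]; exact Commute.one_right y
  | succ n =>
    rw [sqrtCoeff]
    refine ((h _).sub_right (Commute.sum_right _ _ _ fun i _ => ?_)).smul_right _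
    exact ((ih _ (by omega)).mul_right (ih _ (by omega))).smul_right _

theorem coeff_opP {f : ℤ → S⟦X⟧} (a : ℂ) {m : ℕ} (h : ∀ j < m, ∀ r, coeff j (f r) = 0) {j : ℕ}
    (hj : j ≤ m) (r : ℤ) : coeff j (opP X a f r) = coeff j (f r) := by
  rw [opP, map_sub, coeff_complex_smul, sub_eq_self]
  cases j with
  | zero => simp
  | succ j => rw [coeff_succ_mul_X, h j (by omega), smul_zero]

theorem coeff_opM {f : ℤ → S⟦X⟧} (a : ℂ) {m : ℕ} (h : ∀ j < m, ∀ r, coeff j (f r) = 0) {j : ℕ}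
    (hj : j ≤ m) (r : ℤ) : coeff j (opM X a f r) = coeff j (f r) := by
  rw [opM, map_sub, coeff_complex_smul, sub_eq_self]
  cases j with
  | zero => simp
  | succ j => rw [coeff_succ_mul_X, h j (by omega), smul_zero]

/-- The exchange relation is inherited by the solution `β` of `β(t / q) β(q t) = ψ(t)`, since
the lowest coefficient of its defect would satisfy a homogeneous linear equation. -/
theorem defect_eq_zero_of_scaleSeries_mul {q : ℂ} (hq : q ≠ 0)
    (hroot : ∀ n : ℕ, 0 < n → q ^ n ≠ 1) (x : ℤ → S) (f : S⟦X⟧) (hf : coeff 0 f = 1)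
    (h : defect X (fun r => C (x r)) (scaleSeries q⁻¹ f * scaleSeries q f)
      (q⁻¹ ^ 2) (q ^ 2) (q ^ 2) (q⁻¹ ^ 2) = 0) :
    defect X (fun r => C (x r)) f q⁻¹ q q q⁻¹ = 0 := by
  have key := defect_mul (fun y => (commute_X y).symm) (fun r => C (x r)) _ _ _ h
  have s1 := fun r => scaleSeries_defect q⁻¹ x f q⁻¹ q q q⁻¹ r
  have s2 := fun r => scaleSeries_defect q x f q⁻¹ q q q⁻¹ r
  simp only [← pow_two, mul_inv_cancel₀ hq, inv_mul_cancel₀ hq] at s1 s2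
  have main : ∀ m r, coeff m (defect X (fun r => C (x r)) f q⁻¹ q q q⁻¹ r) = 0 := by
    intro m
    induction m using Nat.strong_induction_on with
    | _ m ih =>
    intro r
    have z1 : ∀ j < m, ∀ r, coeff j (defect X (fun r => C (x r)) (scaleSeries q⁻¹ f)
        (q⁻¹ ^ 2) 1 1 (q⁻¹ ^ 2) r) = 0 := by
      intro j hj r
      rw [← s1, coeff_scaleSeries, ih j hj, smul_zero]
    have z2 : ∀ j < m, ∀ r, coeff j (defect X (fun r => C (x r)) (scaleSeries q f)
        1 (q ^ 2) (q ^ 2) 1 r) = 0 := by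
      intro j hj r
      rw [← s2, coeff_scaleSeries, ih j hj, smul_zero]
    have z1' : ∀ j < m, ∀ r, coeff j (opM X 1 (defect X (fun r => C (x r)) (scaleSeries q⁻¹ f)
        (q⁻¹ ^ 2) 1 1 (q⁻¹ ^ 2)) r) = 0 := by
      intro j hj r
      rw [coeff_opM 1 z1 hj.le, z1 j hj]
    have z2' : ∀ j < m, ∀ r, coeff j (opM X 1 (defect X (fun r => C (x r)) (scaleSeries q f)
        1 (q ^ 2) (q ^ 2) 1) r) = 0 := by
      intro j hj r
      rw [coeff_opM 1 z2 hj.le, z2 j hj]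
    -- only the lowest coefficients contribute to the coefficient of degree `m`, which becomes
    -- `(q⁻ᵐ + qᵐ)` times the `m`-th coefficient of the defect
    have k := congrArg (coeff m) (key r)
    rw [map_add, map_zero, coeff_mul, coeff_mul, Finset.sum_eq_single (m, 0),
      Finset.sum_eq_single (0, m)] at k
    · rw [coeff_opP _ z1' le_rfl, coeff_opP _ z2' le_rfl, coeff_opM _ z1 le_rfl,
        coeff_opM _ z2 le_rfl, ← s1, ← s2, coeff_scaleSeries, coeff_scaleSeries,
        coeff_scaleSeries, coeff_scaleSeries, hf, pow_zero, pow_zero, one_smul, mul_one,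
        one_mul, ← add_smul] at k
      refine (smul_eq_zero_iff_right ?_).mp k
      intro h
      rcases Nat.eq_zero_or_pos m with rfl | hm
      · norm_num at h
      apply hroot (4 * m) (by omega)
      have e : q ^ m * q⁻¹ ^ m = 1 := by
        rw [← mul_pow, mul_inv_cancel₀ hq, one_pow]
      linear_combination q ^ m * (q ^ (2 * m) - 1) * h - (q ^ (2 * m) - 1) * e
    · rintro ⟨i, j⟩ hij hne
      rw [Finset.HasAntidiagonal.mem_antidiagonal] at hij
      simp only at hij
      have hj : j < m := by
        rcases Nat.eq_zero_or_pos i with rfl | hi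
        · exact absurd (by rw [← hij, zero_add]) hne
        · omega
      simp only
      rw [coeff_opP _ z2' hj.le, z2' j hj, mul_zero]
    · intro hn; simp at hn
    · rintro ⟨i, j⟩ hij hne
      rw [Finset.HasAntidiagonal.mem_antidiagonal] at hij
      simp only at hij
      have hi : i < m := by
        rcases Nat.eq_zero_or_pos j with rfl | hj
        · exact absurd (by rw [← hij, add_zero]) hne
        · omega
      simp only
      rw [coeff_opP _ z1' hi.le, z1' i hi, zero_mul]
    · intro hn; simp at hn
  funext r
  ext m
  rw [main]; rfl

end Scale

section Exchange

open PowerSeries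

variable {S : Type*} [Ring S] [Algebra ℂ S]

theorem C_complex_smul (a : ℂ) (s : S) : (C (a • s) : S⟦X⟧) = a • C s := by
  ext n
  rw [coeff_complex_smul, coeff_C, coeff_C]
  split_ifs <;> simp

/-- Coefficientwise form of the exchange relation. -/
theorem defect_eq_zero_iff {a b : ℂ} (hab : a * b = 1) (x : ℤ → S) (φ : ℕ → S) :
    defect X (fun r => C (x r)) (PowerSeries.mk φ) a b b a = 0 ↔ ∀ r,
      φ 0 * x r - x r * φ 0 = 0 ∧ φ 1 * x r - x r * φ 1 = exchange a b x r (φ 0) ∧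
      ∀ n, (φ (n + 2) + φ n) * x r - x r * (φ (n + 2) + φ n) = exchange a b x r (φ (n + 1)) := by
  have e : ∀ r, defect X (fun r => C (x r)) (PowerSeries.mk φ) a b b a r =
      (PowerSeries.mk φ * C (x r) - C (x r) * PowerSeries.mk φ) +
      (PowerSeries.mk φ * C (x r) - C (x r) * PowerSeries.mk φ) * X * X -
      (PowerSeries.mk φ * C (a • x (r + 1) + b • x (r - 1)) -
        C (b • x (r + 1) + a • x (r - 1)) * PowerSeries.mk φ) * X := by
    intro r
    have hX : ∀ f : S⟦X⟧, X * f = f * X := fun f => (commute_X f).symm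
    simp only [defect, opP, opM, Pi.sub_apply, sub_mul, mul_sub, smul_sub, add_mul, mul_add,
      smul_mul_assoc, mul_smul_comm, smul_smul, map_add, C_complex_smul, mul_assoc, hX, hab,
      add_sub_cancel_right, mul_comm b a, one_smul]
    abel
  have c0 : ∀ r, coeff 0 (defect X (fun r => C (x r)) (PowerSeries.mk φ) a b b a r) =
      φ 0 * x r - x r * φ 0 := by
    intro r; rw [e]
    simp only [map_sub, map_add, coeff_zero_mul_X, coeff_mul_C, coeff_C_mul, coeff_mk, add_zero,
      sub_zero]
  have c1 : ∀ r, coeff 1 (defect X (fun r => C (x r)) (PowerSeries.mk φ) a b b a r) =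
      φ 1 * x r - x r * φ 1 - exchange a b x r (φ 0) := by
    intro r; rw [e]
    simp only [map_sub, map_add, coeff_zero_mul_X, coeff_mul_C, coeff_C_mul, coeff_mk, add_zero,
      exchange_apply, (coeff_succ_mul_X 0 _ : coeff 1 _ = _), add_mul, mul_add, C_complex_smul,
      mul_smul_comm, smul_mul_assoc, coeff_complex_smul, smul_sub]
    abel
  have c2 : ∀ r n, coeff (n + 2) (defect X (fun r => C (x r)) (PowerSeries.mk φ) a b b a r) =
      (φ (n + 2) + φ n) * x r - x r * (φ (n + 2) + φ n) - exchange a b x r (φ (n + 1)) := by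
    intro r n; rw [e]
    simp only [map_sub, map_add, coeff_succ_mul_X, coeff_mul_C, coeff_C_mul,
      coeff_mk, exchange_apply, add_mul, mul_add,
      C_complex_smul, mul_smul_comm, smul_mul_assoc, coeff_complex_smul, smul_sub]
    abel
  constructor
  · intro h r
    rw [← c0, ← sub_eq_zero (a := φ 1 * x r - x r * φ 1), ← c1, h]
    refine ⟨rfl, rfl, fun n => ?_⟩
    rw [← sub_eq_zero, ← c2, h]; rfl
  · intro h
    funext r
    ext n
    match n with
    | 0 => rw [c0, (h r).1]; rfl
    | 1 => rw [c1, (h r).2.1, sub_self]; rfl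
    | n + 2 => rw [c2, (h r).2.2, sub_self]; rfl

end Exchange

section SquareRoot

open PowerSeries

variable {S : Type*} [Ring S] [Algebra ℂ S] {q c : ℂ} {x : ℤ → S} {h : S}

variable (q c x) in
/-- The coefficients of the generating series of imaginary root vectors in the variable `t`
for which the exchange relation factors. -/
def thetaHat : ℕ → S
  | 0 => algebraMap ℂ S (c / (q ^ 2 - q⁻¹ ^ 2))
  | 1 => (1 / 2 : ℂ) • quadSeq q x 0
  | 2 => quadSeq q x 1 - algebraMap ℂ S (c / (q ^ 2 - q⁻¹ ^ 2))
  | n + 3 => quadSeq q x (n + 2)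

/-- An even sequence is determined by the central values of its iterates under `symShift`, so
`quadSeq` inherits commutativity from the imaginary root vectors. -/
theorem RootSeq.commute_quadSeq (hq : q ≠ 0) (hroot : ∀ n : ℕ, 0 < n → q ^ n ≠ 1) (hc : c ≠ 0)
    (H : RootSeq q c x h) (m n : ℕ) : Commute (quadSeq q x m) (quadSeq q x n) := by
  have gen : ∀ y : S, (∀ k, Commute y (theta q c x k)) → ∀ n : ℕ, Commute y (quadSeq q x n) := by
    intro y hy n
    refine sub_eq_zero.mp (eq_zero_of_symShift_iterate (f := fun i => commL y (quadSeq q x i))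
      (fun i => by rw [quadSeq_neg]) n ?_ n le_rfl)
    intro k _
    have := symShift_iterate_map (commL y).toAddMonoidHom (quadSeq q x) k 0
    simp only [LinearMap.toAddMonoidHom_coe] at this
    rw [this, two_smul_theta (c := c), map_smul, commL_apply, (hy (k + 1)).eq, sub_self, smul_zero]
  exact gen _ (fun k => (gen _ (fun l => H.theta_commute hq hroot hc k l) m).symm) n

theorem RootSeq.commute_thetaHat (hq : q ≠ 0) (hroot : ∀ n : ℕ, 0 < n → q ^ n ≠ 1) (hc : c ≠ 0)
    (H : RootSeq q c x h) (m n : ℕ) : Commute (thetaHat q c x m) (thetaHat q c x n) := by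
  have gen : ∀ y : S, (∀ k : ℕ, Commute y (quadSeq q x k)) → ∀ n, Commute y (thetaHat q c x n) := by
    intro y hy n
    match n with
    | 0 => exact (Algebra.commutes _ _).symm
    | 1 => exact (hy 0).smul_right _
    | 2 => exact (hy 1).sub_right (Algebra.commutes _ _).symm
    | n + 3 => exact_mod_cast hy (n + 2)
  exact gen _ (fun k => (gen _ (fun l => H.commute_quadSeq hq hroot hc k l) m).symm) n

/-- The exchange relations of the imaginary root vectors, in terms of generating series; the scalar
subtracted in degree two makes them hold in all degrees. -/
theorem RootSeq.defect_thetaHat (hq : q ≠ 0) (hroot : ∀ n : ℕ, 0 < n → q ^ n ≠ 1) (hc : c ≠ 0)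
    (H : RootSeq q c x h) : defect X (fun r => C (x r)) (PowerSeries.mk (thetaHat q c x))
      (q ^ 2) (q⁻¹ ^ 2) (q⁻¹ ^ 2) (q ^ 2) = 0 := by
  have hqq : q ^ 2 * q⁻¹ ^ 2 = 1 := by rw [← mul_pow, mul_inv_cancel₀ hq, one_pow]
  rw [defect_eq_zero_iff hqq]
  intro r
  have E := fun n : ℕ => (H.invUpTo hq hroot hc (n + 1)).exchange_eq (m := n) hq (by simp) r
  have s1 : thetaHat q c x 1 * x r - x r * thetaHat q c x 1 =
      exchange (q ^ 2) (q⁻¹ ^ 2) x r (thetaHat q c x 0) :=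
    (H.invUpTo hq hroot hc 0).theta_exchange hq hroot H le_rfl r
  refine ⟨?_, s1, fun n => ?_⟩
  · rw [thetaHat, Algebra.commutes, sub_self]
  match n with
  | 0 =>
    have h0 := E 0
    simp only [symShift, Nat.cast_zero, zero_add, zero_sub, quadSeq_neg] at h0
    have e : (2 : ℂ) • ((quadSeq q x 1) * x r - x r * quadSeq q x 1) =
        (2 : ℂ) • exchange (q ^ 2) (q⁻¹ ^ 2) x r (thetaHat q c x 1) := by
      rw [thetaHat, map_smul, ← h0]
      simp only [two_smul, mul_add, add_mul, smul_sub, smul_add]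
      module
    have e2 := smul_right_injective S (two_ne_zero (α := ℂ)) e
    simp only [zero_add]
    rw [← e2, thetaHat, thetaHat, sub_add_cancel]
  | 1 =>
    have h0 := E 1
    rw [thetaHat] at s1
    simp only [symShift, Nat.cast_one, sub_self] at h0
    simp only [Nat.reduceAdd]
    rw [thetaHat, thetaHat, thetaHat, map_sub, ← h0]
    rw [thetaHat] at s1
    rw [← s1]
    norm_num
    simp only [mul_add, add_mul, smul_mul_assoc, mul_smul_comm]
    module
  | 2 =>
    have h0 := E 2
    simp only [symShift] at h0
    simp only [Nat.reduceAdd]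
    rw [thetaHat, thetaHat, thetaHat]
    norm_num at h0 ⊢
    rw [← h0, add_mul, mul_add, add_mul, mul_add, sub_mul, mul_sub, Algebra.commutes]
    abel
  | n + 3 =>
    have h0 := E (n + 3)
    simp only [symShift] at h0
    rw [show n + 3 + 1 = n + 1 + 3 by ring, show n + 3 + 2 = n + 2 + 3 by ring, thetaHat, thetaHat,
      thetaHat]
    push_cast at h0 ⊢
    rw [show (n : ℤ) + 3 + 1 = n + 2 + 2 by ring, show (n : ℤ) + 3 - 1 = n + 2 by ring] at h0
    rw [show (n : ℤ) + 1 + 2 = n + 3 by ring]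
    exact h0

/-- A commuting sequence with exchange relations whose parameters are square roots of those of the
imaginary root vectors. -/
theorem RootSeq.exists_sqrt (hq : q ≠ 0) (hroot : ∀ n : ℕ, 0 < n → q ^ n ≠ 1) (hc : c ≠ 0)
    (H : RootSeq q c x h) : ∃ β : ℕ → S, β 0 = 1 ∧ (∀ i j, Commute (β i) (β j)) ∧
      (∀ i, Commute h (β i)) ∧
      defect X (fun r => C (x r)) (PowerSeries.mk β) q⁻¹ q q q⁻¹ = 0 := by
  have hd := q_sq_sub_ne_zero hq hroot
  set k := c / (q ^ 2 - q⁻¹ ^ 2) with hk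
  have hk0 : k ≠ 0 := div_ne_zero hc hd
  have hcomm := H.commute_thetaHat hq hroot hc
  have hdef := H.defect_thetaHat hq hroot hc
  have hh : h = thetaHat q c x 1 := by
    rw [thetaHat, quadSeq, abs_zero, quadForm_self H, smul_smul]; norm_num
  have h0 : thetaHat q c x 0 = algebraMap ℂ S k := by rw [thetaHat]
  -- the inverse of the generating series, normalised to constant term `1`
  let un : Sˣ := ⟨algebraMap ℂ S k, algebraMap ℂ S k⁻¹, by rw [← map_mul, mul_inv_cancel₀ hk0,
    map_one], by rw [← map_mul, inv_mul_cancel₀ hk0, map_one]⟩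
  set Θ : S⟦X⟧ := PowerSeries.mk (thetaHat q c x) with hΘ
  have hc0 : constantCoeff Θ = un := by
    rw [← coeff_zero_eq_constantCoeff_apply, hΘ, coeff_mk, h0]
  have i1 := mul_invOfUnit Θ un hc0
  have i2 := invOfUnit_mul Θ un hc0
  set Ω := invOfUnit Θ un with hΩ
  let ψ : ℕ → S := fun n => k • coeff n Ω
  have hψ0 : ψ 0 = 1 := by
    have : coeff 0 Ω = algebraMap ℂ S k⁻¹ := by
      rw [hΩ, coeff_invOfUnit]; simp; rfl
    change k • coeff 0 Ω = 1
    rw [this, Algebra.smul_def, ← map_mul, mul_inv_cancel₀ hk0, map_one]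
  have hψ : PowerSeries.mk ψ = k • Ω := by ext n; rw [coeff_mk]; rfl
  have hdψ : defect X (fun r => C (x r)) (PowerSeries.mk ψ) (q⁻¹ ^ 2) (q ^ 2) (q ^ 2) (q⁻¹ ^ 2)
      = 0 := by
    funext r
    have := congrFun hdef r
    simp only [defect, Pi.sub_apply, Pi.zero_apply, sub_eq_zero] at this ⊢
    rw [hψ, smul_mul_assoc, mul_smul_comm]
    congr 1
    have h3 := congrArg (fun z => Ω * z * Ω) this
    rw [← mul_assoc, i2, one_mul, ← mul_assoc, mul_assoc _ Θ Ω, i1, mul_one] at h3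
    simp only [opP_opM] at h3 ⊢
    exact h3.symm
  have hcψ : ∀ y : S, (∀ n, Commute y (thetaHat q c x n)) → ∀ n, Commute y (ψ n) := by
    intro y hy n
    have e1 : C y * Θ = Θ * C y := by
      ext n; rw [coeff_C_mul, coeff_mul_C, hΘ, coeff_mk, (hy n).eq]
    have e2 : C y * Ω = Ω * C y := by
      have h3 := congrArg (fun z => Ω * z * Ω) e1
      rw [← mul_assoc, mul_assoc _ Θ Ω, i1, mul_one, ← mul_assoc, i2, one_mul] at h3
      exact h3.symm
    have e3 := congrArg (coeff n) e2
    rw [coeff_C_mul, coeff_mul_C] at e3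
    exact (show Commute y (coeff n Ω) from e3).smul_right k
  have hcβ : ∀ y : S, (∀ n, Commute y (thetaHat q c x n)) → ∀ n, Commute y (sqrtCoeff q ψ n) :=
    fun y hy => commute_sqrtCoeff q ψ y (hcψ y hy)
  refine ⟨sqrtCoeff q ψ, by rw [sqrtCoeff], ?_, ?_, ?_⟩
  · intro i j
    refine commute_sqrtCoeff q ψ _ (fun n => ?_) j
    exact hcψ _ (fun m => (hcβ _ (fun l => hcomm m l) i).symm) n
  · intro i
    rw [hh]
    exact hcβ _ (fun l => hcomm 1 l) i
  · refine defect_eq_zero_of_scaleSeries_mul hq hroot x _ (by rw [coeff_mk, sqrtCoeff]) ?_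
    rw [scaleSeries_mul_sqrtCoeff hq hroot ψ hψ0, hdψ]

/-- Passing to the variable `t + t⁻¹` simplifies the exchange relation. -/
theorem RootSeq.exists_exchange (hq : q ≠ 0) (hroot : ∀ n : ℕ, 0 < n → q ^ n ≠ 1) (hc : c ≠ 0)
    (H : RootSeq q c x h) : ∃ b : ℕ → S, b 0 = 1 ∧ (∀ i j, Commute (b i) (b j)) ∧
      (∀ i, Commute h (b i)) ∧
      ∀ k r, b (k + 1) * x r - x r * b (k + 1) = exchange q⁻¹ q x r (b k) := by
  obtain ⟨β, hβ0, hβ, hβh, hd⟩ := H.exists_sqrt hq hroot hc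
  rw [defect_eq_zero_iff (inv_mul_cancel₀ hq)] at hd
  -- extended by zero to negative indices, `β` satisfies one exchange relation at all indices
  let g : ℤ → S := fun n => if 0 ≤ n then β n.toNat else 0
  have gnat : ∀ n : ℕ, g n = β n := fun n => by simp [g]
  have gneg : ∀ n : ℤ, n < 0 → g n = 0 := fun n hn => by simp [g, hn]
  have hg : ∀ n r, symShift g n * x r - x r * symShift g n = exchange q⁻¹ q x r (g n) := by
    intro n r
    rcases lt_trichotomy n (-1) with hn | rfl | hn
    · rw [symShift, gneg _ (by omega), gneg _ (by omega), gneg _ (by omega), map_zero]; simp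
    · rw [symShift, gneg (-1) (by omega), gneg (-1 - 1) (by omega), map_zero,
        show (-1 : ℤ) + 1 = (0 : ℕ) by norm_num, gnat, add_zero, hβ0]
      simp
    · obtain ⟨m, rfl⟩ := Int.eq_ofNat_of_zero_le (show 0 ≤ n by omega)
      cases m with
      | zero =>
        have h1 := (hd r).2.1
        rw [symShift, gneg ((0 : ℕ) - 1) (by norm_num), add_zero,
          show ((0 : ℕ) : ℤ) + 1 = (1 : ℕ) by norm_num, gnat, gnat]
        exact h1
      | succ m =>
        have h1 := (hd r).2.2 m
        rw [symShift, show ((m + 1 : ℕ) : ℤ) + 1 = (m + 2 : ℕ) by push_cast; ring,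
          show ((m + 1 : ℕ) : ℤ) - 1 = (m : ℕ) by push_cast; ring, gnat, gnat, gnat]
        exact h1
  have hcom : ∀ y : S, (∀ i, Commute y (β i)) → ∀ k, Commute y (symShift^[k] g 0) := by
    intro y hy k
    have h1 := symShift_iterate_map (commL y).toAddMonoidHom g k 0
    rw [symShift_iterate_eq_zero] at h1
    · exact sub_eq_zero.mp h1.symm
    · intro i _ _
      rcases lt_or_ge i 0 with hi | hi
      · rw [gneg i hi, map_zero]
      · obtain ⟨m, rfl⟩ := Int.eq_ofNat_of_zero_le hi
        rw [gnat]
        exact sub_eq_zero.mpr (hy m)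
  refine ⟨fun k => symShift^[k] g 0, ?_, ?_, ?_, ?_⟩
  · have := gnat 0
    simp only [Function.iterate_zero, id]
    rw [← hβ0, ← this, Nat.cast_zero]
  · intro i j
    exact hcom _ (fun m => (hcom _ (fun l => hβ m l) i).symm) j
  · exact hcom _ hβh
  · intro k r
    let L : S →ₗ[ℂ] S := LinearMap.mulRight ℂ (x r) - LinearMap.mulLeft ℂ (x r)
    have e1 := symShift_iterate_map L.toAddMonoidHom (symShift g) k 0
    have e2 := symShift_iterate_map (exchange q⁻¹ q x r).toAddMonoidHom g k 0
    rw [symShift_iterate_congr (f := fun i => L.toAddMonoidHom (symShift g i))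
      (g := fun i => (exchange q⁻¹ q x r).toAddMonoidHom (g i)) k 0
      (fun i h1 h2 => hg i r), e2, ← Function.iterate_succ_apply] at e1
    exact e1.symm

end SquareRoot

/-! ### Exchange relations with the generators -/

section Telescope

open PowerSeries

variable {S : Type*} [Ring S] [Algebra ℂ S] {q c : ℂ} {x : ℤ → S} {h : S}

/-- The operator `1 - t (k w⁻¹ + l w)` on sequences of power series in `t`, where `w` is the
shift `r ↦ r + 1`. -/
def opD (k l : ℂ) (f : ℤ → S⟦X⟧) : ℤ → S⟦X⟧ :=
  fun r => f r - (k • f (r - 1) + l • f (r + 1)) * X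

theorem eq_zero_of_opD {k l : ℂ} {f : ℤ → S⟦X⟧} (hf : opD k l f = 0) : f = 0 := by
  have h1 : ∀ n r, coeff n (f r) = 0 := by
    intro n
    induction n with
    | zero =>
      intro r
      have := congrArg (coeff 0) (congrFun hf r)
      simpa [opD] using this
    | succ n ih =>
      intro r
      have := congrArg (coeff (n + 1)) (congrFun hf r)
      simp only [opD, map_sub, coeff_succ_mul_X, map_add, coeff_complex_smul, ih, smul_zero,
        add_zero, sub_zero] at this
      exact this
  funext r
  ext n
  exact h1 n r

/-- The coefficients of the solution `f` of `opD k l f = x`. -/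
def opDInvCoeff (k l : ℂ) (x : ℤ → S) : ℕ → ℤ → S
  | 0 => x
  | n + 1 => fun r => k • opDInvCoeff k l x n (r - 1) + l • opDInvCoeff k l x n (r + 1)

theorem exists_opD_eq (k l : ℂ) (x : ℤ → S) : ∃ f, opD k l f = fun r => C (x r) := by
  refine ⟨fun r => PowerSeries.mk fun n => opDInvCoeff k l x n r, ?_⟩
  funext r
  ext n
  rw [opD, map_sub]
  cases n with
  | zero => simp [opDInvCoeff]
  | succ n =>
    rw [coeff_succ_mul_X, map_add, coeff_complex_smul, coeff_complex_smul, coeff_mk, coeff_mk,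
      coeff_mk, coeff_C, if_neg (Nat.succ_ne_zero n), opDInvCoeff, sub_self]

/-- The bilinear form polarising `quadForm`. -/
def bilForm {R : Type*} [Ring R] [Algebra ℂ R] (q : ℂ) (f g : ℤ → R) (r s : ℤ) : R :=
  qComm q (f r) (g (s + 1)) + qComm q (g s) (f (r + 1))

theorem bilForm_opD_left (k l : ℂ) (f g : ℤ → S⟦X⟧) (s : ℤ) :
    (fun r => bilForm q (opD k l f) g r s) = opD k l fun r => bilForm q f g r s := by
  funext r
  have hX : ∀ f : S⟦X⟧, X * f = f * X := fun f => (commute_X f).symm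
  simp only [bilForm, opD, qComm, sub_mul, mul_sub, add_mul, mul_add, smul_add, smul_sub,
    smul_mul_assoc, mul_smul_comm, mul_assoc, hX, sub_add_cancel, add_sub_cancel_right,
    smul_comm q k, smul_comm q l, smul_comm q⁻¹ k, smul_comm q⁻¹ l]
  abel

theorem bilForm_opD_right (k l : ℂ) (f g : ℤ → S⟦X⟧) (r : ℤ) :
    (fun s => bilForm q f (opD k l g) r s) = opD k l fun s => bilForm q f g r s := by
  funext s
  have hX : ∀ f : S⟦X⟧, X * f = f * X := fun f => (commute_X f).symm
  simp only [bilForm, opD, qComm, sub_mul, mul_sub, add_mul, mul_add, smul_add, smul_sub,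
    smul_mul_assoc, mul_smul_comm, mul_assoc, hX, sub_add_cancel, add_sub_cancel_right,
    smul_comm q k, smul_comm q l, smul_comm q⁻¹ k, smul_comm q⁻¹ l]
  abel

theorem opD_sub (k l : ℂ) (f g : ℤ → S⟦X⟧) : opD k l (f - g) = opD k l f - opD k l g := by
  funext r
  simp only [opD, Pi.sub_apply, smul_sub, add_mul, sub_mul]
  abel

theorem opD_shift (k l : ℂ) (f : ℤ → S⟦X⟧) :
    opD k l (fun r => f (r + 1)) = fun r => opD k l f (r + 1) := by
  funext r
  simp only [opD, sub_add_cancel, add_sub_cancel_right]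

/-- The translation invariance of the quadratic expressions passes to the solution of
`opD k l f = x`. -/
theorem RootSeq.qComm_opD_inv (hq : q ≠ 0) (hroot : ∀ n : ℕ, 0 < n → q ^ n ≠ 1) (hc : c ≠ 0)
    (H : RootSeq q c x h) {k l : ℂ} {f : ℤ → S⟦X⟧} (hf : opD k l f = fun r => C (x r)) (r : ℤ) :
    qComm q (f (r + 1)) (f (r + 1 + 1)) = qComm q (f r) (f (r + 1)) := by
  have hx : ∀ r s, quadForm q x (r + 1) (s + 1) = quadForm q x r s := by
    intro r s
    have h1 := H.invUpTo hq hroot hc (s - r).natAbs (r + 1) (s - r) (by simp)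
    have h2 := H.invUpTo hq hroot hc (s - r).natAbs r (s - r) (by simp)
    rw [show r + 1 + (s - r) = s + 1 by ring] at h1
    rw [show r + (s - r) = s by ring] at h2
    rw [h1, h2]
  have hCx : ∀ r s, bilForm q (fun r => (C (x r) : S⟦X⟧)) (fun r => C (x r)) r s =
      C (quadForm q x r s) := by
    intro r s
    simp only [bilForm, quadForm, qComm, map_add, map_sub, C_complex_smul, map_mul]
  have h1 : ∀ r s, bilForm q (fun r => C (x r)) f (r + 1) (s + 1) =
      bilForm q (fun r => C (x r)) f r s := by
    intro r s
    have : opD k l ((fun s => bilForm q (fun r => C (x r)) f (r + 1) (s + 1)) -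
        fun s => bilForm q (fun r => C (x r)) f r s) = 0 := by
      rw [opD_sub, opD_shift k l (fun s => bilForm q (fun r => C (x r)) f (r + 1) s),
        ← bilForm_opD_right, ← bilForm_opD_right, hf]
      funext s
      simp only [Pi.sub_apply, hCx, hx, sub_self, Pi.zero_apply]
    exact sub_eq_zero.mp (congrFun (eq_zero_of_opD this) s)
  have h2 : ∀ r s, bilForm q f f (r + 1) (s + 1) = bilForm q f f r s := by
    intro r s
    have : opD k l ((fun r => bilForm q f f (r + 1) (s + 1)) -
        fun r => bilForm q f f r s) = 0 := by
      rw [opD_sub, opD_shift k l (fun r => bilForm q f f r (s + 1)),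
        ← bilForm_opD_left, ← bilForm_opD_left, hf]
      funext r
      simp only [Pi.sub_apply, h1, sub_self, Pi.zero_apply]
    exact sub_eq_zero.mp (congrFun (eq_zero_of_opD this) r)
  have h3 := h2 r r
  simp only [bilForm, ← two_smul ℂ] at h3
  exact smul_right_injective _ (two_ne_zero (α := ℂ)) h3

/-- Relations of the first and second kind between `P = [X, b]_q` and `Q = [b, Y]_q`. Both
`P + (q + q⁻¹) t Q` and `Q + (q + q⁻¹) t P` are multiples of terms of the telescoping
solution of `opD q q⁻¹ f = x` multiplied by the series `b`. -/
theorem RootSeq.lie_qComm_of_exchange (hq : q ≠ 0) (hroot : ∀ n : ℕ, 0 < n → q ^ n ≠ 1)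
    (hc : c ≠ 0) (H : RootSeq q c x h) (b : ℕ → S)
    (hb0 : b 0 = 1)
    (hb : ∀ k r, b (k + 1) * x r - x r * b (k + 1) = exchange q⁻¹ q x r (b k)) (k : ℕ) :
    ⁅x 1, qComm q (x 1) (b (k + 1))⁆ = -(q + q⁻¹) • ⁅x 1, qComm q (b k) (x 0)⁆ ∧
    ⁅x 0, qComm q (b (k + 1)) (x 0)⁆ = -(q + q⁻¹) • ⁅x 0, qComm q (x 1) (b k)⁆ := by
  obtain ⟨f, hf⟩ := exists_opD_eq q q⁻¹ x
  set B : S⟦X⟧ := PowerSeries.mk b with hB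
  have hX : ∀ f : S⟦X⟧, X * f = f * X := fun f => (commute_X f).symm
  -- the exchange relation in terms of generating series
  have e1 : ∀ r, B * opD q q⁻¹ (fun r => C (x r)) r = opD q⁻¹ q (fun r => C (x r)) r * B := by
    intro r
    simp only [opD, mul_sub, sub_mul, ← C_complex_smul, ← map_add, mul_assoc, hX]
    rw [← mul_assoc, ← mul_assoc (C _) B]
    ext n
    cases n with
    | zero => simp [hB, hb0]
    | succ n =>
      simp only [map_sub, coeff_succ_mul_X, coeff_C_mul, coeff_mul_C, hB, coeff_mk]
      rw [sub_eq_sub_iff_sub_eq_sub, hb, exchange_apply]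
      simp only [mul_add, add_mul, mul_smul_comm, smul_mul_assoc, smul_sub]
      abel
  have e3 : ∀ r, C (x r) = opD q q⁻¹ f r := fun r => by rw [hf]
  -- cancelling `opD q q⁻¹`, which is injective
  have e2 : ∀ r, B * C (x r) = opD q⁻¹ q f r * B := by
    have : opD q q⁻¹ ((fun r => B * C (x r)) - fun r => opD q⁻¹ q f r * B) = 0 := by
      funext r
      have h1 := e1 r
      rw [← hf, ← sub_eq_zero] at h1
      rw [Pi.zero_apply, ← h1]
      simp only [e3, opD, Pi.sub_apply, mul_sub, sub_mul, smul_sub, smul_add, mul_add, add_mul,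
        smul_mul_assoc, mul_smul_comm, mul_assoc, hX, sub_add_cancel, add_sub_cancel_right,
        smul_smul, mul_inv_cancel₀ hq, inv_mul_cancel₀ hq, one_smul]
      abel
    intro r
    exact sub_eq_zero.mp (congrFun (eq_zero_of_opD this) r)
  have q1 := H.qComm_opD_inv hq hroot hc hf 0
  have q0 := H.qComm_opD_inv hq hroot hc hf (-1)
  norm_num at q0 q1
  -- `x₁` commutes with `f₁ B`, since `[f₀, f₁]_q = [f₁, f₂]_q`; likewise for `x₀` and `f₀ B`
  have comm1 : C (x 1) * (f 1 * B) = f 1 * B * C (x 1) := by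
    rw [mul_assoc, e2, e3, ← mul_assoc, ← mul_assoc]
    congr 1
    simp only [opD, mul_sub, sub_mul, add_mul, mul_add, smul_mul_assoc, mul_smul_comm, mul_assoc,
      hX]
    norm_num
    simp only [qComm, sub_eq_sub_iff_add_eq_add] at q1
    have := congrArg (fun z => z * (X : S⟦X⟧)) q1
    simp only [add_mul, smul_mul_assoc, mul_assoc] at this
    rw [← this, add_comm]
  have comm0 : C (x 0) * (f 0 * B) = f 0 * B * C (x 0) := by
    rw [mul_assoc, e2, e3, ← mul_assoc, ← mul_assoc]
    congr 1
    simp only [opD, mul_sub, sub_mul, add_mul, mul_add, smul_mul_assoc, mul_smul_comm, mul_assoc,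
      hX]
    norm_num
    simp only [qComm, sub_eq_sub_iff_add_eq_add] at q0
    have := congrArg (fun z => z * (X : S⟦X⟧)) q0
    simp only [add_mul, smul_mul_assoc, mul_assoc] at this
    rw [← this, add_comm]
  -- every term on the right-hand side is a multiple of `f₁ B`, respectively `f₀ B`
  have P1 : qComm q (C (x 1)) B + (q + q⁻¹) • (qComm q B (C (x 0)) * X) =
      (q - q⁻¹) • (f 1 * B - (q + q⁻¹) ^ 2 • (f 1 * B * X * X)) := by
    simp only [qComm, e2]
    simp only [e3, opD, sub_mul, smul_sub, smul_add, add_mul, smul_mul_assoc, mul_assoc, hX,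
      zero_add, sub_self, smul_smul]
    norm_num
    match_scalars <;> field_simp <;> ring
  have P0 : qComm q B (C (x 0)) + (q + q⁻¹) • (qComm q (C (x 1)) B * X) =
      (q - q⁻¹) • (f 0 * B - (q + q⁻¹) ^ 2 • (f 0 * B * X * X)) := by
    simp only [qComm, e2]
    simp only [e3, opD, sub_mul, smul_sub, smul_add, add_mul, smul_mul_assoc, mul_assoc, hX,
      zero_add, sub_self, smul_smul]
    norm_num
    match_scalars <;> field_simp <;> ring
  have fin : ∀ (y : S) (F P Q : S⟦X⟧), C y * F = F * C y →
      P + (q + q⁻¹) • (Q * X) = (q - q⁻¹) • (F - (q + q⁻¹) ^ 2 • (F * X * X)) →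
      ⁅y, coeff (k + 1) P⁆ = -(q + q⁻¹) • ⁅y, coeff k Q⁆ := by
    intro y F P Q hy hPQ
    have h1 : C y * (P + (q + q⁻¹) • (Q * X)) = (P + (q + q⁻¹) • (Q * X)) * C y := by
      rw [hPQ]
      simp only [mul_smul_comm, smul_mul_assoc, mul_sub, sub_mul, ← mul_assoc, hy]
      simp only [mul_assoc, hX]
    have h2 := congrArg (coeff (k + 1)) h1
    rw [coeff_C_mul, coeff_mul_C, map_add, coeff_complex_smul, coeff_succ_mul_X, mul_add, add_mul,
      mul_smul_comm, smul_mul_assoc, ← sub_eq_zero] at h2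
    rw [← sub_eq_zero, ← h2, Ring.lie_def, Ring.lie_def]
    module
  have cP : ∀ n, coeff n (qComm q (C (x 1)) B) = qComm q (x 1) (b n) := by
    intro n
    simp only [qComm, map_sub, coeff_complex_smul, coeff_C_mul, coeff_mul_C, hB, coeff_mk]
  have cQ : ∀ n, coeff n (qComm q B (C (x 0))) = qComm q (b n) (x 0) := by
    intro n
    simp only [qComm, map_sub, coeff_complex_smul, coeff_C_mul, coeff_mul_C, hB, coeff_mk]
  rw [← cP, ← cQ, ← cP, ← cQ]
  exact ⟨fin _ _ _ _ comm1 P1, fin _ _ _ _ comm0 P0⟩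

end Telescope

section Generating

variable {S : Type*} [Ring S] [Algebra ℂ S]

/-- The sequences from which the currents are built: a commuting sequence `b` starting with `1`,
together with its relations with the generators `X` and `Y`. -/
structure GenSeq (q c : ℂ) (X Y : S) (b : ℕ → S) : Prop where
  zero : b 0 = 1
  commute : ∀ i j, Commute (b i) (b j)
  commute_qComm : ∀ i, Commute (qComm q Y X) (b i)
  lie_left : ∀ k, ⁅X, qComm q X (b (k + 1))⁆ = -(q + q⁻¹) • ⁅X, qComm q (b k) Y⁆
  lie_right : ∀ k, ⁅Y, qComm q (b (k + 1)) Y⁆ = -(q + q⁻¹) • ⁅Y, qComm q X (b k)⁆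
  succ_left : ∀ k, -c • ⁅X, b (k + 1)⁆ = qComm q ⁅X, qComm q (b k) Y⁆ X
  succ_right : ∀ k, -c • ⁅b (k + 1), Y⁆ = qComm q Y ⁅X, qComm q (b k) Y⁆

/-- If `b` commutes with `[Y, X]_q`, the two mixed commutators agree. -/
theorem lie_qComm_eq {q : ℂ} {X Y b : S} (hb : Commute (qComm q Y X) b) :
    ⁅X, qComm q b Y⁆ = ⁅qComm q X b, Y⁆ := by
  have h1 := hb.eq
  rw [← sub_eq_zero] at h1 ⊢
  rw [← h1]
  simp only [qComm, Ring.lie_def, mul_sub, sub_mul, mul_smul_comm, smul_mul_assoc, mul_assoc]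
  abel

/-- Two elements satisfying the `q`-Dolan–Grady relations in both orders admit a sequence `GenSeq`:
the coefficients, in the variable `t + t⁻¹`, of the series `β` extracted from the generating series
of imaginary root vectors. -/
theorem exists_genSeq {q c : ℂ} (hq : q ≠ 0) (hroot : ∀ n : ℕ, 0 < n → q ^ n ≠ 1) (hc : c ≠ 0)
    {X Y : S} (h1 : DolanGrady q (-c * (q + q⁻¹)) X Y) (h2 : DolanGrady q (-c * (q + q⁻¹)) Y X) :
    ∃ b : ℕ → S, GenSeq q c X Y b := by
  obtain ⟨x, hx0, hx1, H⟩ := exists_rootSeq hq hroot hc h1 h2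
  obtain ⟨b, hb0, hb, hbh, hbx⟩ := H.exists_exchange hq hroot hc
  have hde := H.lie_qComm_of_exchange hq hroot hc b hb0 hbx
  have hlieY := H.lie_eq 0
  have hlieX := H.lie_eq 1
  have exX := fun k => hbx k 1
  have exY := fun k => hbx k 0
  rw [hx0] at hlieY
  rw [hx1] at hlieX
  norm_num [exchange_apply] at hlieY hlieX exX exY
  rw [hx0, hx1] at hde
  rw [hx1] at exX hlieY
  simp only [hx1] at exY
  rw [hx0] at hlieX exY
  simp only [hx0] at exX
  -- a `q`-analogue of the Jacobi identity
  have jac : ∀ P : S, qComm q ⁅P, Y⁆ X = ⁅P, qComm q Y X⁆ + qComm q Y ⁅X, P⁆ := by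
    intro P
    simp only [qComm, Ring.lie_def, mul_sub, sub_mul, mul_smul_comm, smul_mul_assoc, mul_assoc,
      smul_sub]
    abel
  -- the relations `⁅h, x_r⁆ = c (x_{r+1} - x_{r-1})` eliminate `x₂` and `x₋₁` from the exchange
  -- relations of `b` with `x₁ = X` and `x₀ = Y`
  have KX : ∀ k, -c • ⁅X, b (k + 1)⁆ =
      (c * (q + q⁻¹)) • ⁅b k, Y⁆ + ⁅qComm q X (b k), qComm q Y X⁆ := by
    intro k
    have e : ⁅qComm q X (b k), qComm q Y X⁆ = -qComm q ⁅qComm q Y X, X⁆ (b k) := by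
      have h3 := (hbh k).eq
      have h4 : ∀ z, qComm q Y X * (b k * z) = b k * (qComm q Y X * z) := fun z => by
        rw [← mul_assoc, h3, mul_assoc]
      generalize qComm q Y X = u at *
      simp only [qComm, Ring.lie_def, mul_sub, sub_mul, mul_smul_comm, smul_mul_assoc, mul_assoc,
        h3, h4, smul_sub]
      abel
    rw [e, hlieX, Ring.lie_def, ← neg_sub (b (k + 1) * X), exX]
    simp only [qComm, Ring.lie_def, mul_sub, sub_mul, mul_smul_comm, smul_mul_assoc, smul_sub]
    module
  have KY : ∀ k, -c • ⁅b (k + 1), Y⁆ =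
      (c * (q + q⁻¹)) • ⁅X, b k⁆ - ⁅qComm q (b k) Y, qComm q Y X⁆ := by
    intro k
    have e : ⁅qComm q (b k) Y, qComm q Y X⁆ = -qComm q (b k) ⁅qComm q Y X, Y⁆ := by
      have h3 := (hbh k).eq
      have h4 : ∀ z, qComm q Y X * (b k * z) = b k * (qComm q Y X * z) := fun z => by
        rw [← mul_assoc, h3, mul_assoc]
      generalize qComm q Y X = u at *
      simp only [qComm, Ring.lie_def, mul_sub, sub_mul, mul_smul_comm, smul_mul_assoc, mul_assoc,
        h3, h4, smul_sub]
      abel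
    rw [e, hlieY, Ring.lie_def, exY]
    simp only [qComm, Ring.lie_def, mul_sub, sub_mul, mul_smul_comm, smul_mul_assoc, smul_sub]
    module
  have neg1 : ∀ (a b : S), ⁅a, b⁆ = -⁅b, a⁆ := fun a b => by
    rw [Ring.lie_def, Ring.lie_def, neg_sub]
  have qs1 : ∀ (t : ℂ) (a b : S), qComm q (t • a) b = t • qComm q a b := fun t a b => by
    simp only [qComm, mul_smul_comm, smul_mul_assoc, smul_sub, smul_comm t]
  have qs2 : ∀ (t : ℂ) (a b : S), qComm q a (t • b) = t • qComm q a b := fun t a b => by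
    simp only [qComm, mul_smul_comm, smul_mul_assoc, smul_sub, smul_comm t]
  -- the relations at `k + 1` follow from two relations at `k`, which for `k > 0` are consequences
  -- of the relations already proved
  have red : ∀ k, (c * (q + q⁻¹)) • ⁅b k, Y⁆ = qComm q Y ⁅X, qComm q X (b k)⁆ →
      (c * (q + q⁻¹)) • ⁅X, b k⁆ = qComm q ⁅qComm q (b k) Y, Y⁆ X →
      -c • ⁅X, b (k + 1)⁆ = qComm q ⁅X, qComm q (b k) Y⁆ X ∧
      -c • ⁅b (k + 1), Y⁆ = qComm q Y ⁅X, qComm q (b k) Y⁆ := by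
    intro k h3 h4
    have j1 := jac (qComm q X (b k))
    have j2 := jac (qComm q (b k) Y)
    rw [← lie_qComm_eq (hbh k)] at j1
    rw [KX, KY, j1, h3, h4, j2, add_comm]
    exact ⟨rfl, add_sub_cancel_left _ _⟩
  have main : ∀ k, -c • ⁅X, b (k + 1)⁆ = qComm q ⁅X, qComm q (b k) Y⁆ X ∧
      -c • ⁅b (k + 1), Y⁆ = qComm q Y ⁅X, qComm q (b k) Y⁆ := by
    intro k
    induction k with
    | zero =>
      apply red <;> rw [hb0] <;> simp [Ring.lie_def, qComm, mul_sub, sub_mul]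
    | succ k ih =>
      apply red
      · rw [(hde k).1, qs2, ← ih.2, smul_smul]
        congr 1; ring
      · rw [neg1 _ Y, (hde k).2, neg1 Y, ← lie_qComm_eq (hbh k), smul_neg, neg_neg, qs1, ← ih.1,
          smul_smul]
        module
  exact ⟨b, hb0, hb, hbh, fun k => (hde k).1, fun k => (hde k).2, fun k => (main k).1,
    fun k => (main k).2⟩

end Generating

/-! ### Intertwiners in terms of coefficients -/

section SeqIntertwiner

variable {N : Type*} [AddCommGroup N] [Module ℂ N]

/-- The equations satisfied by the coefficient sequences of the entries of an intertwiner. The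
maps `lX`, `rX`, `lY`, `rY` are the left and right multiplications by the images of the two
generators; keeping them abstract covers intertwiners with operator-valued entries as well. -/
structure IsSeqIntertwiner (q kp km : ℂ) (lX rX lY rY : N →ₗ[ℂ] N) (a b c d : ℤ → N) : Prop where
  X₁₁ : ∀ n, q • rX (a n) + km • b (n + 1) = q • lX (a n) + kp • c (n + 1)
  X₁₂ : ∀ n, kp • a (n - 1) + q⁻¹ • rX (b n) = q • lX (b n) + kp • d (n + 1)
  X₂₁ : ∀ n, q • rX (c n) + km • d (n + 1) = km • a (n - 1) + q⁻¹ • lX (c n)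
  X₂₂ : ∀ n, kp • c (n - 1) + q⁻¹ • rX (d n) = km • b (n - 1) + q⁻¹ • lX (d n)
  Y₁₁ : ∀ n, q⁻¹ • rY (a n) + km • b (n - 1) = q⁻¹ • lY (a n) + kp • c (n - 1)
  Y₁₂ : ∀ n, kp • a (n + 1) + q • rY (b n) = q⁻¹ • lY (b n) + kp • d (n - 1)
  Y₂₁ : ∀ n, q⁻¹ • rY (c n) + km • d (n - 1) = km • a (n + 1) + q • lY (c n)
  Y₂₂ : ∀ n, kp • c (n + 1) + q • rY (d n) = km • b (n + 1) + q • lY (d n)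

variable {q kp km : ℂ} {lX rX lY rY : N →ₗ[ℂ] N} {a b c d a' b' c' d' : ℤ → N}

theorem IsSeqIntertwiner.sub (h : IsSeqIntertwiner q kp km lX rX lY rY a b c d)
    (h' : IsSeqIntertwiner q kp km lX rX lY rY a' b' c' d') :
    IsSeqIntertwiner q kp km lX rX lY rY (a - a') (b - b') (c - c') (d - d') := by
  have key : ∀ {s t u v s' t' u' v' : N}, s + t = u + v → s' + t' = u' + v' →
      (s - s') + (t - t') = (u - u') + (v - v') := by
    intro s t u v s' t' u' v' h1 h2
    rw [← add_sub_add_comm, h1, h2, add_sub_add_comm]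
  constructor <;> intro n <;> simp only [Pi.sub_apply, map_sub, smul_sub]
  · exact key (h.X₁₁ n) (h'.X₁₁ n)
  · exact key (h.X₁₂ n) (h'.X₁₂ n)
  · exact key (h.X₂₁ n) (h'.X₂₁ n)
  · exact key (h.X₂₂ n) (h'.X₂₂ n)
  · exact key (h.Y₁₁ n) (h'.Y₁₁ n)
  · exact key (h.Y₁₂ n) (h'.Y₁₂ n)
  · exact key (h.Y₂₁ n) (h'.Y₂₁ n)
  · exact key (h.Y₂₂ n) (h'.Y₂₂ n)

/-- The lowest coefficient of the upper right entry commutes with the generators, and it bounds the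
orders of the other entries. -/
theorem IsSeqIntertwiner.lowest (hq : q + q⁻¹ ≠ 0) (hkp : kp ≠ 0) (hkm : km ≠ 0)
    (h : IsSeqIntertwiner q kp km lX rX lY rY a b c d) {m : ℤ}
    (ham : ∀ n < m, a n = 0) (hdm : ∀ n < m, d n = 0) {n₀ : ℤ} (hb : ∀ n < n₀, b n = 0) :
    (∀ n ≤ n₀, a n = 0 ∧ d n = 0) ∧ (∀ n < n₀, c n = 0) ∧
      lX (b n₀) = rX (b n₀) ∧ lY (b n₀) = rY (b n₀) := by
  have ad : ∀ k : ℕ, ∀ n, n < m + k → n ≤ n₀ → a n = 0 ∧ d n = 0 := by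
    intro k
    induction k with
    | zero => intro n hn _; exact ⟨ham n (by simpa using hn), hdm n (by simpa using hn)⟩
    | succ k ih =>
      intro n hn hn0
      have hb' := hb (n - 1) (by omega)
      have h1 := h.Y₁₂ (n - 1)
      have h2 := h.X₁₂ (n - 1)
      obtain ⟨e1, e2⟩ := ih (n - 1 - 1) (by push_cast at hn; omega) (by omega)
      simp only [hb', e1, e2, map_zero, smul_zero, add_zero, zero_add, sub_add_cancel] at h1 h2
      exact ⟨(smul_eq_zero_iff_right hkp).mp h1, (smul_eq_zero_iff_right hkp).mp h2.symm⟩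
  have ad' : ∀ n ≤ n₀, a n = 0 ∧ d n = 0 := by
    intro n hn
    exact ad (n - m + 1).toNat n (by omega) hn
  have hc : ∀ n ≤ n₀, kp • c n = km • b n := by
    intro n hn
    have h1 := h.X₁₁ (n - 1)
    simp only [(ad' (n - 1) (by omega)).1, map_zero, smul_zero, zero_add, sub_add_cancel] at h1
    exact h1.symm
  have hc0 := hc n₀ le_rfl
  refine ⟨ad', fun n hn => ?_, ?_, ?_⟩
  · have := hc n hn.le
    rw [hb n hn, smul_zero] at this
    exact (smul_eq_zero_iff_right hkp).mp this
  · have h1 := h.X₁₂ n₀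
    have h2 := h.X₂₁ n₀
    simp only [(ad' (n₀ - 1) (by omega)).1, smul_zero, zero_add] at h1 h2
    have hl := congrArg lX hc0
    have hr := congrArg rX hc0
    simp only [map_smul] at hl hr
    have h3 : (km * (q + q⁻¹)) • (lX (b n₀) - rX (b n₀)) = 0 := by
      linear_combination (norm := module) -km • h1 - kp • h2 + q • hr - q⁻¹ • hl
    exact sub_eq_zero.mp ((smul_eq_zero_iff_right (mul_ne_zero hkm hq)).mp h3)
  · have h1 := h.Y₁₂ n₀
    have h2 := h.Y₂₁ n₀
    simp only [(ad' (n₀ - 1) (by omega)).2, smul_zero, add_zero] at h1 h2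
    have hl := congrArg lY hc0
    have hr := congrArg rY hc0
    simp only [map_smul] at hl hr
    have h3 : (km * (q + q⁻¹)) • (lY (b n₀) - rY (b n₀)) = 0 := by
      linear_combination (norm := module) -km • h1 - kp • h2 + q⁻¹ • hr - q • hl
    exact sub_eq_zero.mp ((smul_eq_zero_iff_right (mul_ne_zero hkm hq)).mp h3)

/-- An intertwiner is determined by its upper right entry. -/
theorem IsSeqIntertwiner.eq_zero (hq : q + q⁻¹ ≠ 0) (hkp : kp ≠ 0) (hkm : km ≠ 0)
    (h : IsSeqIntertwiner q kp km lX rX lY rY a b c d) {m : ℤ}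
    (ham : ∀ n < m, a n = 0) (hdm : ∀ n < m, d n = 0) (hb : b = 0) :
    a = 0 ∧ c = 0 ∧ d = 0 := by
  have key := fun n₀ => h.lowest hq hkp hkm ham hdm (n₀ := n₀) (fun n _ => congrFun hb n)
  exact ⟨funext fun n => ((key n).1 n le_rfl).1, funext fun n => (key (n + 1)).2.1 n (by omega),
    funext fun n => ((key n).1 n le_rfl).2⟩

end SeqIntertwiner

/-! ### Currents -/

section Current

variable {S : Type*} [Ring S] [Algebra ℂ S]

/-- The coefficients of the powers of `U⁻¹`. -/
def symCoeff (q : ℂ) (k : ℕ) (n : ℤ) : ℂ := ((symVar q)⁻¹ ^ (k + 1)).coeff n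

/-- The coefficients of a current are finite sums, as `U⁻ᵏ⁻¹` has order `2 k + 2`. -/
theorem coeff_current {q : ℂ} (hq : q ≠ 0) (hq' : q + q⁻¹ ≠ 0) (X : ℕ → S) {n : ℤ} {N : ℕ}
    (hN : n < N) : (current q X).coeff n = ∑ k ∈ Finset.range N, symCoeff q k n • X k := by
  rcases lt_or_ge n 0 with hn | hn
  · rw [Finset.sum_eq_zero fun k _ => by
      rw [symCoeff, coeff_symVar_inv_pow hq hq' k (by omega), zero_smul]]
    rw [current]
    apply HahnSeries.embDomain_of_notMem_range
    rintro ⟨m, hm⟩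
    have : (m : ℤ) = n := hm
    omega
  · obtain ⟨m, rfl⟩ := Int.eq_ofNat_of_zero_le hn
    rw [current, HahnSeries.ofPowerSeries_apply_coeff, PowerSeries.coeff_mk]
    refine Finset.sum_subset (Finset.range_mono (by omega)) fun k _ hk => ?_
    rw [Finset.mem_range, not_lt] at hk
    rw [coeff_symVar_inv_pow hq hq' k (by omega), zero_smul]

theorem coeff_current_of_neg {q : ℂ} (hq : q ≠ 0) (hq' : q + q⁻¹ ≠ 0) (X : ℕ → S) {n : ℤ}
    (hn : n < 2) : (current q X).coeff n = 0 := by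
  rw [coeff_current hq hq' X (N := 2) (by omega)]
  exact Finset.sum_eq_zero fun k _ => by
    rw [symCoeff, coeff_symVar_inv_pow hq hq' k (by omega), zero_smul]

theorem map_coeff_current {q : ℂ} (hq : q ≠ 0) (hq' : q + q⁻¹ ≠ 0) {M : Type*} [Ring M]
    [Algebra ℂ M] (L : S →ₗ[ℂ] M) (X : ℕ → S) (n : ℤ) :
    L ((current q X).coeff n) = (current q fun k => L (X k)).coeff n := by
  rw [coeff_current hq hq' X (N := n.toNat + 1) (by omega),
    coeff_current hq hq' _ (N := n.toNat + 1) (by omega), map_sum]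
  simp only [map_smul]

theorem coeff_current_add {q : ℂ} (hq : q ≠ 0) (hq' : q + q⁻¹ ≠ 0) (a b : ℂ) (X Y : ℕ → S)
    (n : ℤ) :
    (current q fun k => a • X k + b • Y k).coeff n =
      a • (current q X).coeff n + b • (current q Y).coeff n := by
  rw [coeff_current hq hq' _ (N := n.toNat + 1) (by omega),
    coeff_current hq hq' X (N := n.toNat + 1) (by omega),
    coeff_current hq hq' Y (N := n.toNat + 1) (by omega), Finset.smul_sum, Finset.smul_sum,
    ← Finset.sum_add_distrib]
  refine Finset.sum_congr rfl fun k _ => ?_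
  rw [smul_add, smul_comm _ a, smul_comm _ b]

theorem symVar_ne_zero {q : ℂ} (hq : q ≠ 0) (hq' : q + q⁻¹ ≠ 0) : symVar q ≠ 0 := by
  intro h
  have hc : (symVar q).coeff (-2) ≠ 0 := by simp [symVar, hq, hq']
  rw [h] at hc
  exact hc rfl

theorem coeff_symVar_mul (q : ℂ) (f : LaurentSeries ℂ) (n : ℤ) :
    (symVar q * f).coeff n =
      q / (q + q⁻¹) * f.coeff (n - 2) + q⁻¹ / (q + q⁻¹) * f.coeff (n + 2) := by
  rw [symVar, add_mul, HahnSeries.coeff_add, HahnSeries.coeff_single_mul,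
    HahnSeries.coeff_single_mul, sub_neg_eq_add]

/-- Multiplication by `U` shifts a current. -/
theorem current_shift {q : ℂ} (hq : q ≠ 0) (hq' : q + q⁻¹ ≠ 0) (X : ℕ → S) (n : ℤ) :
    (q / (q + q⁻¹)) • (current q X).coeff (n - 2) + (q⁻¹ / (q + q⁻¹)) • (current q X).coeff (n + 2)
      = (if n = 0 then X 0 else 0) + (current q fun k => X (k + 1)).coeff n := by
  have hU := symVar_ne_zero hq hq'
  rw [coeff_current hq hq' X (N := n.toNat + 2 + 1) (n := n - 2) (by push_cast; omega),
    coeff_current hq hq' X (N := n.toNat + 2 + 1) (n := n + 2) (by push_cast; omega),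
    coeff_current hq hq' _ (N := n.toNat + 2) (by push_cast; omega), Finset.smul_sum,
    Finset.smul_sum, ← Finset.sum_add_distrib, Finset.sum_range_succ', add_comm]
  simp only [smul_smul, ← add_smul]
  congr 1
  · rw [symCoeff, symCoeff, ← coeff_symVar_mul, zero_add, pow_one, mul_inv_cancel₀ hU,
      HahnSeries.coeff_one]
    split_ifs <;> simp
  · refine Finset.sum_congr rfl fun k _ => ?_
    rw [symCoeff, symCoeff, ← coeff_symVar_mul, symCoeff, pow_succ' _ (k + 1), ← mul_assoc,
      mul_inv_cancel₀ hU, one_mul]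

/-- A current determines its modes. -/
theorem eq_zero_of_current {q : ℂ} (hq : q ≠ 0) (hq' : q + q⁻¹ ≠ 0) (X : ℕ → S)
    (h : ∀ n, (current q X).coeff n = 0) (k : ℕ) : X k = 0 := by
  induction k generalizing X with
  | zero =>
    have h1 := current_shift hq hq' X 0
    rw [h, h, coeff_current_of_neg hq hq' _ (by norm_num)] at h1
    simpa using h1.symm
  | succ k ih =>
    refine ih (fun k => X (k + 1)) fun n => ?_
    have h1 := current_shift hq hq' X n
    have h0 : X 0 = 0 := by
      have h1 := current_shift hq hq' X 0
      rw [h, h, coeff_current_of_neg hq hq' _ (by norm_num)] at h1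
      simpa using h1.symm
    rw [h, h, h0] at h1
    simpa using h1.symm

end Current

section CurrentAlgebra

variable {S : Type*} [Ring S] [Algebra ℂ S]

/-- The defining relations of `𝒜_q` in which one of the generators `W₀`, `W₁` occurs, together with
the commutativity of the `G`. -/
structure IsCurrentBase (q ρ : ℂ) (Wn Wp G Gt : ℕ → S) : Prop where
  W0_Wp : ∀ k, ⁅Wn 0, Wp k⁆ = (q + q⁻¹)⁻¹ • (Gt k - G k)
  Wn_W1 : ∀ k, ⁅Wn k, Wp 0⁆ = (q + q⁻¹)⁻¹ • (Gt k - G k)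
  W0_G : ∀ k, qComm q (Wn 0) (G k) = ρ • Wn (k + 1) - ρ • Wp k
  Gt_W0 : ∀ k, qComm q (Gt k) (Wn 0) = ρ • Wn (k + 1) - ρ • Wp k
  G_W1 : ∀ k, qComm q (G k) (Wp 0) = ρ • Wp (k + 1) - ρ • Wn k
  W1_Gt : ∀ k, qComm q (Wp 0) (Gt k) = ρ • Wp (k + 1) - ρ • Wn k
  W0_Wn : ∀ k, Commute (Wn 0) (Wn k)
  W1_Wp : ∀ k, Commute (Wp 0) (Wp k)
  G_G : ∀ k l, Commute (G k) (G l)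

variable {q kp km : ℂ} {Wn Wp G Gt : ℕ → S}

variable (q kp km) in
/-- The matrix `K(u)` built from sequences of modes. -/
def curMatrix (Wn Wp G Gt : ℕ → S) : LaurentMatrix S :=
  !![q • ((formalVar S : Laurent S) * current q Wn)
        - q⁻¹ • (((formalVar S)⁻¹ : (Laurent S)ˣ) * current q Wp),
      (km * (q + q⁻¹))⁻¹ • current q G + algebraMap ℂ _ (kp * (q + q⁻¹) / (q - q⁻¹));
     (kp * (q + q⁻¹))⁻¹ • current q Gt + algebraMap ℂ _ (km * (q + q⁻¹) / (q - q⁻¹)),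
      q • ((formalVar S : Laurent S) * current q Wp)
        - q⁻¹ • (((formalVar S)⁻¹ : (Laurent S)ˣ) * current q Wn)]

theorem coeff_formalVar_mul {R : Type*} [Ring R] (f : Laurent R) (n : ℤ) :
    ((formalVar R : Laurent R) * f).coeff n = f.coeff (n - 1) := by
  change (HahnSeries.single 1 1 * f).coeff n = _
  rw [HahnSeries.coeff_single_mul, one_mul]

theorem coeff_formalVar_inv_mul {R : Type*} [Ring R] (f : Laurent R) (n : ℤ) :
    ((((formalVar R)⁻¹ : (Laurent R)ˣ) : Laurent R) * f).coeff n = f.coeff (n + 1) := by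
  change (HahnSeries.single (-1) 1 * f).coeff n = _
  rw [HahnSeries.coeff_single_mul, one_mul, sub_neg_eq_add]

theorem coeff_algebraMap (z : ℂ) (n : ℤ) :
    (algebraMap ℂ (Laurent S) z).coeff n = z • (if n = 0 then (1 : S) else 0) := by
  have : algebraMap ℂ (Laurent S) z = HahnSeries.single 0 (algebraMap ℂ S z) := rfl
  rw [this, HahnSeries.coeff_single, Algebra.algebraMap_eq_smul_one]
  split_ifs <;> simp

/-- The defining relations of `𝒜_q` say that `K(u)` is an intertwiner. -/
theorem IsCurrentBase.isSeqIntertwiner (hq : q ≠ 0) (hq' : q + q⁻¹ ≠ 0) (hq'' : q - q⁻¹ ≠ 0)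
    (hkp : kp ≠ 0) (hkm : km ≠ 0)
    (H : IsCurrentBase q (kp * km * (q + q⁻¹) ^ 2) Wn Wp G Gt) :
    IsSeqIntertwiner q kp km (LinearMap.mulLeft ℂ (Wn 0)) (LinearMap.mulRight ℂ (Wn 0))
      (LinearMap.mulLeft ℂ (Wp 0)) (LinearMap.mulRight ℂ (Wp 0))
      (fun n => (curMatrix q kp km Wn Wp G Gt 0 0).coeff n)
      (fun n => (curMatrix q kp km Wn Wp G Gt 0 1).coeff n)
      (fun n => (curMatrix q kp km Wn Wp G Gt 1 0).coeff n)
      (fun n => (curMatrix q kp km Wn Wp G Gt 1 1).coeff n) := by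
  have bal : ∀ (y : S) (Z : ℕ → S) (n : ℤ), y * (current q Z).coeff n =
      (current q fun k => y * Z k).coeff n := fun y Z n =>
    map_coeff_current hq hq' (LinearMap.mulLeft ℂ y) Z n
  have bar : ∀ (y : S) (Z : ℕ → S) (n : ℤ), (current q Z).coeff n * y =
      (current q fun k => Z k * y).coeff n := fun y Z n =>
    map_coeff_current hq hq' (LinearMap.mulRight ℂ y) Z n
  have lin : ∀ (t s t' s' : ℂ) (V V' Z Z' : ℕ → S), (∀ k, t • V k + s • V' k = t' • Z k + s' • Z' k)
      → ∀ n, t • (current q V).coeff n + s • (current q V').coeff n =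
        t' • (current q Z).coeff n + s' • (current q Z').coeff n := by
    intro t s t' s' V V' Z Z' h n
    rw [← coeff_current_add hq hq', ← coeff_current_add hq hq']
    simp only [h]
  have r1 : ∀ n, Wn 0 * (current q Wn).coeff n = (current q Wn).coeff n * Wn 0 := by
    intro n; rw [bal, bar]; simp only [(H.W0_Wn _).eq]
  have r2 : ∀ n, Wp 0 * (current q Wp).coeff n = (current q Wp).coeff n * Wp 0 := by
    intro n; rw [bal, bar]; simp only [(H.W1_Wp _).eq]
  have r3 : ∀ n, Wn 0 * (current q Wp).coeff n - (current q Wp).coeff n * Wn 0 =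
      (q + q⁻¹)⁻¹ • ((current q Gt).coeff n - (current q G).coeff n) := by
    intro n
    have := lin 1 (-1) ((q + q⁻¹)⁻¹) (-(q + q⁻¹)⁻¹) (fun k => Wn 0 * Wp k) (fun k => Wp k * Wn 0)
      Gt G (fun k => by
        have := H.W0_Wp k
        rw [Ring.lie_def] at this
        linear_combination (norm := module) this) n
    rw [bal, bar]
    linear_combination (norm := module) this
  have r4 : ∀ n, (current q Wn).coeff n * Wp 0 - Wp 0 * (current q Wn).coeff n =
      (q + q⁻¹)⁻¹ • ((current q Gt).coeff n - (current q G).coeff n) := by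
    intro n
    have := lin 1 (-1) ((q + q⁻¹)⁻¹) (-(q + q⁻¹)⁻¹) (fun k => Wn k * Wp 0) (fun k => Wp 0 * Wn k)
      Gt G (fun k => by
        have := H.Wn_W1 k
        rw [Ring.lie_def] at this
        linear_combination (norm := module) this) n
    rw [bal, bar]
    linear_combination (norm := module) this
  have sn := fun n => current_shift hq hq' Wn n
  have sp := fun n => current_shift hq hq' Wp n
  have r5 : ∀ n, q • (Wn 0 * (current q G).coeff n) - q⁻¹ • ((current q G).coeff n * Wn 0) =
      (kp * km * (q + q⁻¹) ^ 2) • (current q fun k => Wn (k + 1)).coeff n -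
        (kp * km * (q + q⁻¹) ^ 2) • (current q Wp).coeff n := by
    intro n
    have := lin q (-q⁻¹) (kp * km * (q + q⁻¹) ^ 2) (-(kp * km * (q + q⁻¹) ^ 2))
      (fun k => Wn 0 * G k) (fun k => G k * Wn 0) (fun k => Wn (k + 1)) Wp (fun k => by
        have := H.W0_G k
        rw [qComm] at this
        linear_combination (norm := module) this) n
    rw [bal, bar]
    linear_combination (norm := module) this
  have r6 : ∀ n, q • ((current q Gt).coeff n * Wn 0) - q⁻¹ • (Wn 0 * (current q Gt).coeff n) =
      (kp * km * (q + q⁻¹) ^ 2) • (current q fun k => Wn (k + 1)).coeff n -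
        (kp * km * (q + q⁻¹) ^ 2) • (current q Wp).coeff n := by
    intro n
    have := lin q (-q⁻¹) (kp * km * (q + q⁻¹) ^ 2) (-(kp * km * (q + q⁻¹) ^ 2))
      (fun k => Gt k * Wn 0) (fun k => Wn 0 * Gt k) (fun k => Wn (k + 1)) Wp (fun k => by
        have := H.Gt_W0 k
        rw [qComm] at this
        linear_combination (norm := module) this) n
    rw [bal, bar]
    linear_combination (norm := module) this
  have r7 : ∀ n, q • ((current q G).coeff n * Wp 0) - q⁻¹ • (Wp 0 * (current q G).coeff n) =
      (kp * km * (q + q⁻¹) ^ 2) • (current q fun k => Wp (k + 1)).coeff n -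
        (kp * km * (q + q⁻¹) ^ 2) • (current q Wn).coeff n := by
    intro n
    have := lin q (-q⁻¹) (kp * km * (q + q⁻¹) ^ 2) (-(kp * km * (q + q⁻¹) ^ 2))
      (fun k => G k * Wp 0) (fun k => Wp 0 * G k) (fun k => Wp (k + 1)) Wn (fun k => by
        have := H.G_W1 k
        rw [qComm] at this
        linear_combination (norm := module) this) n
    rw [bal, bar]
    linear_combination (norm := module) this
  have r8 : ∀ n, q • (Wp 0 * (current q Gt).coeff n) - q⁻¹ • ((current q Gt).coeff n * Wp 0) =
      (kp * km * (q + q⁻¹) ^ 2) • (current q fun k => Wp (k + 1)).coeff n -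
        (kp * km * (q + q⁻¹) ^ 2) • (current q Wn).coeff n := by
    intro n
    have := lin q (-q⁻¹) (kp * km * (q + q⁻¹) ^ 2) (-(kp * km * (q + q⁻¹) ^ 2))
      (fun k => Wp 0 * Gt k) (fun k => Gt k * Wp 0) (fun k => Wp (k + 1)) Wn (fun k => by
        have := H.W1_Gt k
        rw [qComm] at this
        linear_combination (norm := module) this) n
    rw [bal, bar]
    linear_combination (norm := module) this
  have ca : ∀ n, (curMatrix q kp km Wn Wp G Gt 0 0).coeff n =
      q • (current q Wn).coeff (n - 1) - q⁻¹ • (current q Wp).coeff (n + 1) := by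
    intro n
    simp [curMatrix, coeff_formalVar_mul, coeff_formalVar_inv_mul]
  have cd : ∀ n, (curMatrix q kp km Wn Wp G Gt 1 1).coeff n =
      q • (current q Wp).coeff (n - 1) - q⁻¹ • (current q Wn).coeff (n + 1) := by
    intro n
    simp [curMatrix, coeff_formalVar_mul, coeff_formalVar_inv_mul]
  have cb : ∀ n, (curMatrix q kp km Wn Wp G Gt 0 1).coeff n =
      (km * (q + q⁻¹))⁻¹ • (current q G).coeff n +
        (kp * (q + q⁻¹) / (q - q⁻¹)) • (if n = 0 then 1 else 0) := by
    intro n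
    rw [← coeff_algebraMap]
    rfl
  have cc : ∀ n, (curMatrix q kp km Wn Wp G Gt 1 0).coeff n =
      (kp * (q + q⁻¹))⁻¹ • (current q Gt).coeff n +
        (km * (q + q⁻¹) / (q - q⁻¹)) • (if n = 0 then 1 else 0) := by
    intro n
    rw [← coeff_algebraMap]
    rfl
  have e1 : ∀ n : ℤ, n + 1 + 1 = n + 2 := fun n => by ring
  have e2 : ∀ n : ℤ, n - 1 - 1 = n - 2 := fun n => by ring
  have h2 : q ^ 2 + 1 ≠ 0 := by
    intro h; apply hq'; field_simp; linear_combination h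
  have h3 : q ^ 2 - 1 ≠ 0 := by
    intro h; apply hq''; field_simp; linear_combination h
  constructor <;> intro n <;>
    simp only [LinearMap.mulLeft_apply, LinearMap.mulRight_apply, ca, cb, cc, cd, mul_add, add_mul,
      mul_sub, sub_mul, mul_smul_comm, smul_mul_assoc, add_sub_cancel_right, sub_add_cancel, e1, e2,
      mul_ite, ite_mul, mul_one, one_mul, mul_zero, zero_mul]
  · linear_combination (norm := (match_scalars <;> field_simp <;> ring))
      (-q ^ 2) • r1 (n - 1) + r3 (n + 1)
  · have := sn n
    split_ifs at this ⊢ <;>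
    linear_combination (norm := (match_scalars <;> field_simp <;> ring))
      (-(km * (q + q⁻¹))⁻¹) • r5 n + (kp * (q + q⁻¹)) • this
  · have := sn n
    split_ifs at this ⊢ <;>
    linear_combination (norm := (match_scalars <;> field_simp <;> ring))
      (kp * (q + q⁻¹))⁻¹ • r6 n - (km * (q + q⁻¹)) • this
  · linear_combination (norm := (match_scalars <;> field_simp <;> ring))
      (q⁻¹ ^ 2) • r1 (n + 1) - r3 (n - 1)
  · linear_combination (norm := (match_scalars <;> field_simp <;> ring))
      (q⁻¹ ^ 2) • r2 (n + 1) + r4 (n - 1)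
  · have := sp n
    split_ifs at this ⊢ <;>
    linear_combination (norm := (match_scalars <;> field_simp <;> ring))
      (km * (q + q⁻¹))⁻¹ • r7 n - (kp * (q + q⁻¹)) • this
  · have := sp n
    split_ifs at this ⊢ <;>
    linear_combination (norm := (match_scalars <;> field_simp <;> ring))
      (-(kp * (q + q⁻¹))⁻¹) • r8 n + (km * (q + q⁻¹)) • this
  · linear_combination (norm := (match_scalars <;> field_simp <;> ring))
      (-q ^ 2) • r2 (n - 1) - r4 (n + 1)

end CurrentAlgebra

/-! ### The action on `𝒱_u ⊗ W` -/

section SiteMatrices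

variable {S : Type*} [Ring S] [Algebra ℂ S]

/-- The matrix of the first generator acting on `𝒱_u ⊗ W`, when it acts on `W` as `X`. -/
def siteX (q kp km : ℂ) (u : Sˣ) (X : S) : Matrix (Fin 2) (Fin 2) S :=
  !![q • X, kp • (u : S); km • ((u⁻¹ : Sˣ) : S), q⁻¹ • X]

/-- The matrix of the second generator acting on `𝒱_u ⊗ W`, when it acts on `W` as `Y`. -/
def siteY (q kp km : ℂ) (u : Sˣ) (Y : S) : Matrix (Fin 2) (Fin 2) S :=
  !![q⁻¹ • Y, kp • ((u⁻¹ : Sˣ) : S); km • (u : S), q • Y]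

namespace Params

variable (p : Params)

theorem s_mul_s : p.s * p.s = p.q := by rw [← p.s_sq, pow_two]

theorem tensorAction_A (u : Sˣ) (ψ : QOnsager p.q p.rho →ₐ[ℂ] S)
    (hψ : ∀ t, Commute (u : S) (ψ t)) :
    p.tensorAction u ψ hψ (QOnsager.A p.q p.rho) =
      siteX p.q p.kp p.km u (ψ (QOnsager.A p.q p.rho)) := by
  have hs := p.s_ne_zero
  rw [tensorAction, AlgHom.comp_apply, coaction_A, coactA, map_add,
    Algebra.TensorProduct.lift_tmul, Algebra.TensorProduct.lift_tmul]
  simp only [map_add, map_mul, map_smul, evalRep_gen, map_one, mul_one, AlgHom.comp_apply]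
  change _ + _ * Matrix.scalar (Fin 2) (ψ (QOnsager.A p.q p.rho)) = _
  ext i j
  fin_cases i <;> fin_cases j <;>
    simp [evalGen, siteX, Algebra.algebraMap_eq_smul_one, smul_smul, hs, s_mul_s, ← mul_inv]

theorem tensorAction_Astar (u : Sˣ) (ψ : QOnsager p.q p.rho →ₐ[ℂ] S)
    (hψ : ∀ t, Commute (u : S) (ψ t)) :
    p.tensorAction u ψ hψ (QOnsager.Astar p.q p.rho) =
      siteY p.q p.kp p.km u (ψ (QOnsager.Astar p.q p.rho)) := by
  have hs := p.s_ne_zero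
  rw [tensorAction, AlgHom.comp_apply, coaction_Astar, coactAstar, map_add,
    Algebra.TensorProduct.lift_tmul, Algebra.TensorProduct.lift_tmul]
  simp only [map_add, map_mul, map_smul, evalRep_gen, map_one, mul_one, AlgHom.comp_apply]
  change _ + _ * Matrix.scalar (Fin 2) (ψ (QOnsager.Astar p.q p.rho)) = _
  ext i j
  fin_cases i <;> fin_cases j <;>
    simp [evalGen, siteY, Algebra.algebraMap_eq_smul_one, smul_smul, hs, s_mul_s, ← mul_inv]

end Params

/-- A property of elements of the `q`-Onsager algebra may be checked on the generators. -/
theorem QOnsager.induction {q ρ : ℂ} {P : QOnsager q ρ → Prop} (hA : P (QOnsager.A q ρ))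
    (hAstar : P (QOnsager.Astar q ρ)) (halg : ∀ r : ℂ, P (algebraMap ℂ _ r))
    (hadd : ∀ x y, P x → P y → P (x + y)) (hmul : ∀ x y, P x → P y → P (x * y))
    (t : QOnsager q ρ) : P t := by
  obtain ⟨x, rfl⟩ := RingQuot.mkAlgHom_surjective ℂ (OnsRel q ρ) t
  induction x using FreeAlgebra.induction with
  | grade0 r => rw [AlgHom.commutes]; exact halg r
  | grade1 g => cases g with
    | A => exact hA
    | Astar => exact hAstar
  | mul a b ha hb => rw [map_mul]; exact hmul _ _ ha hb
  | add a b ha hb => rw [map_add]; exact hadd _ _ ha hb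

/-- Two representations of the `q`-Onsager algebra are intertwined by an element as soon as this
holds for the generators. -/
theorem QOnsager.intertwines {q ρ : ℂ} {R : Type*} [Ring R] [Algebra ℂ R]
    {f g : QOnsager q ρ →ₐ[ℂ] R} {K : R} (hA : K * f (QOnsager.A q ρ) = g (QOnsager.A q ρ) * K)
    (hAstar : K * f (QOnsager.Astar q ρ) = g (QOnsager.Astar q ρ) * K) (t : QOnsager q ρ) :
    K * f t = g t * K := by
  induction t using QOnsager.induction with
  | hA => exact hA
  | hAstar => exact hAstar
  | halg r => rw [AlgHom.commutes, AlgHom.commutes, Algebra.commutes]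
  | hadd x y hx hy => rw [map_add, map_add, mul_add, add_mul, hx, hy]
  | hmul x y hx hy => rw [map_mul, map_mul, ← mul_assoc, hx, mul_assoc, hy, mul_assoc]

theorem coeff_mul_formalVar {R : Type*} [Ring R] (f : Laurent R) (n : ℤ) :
    (f * (formalVar R : Laurent R)).coeff n = f.coeff (n - 1) := by
  change (f * HahnSeries.single 1 1).coeff n = _
  rw [← sub_add_cancel n 1, HahnSeries.coeff_mul_single_add, mul_one, add_sub_cancel_right]

theorem coeff_mul_formalVar_inv {R : Type*} [Ring R] (f : Laurent R) (n : ℤ) :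
    (f * (((formalVar R)⁻¹ : (Laurent R)ˣ) : Laurent R)).coeff n = f.coeff (n + 1) := by
  change (f * HahnSeries.single (-1) 1).coeff n = _
  conv_lhs => rw [← add_neg_cancel_right n 1]
  rw [HahnSeries.coeff_mul_single_add, mul_one]

variable {q kp km : ℂ}

/-- Matrices with entries in `S((u))` that intertwine the actions on `𝒱_u ⊗ W` and `𝒱_{u⁻¹} ⊗ W`,
in terms of the coefficients of their entries. -/
theorem isSeqIntertwiner_iff {X Y : S} {K : LaurentMatrix S} :
    IsSeqIntertwiner q kp km (LinearMap.mulLeft ℂ X) (LinearMap.mulRight ℂ X)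
        (LinearMap.mulLeft ℂ Y) (LinearMap.mulRight ℂ Y) (fun n => (K 0 0).coeff n)
        (fun n => (K 0 1).coeff n) (fun n => (K 1 0).coeff n) (fun n => (K 1 1).coeff n) ↔
      K * siteX q kp km (formalVar S) (HahnSeries.C X) =
          siteX q kp km (formalVar S)⁻¹ (HahnSeries.C X) * K ∧
        K * siteY q kp km (formalVar S) (HahnSeries.C Y) =
          siteY q kp km (formalVar S)⁻¹ (HahnSeries.C Y) * K := by
  have cl : ∀ (Z : S) (f : Laurent S) n, (HahnSeries.C Z * f).coeff n = Z * f.coeff n := by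
    intro Z f n
    rw [HahnSeries.C_apply, HahnSeries.coeff_single_mul, sub_zero]
  have cr : ∀ (Z : S) (f : Laurent S) n, (f * HahnSeries.C Z).coeff n = f.coeff n * Z := by
    intro Z f n
    rw [HahnSeries.C_apply]
    conv_lhs => rw [← add_zero n]
    rw [HahnSeries.coeff_mul_single_add]
  constructor
  · intro h
    constructor <;> ext i j n <;> fin_cases i <;> fin_cases j <;>
      simp [siteX, siteY, Matrix.mul_apply, coeff_mul_formalVar, coeff_mul_formalVar_inv,
        coeff_formalVar_mul, coeff_formalVar_inv_mul]
    · exact h.X₁₁ n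
    · exact h.X₁₂ n
    · exact h.X₂₁ n
    · exact h.X₂₂ n
    · exact h.Y₁₁ n
    · exact h.Y₁₂ n
    · exact h.Y₂₁ n
    · exact h.Y₂₂ n
  · rintro ⟨hX, hY⟩
    have eX : ∀ i j n, _ := fun i j n => congrArg (fun M : LaurentMatrix S => (M i j).coeff n) hX
    have eY : ∀ i j n, _ := fun i j n => congrArg (fun M : LaurentMatrix S => (M i j).coeff n) hY
    constructor <;> intro n
    · simpa [siteX, siteY, Matrix.mul_apply, cl, cr, coeff_mul_formalVar, coeff_mul_formalVar_inv,
        coeff_formalVar_mul, coeff_formalVar_inv_mul] using eX 0 0 n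
    · simpa [siteX, siteY, Matrix.mul_apply, cl, cr, coeff_mul_formalVar, coeff_mul_formalVar_inv,
        coeff_formalVar_mul, coeff_formalVar_inv_mul] using eX 0 1 n
    · simpa [siteX, siteY, Matrix.mul_apply, cl, cr, coeff_mul_formalVar, coeff_mul_formalVar_inv,
        coeff_formalVar_mul, coeff_formalVar_inv_mul] using eX 1 0 n
    · simpa [siteX, siteY, Matrix.mul_apply, cl, cr, coeff_mul_formalVar, coeff_mul_formalVar_inv,
        coeff_formalVar_mul, coeff_formalVar_inv_mul] using eX 1 1 n
    · simpa [siteX, siteY, Matrix.mul_apply, cl, cr, coeff_mul_formalVar, coeff_mul_formalVar_inv,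
        coeff_formalVar_mul, coeff_formalVar_inv_mul] using eY 0 0 n
    · simpa [siteX, siteY, Matrix.mul_apply, cl, cr, coeff_mul_formalVar, coeff_mul_formalVar_inv,
        coeff_formalVar_mul, coeff_formalVar_inv_mul] using eY 0 1 n
    · simpa [siteX, siteY, Matrix.mul_apply, cl, cr, coeff_mul_formalVar, coeff_mul_formalVar_inv,
        coeff_formalVar_mul, coeff_formalVar_inv_mul] using eY 1 0 n
    · simpa [siteX, siteY, Matrix.mul_apply, cl, cr, coeff_mul_formalVar, coeff_mul_formalVar_inv,
        coeff_formalVar_mul, coeff_formalVar_inv_mul] using eY 1 1 n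

/-- It suffices to intertwine the two generators of the `q`-Onsager algebra. -/
theorem Params.isIntertwiner_iff (p : Params) (φ : QOnsager p.q p.rho →ₐ[ℂ] S)
    (K : LaurentMatrix S) :
    p.IsIntertwiner φ K ↔
      K * siteX p.q p.kp p.km (formalVar S) (HahnSeries.C (φ (QOnsager.A p.q p.rho))) =
          siteX p.q p.kp p.km (formalVar S)⁻¹ (HahnSeries.C (φ (QOnsager.A p.q p.rho))) * K ∧
        K * siteY p.q p.kp p.km (formalVar S) (HahnSeries.C (φ (QOnsager.Astar p.q p.rho))) =
          siteY p.q p.kp p.km (formalVar S)⁻¹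
            (HahnSeries.C (φ (QOnsager.Astar p.q p.rho))) * K := by
  have h1 := p.tensorAction_A (formalVar S) ((constHom S).comp φ)
    fun t => formalVar_commute_C (φ t)
  have h2 := p.tensorAction_A (formalVar S)⁻¹ ((constHom S).comp φ)
    fun t => (formalVar_commute_C (φ t)).units_inv_left
  have h3 := p.tensorAction_Astar (formalVar S) ((constHom S).comp φ)
    fun t => formalVar_commute_C (φ t)
  have h4 := p.tensorAction_Astar (formalVar S)⁻¹ ((constHom S).comp φ)
    fun t => (formalVar_commute_C (φ t)).units_inv_left
  constructor
  · intro h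
    have hA := h (QOnsager.A p.q p.rho)
    have hAs := h (QOnsager.Astar p.q p.rho)
    rw [Params.actU, Params.actUInv] at hA hAs
    rw [h1, h2] at hA
    rw [h3, h4] at hAs
    exact ⟨hA, hAs⟩
  · rintro ⟨hA, hAs⟩ t
    refine QOnsager.intertwines ?_ ?_ t
    · rw [Params.actU, Params.actUInv, h1, h2]; exact hA
    · rw [Params.actU, Params.actUInv, h3, h4]; exact hAs

theorem Params.KMatrix_eq (p : Params) (Φ : Aq p.q p.rho →ₐ[ℂ] S) :
    p.KMatrix Φ = curMatrix p.q p.kp p.km (fun k => Φ (Aq.gen p.q p.rho (CurGen.Wneg k)))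
      (fun k => Φ (Aq.gen p.q p.rho (CurGen.Wpos k))) (fun k => Φ (Aq.gen p.q p.rho (CurGen.G k)))
      (fun k => Φ (Aq.gen p.q p.rho (CurGen.Gt k))) :=
  rfl

end SiteMatrices

/-! ### Two sites -/

section TwoSites

section Kronecker

variable {T : Type*} [Ring T]

theorem one_kronecker_mul {D K M : Matrix (Fin 2) (Fin 2) T}
    (hD : ∀ i j t, Commute (D i j) t) :
    ((1 : Matrix (Fin 2) (Fin 2) T) ⊗ₖ K) * (D ⊗ₖ M) = D ⊗ₖ (K * M) := by
  ext ⟨i, j⟩ ⟨k, l⟩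
  simp only [Matrix.mul_apply, Matrix.kroneckerMap_apply, Fintype.sum_prod_type, Matrix.one_apply,
    ite_mul, one_mul, zero_mul, Finset.mul_sum]
  rw [Finset.sum_eq_single i (fun b _ hb => by simp [hb.symm]) (by simp)]
  refine Finset.sum_congr rfl fun m _ => ?_
  rw [if_pos rfl, ← mul_assoc, ← mul_assoc, (hD i k _).eq]

theorem kronecker_mul_one_kronecker {D K M : Matrix (Fin 2) (Fin 2) T} :
    (D ⊗ₖ M) * ((1 : Matrix (Fin 2) (Fin 2) T) ⊗ₖ K) = D ⊗ₖ (M * K) := by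
  ext ⟨i, j⟩ ⟨k, l⟩
  simp only [Matrix.mul_apply, Matrix.kroneckerMap_apply, Fintype.sum_prod_type, Matrix.one_apply,
    ite_mul, one_mul, zero_mul, Finset.mul_sum]
  rw [Finset.sum_eq_single k (fun b _ hb => by simp [hb]) (by simp)]
  refine Finset.sum_congr rfl fun m _ => ?_
  rw [if_pos rfl, mul_assoc]

theorem kronecker_one_mul {D K M : Matrix (Fin 2) (Fin 2) T} :
    (K ⊗ₖ (1 : Matrix (Fin 2) (Fin 2) T)) * (M ⊗ₖ D) = (K * M) ⊗ₖ D := by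
  ext ⟨i, j⟩ ⟨k, l⟩
  simp only [Matrix.mul_apply, Matrix.kroneckerMap_apply, Fintype.sum_prod_type, Matrix.one_apply,
    mul_ite, mul_one, mul_zero, Finset.sum_mul]
  refine Finset.sum_congr rfl fun m _ => ?_
  rw [Finset.sum_eq_single j (fun b _ hb => by simp [hb.symm]) (by simp), if_pos rfl, mul_assoc]

theorem kronecker_mul_kronecker_one {D K M : Matrix (Fin 2) (Fin 2) T}
    (hD : ∀ i j t, Commute (D i j) t) :
    (M ⊗ₖ D) * (K ⊗ₖ (1 : Matrix (Fin 2) (Fin 2) T)) = (M * K) ⊗ₖ D := by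
  ext ⟨i, j⟩ ⟨k, l⟩
  simp only [Matrix.mul_apply, Matrix.kroneckerMap_apply, Fintype.sum_prod_type, Matrix.one_apply,
    mul_ite, mul_one, mul_zero, Finset.sum_mul]
  refine Finset.sum_congr rfl fun m _ => ?_
  rw [Finset.sum_eq_single l (fun b _ hb => by simp [hb]) (by simp), if_pos rfl, mul_assoc,
    (hD j l _).eq, mul_assoc]

end Kronecker

variable {T : Type*} [Ring T] [Algebra ℂ T]

/-- The matrix of the first generator on `𝒱_x ⊗ (𝒱_y ⊗ W)`; `M` is its matrix on `𝒱_y ⊗ W`. -/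
def outerX (q kp km : ℂ) (x : Tˣ) (M : Matrix (Fin 2) (Fin 2) T) :
    Matrix (Fin 2 × Fin 2) (Fin 2 × Fin 2) T :=
  siteX q 0 0 1 1 ⊗ₖ M + siteX q kp km x 0 ⊗ₖ 1

/-- The matrix of the first generator on `𝒱_y ⊗ (𝒱_x ⊗ W)`, with the two factors `ℂ²` exchanged. -/
def outerX' (q kp km : ℂ) (y : Tˣ) (M : Matrix (Fin 2) (Fin 2) T) :
    Matrix (Fin 2 × Fin 2) (Fin 2 × Fin 2) T :=
  M ⊗ₖ siteX q 0 0 1 1 + 1 ⊗ₖ siteX q kp km y 0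

set_option maxHeartbeats 1000000 in
/-- The `R`-matrix exchanges the two factors `ℂ²`. -/
theorem RMatrix_mul_outerX {q kp km : ℂ} (hq : q ≠ 0) (x y : Tˣ) (X : T)
    (hx : ∀ t, Commute (x : T) t) (hy : ∀ t, Commute (y : T) t) :
    RMatrix q (x * y⁻¹) * outerX q kp km x (siteX q kp km y X) =
      outerX' q kp km y (siteX q kp km x X) * RMatrix q (x * y⁻¹) := by
  have hX : X * x = x * X := ((hx X).symm).eq
  have hX' : X * ((x⁻¹ : Tˣ) : T) = ((x⁻¹ : Tˣ) : T) * X := ((hx X).units_inv_left.symm).eq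
  have hY : X * y = y * X := ((hy X).symm).eq
  have hY' : X * ((y⁻¹ : Tˣ) : T) = ((y⁻¹ : Tˣ) : T) * X := ((hy X).units_inv_left.symm).eq
  have h1 : (y : T) * x = x * y := (hy x).eq
  have h2 : (y : T) * ((x⁻¹ : Tˣ) : T) = ((x⁻¹ : Tˣ) : T) * y := (hy _).eq
  have h3 : ((y⁻¹ : Tˣ) : T) * x = x * ((y⁻¹ : Tˣ) : T) := (hx _).symm.eq
  have h4 : ((y⁻¹ : Tˣ) : T) * ((x⁻¹ : Tˣ) : T) = ((x⁻¹ : Tˣ) : T) * ((y⁻¹ : Tˣ) : T) :=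
    (hy _).units_inv_left.eq
  have ext : ∀ {x y z : T}, x * y = z → ∀ w, x * (y * w) = z * w := by
    intro x y z h w; rw [← mul_assoc, h]
  ext ⟨i, j⟩ ⟨k, l⟩
  fin_cases i <;> fin_cases j <;> fin_cases k <;> fin_cases l <;>
    simp [RMatrix, outerX, outerX', siteX, Matrix.mul_apply, Fintype.sum_prod_type,
      finProdFinEquiv, Algebra.algebraMap_eq_smul_one, mul_sub, sub_mul, mul_add, add_mul,
      smul_smul, mul_assoc, hY, hY', h1, h2, h3, h4, ext hX, ext hX', ext h1,
      ext h2, ext h3, ext h4] <;>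
  match_scalars <;> field_simp <;> ring

theorem RMatrix_swap (q : ℂ) (z : Tˣ) :
    (RMatrix q z).submatrix (Equiv.prodComm (Fin 2) (Fin 2)) (Equiv.prodComm (Fin 2) (Fin 2)) =
      RMatrix q z := by
  ext ⟨i, j⟩ ⟨k, l⟩
  fin_cases i <;> fin_cases j <;> fin_cases k <;> fin_cases l <;> rfl

theorem outerX_swap (q kp km : ℂ) (x : Tˣ) {M : Matrix (Fin 2) (Fin 2) T} :
    (outerX q kp km x M).submatrix (Equiv.prodComm (Fin 2) (Fin 2)) (Equiv.prodComm (Fin 2) (Fin 2))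
      = outerX' q kp km x M := by
  ext ⟨i, j⟩ ⟨k, l⟩
  fin_cases i <;> fin_cases j <;> fin_cases k <;> fin_cases l <;> simp [outerX, outerX', siteX]

theorem RMatrix_mul_outerX' {q kp km : ℂ} (hq : q ≠ 0) (x y : Tˣ) (X : T)
    (hx : ∀ t, Commute (x : T) t) (hy : ∀ t, Commute (y : T) t) :
    RMatrix q (y * x⁻¹) * outerX' q kp km y (siteX q kp km x X) =
      outerX q kp km x (siteX q kp km y X) * RMatrix q (y * x⁻¹) := by
  have h := congrArg (fun M => Matrix.submatrix M (Equiv.prodComm (Fin 2) (Fin 2))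
    (Equiv.prodComm (Fin 2) (Fin 2))) (RMatrix_mul_outerX (kp := kp) (km := km) hq y x X hy hx)
  simp only [← Matrix.submatrix_mul_equiv _ _ _ (Equiv.prodComm (Fin 2) (Fin 2)) _, RMatrix_swap,
    outerX_swap] at h
  rw [h, ← outerX_swap]
  rfl

/-- The second generator acts as the first one with `q` and `u` inverted, so that statements about
the first generator apply to both. -/
theorem siteY_eq (q kp km : ℂ) (u : Tˣ) (Y : T) : siteY q kp km u Y = siteX q⁻¹ kp km u⁻¹ Y := by
  simp [siteX, siteY]

theorem RMatrix_inv (q : ℂ) (z : Tˣ) : RMatrix q⁻¹ z⁻¹ = -RMatrix q z := by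
  ext ⟨i, j⟩ ⟨k, l⟩
  fin_cases i <;> fin_cases j <;> fin_cases k <;> fin_cases l <;>
    simp [RMatrix, finProdFinEquiv]

/-- The two sides of the reflection equation intertwine the same pair of actions. -/
theorem reflection_intertwines {q kp km : ℂ} (hq : q ≠ 0) (u v : Tˣ) (X : T)
    (hu : ∀ t, Commute (u : T) t) (hv : ∀ t, Commute (v : T) t) {Ku Kv : Matrix (Fin 2) (Fin 2) T}
    (hKu : Ku * siteX q kp km u X = siteX q kp km u⁻¹ X * Ku)
    (hKv : Kv * siteX q kp km v X = siteX q kp km v⁻¹ X * Kv)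
    (Z : Matrix (Fin 2 × Fin 2) (Fin 2 × Fin 2) T)
    (hZ : Z = RMatrix q (u * v⁻¹) * (Ku ⊗ₖ 1) * RMatrix q (u * v) * (1 ⊗ₖ Kv) -
      (1 ⊗ₖ Kv) * RMatrix q (u * v) * (Ku ⊗ₖ 1) * RMatrix q (u * v⁻¹)) :
    Z * outerX q kp km u (siteX q kp km v X) =
      outerX q kp km u⁻¹ (siteX q kp km v⁻¹ X) * Z := by
  have hu' : ∀ t, Commute ((u⁻¹ : Tˣ) : T) t := fun t => (hu t).units_inv_left
  have hv' : ∀ t, Commute ((v⁻¹ : Tˣ) : T) t := fun t => (hv t).units_inv_left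
  have c1 : ∀ (x : Tˣ), (∀ t, Commute (x : T) t) → ∀ i j t, Commute (siteX q kp km x 0 i j) t := by
    intro x hx i j t
    fin_cases i <;> fin_cases j <;> simp [siteX]
    · exact (hx t).smul_left kp
    · exact (hx t).units_inv_left.smul_left km
  have c0 : ∀ i j t, Commute (siteX q 0 0 (1 : Tˣ) (1 : T) i j) t := by
    intro i j t
    fin_cases i <;> fin_cases j <;> simp [siteX]
    · exact (Commute.one_left t).smul_left q
    · exact (Commute.one_left t).smul_left q⁻¹
  have c2 : ∀ (i j : Fin 2) t, Commute ((1 : Matrix (Fin 2) (Fin 2) T) i j) t := by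
    intro i j t
    rw [Matrix.one_apply]
    split_ifs
    · exact Commute.one_left t
    · exact Commute.zero_left t
  -- `I ⊗ K(v)` and `K(u) ⊗ I` act next to `W` in their respective orderings of the factors
  have kv : ∀ x : Tˣ, (∀ t, Commute (x : T) t) →
      (1 ⊗ₖ Kv) * outerX q kp km x (siteX q kp km v X) =
        outerX q kp km x (siteX q kp km v⁻¹ X) * (1 ⊗ₖ Kv) := by
    intro x hx
    rw [outerX, outerX, mul_add, add_mul, one_kronecker_mul c0, one_kronecker_mul (c1 x hx),
      kronecker_mul_one_kronecker, kronecker_mul_one_kronecker, hKv, mul_one, one_mul]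
  have ku : ∀ y : Tˣ, (∀ t, Commute (y : T) t) →
      (Ku ⊗ₖ 1) * outerX' q kp km y (siteX q kp km u X) =
        outerX' q kp km y (siteX q kp km u⁻¹ X) * (Ku ⊗ₖ 1) := by
    intro y hy
    rw [outerX', outerX', mul_add, add_mul, kronecker_one_mul, kronecker_one_mul,
      kronecker_mul_kronecker_one c0, kronecker_mul_kronecker_one (c1 y hy), hKu, mul_one, one_mul]
  have e1 : (v⁻¹ : Tˣ) * (u⁻¹)⁻¹ = u * v⁻¹ := by
    ext; simpa using (hu _).symm.eq
  have e2 : (v : Tˣ) * (u⁻¹)⁻¹ = u * v := by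
    ext; simpa using (hu _).symm.eq
  have r1 := RMatrix_mul_outerX (kp := kp) (km := km) hq u v⁻¹ X hu hv'
  have r2 := RMatrix_mul_outerX' (kp := kp) (km := km) hq u⁻¹ v⁻¹ X hu' hv'
  have r3 := RMatrix_mul_outerX (kp := kp) (km := km) hq u v X hu hv
  have r4 := RMatrix_mul_outerX' (kp := kp) (km := km) hq u⁻¹ v X hu' hv
  rw [inv_inv] at r1
  rw [e1] at r2
  rw [e2] at r4
  rw [hZ, sub_mul, mul_sub]
  congr 1
  · rw [mul_assoc, kv u hu, ← mul_assoc, mul_assoc _ (RMatrix q (u * v)), r1, ← mul_assoc,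
      mul_assoc _ (Ku ⊗ₖ 1), ku v⁻¹ hv', ← mul_assoc, r2]
    simp only [mul_assoc]
  · rw [mul_assoc, r3, ← mul_assoc, mul_assoc _ (Ku ⊗ₖ 1), ku v hv, ← mul_assoc,
      mul_assoc _ (RMatrix q (u * v)), r4, ← mul_assoc, kv u⁻¹ hu']
    simp only [mul_assoc]

end TwoSites

/-! ### The reflection equation from the uniqueness of intertwiners -/

theorem coeff_C_mul {R : Type*} [Ring R] (Z : R) (f : Laurent R) (n : ℤ) :
    (HahnSeries.C Z * f).coeff n = Z * f.coeff n := by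
  rw [HahnSeries.C_apply, HahnSeries.coeff_single_mul, sub_zero]

theorem coeff_mul_C {R : Type*} [Ring R] (Z : R) (f : Laurent R) (n : ℤ) :
    (f * HahnSeries.C Z).coeff n = f.coeff n * Z := by
  rw [HahnSeries.C_apply]
  conv_lhs => rw [← add_zero n]
  rw [HahnSeries.coeff_mul_single_add]

theorem exists_forall_coeff_eq_zero {R ι : Type*} [Ring R] [Finite ι] (f : ι → Laurent R) :
    ∃ m : ℤ, ∀ i, ∀ n < m, (f i).coeff n = 0 := by
  obtain ⟨m, hm⟩ := (Set.finite_range fun i => (f i).order).bddBelow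
  exact ⟨m, fun i n hn => HahnSeries.coeff_eq_zero_of_lt_order
    (hn.trans_le (hm (Set.mem_range_self i)))⟩

theorem formalVar_commute {R : Type*} [Ring R] (f : Laurent R) :
    Commute (formalVar R : Laurent R) f := by
  ext n
  rw [coeff_mul_formalVar, coeff_formalVar_mul]

section Reflection

variable {q kp km : ℂ}

theorem IsSeqIntertwiner.map {N N' : Type*} [AddCommGroup N] [Module ℂ N] [AddCommGroup N']
    [Module ℂ N'] {lX rX lY rY : N →ₗ[ℂ] N} {lX' rX' lY' rY' : N' →ₗ[ℂ] N'} {a b c d : ℤ → N}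
    (h : IsSeqIntertwiner q kp km lX rX lY rY a b c d) (L : N →ₗ[ℂ] N')
    (h₁ : ∀ x, L (lX x) = lX' (L x)) (h₂ : ∀ x, L (rX x) = rX' (L x))
    (h₃ : ∀ x, L (lY x) = lY' (L x)) (h₄ : ∀ x, L (rY x) = rY' (L x)) :
    IsSeqIntertwiner q kp km lX' rX' lY' rY' (fun n => L (a n)) (fun n => L (b n))
      (fun n => L (c n)) (fun n => L (d n)) := by
  constructor <;> intro n
  · simpa only [map_add, map_smul, h₁, h₂, h₃, h₄] using congrArg L (h.X₁₁ n)
  · simpa only [map_add, map_smul, h₁, h₂, h₃, h₄] using congrArg L (h.X₁₂ n)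
  · simpa only [map_add, map_smul, h₁, h₂, h₃, h₄] using congrArg L (h.X₂₁ n)
  · simpa only [map_add, map_smul, h₁, h₂, h₃, h₄] using congrArg L (h.X₂₂ n)
  · simpa only [map_add, map_smul, h₁, h₂, h₃, h₄] using congrArg L (h.Y₁₁ n)
  · simpa only [map_add, map_smul, h₁, h₂, h₃, h₄] using congrArg L (h.Y₁₂ n)
  · simpa only [map_add, map_smul, h₁, h₂, h₃, h₄] using congrArg L (h.Y₂₁ n)
  · simpa only [map_add, map_smul, h₁, h₂, h₃, h₄] using congrArg L (h.Y₂₂ n)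

/-- The coefficients of the `2 × 2` blocks of a `4 × 4` matrix with entries in `R((u))`. -/
def blockCoeff {R : Type*} [Ring R] (Z : Matrix (Fin 2 × Fin 2) (Fin 2 × Fin 2) (Laurent R))
    (i j : Fin 2) (n : ℤ) : Matrix (Fin 2) (Fin 2) R :=
  Matrix.of fun k l => (Z (i, k) (j, l)).coeff n

/-- A two-site intertwiner, seen as a one-site intertwiner whose entries are its `2 × 2` blocks and
whose auxiliary space is `𝒱_v ⊗ W`. -/
theorem isSeqIntertwiner_blockCoeff {R : Type*} [Ring R] [Algebra ℂ R]
    {Z : Matrix (Fin 2 × Fin 2) (Fin 2 × Fin 2) (Laurent R)} {M M' P P' : Matrix (Fin 2) (Fin 2) R}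
    (hX : Z * outerX q kp km (formalVar R) (M.map HahnSeries.C) =
      outerX q kp km (formalVar R)⁻¹ (M'.map HahnSeries.C) * Z)
    (hY : Z * outerX q⁻¹ kp km (formalVar R)⁻¹ (P.map HahnSeries.C) =
      outerX q⁻¹ kp km (formalVar R) (P'.map HahnSeries.C) * Z) :
    IsSeqIntertwiner q kp km (LinearMap.mulLeft ℂ M') (LinearMap.mulRight ℂ M)
      (LinearMap.mulLeft ℂ P') (LinearMap.mulRight ℂ P) (blockCoeff Z 0 0) (blockCoeff Z 0 1)
      (blockCoeff Z 1 0) (blockCoeff Z 1 1) := by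
  have eX : ∀ i j k l n, _ := fun i j k l n => congrArg
    (fun M : Matrix (Fin 2 × Fin 2) (Fin 2 × Fin 2) (Laurent R) => (M (i, k) (j, l)).coeff n) hX
  have eY : ∀ i j k l n, _ := fun i j k l n => congrArg
    (fun M : Matrix (Fin 2 × Fin 2) (Fin 2 × Fin 2) (Laurent R) => (M (i, k) (j, l)).coeff n) hY
  simp only [outerX, siteX, Matrix.mul_apply, Fintype.sum_prod_type, Fin.sum_univ_two,
    Matrix.add_apply, Matrix.kroneckerMap_apply, Matrix.map_apply, Matrix.one_apply] at eX eY
  constructor <;> intro n <;> ext k l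
  · have := eX 0 0 k l n
    fin_cases k <;> fin_cases l <;>
    simpa [blockCoeff, Matrix.mul_apply, coeff_C_mul, coeff_mul_C, coeff_mul_formalVar,
        coeff_mul_formalVar_inv, coeff_formalVar_mul, coeff_formalVar_inv_mul, mul_add, add_mul]
      using this
  · have := eX 0 1 k l n
    fin_cases k <;> fin_cases l <;>
    simpa [blockCoeff, Matrix.mul_apply, coeff_C_mul, coeff_mul_C, coeff_mul_formalVar,
        coeff_mul_formalVar_inv, coeff_formalVar_mul, coeff_formalVar_inv_mul, mul_add, add_mul]
      using this
  · have := eX 1 0 k l n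
    fin_cases k <;> fin_cases l <;>
    simpa [blockCoeff, Matrix.mul_apply, coeff_C_mul, coeff_mul_C, coeff_mul_formalVar,
        coeff_mul_formalVar_inv, coeff_formalVar_mul, coeff_formalVar_inv_mul, mul_add, add_mul]
      using this
  · have := eX 1 1 k l n
    fin_cases k <;> fin_cases l <;>
    simpa [blockCoeff, Matrix.mul_apply, coeff_C_mul, coeff_mul_C, coeff_mul_formalVar,
        coeff_mul_formalVar_inv, coeff_formalVar_mul, coeff_formalVar_inv_mul, mul_add, add_mul]
      using this
  · have := eY 0 0 k l n
    fin_cases k <;> fin_cases l <;>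
    simpa [blockCoeff, Matrix.mul_apply, coeff_C_mul, coeff_mul_C, coeff_mul_formalVar,
        coeff_mul_formalVar_inv, coeff_formalVar_mul, coeff_formalVar_inv_mul, mul_add, add_mul]
      using this
  · have := eY 0 1 k l n
    fin_cases k <;> fin_cases l <;>
    simpa [blockCoeff, Matrix.mul_apply, coeff_C_mul, coeff_mul_C, coeff_mul_formalVar,
        coeff_mul_formalVar_inv, coeff_formalVar_mul, coeff_formalVar_inv_mul, mul_add, add_mul]
      using this
  · have := eY 1 0 k l n
    fin_cases k <;> fin_cases l <;>
    simpa [blockCoeff, Matrix.mul_apply, coeff_C_mul, coeff_mul_C, coeff_mul_formalVar,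
        coeff_mul_formalVar_inv, coeff_formalVar_mul, coeff_formalVar_inv_mul, mul_add, add_mul]
      using this
  · have := eY 1 1 k l n
    fin_cases k <;> fin_cases l <;>
    simpa [blockCoeff, Matrix.mul_apply, coeff_C_mul, coeff_mul_C, coeff_mul_formalVar,
        coeff_mul_formalVar_inv, coeff_formalVar_mul, coeff_formalVar_inv_mul, mul_add, add_mul]
      using this

theorem siteX_map {S T : Type*} [Ring S] [Algebra ℂ S] [Ring T] [Algebra ℂ T] (f : S →ₐ[ℂ] T)
    (u : Sˣ) (X : S) : (siteX q kp km u X).map f =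
      siteX q kp km (Units.map (f : S →* T) u) (f X) := by
  ext i j
  fin_cases i <;> fin_cases j <;> simp [siteX]

/-- The corner entry of the difference of the two sides of the reflection equation. -/
theorem reflection_corner {T : Type*} [Ring T] [Algebra ℂ T] {q : ℂ} {u v : Tˣ}
    (hu : ∀ t, Commute (u : T) t) (hv : ∀ t, Commute (v : T) t) {Ku Kv : Matrix (Fin 2) (Fin 2) T}
    (hB : Commute (Ku 0 1) (Kv 0 1)) :
    (RMatrix q (u * v⁻¹) * (Ku ⊗ₖ 1) * RMatrix q (u * v) * (1 ⊗ₖ Kv) -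
      (1 ⊗ₖ Kv) * RMatrix q (u * v) * (Ku ⊗ₖ 1) * RMatrix q (u * v⁻¹) :
        Matrix (Fin 2 × Fin 2) (Fin 2 × Fin 2) T) (0, 0) (1, 1) = 0 := by
  have hx : ∀ t, Commute (((u * v⁻¹ : Tˣ)) : T) t := fun t => by
    rw [Units.val_mul]; exact (hu t).mul_left (hv t).units_inv_left
  have hy : ∀ t, Commute (((u * v : Tˣ)) : T) t := fun t => by
    rw [Units.val_mul]; exact (hu t).mul_left (hv t)
  have ha : ∀ t, Commute (q • ((u * v⁻¹ : Tˣ) : T) - q⁻¹ • (((u * v⁻¹)⁻¹ : Tˣ) : T)) t := fun t =>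
    ((hx t).smul_left q).sub_left ((hx t).units_inv_left.smul_left q⁻¹)
  have hb : ∀ t, Commute (((u * v : Tˣ) : T) - (((u * v)⁻¹ : Tˣ) : T)) t := fun t =>
    (hy t).sub_left (hy t).units_inv_left
  have key : (RMatrix q (u * v⁻¹) * (Ku ⊗ₖ 1) * RMatrix q (u * v) * (1 ⊗ₖ Kv) -
      (1 ⊗ₖ Kv) * RMatrix q (u * v) * (Ku ⊗ₖ 1) * RMatrix q (u * v⁻¹) :
        Matrix (Fin 2 × Fin 2) (Fin 2 × Fin 2) T) (0, 0) (1, 1) =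
      (q • ((u * v⁻¹ : Tˣ) : T) - q⁻¹ • (((u * v⁻¹)⁻¹ : Tˣ) : T)) * Ku 0 1 *
        (((u * v : Tˣ) : T) - (((u * v)⁻¹ : Tˣ) : T)) * Kv 0 1 -
      Kv 0 1 * (((u * v : Tˣ) : T) - (((u * v)⁻¹ : Tˣ) : T)) * Ku 0 1 *
        (q • ((u * v⁻¹ : Tˣ) : T) - q⁻¹ • (((u * v⁻¹)⁻¹ : Tˣ) : T)) := by
    simp [RMatrix, finProdFinEquiv, Matrix.mul_apply, Fintype.sum_prod_type]
  have swap : ∀ {a b x y : T}, (∀ t, Commute a t) → (∀ t, Commute b t) → Commute x y →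
      a * x * b * y - y * b * x * a = 0 := by
    intro a b x y ha hb hxy
    rw [(ha (y * b * x)).symm.eq, (hb y).symm.eq, sub_eq_zero, mul_assoc a x, (hb x).symm.eq]
    simp only [mul_assoc, hxy.eq]
  rw [key]
  exact swap ha hb hB

/-- A two-site intertwiner is determined by its corner entry: the lowest coefficient of the upper
right block is a one-site intertwiner. -/
theorem eq_zero_of_isSeqIntertwiner_blockCoeff {S : Type*} [Ring S] [Algebra ℂ S]
    (hq' : q + q⁻¹ ≠ 0) (hkp : kp ≠ 0) (hkm : km ≠ 0) {X Y : S}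
    {Z : Matrix (Fin 2 × Fin 2) (Fin 2 × Fin 2) (Laurent (Laurent S))}
    (hseq : IsSeqIntertwiner q kp km
      (LinearMap.mulLeft ℂ (siteX q kp km (formalVar S)⁻¹ (HahnSeries.C X)))
      (LinearMap.mulRight ℂ (siteX q kp km (formalVar S) (HahnSeries.C X)))
      (LinearMap.mulLeft ℂ (siteX q⁻¹ kp km (formalVar S) (HahnSeries.C Y)))
      (LinearMap.mulRight ℂ (siteX q⁻¹ kp km (formalVar S)⁻¹ (HahnSeries.C Y)))
      (blockCoeff Z 0 0) (blockCoeff Z 0 1) (blockCoeff Z 1 0) (blockCoeff Z 1 1))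
    (corner : Z (0, 0) (1, 1) = 0) : Z = 0 := by
  obtain ⟨m, hm⟩ := exists_forall_coeff_eq_zero
    fun i : (Fin 2 × Fin 2) × (Fin 2 × Fin 2) => Z i.1 i.2
  have hm' : ∀ i j, ∀ n < m, blockCoeff Z i j n = 0 := fun i j n hn =>
    Matrix.ext fun k l => hm ((i, k), (j, l)) n hn
  -- uniqueness on one site, for the blocks
  have one_site : ∀ {B : LaurentMatrix S},
      siteX q kp km (formalVar S)⁻¹ (HahnSeries.C X) * B =
        B * siteX q kp km (formalVar S) (HahnSeries.C X) →
      siteX q⁻¹ kp km (formalVar S) (HahnSeries.C Y) * B =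
        B * siteX q⁻¹ kp km (formalVar S)⁻¹ (HahnSeries.C Y) → B 0 1 = 0 → B = 0 := by
    intro B hX0 hY0 h0
    have hs := isSeqIntertwiner_iff.2 ⟨hX0.symm, by
      rw [siteY_eq, siteY_eq, inv_inv]; exact hY0.symm⟩
    obtain ⟨m', hm''⟩ := exists_forall_coeff_eq_zero fun i : Fin 2 × Fin 2 => B i.1 i.2
    obtain ⟨e1, e2, e3⟩ := hs.eq_zero hq' hkp hkm (hm'' (0, 0)) (hm'' (1, 1))
      (by rw [h0]; rfl)
    have h00 : B 0 0 = 0 := HahnSeries.ext e1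
    have h10 : B 1 0 = 0 := HahnSeries.ext e2
    have h11 : B 1 1 = 0 := HahnSeries.ext e3
    ext1 i j
    fin_cases i <;> fin_cases j <;> assumption
  have hb : ∀ n, blockCoeff Z 0 1 n = 0 := by
    have key : ∀ k : ℕ, ∀ n < m + k, blockCoeff Z 0 1 n = 0 := by
      intro k
      induction k with
      | zero => intro n hn; exact hm' 0 1 n (by simpa using hn)
      | succ k ih =>
        intro n hn
        rcases lt_or_eq_of_le (show n ≤ m + k by push_cast at hn; omega) with hlt | rfl
        · exact ih n hlt
        obtain ⟨-, -, hX0, hY0⟩ := hseq.lowest hq' hkp hkm (hm' 0 0) (hm' 1 1) ih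
        refine one_site hX0 hY0 ?_
        rw [blockCoeff, Matrix.of_apply, corner]
        rfl
    intro n
    exact key (n - m + 1).toNat n (by omega)
  obtain ⟨e1, e2, e3⟩ := hseq.eq_zero hq' hkp hkm (hm' 0 0) (hm' 1 1) (funext hb)
  have entry : ∀ i j, (∀ n, blockCoeff Z i j n = 0) → ∀ k l, Z (i, k) (j, l) = 0 :=
    fun i j h k l => HahnSeries.ext (funext fun n => congrFun (congrFun (h n) k) l)
  ext1 ⟨i, k⟩ ⟨j, l⟩
  fin_cases i <;> fin_cases j
  · exact entry 0 0 (congrFun e1) k l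
  · exact entry 0 1 hb k l
  · exact entry 1 0 (congrFun e2) k l
  · exact entry 1 1 (congrFun e3) k l

/-- An intertwiner satisfies the reflection equation as soon as the coefficients of its upper right
entry commute with each other: the difference of the two sides is an intertwiner whose corner
entry is a multiple of their commutator, so uniqueness makes it vanish. -/
theorem reflectionEquation_of_commute {S : Type*} [Ring S] [Algebra ℂ S] (hq : q ≠ 0)
    (hq' : q + q⁻¹ ≠ 0) (hkp : kp ≠ 0) (hkm : km ≠ 0) {X Y : S} {K : LaurentMatrix S}
    (hX : K * siteX q kp km (formalVar S) (HahnSeries.C X) =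
      siteX q kp km (formalVar S)⁻¹ (HahnSeries.C X) * K)
    (hY : K * siteY q kp km (formalVar S) (HahnSeries.C Y) =
      siteY q kp km (formalVar S)⁻¹ (HahnSeries.C Y) * K)
    (hK : ∀ m n, Commute ((K 0 1).coeff m) ((K 0 1).coeff n)) : ReflectionEquation q K := by
  rw [ReflectionEquation]
  set u : (Laurent (Laurent S))ˣ := formalVar (Laurent S) with hu_def
  set v : (Laurent (Laurent S))ˣ :=
    Units.map (HahnSeries.C : Laurent S →+* Laurent (Laurent S)).toMonoidHom
      (formalVar S) with hv_def
  set Ku : LaurentMatrix (Laurent S) := K.map fun x => x.map (HahnSeries.C : S →+* Laurent S)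
    with hKu_def
  set Kv : LaurentMatrix (Laurent S) := K.map (HahnSeries.C : Laurent S →+* Laurent (Laurent S))
    with hKv_def
  have hu : ∀ t, Commute (u : Laurent (Laurent S)) t := fun t => formalVar_commute t
  have hv : ∀ t, Commute (v : Laurent (Laurent S)) t := by
    intro t
    ext1
    funext n
    change (HahnSeries.C (formalVar S : Laurent S) * t).coeff n =
      (t * HahnSeries.C (formalVar S : Laurent S)).coeff n
    rw [coeff_C_mul, coeff_mul_C, (formalVar_commute _).eq]
  obtain ⟨hKuX, hKuY⟩ := (isSeqIntertwiner_iff (X := (HahnSeries.C X : Laurent S))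
    (Y := (HahnSeries.C Y : Laurent S)) (K := Ku)).1
    ((isSeqIntertwiner_iff.2 ⟨hX, hY⟩).map (constHom S).toLinearMap
      (fun x => map_mul (constHom S) _ _) (fun x => map_mul (constHom S) _ _)
      (fun x => map_mul (constHom S) _ _) (fun x => map_mul (constHom S) _ _))
  have mapX : ∀ (r : ℂ) (w : (Laurent S)ˣ) (Z : Laurent S), (siteX r kp km w Z).map HahnSeries.C =
      siteX r kp km (Units.map (HahnSeries.C : Laurent S →+* Laurent (Laurent S)).toMonoidHom w)
        (HahnSeries.C Z) := fun r w Z => siteX_map (constHom (Laurent S)) w Z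
  rw [siteY_eq, siteY_eq] at hY
  rw [siteY_eq, siteY_eq] at hKuY
  have hKvX : Kv * siteX q kp km v (HahnSeries.C (HahnSeries.C X)) =
      siteX q kp km v⁻¹ (HahnSeries.C (HahnSeries.C X)) * Kv := by
    have := congrArg (RingHom.mapMatrix (HahnSeries.C : Laurent S →+* Laurent (Laurent S))) hX
    simp only [map_mul, RingHom.mapMatrix_apply, mapX] at this
    exact this
  have hKvY : Kv * siteX q⁻¹ kp km v⁻¹ (HahnSeries.C (HahnSeries.C Y)) =
      siteX q⁻¹ kp km v⁻¹⁻¹ (HahnSeries.C (HahnSeries.C Y)) * Kv := by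
    have := congrArg (RingHom.mapMatrix (HahnSeries.C : Laurent S →+* Laurent (Laurent S))) hY
    simp only [map_mul, RingHom.mapMatrix_apply, mapX] at this
    exact this
  set Z := RMatrix q (u * v⁻¹) * (Ku ⊗ₖ 1) * RMatrix q (u * v) * (1 ⊗ₖ Kv) -
      (1 ⊗ₖ Kv) * RMatrix q (u * v) * (Ku ⊗ₖ 1) * RMatrix q (u * v⁻¹) with hZ
  have hZX := reflection_intertwines hq u v _ hu hv hKuX hKvX Z hZ
  have uv1 : u⁻¹ * v⁻¹⁻¹ = (u * v⁻¹)⁻¹ := by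
    rw [mul_inv_rev]
    exact Units.ext (hv _).symm.eq
  have uv2 : u⁻¹ * v⁻¹ = (u * v)⁻¹ := by
    rw [mul_inv_rev]
    exact Units.ext (hv _).units_inv_left.symm.eq
  -- the second generator is treated as the first one, with `q`, `u` and `v` inverted; the two
  -- signs in `RMatrix_inv` cancel
  have hZY := reflection_intertwines (inv_ne_zero hq) u⁻¹ v⁻¹ _ (fun t => (hu t).units_inv_left)
    (fun t => (hv t).units_inv_left) hKuY hKvY Z (by
      rw [uv1, uv2, RMatrix_inv, RMatrix_inv, hZ]
      simp only [neg_mul, mul_neg, neg_neg])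
  rw [inv_inv, inv_inv] at hZY
  have hseq := isSeqIntertwiner_blockCoeff (Z := Z)
    (M := siteX q kp km (formalVar S) (HahnSeries.C X))
    (M' := siteX q kp km (formalVar S)⁻¹ (HahnSeries.C X))
    (P := siteX q⁻¹ kp km (formalVar S)⁻¹ (HahnSeries.C Y))
    (P' := siteX q⁻¹ kp km (formalVar S) (HahnSeries.C Y))
    (by rw [mapX, mapX]; exact hZX) (by rw [mapX, mapX]; exact hZY)
  have corner : Z (0, 0) (1, 1) = 0 := by
    have hB : Commute (Ku 0 1) (Kv 0 1) := by
      ext1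
      funext n
      change (Ku 0 1 * HahnSeries.C (K 0 1)).coeff n = (HahnSeries.C (K 0 1) * Ku 0 1).coeff n
      rw [coeff_C_mul, coeff_mul_C]
      change HahnSeries.C ((K 0 1).coeff n) * K 0 1 = K 0 1 * HahnSeries.C ((K 0 1).coeff n)
      ext k
      rw [coeff_C_mul, coeff_mul_C, (hK n k).eq]
    rw [hZ]
    exact reflection_corner hu hv hB
  exact sub_eq_zero.1 (hZ.symm.trans
    (eq_zero_of_isSeqIntertwiner_blockCoeff hq' hkp hkm hseq corner))

end Reflection

/-! ### Exchange relations from the reflection equation -/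

section Exchange

variable {F T : Type*} [Field F] [Ring T] [Algebra F T]

/-- The four entries of the reflection equation in which the spins on the two sides differ by one,
with spectral parameters `P = q u` and `P' = q v`: they determine the exchange of the diagonal
entries of `K`, written as `A = P w - P⁻¹ x` and `D = P x - P⁻¹ w`, with an off-diagonal one. -/
theorem exchange_weight_one {P P' Q : F} (hP : P ≠ 0) (hP' : P' ≠ 0) (hQ : Q ≠ 0)
    (n₁ : P ^ 2 * Q ^ 2 - P' ^ 2 ≠ 0) (n₂ : P ^ 2 - P' ^ 2 ≠ 0) (n₃ : P ^ 2 * P' ^ 2 - Q ^ 2 ≠ 0)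
    (n₄ : P ^ 2 * P' ^ 2 - Q ^ 4 ≠ 0) (n₅ : P ^ 4 - 1 ≠ 0) (n₆ : P' ^ 4 - 1 ≠ 0)
    {ax bx ay bY c : F} (hax : ax = P * Q / P' - P' / (P * Q)) (hbx : bx = P / P' - P' / P)
    (hay : ay = P * P' / Q - Q / (P * P')) (hby : bY = P * P' / Q ^ 2 - Q ^ 2 / (P * P'))
    (hc : c = Q - Q⁻¹)
    {w x b w' x' b' A A' D D' : T} (hA : A = P • w - P⁻¹ • x) (hD : D = P • x - P⁻¹ • w)
    (hA' : A' = P' • w' - P'⁻¹ • x') (hD' : D' = P' • x' - P'⁻¹ • w')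
    (e₁ : (ax * ay) • (A * b') + (ax * c) • (b * D') =
      (bx * bY) • (b' * A) + (c * ay) • (A' * b) + (c * c) • (b' * D))
    (e₂ : (ax * bY) • (b * A') =
      (c * bY) • (b' * A) + (bx * ay) • (A' * b) + (bx * c) • (b' * D))
    (e₃ : (bx * c) • (A * b') + (bx * ay) • (b * D') + (c * bY) • (D * b') = (ax * bY) • (D' * b))
    (e₄ : (c * c) • (A * b') + (c * ay) • (b * D') + (bx * bY) • (D * b') =
      (ax * c) • (A' * b) + (ax * ay) • (b' * D)) :
    ⁅w, b'⁆ + ⁅b, w'⁆ = 0 ∧ ⁅x, b'⁆ + ⁅b, x'⁆ = 0 := by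
  have hax' : ax = (P ^ 2 * Q ^ 2 - P' ^ 2) / (P * P' * Q) := by rw [hax]; field_simp
  have hbx' : bx = (P ^ 2 - P' ^ 2) / (P * P') := by rw [hbx]; field_simp
  have hay' : ay = (P ^ 2 * P' ^ 2 - Q ^ 2) / (P * P' * Q) := by rw [hay]; field_simp
  have hby' : bY = (P ^ 2 * P' ^ 2 - Q ^ 4) / (P * P' * Q ^ 2) := by rw [hby]; field_simp
  have hc' : c = (Q ^ 2 - 1) / Q := by rw [hc]; field_simp
  have inv : ∀ {R : F} {y z E : T}, R ≠ 0 → R ^ 4 - 1 ≠ 0 → ∀ {B}, B = R • z - R⁻¹ • y →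
      E = R • y - R⁻¹ • z → z = (R ^ 2 / (R ^ 4 - 1)) • (R • B + R⁻¹ • E) := by
    intro R y z E hR hR4 B hB hE
    rw [hB, hE]
    match_scalars <;> field_simp <;> ring
  have hw := inv hP n₅ hA hD
  have hx := inv hP n₅ hD hA
  have hw' := inv hP' n₆ hA' hD'
  have hx' := inv hP' n₆ hD' hA'
  clear inv hax hbx hay hby hc hA hD hA' hD'
  subst hw hx hw' hx' hax' hbx' hay' hby' hc'
  have n₁' : Q ^ 2 * P ^ 2 - P' ^ 2 ≠ 0 := by rwa [mul_comm]
  have n₄' : P' ^ 2 * P ^ 2 - Q ^ 4 ≠ 0 := by rwa [mul_comm]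
  simp only [Ring.lie_def, mul_add, add_mul, mul_smul_comm, smul_mul_assoc, smul_add]
  set s := P ^ 2 / (P ^ 4 - 1) with hs
  set s' := P' ^ 2 / (P' ^ 4 - 1) with hs'
  -- the multipliers solve the linear system expressing the two combinations through `e₁`, …, `e₄`
  set N := P * P' * Q * (P * P' * Q ^ 2) / ((P ^ 2 * Q ^ 2 - P' ^ 2) * (P ^ 2 * P' ^ 2 - Q ^ 4))
  set M := P * P' * (P * P' * Q ^ 2) / ((P ^ 2 - P' ^ 2) * (P ^ 2 * P' ^ 2 - Q ^ 4))
  set L := (Q ^ 2 - 1) / Q * ((P ^ 2 * P' ^ 2 - Q ^ 4) / (P * P' * Q ^ 2))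
  constructor
  · linear_combination (norm := skip) (M * (P * s - P' * s' * N * L)) • e₁ + (P' * s' * N) • e₂
      + (s' / P' * N) • e₃ + (M * (s / P - s' / P' * N * L)) • e₄
    match_scalars <;> simp only [N, M, L, s, s'] <;> field_simp <;> ring
  · linear_combination (norm := skip) (M * (s / P - s' / P' * N * L)) • e₁ + (s' / P' * N) • e₂
      + (P' * s' * N) • e₃ + (M * (P * s - P' * s' * N * L)) • e₄
    match_scalars <;> simp only [N, M, L, s, s'] <;> field_simp <;> ring

/-- The six spin-preserving entries of the reflection equation, with spectral parameters `P = q u`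
and `P' = q v`. -/
theorem exchange_weight_zero {P P' Q : F} (hP : P ≠ 0) (hP' : P' ≠ 0) (hQ : Q ≠ 0)
    (n₁ : P ^ 2 * Q ^ 2 - P' ^ 2 ≠ 0) (n₂ : P ^ 2 - P' ^ 2 ≠ 0) (n₃ : P ^ 2 * P' ^ 2 - Q ^ 2 ≠ 0)
    (n₅ : P ^ 4 - 1 ≠ 0) (n₆ : P' ^ 4 - 1 ≠ 0) (n₇ : P ^ 2 - P' ^ 2 * Q ^ 2 ≠ 0)
    (n₈ : P ^ 2 * P' ^ 2 - 1 ≠ 0) (n₉ : Q ^ 2 - 1 ≠ 0) (n₄ : P ^ 2 * P' ^ 2 - Q ^ 4 ≠ 0)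
    {ax bx ay bY c : F} (hax : ax = P * Q / P' - P' / (P * Q)) (hbx : bx = P / P' - P' / P)
    (hay : ay = P * P' / Q - Q / (P * P')) (hby : bY = P * P' / Q ^ 2 - Q ^ 2 / (P * P'))
    (hc : c = Q - Q⁻¹)
    {w x B C w' x' B' C' A A' D D' : T} (hA : A = P • w - P⁻¹ • x) (hD : D = P • x - P⁻¹ • w)
    (hA' : A' = P' • w' - P'⁻¹ • x') (hD' : D' = P' • x' - P'⁻¹ • w')
    (e₁ : (ax * ay) • (A * A') + (ax * c) • (B * C') = (ax * ay) • (A' * A) + (ax * c) • (B' * C))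
    (e₂ : (ax * ay) • (D * D') + (ax * c) • (C * B') = (ax * ay) • (D' * D) + (ax * c) • (C' * B))
    (e₃ : (c * ay) • (C * B') + (bx * bY) • (A * D') + (c * c) • (D * D') =
      (bx * bY) • (D' * A) + (c * ay) • (C' * B) + (c * c) • (D' * D))
    (e₄ : (c * ay) • (B * C') + (bx * bY) • (D * A') + (c * c) • (A * A') =
      (bx * bY) • (A' * D) + (c * ay) • (B' * C) + (c * c) • (A' * A))
    (e₅ : (bx * c) • (A * A') + (c * bY) • (D * A') + (bx * ay) • (B * C') =
      (c * bY) • (D' * A) + (bx * ay) • (C' * B) + (bx * c) • (D' * D))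
    (e₆ : (bx * c) • (D * D') + (c * bY) • (A * D') + (bx * ay) • (C * B') =
      (c * bY) • (A' * D) + (bx * ay) • (B' * C) + (bx * c) • (A' * A)) :
    ⁅w, w'⁆ = 0 ∧ ⁅x, x'⁆ = 0 ∧ ⁅w, x'⁆ + ⁅x, w'⁆ = 0 ∧ ⁅C, B'⁆ + ⁅B, C'⁆ = 0 := by
  have hax' : ax = (P ^ 2 * Q ^ 2 - P' ^ 2) / (P * P' * Q) := by rw [hax]; field_simp
  have hbx' : bx = (P ^ 2 - P' ^ 2) / (P * P') := by rw [hbx]; field_simp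
  have hay' : ay = (P ^ 2 * P' ^ 2 - Q ^ 2) / (P * P' * Q) := by rw [hay]; field_simp
  have hby' : bY = (P ^ 2 * P' ^ 2 - Q ^ 4) / (P * P' * Q ^ 2) := by rw [hby]; field_simp
  have hc' : c = (Q ^ 2 - 1) / Q := by rw [hc]; field_simp
  have hax0 : ax ≠ 0 := by rw [hax']; positivity
  have hbx0 : bx ≠ 0 := by rw [hbx']; positivity
  have hay0 : ay ≠ 0 := by rw [hay']; positivity
  have hby0 : bY ≠ 0 := by rw [hby']; positivity
  have hc0 : c ≠ 0 := by rw [hc']; positivity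
  -- `bz` is the weight complementary to `bY` in the factorisation of `ay ^ 2 - c ^ 2`
  obtain ⟨bz, hbz⟩ : ∃ bz, bz = P * P' - (P * P')⁻¹ := ⟨_, rfl⟩
  have hbz0 : bz ≠ 0 := by
    have : bz = (P ^ 2 * P' ^ 2 - 1) / (P * P') := by rw [hbz]; field_simp
    rw [this]; positivity
  have hbyz : ay ^ 2 - c ^ 2 = bY * bz := by
    rw [hay, hc, hby, hbz]; field_simp; ring
  have hcb0 : c ^ 2 - bx ^ 2 ≠ 0 := by
    have : c ^ 2 - bx ^ 2 = -((P ^ 2 * Q ^ 2 - P' ^ 2) * (P ^ 2 - P' ^ 2 * Q ^ 2)) /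
      (P * P' * Q) ^ 2 := by rw [hc', hbx']; field_simp; ring
    rw [this]
    exact div_ne_zero (neg_ne_zero.2 (mul_ne_zero n₁ n₇)) (by positivity)
  have can : ∀ {r : F} {y : T}, r ≠ 0 → r • y = 0 → y = 0 := fun hr h =>
    (smul_eq_zero_iff_right hr).mp h
  -- the diagonal relations express `[B, C']`-like terms through `[A, A']` and `[D, D']`
  have f₁ : ay • (A * A' - A' * A) + c • (B * C' - B' * C) = 0 := can hax0 (by
    linear_combination (norm := module) e₁)
  have f₂ : ay • (D * D' - D' * D) + c • (C * B' - C' * B) = 0 := can hax0 (by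
    linear_combination (norm := module) e₂)
  have f₃ : bx • (A * D' - D' * A) - bz • (D * D' - D' * D) = 0 := can hby0 (by
    have : (bY * bz) • (D * D' - D' * D) = (ay ^ 2 - c ^ 2) • (D * D' - D' * D) := by rw [hbyz]
    linear_combination (norm := module) e₃ - ay • f₂ - this)
  have f₄ : bx • (D * A' - A' * D) - bz • (A * A' - A' * A) = 0 := can hby0 (by
    have : (bY * bz) • (A * A' - A' * A) = (ay ^ 2 - c ^ 2) • (A * A' - A' * A) := by rw [hbyz]
    linear_combination (norm := module) e₄ - ay • f₁ - this)
  have f₅ : (A * D' - D' * A) + (D * A' - A' * D) = 0 := by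
    refine can hcb0 (can hby0 ?_)
    have h1 : (bY * bz) • (D * D' - D' * D + (A * A' - A' * A)) =
      (ay ^ 2 - c ^ 2) • (D * D' - D' * D + (A * A' - A' * A)) := by rw [hbyz]
    linear_combination (norm := module) c • e₅ + c • e₆ - (bx * ay) • f₁ - (bx * ay) • f₂
      - (bx * bY) • f₃ - (bx * bY) • f₄ - bx • h1
  have f₆ : (A * A' - A' * A) + (D * D' - D' * D) = 0 := can hbz0 (by
    linear_combination (norm := module) bx • f₅ - f₃ - f₄)
  have inv : ∀ {R : F} {y z E : T}, R ≠ 0 → R ^ 4 - 1 ≠ 0 → ∀ {B}, B = R • z - R⁻¹ • y →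
      E = R • y - R⁻¹ • z → z = (R ^ 2 / (R ^ 4 - 1)) • (R • B + R⁻¹ • E) := by
    intro R y z E hR hR4 B hB hE
    rw [hB, hE]
    match_scalars <;> field_simp <;> ring
  have hw := inv hP n₅ hA hD
  have hx := inv hP n₅ hD hA
  have hw' := inv hP' n₆ hA' hD'
  have hx' := inv hP' n₆ hD' hA'
  have hzx : bz = (P * P' - (P * P')⁻¹) := hbz
  have hzx' : bx * (P / P' - P' / P)⁻¹ = 1 := by rw [← hbx]; exact mul_inv_cancel₀ hbx0
  have g₃ : (A * D' - D' * A) + (bz / bx) • (A * A' - A' * A) = 0 := can hbx0 (by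
    linear_combination (norm := (match_scalars <;> field_simp <;> ring)) f₃ + bz • f₆)
  have g₄ : (D * A' - A' * D) - (bz / bx) • (A * A' - A' * A) = 0 := can hbx0 (by
    linear_combination (norm := (match_scalars <;> field_simp <;> ring)) f₄)
  set s := P ^ 2 / (P ^ 4 - 1)
  set s' := P' ^ 2 / (P' ^ 4 - 1)
  have hk : bz / bx * (P / P' - P' / P) = P * P' - (P * P')⁻¹ := by
    rw [← hbx, div_mul_cancel₀ _ hbx0, hbz]
  clear_value s s'
  refine ⟨?_, ?_, ?_, ?_⟩
  · simp only [hw, hw', Ring.lie_def, mul_add, add_mul, mul_smul_comm, smul_mul_assoc]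
    have hk' := congrArg (fun r => (s * s' * r) • (A * A' - A' * A)) hk
    linear_combination (norm := (match_scalars <;> field_simp <;> ring))
      (s * s' * (P * P')⁻¹) • f₆ + (s * s' * P / P') • g₃ + (s * s' * P' / P) • g₄ - hk'
  · simp only [hx, hx', Ring.lie_def, mul_add, add_mul, mul_smul_comm, smul_mul_assoc]
    have hk' := congrArg (fun r => (s * s' * r) • (A * A' - A' * A)) hk
    linear_combination (norm := (match_scalars <;> field_simp <;> ring))
      (s * s' * (P * P')) • f₆ + (s * s' * P' / P) • g₃ + (s * s' * P / P') • g₄ + hk'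
  · simp only [hw, hx', hx, hw', Ring.lie_def, mul_add, add_mul, mul_smul_comm, smul_mul_assoc]
    linear_combination (norm := (match_scalars <;> field_simp <;> ring))
      (s * s' * (P / P' + P' / P)) • f₆ + (s * s' * (P * P' + (P * P')⁻¹)) • f₅
  · refine can hc0 ?_
    rw [Ring.lie_def, Ring.lie_def]
    linear_combination (norm := module) f₁ + f₂ - ay • f₆

end Exchange

section SixVertex

variable {F T : Type*} [Field F] [Ring T] [Algebra F T]

/-- A `4 × 4` matrix of six-vertex shape, with weights in a field of central scalars. -/
def sixVertex (T : Type*) [Ring T] [Algebra F T] (a b c : F) :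
    Matrix (Fin 2 × Fin 2) (Fin 2 × Fin 2) T :=
  Matrix.reindex finProdFinEquiv.symm finProdFinEquiv.symm
    !![algebraMap F T a, 0, 0, 0;
       0, algebraMap F T b, algebraMap F T c, 0;
       0, algebraMap F T c, algebraMap F T b, 0;
       0, 0, 0, algebraMap F T a]

/-- The reflection equation with six-vertex weights implies the exchange relations between the
entries of `K` and those of `L`, except the one between the upper right entries. -/
theorem exchange_of_sixVertex {P P' Q : F} (hP : P ≠ 0) (hP' : P' ≠ 0) (hQ : Q ≠ 0)
    (n₁ : P ^ 2 * Q ^ 2 - P' ^ 2 ≠ 0) (n₂ : P ^ 2 - P' ^ 2 ≠ 0) (n₃ : P ^ 2 * P' ^ 2 - Q ^ 2 ≠ 0)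
    (n₄ : P ^ 2 * P' ^ 2 - Q ^ 4 ≠ 0) (n₅ : P ^ 4 - 1 ≠ 0) (n₆ : P' ^ 4 - 1 ≠ 0)
    (n₇ : P ^ 2 - P' ^ 2 * Q ^ 2 ≠ 0) (n₈ : P ^ 2 * P' ^ 2 - 1 ≠ 0) (n₉ : Q ^ 2 - 1 ≠ 0)
    {ax bx ay bY c : F} (hax : ax = P * Q / P' - P' / (P * Q)) (hbx : bx = P / P' - P' / P)
    (hay : ay = P * P' / Q - Q / (P * P')) (hby : bY = P * P' / Q ^ 2 - Q ^ 2 / (P * P'))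
    (hc : c = Q - Q⁻¹) {K L : Matrix (Fin 2) (Fin 2) T} {w x w' x' : T}
    (hA : K 0 0 = P • w - P⁻¹ • x) (hD : K 1 1 = P • x - P⁻¹ • w)
    (hA' : L 0 0 = P' • w' - P'⁻¹ • x') (hD' : L 1 1 = P' • x' - P'⁻¹ • w')
    (h : sixVertex T ax bx c * (K ⊗ₖ 1) * sixVertex T ay bY c * (1 ⊗ₖ L) =
      (1 ⊗ₖ L) * sixVertex T ay bY c * (K ⊗ₖ 1) * sixVertex T ax bx c) :
    (⁅w, w'⁆ = 0 ∧ ⁅x, x'⁆ = 0 ∧ ⁅w, x'⁆ + ⁅x, w'⁆ = 0 ∧ ⁅K 1 0, L 0 1⁆ + ⁅K 0 1, L 1 0⁆ = 0) ∧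
    (⁅w, L 0 1⁆ + ⁅K 0 1, w'⁆ = 0 ∧ ⁅x, L 0 1⁆ + ⁅K 0 1, x'⁆ = 0) ∧
    (⁅w, L 1 0⁆ + ⁅K 1 0, w'⁆ = 0 ∧ ⁅x, L 1 0⁆ + ⁅K 1 0, x'⁆ = 0) ∧ ⁅K 1 0, L 1 0⁆ = 0 := by
  have e : ∀ i j k l, _ := fun i j k l => congrFun (congrFun h (i, j)) (k, l)
  have smul_r : ∀ (z : F) (t : T), t * algebraMap F T z = z • t := by
    intro z t; rw [← Algebra.commutes, Algebra.smul_def]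
  have smul_l : ∀ (z : F) (t : T), algebraMap F T z * t = z • t := by
    intro z t; rw [Algebra.smul_def]
  simp only [Matrix.mul_apply, Fintype.sum_prod_type, Fin.sum_univ_two,
    Matrix.kroneckerMap_apply, Matrix.one_apply] at e
  -- the entries, sorted by the change of the total spin
  have u1 := e 0 0 0 1
  have u2 := e 0 0 1 0
  have u3 := e 0 1 1 1
  have u4 := e 1 0 1 1
  have d1 := e 1 1 1 0
  have d2 := e 1 1 0 1
  have d3 := e 1 0 0 0
  have d4 := e 0 1 0 0
  have z1 := e 0 0 0 0
  have z2 := e 1 1 1 1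
  have z3 := e 0 1 0 1
  have z4 := e 1 0 1 0
  have z5 := e 0 1 1 0
  have z6 := e 1 0 0 1
  have cc := e 1 1 0 0
  clear e h
  simp [sixVertex, finProdFinEquiv, add_mul, smul_r, smul_l, smul_smul]
    at u1 u2 u3 u4 d1 d2 d3 d4 z1 z2 z3 z4 z5 z6 cc
  refine ⟨?_, ?_, ?_, ?_⟩
  · refine exchange_weight_zero hP hP' hQ n₁ n₂ n₃ n₅ n₆ n₇ n₈ n₉ n₄ hax hbx hay hby hc hA hD
      hA' hD' ?_ ?_ ?_ ?_ ?_ ?_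
    · linear_combination (norm := module) z1
    · linear_combination (norm := module) z2
    · linear_combination (norm := module) z3
    · linear_combination (norm := module) z4
    · linear_combination (norm := module) z5
    · linear_combination (norm := module) z6
  · refine exchange_weight_one hP hP' hQ n₁ n₂ n₃ n₄ n₅ n₆ hax hbx hay hby hc hA hD hA' hD'
      ?_ ?_ ?_ ?_
    · linear_combination (norm := module) u1
    · linear_combination (norm := module) u2
    · linear_combination (norm := module) u3
    · linear_combination (norm := module) u4
  · refine And.symm (exchange_weight_one hP hP' hQ n₁ n₂ n₃ n₄ n₅ n₆ hax hbx hay hby hc hD hA hD'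
      hA' ?_ ?_ ?_ ?_)
    · linear_combination (norm := module) d1
    · linear_combination (norm := module) d2
    · linear_combination (norm := module) d3
    · linear_combination (norm := module) d4
  · have hax0 : ax ≠ 0 := by
      have : ax = (P ^ 2 * Q ^ 2 - P' ^ 2) / (P * P' * Q) := by rw [hax]; field_simp
      rw [this]; positivity
    have hby0 : bY ≠ 0 := by
      have : bY = (P ^ 2 * P' ^ 2 - Q ^ 4) / (P * P' * Q ^ 2) := by rw [hby]; field_simp
      rw [this]; positivity
    refine (smul_eq_zero_iff_right (mul_ne_zero hax0 hby0)).mp ?_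
    rw [Ring.lie_def]
    linear_combination (norm := module) cc

end SixVertex

section CoeffMap

/-- The ring homomorphism `R((u)) → R'((u))` induced by a ring homomorphism of the coefficients. -/
def laurentMap {R R' : Type*} [Ring R] [Ring R'] (f : R →+* R') : Laurent R →+* Laurent R' where
  toFun x := x.map f
  map_one' := HahnSeries.map_one f.toMonoidWithZeroHom
  map_mul' _ _ := HahnSeries.map_mul (f : R →ₙ+* R')
  map_zero' := HahnSeries.map_zero (f : ZeroHom R R')
  map_add' _ _ := HahnSeries.map_add (f : R →+ R')

theorem commute_of_coeff {R : Type*} [Ring R] {f g : Laurent R}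
    (h : ∀ i j, Commute (f.coeff i) (g.coeff j)) : Commute f g := by
  ext n
  rw [HahnSeries.coeff_mul, HahnSeries.coeff_mul]
  refine Finset.sum_nbij' Prod.swap Prod.swap ?_ ?_ ?_ ?_ ?_
  · intro x hx
    simpa only [Finset.swap_mem_antidiagonal] using hx
  · intro x hx
    simpa only [Finset.swap_mem_antidiagonal] using hx
  · intro x _; rfl
  · intro x _; rfl
  · intro x _
    exact (h _ _).eq

end CoeffMap

section Scalars

/-- The monomial `z uⁱ vʲ` in `ℂ((v))((u))`. -/
def biMonomial (i j : ℤ) (z : ℂ) : Laurent (Laurent ℂ) :=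
  HahnSeries.single i (HahnSeries.single j z)

theorem biMonomial_mul (i j i' j' : ℤ) (z z' : ℂ) :
    biMonomial i j z * biMonomial i' j' z' = biMonomial (i + i') (j + j') (z * z') := by
  simp only [biMonomial, HahnSeries.single_mul_single]

theorem biMonomial_pow (i j : ℤ) (z : ℂ) (n : ℕ) :
    biMonomial i j z ^ n = biMonomial (n * i) (n * j) (z ^ n) := by
  simp only [biMonomial, HahnSeries.single_pow, nsmul_eq_mul]

theorem biMonomial_sub_ne_zero {i j i' j' : ℤ} {z z' : ℂ} (hz : z ≠ 0)
    (h : i ≠ i' ∨ j ≠ j' ∨ z ≠ z') : biMonomial i j z - biMonomial i' j' z' ≠ 0 := by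
  intro h0
  have h1 := congrArg (fun f : Laurent (Laurent ℂ) => (f.coeff i).coeff j) (sub_eq_zero.1 h0)
  rcases eq_or_ne i i' with rfl | hi
  · rcases eq_or_ne j j' with rfl | hj
    · simp [biMonomial] at h1
      simp [h1] at h
    · simp [biMonomial, HahnSeries.coeff_single_of_ne hj] at h1
      exact hz h1
  · simp [biMonomial, HahnSeries.coeff_single_of_ne hi] at h1
    exact hz h1

theorem smul_eq_biMonomial_mul (z : ℂ) (f : Laurent (Laurent ℂ)) :
    z • f = biMonomial 0 0 z * f := by
  ext m n
  rw [biMonomial, HahnSeries.coeff_single_mul, HahnSeries.coeff_single_mul, sub_zero, sub_zero]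
  rfl

theorem biMonomial_inv {z : ℂ} (hz : z ≠ 0) : biMonomial 0 0 z⁻¹ = (biMonomial 0 0 z)⁻¹ := by
  refine eq_inv_of_mul_eq_one_left ?_
  rw [biMonomial_mul, inv_mul_cancel₀ hz]
  rfl

variable {S : Type*} [Ring S] [Algebra ℂ S]

variable (S) in
/-- The inclusion of the scalars `ℂ((v))((u))` in `S((v))((u))`. -/
def scalarMap : Laurent (Laurent ℂ) →+* Laurent (Laurent S) :=
  laurentMap (laurentMap (algebraMap ℂ S))

variable (S) in
/-- `S((v))((u))` as an algebra over the field `ℂ((v))((u))`. -/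
@[reducible] def scalarAlgebra : Algebra (Laurent (Laurent ℂ)) (Laurent (Laurent S)) :=
  (scalarMap S).toAlgebra' fun z t => commute_of_coeff fun i j => commute_of_coeff fun k l =>
    Algebra.commutes ((z.coeff i).coeff k) ((t.coeff j).coeff l)

theorem scalarMap_biMonomial (i j : ℤ) (z : ℂ) : scalarMap S (biMonomial i j z) =
    HahnSeries.single i (HahnSeries.single j (algebraMap ℂ S z)) := by
  ext m n
  change algebraMap ℂ S (((biMonomial i j z).coeff m).coeff n) = _
  rw [biMonomial, HahnSeries.coeff_single, HahnSeries.coeff_single]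
  split_ifs
  · rw [HahnSeries.coeff_single, HahnSeries.coeff_single]
    split_ifs
    · rfl
    · exact map_zero _
  · exact map_zero _

theorem scalarMap_smul (z : ℂ) (f : Laurent (Laurent ℂ)) :
    scalarMap S (z • f) = z • scalarMap S f := by
  ext m n
  change algebraMap ℂ S (z • (f.coeff m).coeff n) = z • algebraMap ℂ S ((f.coeff m).coeff n)
  rw [Algebra.algebraMap_eq_smul_one, Algebra.algebraMap_eq_smul_one, smul_assoc]

/-- Commutators of Laurent series in the two independent variables. -/
theorem coeff_lie_map_C {S : Type*} [Ring S] (f g : Laurent S) (m n : ℤ) :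
    ((⁅f.map (HahnSeries.C : S →+* Laurent S), HahnSeries.C g⁆ :
      Laurent (Laurent S)).coeff m).coeff n = ⁅f.coeff m, g.coeff n⁆ := by
  rw [Ring.lie_def, Ring.lie_def, HahnSeries.coeff_sub, coeff_C_mul, coeff_mul_C,
    HahnSeries.coeff_sub, HahnSeries.map_coeff, coeff_C_mul, coeff_mul_C]

/-- The exchange relations between the coefficients of the entries of a solution of the reflection
equation. The scalars lie in the field `ℂ((v))((u))`, where the weights of the `R`-matrix
are invertible. -/
theorem exchange_of_reflectionEquation {q : ℂ} (hq : q ≠ 0) (hq2 : q ^ 2 ≠ 1) {K : LaurentMatrix S}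
    {w x : Laurent S}
    (hA : K 0 0 = q • ((formalVar S : Laurent S) * w)
      - q⁻¹ • (((formalVar S)⁻¹ : (Laurent S)ˣ) * x))
    (hD : K 1 1 = q • ((formalVar S : Laurent S) * x)
      - q⁻¹ • (((formalVar S)⁻¹ : (Laurent S)ˣ) * w))
    (h : ReflectionEquation q K) (m n : ℤ) :
    (⁅w.coeff m, w.coeff n⁆ = 0 ∧ ⁅x.coeff m, x.coeff n⁆ = 0 ∧
      ⁅w.coeff m, x.coeff n⁆ + ⁅x.coeff m, w.coeff n⁆ = 0 ∧
      ⁅(K 1 0).coeff m, (K 0 1).coeff n⁆ + ⁅(K 0 1).coeff m, (K 1 0).coeff n⁆ = 0) ∧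
    (⁅w.coeff m, (K 0 1).coeff n⁆ + ⁅(K 0 1).coeff m, w.coeff n⁆ = 0 ∧
      ⁅x.coeff m, (K 0 1).coeff n⁆ + ⁅(K 0 1).coeff m, x.coeff n⁆ = 0) ∧
    (⁅w.coeff m, (K 1 0).coeff n⁆ + ⁅(K 1 0).coeff m, w.coeff n⁆ = 0 ∧
      ⁅x.coeff m, (K 1 0).coeff n⁆ + ⁅(K 1 0).coeff m, x.coeff n⁆ = 0) ∧
    ⁅(K 1 0).coeff m, (K 1 0).coeff n⁆ = 0 := by
  let uF : (Laurent (Laurent ℂ))ˣ := formalVar (Laurent ℂ)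
  let vF : (Laurent (Laurent ℂ))ˣ :=
    Units.map (HahnSeries.C : Laurent ℂ →+* Laurent (Laurent ℂ)).toMonoidHom (formalVar ℂ)
  let u : (Laurent (Laurent S))ˣ := formalVar (Laurent S)
  let v : (Laurent (Laurent S))ˣ :=
    Units.map (HahnSeries.C : Laurent S →+* Laurent (Laurent S)).toMonoidHom (formalVar S)
  let _ := scalarAlgebra S
  have alg : algebraMap (Laurent (Laurent ℂ)) (Laurent (Laurent S)) = scalarMap S := rfl
  have hu : Units.map (scalarMap S : Laurent (Laurent ℂ) →* Laurent (Laurent S)) uF = u := by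
    refine Units.ext ((scalarMap_biMonomial 1 0 1).trans ?_)
    rw [map_one]
    rfl
  have hv : Units.map (scalarMap S : Laurent (Laurent ℂ) →* Laurent (Laurent S)) vF = v := by
    refine Units.ext ((scalarMap_biMonomial 0 1 1).trans ?_)
    rw [map_one]
    rfl
  have six : ∀ x : (Laurent (Laurent ℂ))ˣ,
      RMatrix q (Units.map (scalarMap S : Laurent (Laurent ℂ) →* Laurent (Laurent S)) x) =
      sixVertex (Laurent (Laurent S)) (q • (x : Laurent (Laurent ℂ)) -
        q⁻¹ • ((x⁻¹ : (Laurent (Laurent ℂ))ˣ) : Laurent (Laurent ℂ)))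
      ((x : Laurent (Laurent ℂ)) - ((x⁻¹ : (Laurent (Laurent ℂ))ˣ) : Laurent (Laurent ℂ)))
      (biMonomial 0 0 (q - q⁻¹)) := by
    intro x
    have hc : algebraMap ℂ (Laurent (Laurent S)) (q - q⁻¹) =
        scalarMap S (biMonomial 0 0 (q - q⁻¹)) := by
      rw [scalarMap_biMonomial]
      rfl
    simp only [RMatrix, sixVertex, alg, map_sub (scalarMap S), scalarMap_smul, ← hc]
    rfl
  have hP : q • (uF : Laurent (Laurent ℂ)) = biMonomial 1 0 q := by
    rw [smul_eq_biMonomial_mul]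
    exact (biMonomial_mul 0 0 1 0 q 1).trans (by rw [mul_one]; rfl)
  have hP' : q • (vF : Laurent (Laurent ℂ)) = biMonomial 0 1 q := by
    rw [smul_eq_biMonomial_mul]
    exact (biMonomial_mul 0 0 0 1 q 1).trans (by rw [mul_one]; rfl)
  have hQ0 : biMonomial 0 0 q ≠ 0 := by
    intro h
    apply hq
    simpa [biMonomial] using h
  have hQinv := biMonomial_inv hq
  have hac : biMonomial 0 0 (q - q⁻¹) = biMonomial 0 0 q - (biMonomial 0 0 q)⁻¹ := by
    rw [← hQinv, biMonomial, HahnSeries.single_sub, HahnSeries.single_sub]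
    rfl
  have coe_inv : ∀ y : (Laurent (Laurent ℂ))ˣ,
      ((y⁻¹ : (Laurent (Laurent ℂ))ˣ) : Laurent (Laurent ℂ)) =
      (y : Laurent (Laurent ℂ))⁻¹ := fun y => eq_inv_of_mul_eq_one_left y.inv_mul
  have smul_unit : ∀ (z : ℂ) (y : (Laurent (Laurent ℂ))ˣ) (t : Laurent (Laurent S)),
      (z • (y : Laurent (Laurent ℂ))) • t =
        z • (((Units.map (scalarMap S : Laurent (Laurent ℂ) →* Laurent (Laurent S)) y :
          (Laurent (Laurent S))ˣ) : Laurent (Laurent S)) * t) := by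
    intro z y t
    rw [Algebra.smul_def, alg, scalarMap_smul, smul_mul_assoc]
    rfl
  have inv_unit : ∀ y : (Laurent (Laurent ℂ))ˣ, (q • (y : Laurent (Laurent ℂ)))⁻¹ =
      q⁻¹ • ((y⁻¹ : (Laurent (Laurent ℂ))ˣ) : Laurent (Laurent ℂ)) := by
    intro y
    rw [smul_eq_biMonomial_mul, smul_eq_biMonomial_mul, hQinv, coe_inv]
    exact mul_inv (biMonomial 0 0 q) (y : Laurent (Laurent ℂ))
  -- the diagonal entries in the two spectral parameters `q u` and `q v`
  have hAu : ∀ {A w x : Laurent S}, A = q • ((formalVar S : Laurent S) * w)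
      - q⁻¹ • (((formalVar S)⁻¹ : (Laurent S)ˣ) * x) → A.map (HahnSeries.C : S →+* Laurent S) =
      (q • (uF : Laurent (Laurent ℂ))) • w.map (HahnSeries.C : S →+* Laurent S) -
      (q • (uF : Laurent (Laurent ℂ)))⁻¹ • x.map (HahnSeries.C : S →+* Laurent S) := by
    intro A w x h
    rw [inv_unit, smul_unit, smul_unit, map_inv, hu, h]
    ext1
    funext m
    rw [HahnSeries.coeff_sub, HahnSeries.coeff_smul, HahnSeries.coeff_smul, coeff_formalVar_mul,
      coeff_formalVar_inv_mul]
    simp only [HahnSeries.map_coeff, HahnSeries.coeff_sub, HahnSeries.coeff_smul,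
      coeff_formalVar_mul, coeff_formalVar_inv_mul, map_sub]
    congr 1
    · exact map_smul (constHom S) q _
    · exact map_smul (constHom S) q⁻¹ _
  have hAv : ∀ {A w x : Laurent S}, A = q • ((formalVar S : Laurent S) * w)
      - q⁻¹ • (((formalVar S)⁻¹ : (Laurent S)ˣ) * x) → (HahnSeries.C A : Laurent (Laurent S)) =
      (q • (vF : Laurent (Laurent ℂ))) • HahnSeries.C w -
      (q • (vF : Laurent (Laurent ℂ)))⁻¹ • HahnSeries.C x := by
    intro A w x h
    rw [inv_unit, smul_unit, smul_unit, map_inv, hv, h, map_sub]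
    have hs : ∀ (z : ℂ) (y : Laurent S), HahnSeries.C (z • y) =
      z • (HahnSeries.C y : Laurent (Laurent S)) := fun z y => map_smul (constHom (Laurent S)) z y
    rw [hs, hs, map_mul, map_mul]
    rfl
  have hu0 := uF.ne_zero
  have hv0 := vF.ne_zero
  have h1 : (1 : Laurent (Laurent ℂ)) = biMonomial 0 0 1 := by
    rfl
  have hq2' : q ^ 2 ≠ 0 := pow_ne_zero _ hq
  have hq4 : q ^ 4 ≠ 0 := pow_ne_zero _ hq
  have key := exchange_of_sixVertex (F := Laurent (Laurent ℂ)) (T := Laurent (Laurent S))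
    (P := q • (uF : Laurent (Laurent ℂ))) (P' := q • (vF : Laurent (Laurent ℂ)))
    (Q := biMonomial 0 0 q)
    (K := K.map fun x => x.map (HahnSeries.C : S →+* Laurent S))
    (L := K.map (HahnSeries.C : Laurent S →+* Laurent (Laurent S)))
    (ax := q • ((uF * vF⁻¹ : (Laurent (Laurent ℂ))ˣ) : Laurent (Laurent ℂ)) -
      q⁻¹ • (((uF * vF⁻¹)⁻¹ : (Laurent (Laurent ℂ))ˣ) : Laurent (Laurent ℂ)))
    (bx := ((uF * vF⁻¹ : (Laurent (Laurent ℂ))ˣ) : Laurent (Laurent ℂ)) -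
      (((uF * vF⁻¹)⁻¹ : (Laurent (Laurent ℂ))ˣ) : Laurent (Laurent ℂ)))
    (ay := q • ((uF * vF : (Laurent (Laurent ℂ))ˣ) : Laurent (Laurent ℂ)) -
      q⁻¹ • (((uF * vF)⁻¹ : (Laurent (Laurent ℂ))ˣ) : Laurent (Laurent ℂ)))
    (bY := ((uF * vF : (Laurent (Laurent ℂ))ˣ) : Laurent (Laurent ℂ)) -
      (((uF * vF)⁻¹ : (Laurent (Laurent ℂ))ˣ) : Laurent (Laurent ℂ)))
    (c := biMonomial 0 0 (q - q⁻¹))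
    (w := w.map (HahnSeries.C : S →+* Laurent S)) (x := x.map (HahnSeries.C : S →+* Laurent S))
    (w' := HahnSeries.C w) (x' := HahnSeries.C x)
    (smul_ne_zero hq uF.ne_zero) (smul_ne_zero hq vF.ne_zero)
    hQ0
    (by
      simp only [hP, hP', biMonomial_pow, biMonomial_mul]
      exact biMonomial_sub_ne_zero (by positivity) (by norm_num))
    (by
      simp only [hP, hP', biMonomial_pow]
      exact biMonomial_sub_ne_zero (by positivity) (by norm_num))
    (by
      simp only [hP, hP', biMonomial_pow, biMonomial_mul]
      exact biMonomial_sub_ne_zero (by positivity) (by norm_num))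
    (by
      simp only [hP, hP', biMonomial_pow, biMonomial_mul]
      exact biMonomial_sub_ne_zero (by positivity) (by norm_num))
    (by
      simp only [hP, h1, biMonomial_pow]
      exact biMonomial_sub_ne_zero (by positivity) (by norm_num))
    (by
      simp only [hP', h1, biMonomial_pow]
      exact biMonomial_sub_ne_zero (by positivity) (by norm_num))
    (by
      simp only [hP, hP', biMonomial_pow, biMonomial_mul]
      exact biMonomial_sub_ne_zero (by positivity) (by norm_num))
    (by
      simp only [hP, hP', h1, biMonomial_pow, biMonomial_mul]
      exact biMonomial_sub_ne_zero (by positivity) (by norm_num))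
    (by
      simp only [h1, biMonomial_pow]
      exact biMonomial_sub_ne_zero (by positivity) (.inr (.inr hq2)))
    (by
      simp only [smul_eq_biMonomial_mul, hQinv, mul_inv_rev, inv_inv, Units.val_mul, coe_inv]
      field_simp)
    (by
      simp only [mul_inv_rev, inv_inv, Units.val_mul, coe_inv, smul_eq_biMonomial_mul]
      field_simp)
    (by
      simp only [smul_eq_biMonomial_mul, hQinv, mul_inv_rev, Units.val_mul, coe_inv]
      field_simp)
    (by
      simp only [mul_inv_rev, Units.val_mul, coe_inv, smul_eq_biMonomial_mul]
      field_simp)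
    hac (hAu hA) (hAu hD) (hAv hA) (hAv hD) (by
      rw [← six, ← six, map_mul, map_mul, map_inv, hu, hv]
      exact h)
  obtain ⟨⟨k1, k2, k3, k4⟩, ⟨k5, k6⟩, ⟨k7, k8⟩, k9⟩ := key
  have c1 : ∀ {f g : Laurent S}, (⁅f.map (HahnSeries.C : S →+* Laurent S), HahnSeries.C g⁆ :
      Laurent (Laurent S)) = 0 → ⁅f.coeff m, g.coeff n⁆ = 0 := by
    intro f g h
    rw [← coeff_lie_map_C, h]; rfl
  have c2 : ∀ {f g f' g' : Laurent S}, (⁅f.map (HahnSeries.C : S →+* Laurent S), HahnSeries.C g⁆ :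
      Laurent (Laurent S)) + ⁅f'.map (HahnSeries.C : S →+* Laurent S), HahnSeries.C g'⁆ = 0 →
      ⁅f.coeff m, g.coeff n⁆ + ⁅f'.coeff m, g'.coeff n⁆ = 0 := by
    intro f g f' g' h
    rw [← coeff_lie_map_C, ← coeff_lie_map_C, ← HahnSeries.coeff_add, ← HahnSeries.coeff_add, h]
    rfl
  exact ⟨⟨c1 k1, c1 k2, c2 k3, c2 k4⟩, ⟨c2 k5, c2 k6⟩, ⟨c2 k7, c2 k8⟩, c1 k9⟩

end Scalars

/-! ### The remaining relations of `𝒜_q` -/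

section Modes

variable {S : Type*} [Ring S] [Algebra ℂ S] {q : ℂ}

theorem current_commute (hq : q ≠ 0) (hq' : q + q⁻¹ ≠ 0) {X : ℕ → S} {s : S}
    (h : ∀ k, Commute (X k) s) (n : ℤ) : Commute ((current q X).coeff n) s := by
  rw [coeff_current hq hq' X (N := n.toNat + 1) (by omega)]
  exact Commute.sum_left _ _ _ fun k _ => (h k).smul_left _

/-- An identity between commutators of currents gives the identity between their modes. -/
theorem lie_add_lie_of_current (hq : q ≠ 0) (hq' : q + q⁻¹ ≠ 0) {X Y X' Y' : ℕ → S}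
    (h : ∀ m n, ⁅(current q X).coeff m, (current q Y).coeff n⁆ +
      ⁅(current q X').coeff m, (current q Y').coeff n⁆ = 0) (k l : ℕ) :
    ⁅X k, Y l⁆ + ⁅X' k, Y' l⁆ = 0 := by
  -- `adL y` and `adR x` are the two partial applications of the commutator
  let adL : S → S →ₗ[ℂ] S := fun y => LinearMap.mulRight ℂ y - LinearMap.mulLeft ℂ y
  let adR : S → S →ₗ[ℂ] S := fun x => LinearMap.mulLeft ℂ x - LinearMap.mulRight ℂ x
  have h1 : ∀ k n, ⁅X k, (current q Y).coeff n⁆ + ⁅X' k, (current q Y').coeff n⁆ = 0 := by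
    intro k n
    refine eq_zero_of_current hq hq'
      (fun k => ⁅X k, (current q Y).coeff n⁆ + ⁅X' k, (current q Y').coeff n⁆) (fun m => ?_) k
    have e := coeff_current_add hq hq' 1 1 (fun k => adL ((current q Y).coeff n) (X k))
      (fun k => adL ((current q Y').coeff n) (X' k)) m
    rw [← map_coeff_current hq hq', ← map_coeff_current hq hq'] at e
    simp only [one_smul] at e
    exact e.trans (h m n)
  refine eq_zero_of_current hq hq' (fun l => ⁅X k, Y l⁆ + ⁅X' k, Y' l⁆) (fun m => ?_) l
  have e := coeff_current_add hq hq' 1 1 (fun l => adR (X k) (Y l)) (fun l => adR (X' k) (Y' l)) m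
  rw [← map_coeff_current hq hq', ← map_coeff_current hq hq'] at e
  simp only [one_smul] at e
  exact e.trans (h1 k m)

theorem lie_of_current (hq : q ≠ 0) (hq' : q + q⁻¹ ≠ 0) {X Y : ℕ → S}
    (h : ∀ m n, ⁅(current q X).coeff m, (current q Y).coeff n⁆ = 0) (k l : ℕ) : ⁅X k, Y l⁆ = 0 := by
  have := lie_add_lie_of_current hq hq' (X := X) (Y := Y) (X' := X) (Y' := Y)
    (fun m n => by rw [h, add_zero]) k l
  rw [← two_smul ℂ] at this
  exact (smul_eq_zero_iff_right two_ne_zero).mp this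

variable {kp km : ℂ} {Wn Wp G Gt : ℕ → S}

theorem coeff_curMatrix₀₁ (n : ℤ) : (curMatrix q kp km Wn Wp G Gt 0 1).coeff n =
    (km * (q + q⁻¹))⁻¹ • (current q G).coeff n +
      (kp * (q + q⁻¹) / (q - q⁻¹)) • (if n = 0 then 1 else 0) := by
  rw [← coeff_algebraMap]
  rfl

theorem coeff_curMatrix₁₀ (n : ℤ) : (curMatrix q kp km Wn Wp G Gt 1 0).coeff n =
    (kp * (q + q⁻¹))⁻¹ • (current q Gt).coeff n +
      (km * (q + q⁻¹) / (q - q⁻¹)) • (if n = 0 then 1 else 0) := by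
  rw [← coeff_algebraMap]
  rfl

theorem curMatrix₀₁_commute (hq : q ≠ 0) (hq' : q + q⁻¹ ≠ 0) (hG : ∀ k l, Commute (G k) (G l))
    (m n : ℤ) : Commute ((curMatrix q kp km Wn Wp G Gt 0 1).coeff m)
      ((curMatrix q kp km Wn Wp G Gt 0 1).coeff n) := by
  have h1 : ∀ (n : ℤ) (s : S), Commute (if n = 0 then (1 : S) else 0) s := by
    intro n s
    split_ifs
    · exact Commute.one_left s
    · exact Commute.zero_left s
  rw [coeff_curMatrix₀₁, coeff_curMatrix₀₁]
  refine Commute.add_left ?_ ((h1 m _).smul_left _)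
  refine Commute.smul_left (Commute.add_right (Commute.smul_right ?_ _)
    ((h1 n _).symm.smul_right _)) _
  exact current_commute hq hq'
    (fun k => (current_commute hq hq' (fun l => hG l k) n).symm) m

/-- The relations involving `W₀` or `W₁`, together with the commutativity of the `G`, imply the
reflection equation for `K(u)`. -/
theorem IsCurrentBase.reflectionEquation (hq : q ≠ 0) (hq' : q + q⁻¹ ≠ 0) (hq'' : q - q⁻¹ ≠ 0)
    (hkp : kp ≠ 0) (hkm : km ≠ 0)
    (H : IsCurrentBase q (kp * km * (q + q⁻¹) ^ 2) Wn Wp G Gt) :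
    ReflectionEquation q (curMatrix q kp km Wn Wp G Gt) := by
  obtain ⟨hX, hY⟩ := isSeqIntertwiner_iff.1 (H.isSeqIntertwiner hq hq' hq'' hkp hkm)
  exact reflectionEquation_of_commute hq hq' hkp hkm hX hY (curMatrix₀₁_commute hq hq' H.G_G)

/-- The images of the generators of `𝒜_q`. -/
def curGenImage (Wn Wp G Gt : ℕ → S) : CurGen → S
  | CurGen.Wneg k => Wn k
  | CurGen.Wpos k => Wp k
  | CurGen.G k => G k
  | CurGen.Gt k => Gt k

/-- The remaining relations of `𝒜_q` follow: they are the content of the reflection equation. -/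
theorem IsCurrentBase.curRel (hq : q ≠ 0) (hq' : q + q⁻¹ ≠ 0) (hq'' : q - q⁻¹ ≠ 0)
    (hkp : kp ≠ 0) (hkm : km ≠ 0)
    (H : IsCurrentBase q (kp * km * (q + q⁻¹) ^ 2) Wn Wp G Gt) ⦃x y : FreeAlgebra ℂ CurGen⦄
    (h : CurRel q (kp * km * (q + q⁻¹) ^ 2) x y) :
    FreeAlgebra.lift ℂ (curGenImage Wn Wp G Gt) x =
      FreeAlgebra.lift ℂ (curGenImage Wn Wp G Gt) y := by
  have hq2 : q ^ 2 ≠ 1 := by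
    intro h
    apply hq''
    field_simp
    linear_combination h
  have ex := exchange_of_reflectionEquation (K := curMatrix q kp km Wn Wp G Gt)
    (w := current q Wn) (x := current q Wp) hq hq2 rfl rfl
    (H.reflectionEquation hq hq' hq'' hkp hkm)
  -- the constant terms of the off-diagonal entries are scalars and drop out of commutators
  have l1 : ∀ {z r : ℂ} {a b t : S} {m : ℤ}, b = z • a + r • (if m = 0 then 1 else 0) →
      ⁅t, b⁆ = z • ⁅t, a⁆ := by
    intro z r a b t m h
    rw [h, Ring.lie_def, Ring.lie_def]
    split_ifs <;> simp only [mul_add, add_mul, mul_smul_comm, smul_mul_assoc, mul_one, one_mul,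
      mul_zero, zero_mul] <;> module
  have l2 : ∀ {z r : ℂ} {a b t : S} {m : ℤ}, b = z • a + r • (if m = 0 then 1 else 0) →
      ⁅b, t⁆ = z • ⁅a, t⁆ := by
    intro z r a b t m h
    rw [h, Ring.lie_def, Ring.lie_def]
    split_ifs <;> simp only [mul_add, add_mul, mul_smul_comm, smul_mul_assoc, mul_one, one_mul,
      mul_zero, zero_mul] <;> module
  have zb : (km * (q + q⁻¹))⁻¹ ≠ 0 := inv_ne_zero (mul_ne_zero hkm hq')
  have zc : (kp * (q + q⁻¹))⁻¹ ≠ 0 := inv_ne_zero (mul_ne_zero hkp hq')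
  have can : ∀ {z : ℂ} {s : S}, z ≠ 0 → z • s = 0 → s = 0 := fun hz h =>
    (smul_eq_zero_iff_right hz).mp h
  have hWW := lie_of_current hq hq' (X := Wn) (Y := Wn) fun m n => (ex m n).1.1
  have hPP := lie_of_current hq hq' (X := Wp) (Y := Wp) fun m n => (ex m n).1.2.1
  have hWP := lie_add_lie_of_current hq hq' (X := Wn) (Y := Wp) (X' := Wp) (Y' := Wn)
    fun m n => (ex m n).1.2.2.1
  have hWG := lie_add_lie_of_current hq hq' (X := Wn) (Y := G) (X' := G) (Y' := Wn) fun m n =>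
    can zb (by
      have := (ex m n).2.1.1
      rwa [l1 (coeff_curMatrix₀₁ n), l2 (coeff_curMatrix₀₁ m), ← smul_add] at this)
  have hPG := lie_add_lie_of_current hq hq' (X := Wp) (Y := G) (X' := G) (Y' := Wp) fun m n =>
    can zb (by
      have := (ex m n).2.1.2
      rwa [l1 (coeff_curMatrix₀₁ n), l2 (coeff_curMatrix₀₁ m), ← smul_add] at this)
  have hWT := lie_add_lie_of_current hq hq' (X := Wn) (Y := Gt) (X' := Gt) (Y' := Wn) fun m n =>
    can zc (by
      have := (ex m n).2.2.1.1
      rwa [l1 (coeff_curMatrix₁₀ n), l2 (coeff_curMatrix₁₀ m), ← smul_add] at this)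
  have hPT := lie_add_lie_of_current hq hq' (X := Wp) (Y := Gt) (X' := Gt) (Y' := Wp) fun m n =>
    can zc (by
      have := (ex m n).2.2.1.2
      rwa [l1 (coeff_curMatrix₁₀ n), l2 (coeff_curMatrix₁₀ m), ← smul_add] at this)
  have hTT := lie_of_current hq hq' (X := Gt) (Y := Gt) fun m n =>
    can zc (can zc (by
      have := (ex m n).2.2.2
      rwa [l1 (coeff_curMatrix₁₀ n), l2 (coeff_curMatrix₁₀ m)] at this))
  have hTG := lie_add_lie_of_current hq hq' (X := Gt) (Y := G) (X' := G) (Y' := Gt) fun m n =>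
    can zb (can zc (by
      have := (ex m n).1.2.2.2
      rw [l1 (coeff_curMatrix₀₁ n), l1 (coeff_curMatrix₁₀ n), l2 (coeff_curMatrix₀₁ m),
        l2 (coeff_curMatrix₁₀ m)] at this
      linear_combination (norm := module) this))
  have lift_lie : ∀ a b : FreeAlgebra ℂ CurGen,
      FreeAlgebra.lift ℂ (curGenImage Wn Wp G Gt) ⁅a, b⁆ =
        ⁅FreeAlgebra.lift ℂ (curGenImage Wn Wp G Gt) a,
          FreeAlgebra.lift ℂ (curGenImage Wn Wp G Gt) b⁆ := by
    intro a b
    rw [Ring.lie_def, Ring.lie_def, map_sub, map_mul, map_mul]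
  have lift_q : ∀ a b : FreeAlgebra ℂ CurGen,
      FreeAlgebra.lift ℂ (curGenImage Wn Wp G Gt) (qComm q a b) =
        qComm q (FreeAlgebra.lift ℂ (curGenImage Wn Wp G Gt) a)
          (FreeAlgebra.lift ℂ (curGenImage Wn Wp G Gt) b) := by
    intro a b
    rw [qComm, qComm, map_sub, map_smul, map_smul, map_mul, map_mul]
  cases h <;> simp only [lift_lie, lift_q, map_add, map_sub, map_smul, map_zero,
    FreeAlgebra.lift_ι_apply, curGenImage]
  · exact H.W0_Wp _
  · exact H.Wn_W1 _
  · exact H.W0_G _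
  · exact H.Gt_W0 _
  · exact H.G_W1 _
  · exact H.W1_Gt _
  · exact hWW _ _
  · exact hPP _ _
  · exact hWP _ _
  · exact hWG _ _
  · exact hWT _ _
  · exact hPG _ _
  · exact hPT _ _
  · exact sub_eq_zero.2 (H.G_G _ _).eq
  · exact hTT _ _
  · exact hTG _ _

end Modes

/-! ### Extension of a `q`-Dolan–Grady pair to all modes -/

section Existence

variable {S : Type*} [Ring S] [Algebra ℂ S] {q ρ : ℂ}

/-- The modes `(W_{-k}, W_{k+1})`, generated from `(W₀, W₁) = (X, Y)` and a sequence `β`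
proportional to the `G`. -/
def wModes (q : ℂ) (X Y : S) (β : ℕ → S) : ℕ → S × S
  | 0 => (X, Y)
  | k + 1 => ((wModes q X Y β k).2 + qComm q X (β (k + 1)),
      (wModes q X Y β k).1 + qComm q (β (k + 1)) Y)

/-- A pair satisfying the `q`-Dolan–Grady relations extends to all modes of the currents. -/
theorem exists_isCurrentBase (hq : q ≠ 0) (hroot : ∀ n : ℕ, 0 < n → q ^ n ≠ 1) (hρ : ρ ≠ 0)
    (hq' : q + q⁻¹ ≠ 0) (hq'' : q - q⁻¹ ≠ 0) {X Y : S} (h1 : DolanGrady q ρ X Y)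
    (h2 : DolanGrady q ρ Y X) :
    ∃ Wn Wp G Gt : ℕ → S, Wn 0 = X ∧ Wp 0 = Y ∧ IsCurrentBase q ρ Wn Wp G Gt := by
  have hρc : ρ = -(-(ρ * (q + q⁻¹)⁻¹)) * (q + q⁻¹) := by
    rw [neg_neg, inv_mul_cancel_right₀ hq']
  rw [hρc] at h1 h2
  obtain ⟨b, hb⟩ := exists_genSeq hq hroot
    (neg_ne_zero.2 (mul_ne_zero hρ (inv_ne_zero hq'))) h1 h2
  rw [← hρc] at h1 h2
  have h3 : q ^ 2 + 1 ≠ 0 := by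
    intro h; apply hq'; field_simp; linear_combination h
  -- the normalisation `β₀ = (q - q⁻¹)⁻¹` makes `[β₀, s]_q = s`
  set z : ℕ → ℂ := fun k => (q - q⁻¹)⁻¹ * (q + q⁻¹)⁻¹ ^ k with hz
  have zs : ∀ k, z k = (q + q⁻¹) * z (k + 1) := by
    intro k
    rw [hz]
    simp only [pow_succ']
    rw [mul_left_comm (q - q⁻¹)⁻¹, mul_inv_cancel_left₀ hq']
  have qr : ∀ (w : ℂ) (s t : S), qComm q s (w • t) = w • qComm q s t := by
    intro w s t
    simp only [qComm, mul_smul_comm, smul_mul_assoc]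
    module
  have ql : ∀ (w : ℂ) (s t : S), qComm q (w • s) t = w • qComm q s t := by
    intro w s t
    simp only [qComm, mul_smul_comm, smul_mul_assoc]
    module
  have lr : ∀ (w : ℂ) (s t : S), ⁅s, w • t⁆ = w • ⁅s, t⁆ := by
    intro w s t
    simp only [Ring.lie_def, mul_smul_comm, smul_mul_assoc, smul_sub]
  have ll : ∀ (w : ℂ) (s t : S), ⁅w • s, t⁆ = w • ⁅s, t⁆ := by
    intro w s t
    simp only [Ring.lie_def, mul_smul_comm, smul_mul_assoc, smul_sub]
  have ladd : ∀ r s t : S, ⁅r, s + t⁆ = ⁅r, s⁆ + ⁅r, t⁆ := by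
    intro r s t
    simp only [Ring.lie_def, mul_add, add_mul]
    abel
  set β : ℕ → S := fun k => z k • b k with hβ
  have hL : ∀ k, ⁅X, qComm q X (β (k + 1))⁆ = -⁅X, qComm q (β k) Y⁆ := by
    intro k
    simp only [hβ, qr, ql, lr, hb.lie_left, zs k]
    module
  have hR : ∀ k, ⁅Y, qComm q (β (k + 1)) Y⁆ = -⁅Y, qComm q X (β k)⁆ := by
    intro k
    simp only [hβ, qr, ql, lr, hb.lie_right, zs k]
    module
  have hSL : ∀ k, ρ • ⁅X, β (k + 1)⁆ = qComm q ⁅X, qComm q (β k) Y⁆ X := by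
    intro k
    simp only [hβ, ql, lr, ← hb.succ_left, zs k]
    match_scalars
    field_simp
  have hSR : ∀ k, ρ • ⁅β (k + 1), Y⁆ = qComm q Y ⁅X, qComm q (β k) Y⁆ := by
    intro k
    simp only [hβ, qr, ql, lr, ll, ← hb.succ_right, zs k]
    match_scalars
    field_simp
  have hc : ∀ k, ⁅X, qComm q (β k) Y⁆ = ⁅qComm q X (β k), Y⁆ := fun k =>
    lie_qComm_eq ((hb.commute_qComm k).smul_right _)
  set w := wModes q X Y β
  have h0 : ∀ s : S, qComm q (β 0) s = s ∧ qComm q s (β 0) = s := by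
    intro s
    have : (q - q⁻¹) * (q - q⁻¹)⁻¹ = 1 := mul_inv_cancel₀ hq''
    simp only [hβ, hz, qComm, hb.zero, pow_zero, mul_one, mul_smul_comm, smul_mul_assoc, one_mul]
    constructor <;> linear_combination (norm := module) this • s
  -- `⁅X, W₋ₖ⁆` vanishes because `hL` makes the two summands of `W₋ₖ` cancel
  have key : ∀ k, (⁅X, (w k).1⁆ = 0 ∧ ⁅X, (w k).2⁆ = ⁅X, qComm q (β k) Y⁆) ∧
      (⁅Y, (w k).2⁆ = 0 ∧ ⁅Y, (w k).1⁆ = ⁅Y, qComm q X (β k)⁆) := by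
    intro k
    induction k with
    | zero =>
      rw [(h0 Y).1, (h0 X).2]
      exact ⟨⟨sub_self _, rfl⟩, sub_self _, rfl⟩
    | succ k ih =>
      obtain ⟨⟨i1, i2⟩, i3, i4⟩ := ih
      refine ⟨⟨?_, ?_⟩, ?_, ?_⟩
      · change ⁅X, (w k).2 + qComm q X (β (k + 1))⁆ = 0
        rw [ladd, i2, hL, add_neg_cancel]
      · change ⁅X, (w k).1 + qComm q (β (k + 1)) Y⁆ = _
        rw [ladd, i1, zero_add]
      · change ⁅Y, (w k).1 + qComm q (β (k + 1)) Y⁆ = 0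
        rw [ladd, i4, hR, add_neg_cancel]
      · change ⁅Y, (w k).2 + qComm q X (β (k + 1))⁆ = _
        rw [ladd, i3, zero_add]
  have hGW : ∀ k, qComm q X (ρ • β (k + 1)) = ρ • (w (k + 1)).1 - ρ • (w k).2 := by
    intro k
    rw [qr, ← smul_sub]
    change _ = ρ • ((w k).2 + qComm q X (β (k + 1)) - (w k).2)
    rw [add_sub_cancel_left]
  have hWG : ∀ k, qComm q (ρ • β (k + 1)) Y = ρ • (w (k + 1)).2 - ρ • (w k).1 := by
    intro k
    rw [ql, ← smul_sub]
    change _ = ρ • ((w k).1 + qComm q (β (k + 1)) Y - (w k).1)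
    rw [add_sub_cancel_left]
  have hm : ∀ g m : S, (q + q⁻¹)⁻¹ • (g + (q + q⁻¹) • m - g) = m := by
    intro g m
    rw [add_sub_cancel_left, smul_smul, inv_mul_cancel₀ hq', one_smul]
  refine ⟨fun k => (w k).1, fun k => (w k).2, fun k => ρ • β (k + 1),
    fun k => ρ • β (k + 1) + (q + q⁻¹) • ⁅X, qComm q (β k) Y⁆, rfl, rfl, ?_⟩
  constructor
  · intro k
    rw [hm]
    exact (key k).1.2
  · intro k
    rw [hm, hc]
    have := (key k).2.2
    change ⁅(w k).1, Y⁆ = _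
    simp only [Ring.lie_def] at this ⊢
    linear_combination (norm := module) -this
  · exact hGW
  · intro k
    rw [← hGW]
    change qComm q (ρ • β (k + 1) + _) X = _
    have := hSL k
    set m := ⁅X, qComm q (β k) Y⁆
    simp only [qComm, Ring.lie_def, mul_add, add_mul, mul_smul_comm, smul_mul_assoc] at this ⊢
    linear_combination (norm := module) -(q + q⁻¹) • this
  · exact hWG
  · intro k
    rw [← hWG]
    change qComm q Y (ρ • β (k + 1) + _) = _
    have := hSR k
    set m := ⁅X, qComm q (β k) Y⁆
    simp only [qComm, Ring.lie_def, mul_add, add_mul, mul_smul_comm, smul_mul_assoc] at this ⊢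
    linear_combination (norm := module) -(q + q⁻¹) • this
  · exact fun k => sub_eq_zero.1 (key k).1.1
  · exact fun k => sub_eq_zero.1 (key k).2.1
  · intro k l
    exact (((hb.commute _ _).smul_left _).smul_right _ |>.smul_left _).smul_right _

end Existence

/-! ### Schur's lemma for the `q`-Onsager algebra -/

section Schur

open Polynomial

variable {W : Type*} [AddCommGroup W] [Module ℂ W]

/-- For an endomorphism `g` with empty spectrum the vectors `(g - z)⁻¹ w`, with `z ∈ ℂ`, are
linearly independent: a linear relation between them would give a non-zero polynomial in `g`
annihilating `w`. -/
theorem linearIndependent_of_isUnit_sub {g : Module.End ℂ W}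
    (hg : ∀ z : ℂ, IsUnit (g - algebraMap ℂ _ z)) {w : W} (hw : w ≠ 0) {v : ℂ → W}
    (hv : ∀ z, (g - algebraMap ℂ _ z) (v z) = w) : LinearIndependent ℂ v := by
  have hunit : ∀ P : ℂ[X], P ≠ 0 → IsUnit (aeval g P) := by
    intro P hP
    rw [(IsAlgClosed.splits P).eq_prod_roots, map_mul, aeval_C]
    refine (RingHom.isUnit_map _ (isUnit_iff_ne_zero.2 (leadingCoeff_ne_zero.2 hP))).mul ?_
    by_contra h
    obtain ⟨k, hk, -⟩ := spectrum.exists_mem_of_not_isUnit_aeval_prod h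
    refine hk ?_
    rw [spectrum.mem_resolventSet_iff, ← neg_sub, IsUnit.neg_iff]
    exact hg k
  rw [linearIndependent_iff']
  intro s c hs j hj
  set P : ℂ[X] := ∑ i ∈ s, C (c i) * ∏ k ∈ s.erase i, (X - C k) with hP
  have h1 : ∀ i ∈ s, aeval g (∏ k ∈ s, (X - C k)) (v i) =
      aeval g (∏ k ∈ s.erase i, (X - C k)) w := by
    intro i hi
    rw [← Finset.prod_erase_mul s _ hi, map_mul, Module.End.mul_apply]
    congr 1
    rw [← hv i]
    simp
  have h2 : aeval g P w = 0 := by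
    have := congrArg (aeval g (∏ k ∈ s, (X - C k))) hs
    rw [map_zero, map_sum] at this
    rw [hP, map_sum, LinearMap.sum_apply, ← this]
    refine Finset.sum_congr rfl fun i hi => ?_
    rw [map_smul, h1 i hi, map_mul, aeval_C, Module.End.mul_apply]
    rfl
  have h3 : P = 0 := by
    by_contra h
    obtain ⟨x, hx⟩ := hunit P h
    apply hw
    have := congrArg (fun y => (↑x⁻¹ : Module.End ℂ W) y) h2
    simpa [← hx, ← Module.End.mul_apply] using this
  have h4 := congrArg (eval j) h3
  rw [hP, eval_finsetSum, eval_zero, Finset.sum_eq_single_of_mem j hj] at h4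
  · rw [eval_mul, eval_C, eval_prod] at h4
    refine (mul_eq_zero.1 h4).resolve_right (Finset.prod_ne_zero_iff.2 fun k hk => ?_)
    rw [eval_sub, eval_X, eval_C]
    exact sub_ne_zero.2 (Finset.ne_of_mem_erase hk).symm
  · intro i _ hij
    rw [eval_mul, eval_prod, Finset.prod_eq_zero (Finset.mem_erase.2 ⟨hij.symm, hj⟩), mul_zero]
    simp

/-- Schur's lemma for irreducible modules over the `q`-Onsager algebra. Since this algebra has
countable dimension, so has `W`, and an endomorphism without eigenvalue would contradict
the linear independence of the uncountable family `(g - z)⁻¹ w`. -/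
theorem IsIrreducible.exists_eq_algebraMap {q ρ : ℂ} {φ : QOnsager q ρ →ₐ[ℂ] Module.End ℂ W}
    (hφ : IsIrreducible φ) {g : Module.End ℂ W} (hg : ∀ t, Commute g (φ t)) :
    ∃ z : ℂ, g = algebraMap ℂ _ z := by
  by_contra! hne
  obtain ⟨hW, hirr⟩ := hφ
  have hu : ∀ z : ℂ, IsUnit (g - algebraMap ℂ _ z) := by
    intro z
    set h := g - algebraMap ℂ (Module.End ℂ W) z with hh
    have hc : ∀ t w, h (φ t w) = φ t (h w) := fun t w =>
      congrArg (fun f : Module.End ℂ W => f w)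
        ((hg t).sub_left (Algebra.commutes z (φ t))).eq
    have h0 : h ≠ 0 := sub_ne_zero.2 (hne z)
    rw [Module.End.isUnit_iff]
    constructor
    · rw [← LinearMap.ker_eq_bot]
      refine (hirr (LinearMap.ker h) fun t w hw => ?_).resolve_right fun h' => ?_
      · rw [LinearMap.mem_ker] at hw ⊢
        rw [hc, hw, map_zero]
      · exact h0 (LinearMap.ker_eq_top.1 h')
    · rw [← LinearMap.range_eq_top]
      refine (hirr (LinearMap.range h) fun t w hw => ?_).resolve_left fun h' => ?_
      · obtain ⟨y, rfl⟩ := hw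
        exact ⟨φ t y, hc t y⟩
      · exact h0 (LinearMap.range_eq_bot.1 h')
  obtain ⟨w, hw⟩ := exists_ne (0 : W)
  choose v hv using fun z => ((Module.End.isUnit_iff _).1 (hu z)).2 w
  have hli := linearIndependent_of_isUnit_sub hu hw hv
  -- the orbit map `t ↦ t w` is surjective
  let L : FreeAlgebra ℂ OnsGen →ₗ[ℂ] W :=
    ((LinearMap.applyₗ w).comp φ.toLinearMap).comp (RingQuot.mkAlgHom ℂ (OnsRel q ρ)).toLinearMap
  have hL : Function.Surjective L := by
    rw [← LinearMap.range_eq_top]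
    refine (hirr (LinearMap.range L) fun t y hy => ?_).resolve_left fun h' => ?_
    · obtain ⟨x, rfl⟩ := hy
      obtain ⟨s, rfl⟩ := RingQuot.mkAlgHom_surjective ℂ (OnsRel q ρ) t
      refine ⟨s * x, ?_⟩
      change φ (RingQuot.mkAlgHom ℂ (OnsRel q ρ) (s * x)) w = _
      rw [map_mul, map_mul]
      rfl
    · have h1 : L 1 = w := by
        change φ (RingQuot.mkAlgHom ℂ (OnsRel q ρ) 1) w = w
        rw [map_one, map_one]
        rfl
      rw [LinearMap.range_eq_bot.1 h'] at h1
      exact hw h1.symm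
  choose y hy using fun z => hL (v z)
  have hy' : LinearIndependent ℂ y := by
    refine LinearIndependent.of_comp L ?_
    convert hli using 1
    exact funext hy
  have h1 := hy'.cardinal_le_rank
  have : Countable OnsGen := by
    refine Function.Injective.countable (f := fun g : OnsGen => match g with
      | OnsGen.A => (0 : ℕ)
      | OnsGen.Astar => 1) ?_
    rintro (_ | _) (_ | _) h <;> first | rfl | simp at h
  have : Countable (FreeMonoid OnsGen) := inferInstanceAs (Countable (List OnsGen))
  rw [← (FreeAlgebra.basisFreeMonoid ℂ OnsGen).mk_eq_rank'', Cardinal.mk_complex] at h1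
  exact absurd (h1.trans (Cardinal.mk_le_aleph0)) (not_le.2 Cardinal.aleph0_lt_continuum)

end Schur

/-! ### Homomorphisms between the two algebras -/

section Homomorphisms

variable {S : Type*} [Ring S] [Algebra ℂ S] {q ρ : ℂ} {Wn Wp G Gt : ℕ → S}

/-- The symmetry of the relations exchanging `W₋ₖ` with `W_{k+1}` and `G` with `G̃`. -/
theorem IsCurrentBase.swap (H : IsCurrentBase q ρ Wn Wp G Gt)
    (hGt : ∀ k l, Commute (Gt k) (Gt l)) : IsCurrentBase q ρ Wp Wn Gt G where
  W0_Wp k := by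
    have := H.Wn_W1 k
    rw [Ring.lie_def] at this ⊢
    linear_combination (norm := module) -this
  Wn_W1 k := by
    have := H.W0_Wp k
    rw [Ring.lie_def] at this ⊢
    linear_combination (norm := module) -this
  W0_G := H.W1_Gt
  Gt_W0 := H.G_W1
  G_W1 := H.Gt_W0
  W1_Gt := H.W0_G
  W0_Wn := H.W1_Wp
  W1_Wp := H.W0_Wn
  G_G := hGt

/-- The elements `W₀` and `W₁` satisfy the first `q`-Dolan–Grady relation: `W₋₁` is expressed
through `W₀`, `W₁` and `G₁`, and commutes with `W₀`. -/
theorem IsCurrentBase.dolanGrady (hq' : q + q⁻¹ ≠ 0) (H : IsCurrentBase q ρ Wn Wp G Gt) :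
    DolanGrady q ρ (Wn 0) (Wp 0) := by
  have e1 := H.W0_Wp 0
  have e2 := H.W0_G 0
  have e3 := H.Gt_W0 0
  have e4 := (H.W0_Wn 1).eq
  set X := Wn 0
  set Y := Wp 0
  rw [Ring.lie_def] at e1
  have hGt : Gt 0 = G 0 + (q + q⁻¹) • (X * Y - Y * X) := by
    rw [e1, smul_smul, mul_inv_cancel₀ hq', one_smul, add_sub_cancel]
  have hG : X * G 0 - G 0 * X = q • ((X * Y - Y * X) * X) - q⁻¹ • (X * (X * Y - Y * X)) := by
    rw [← sub_eq_zero]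
    refine (smul_eq_zero_iff_right hq').mp ?_
    have := e2.trans e3.symm
    rw [hGt] at this
    simp only [qComm, mul_add, add_mul, mul_smul_comm, smul_mul_assoc] at this
    linear_combination (norm := module) this
  have h1 := congrArg (fun t => X * t - t * X) e2
  have h2 := congrArg (fun t => q • (X * t) - q⁻¹ • (t * X)) hG
  simp only [qComm, mul_sub, sub_mul, mul_smul_comm, smul_mul_assoc, mul_assoc, smul_sub] at h1 h2
  rw [DolanGrady]
  simp only [qComm, Ring.lie_def, mul_sub, sub_mul, mul_smul_comm, smul_mul_assoc, mul_assoc,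
    smul_sub, inv_inv]
  linear_combination (norm := module) h2 - h1 - ρ • e4

theorem IsCurrentBase.map {T : Type*} [Ring T] [Algebra ℂ T] (f : S →ₐ[ℂ] T)
    (H : IsCurrentBase q ρ Wn Wp G Gt) :
    IsCurrentBase q ρ (fun k => f (Wn k)) (fun k => f (Wp k)) (fun k => f (G k))
      (fun k => f (Gt k)) := by
  constructor
  · intro k
    simpa only [Ring.lie_def, map_sub, map_mul, map_smul] using congrArg f (H.W0_Wp k)
  · intro k
    simpa only [Ring.lie_def, map_sub, map_mul, map_smul] using congrArg f (H.Wn_W1 k)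
  · intro k
    simpa only [qComm, map_sub, map_mul, map_smul] using congrArg f (H.W0_G k)
  · intro k
    simpa only [qComm, map_sub, map_mul, map_smul] using congrArg f (H.Gt_W0 k)
  · intro k
    simpa only [qComm, map_sub, map_mul, map_smul] using congrArg f (H.G_W1 k)
  · intro k
    simpa only [qComm, map_sub, map_mul, map_smul] using congrArg f (H.W1_Gt k)
  · exact fun k => (H.W0_Wn k).map f
  · exact fun k => (H.W1_Wp k).map f
  · exact fun k l => (H.G_G k l).map f

open CurGen in
/-- The generators of `𝒜_q` satisfy the relations of `IsCurrentBase`. -/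
theorem Aq.isCurrentBase (q ρ : ℂ) : IsCurrentBase q ρ (fun k => Aq.gen q ρ (Wneg k))
    (fun k => Aq.gen q ρ (Wpos k)) (fun k => Aq.gen q ρ (CurGen.G k))
    (fun k => Aq.gen q ρ (CurGen.Gt k)) := by
  constructor
  · intro k
    simpa only [Aq.gen, Ring.lie_def, map_sub, map_mul, map_smul] using
      RingQuot.mkAlgHom_rel ℂ (CurRel.W0_Wpos (q := q) (ρ := ρ) k)
  · intro k
    simpa only [Aq.gen, Ring.lie_def, map_sub, map_mul, map_smul] using
      RingQuot.mkAlgHom_rel ℂ (CurRel.Wneg_W1 (q := q) (ρ := ρ) k)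
  · intro k
    simpa only [Aq.gen, qComm, map_sub, map_mul, map_smul] using
      RingQuot.mkAlgHom_rel ℂ (CurRel.W0_G (q := q) (ρ := ρ) k)
  · intro k
    simpa only [Aq.gen, qComm, map_sub, map_mul, map_smul] using
      RingQuot.mkAlgHom_rel ℂ (CurRel.Gt_W0 (q := q) (ρ := ρ) k)
  · intro k
    simpa only [Aq.gen, qComm, map_sub, map_mul, map_smul] using
      RingQuot.mkAlgHom_rel ℂ (CurRel.G_W1 (q := q) (ρ := ρ) k)
  · intro k
    simpa only [Aq.gen, qComm, map_sub, map_mul, map_smul] using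
      RingQuot.mkAlgHom_rel ℂ (CurRel.W1_Gt (q := q) (ρ := ρ) k)
  · intro k
    have := RingQuot.mkAlgHom_rel ℂ (CurRel.Wneg_Wneg (q := q) (ρ := ρ) 0 k)
    rw [Ring.lie_def, map_sub, map_zero, map_mul, map_mul] at this
    exact sub_eq_zero.1 this
  · intro k
    have := RingQuot.mkAlgHom_rel ℂ (CurRel.Wpos_Wpos (q := q) (ρ := ρ) 0 k)
    rw [Ring.lie_def, map_sub, map_zero, map_mul, map_mul] at this
    exact sub_eq_zero.1 this
  · intro k l
    have := RingQuot.mkAlgHom_rel ℂ (CurRel.G_G (q := q) (ρ := ρ) k l)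
    rw [Ring.lie_def, map_sub, map_zero, map_mul, map_mul] at this
    exact sub_eq_zero.1 this

theorem Aq.commute_Gt (q ρ : ℂ) (k l : ℕ) :
    Commute (Aq.gen q ρ (CurGen.Gt k)) (Aq.gen q ρ (CurGen.Gt l)) := by
  have := RingQuot.mkAlgHom_rel ℂ (CurRel.Gt_Gt (q := q) (ρ := ρ) k l)
  rw [Ring.lie_def, map_sub, map_zero, map_mul, map_mul] at this
  exact sub_eq_zero.1 this

/-- The images of the generators of the `q`-Onsager algebra. -/
def onsGenImage (X Y : S) : OnsGen → S
  | OnsGen.A => X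
  | OnsGen.Astar => Y

/-- The universal property of the `q`-Onsager algebra. -/
theorem QOnsager.exists_algHom {X Y : S} (h1 : DolanGrady q ρ X Y) (h2 : DolanGrady q ρ Y X) :
    ∃ f : QOnsager q ρ →ₐ[ℂ] S, f (QOnsager.A q ρ) = X ∧ f (QOnsager.Astar q ρ) = Y := by
  have hrel : ∀ ⦃x y : FreeAlgebra ℂ OnsGen⦄, OnsRel q ρ x y →
      FreeAlgebra.lift ℂ (onsGenImage X Y) x = FreeAlgebra.lift ℂ (onsGenImage X Y) y := by
    intro x y h
    cases h
    · simpa only [DolanGrady, qComm, Ring.lie_def, map_sub, map_mul, map_smul,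
        FreeAlgebra.lift_ι_apply, onsGenImage] using h1
    · simpa only [DolanGrady, qComm, Ring.lie_def, map_sub, map_mul, map_smul,
        FreeAlgebra.lift_ι_apply, onsGenImage] using h2
  refine ⟨RingQuot.liftAlgHom ℂ ⟨FreeAlgebra.lift ℂ (onsGenImage X Y), hrel⟩, ?_, ?_⟩
  · rw [QOnsager.A, RingQuot.liftAlgHom_mkAlgHom_apply, FreeAlgebra.lift_ι_apply, onsGenImage]
  · rw [QOnsager.Astar, RingQuot.liftAlgHom_mkAlgHom_apply, FreeAlgebra.lift_ι_apply, onsGenImage]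

theorem QOnsager.hom_ext {f g : QOnsager q ρ →ₐ[ℂ] S}
    (hA : f (QOnsager.A q ρ) = g (QOnsager.A q ρ))
    (hAstar : f (QOnsager.Astar q ρ) = g (QOnsager.Astar q ρ)) : f = g := by
  refine AlgHom.ext fun t => ?_
  induction t using QOnsager.induction with
  | hA => exact hA
  | hAstar => exact hAstar
  | halg r => rw [AlgHom.commutes, AlgHom.commutes]
  | hadd x y hx hy => rw [map_add, map_add, hx, hy]
  | hmul x y hx hy => rw [map_mul, map_mul, hx, hy]

end Homomorphisms

/-! ### Uniqueness of the intertwiner -/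

section Uniqueness

variable {S : Type*} [Ring S] [Algebra ℂ S] {q kp km : ℂ}

theorem commute_siteX {u : Sˣ} {f X : S} (hX : Commute f X) (hu : Commute f (u : S))
    (i j : Fin 2) : Commute f (siteX q kp km u X i j) := by
  have hu' := hu.units_inv_right
  fin_cases i <;> fin_cases j
  · exact hX.smul_right q
  · exact hu.smul_right kp
  · exact hu'.smul_right km
  · exact hX.smul_right q⁻¹

theorem commute_siteY {u : Sˣ} {f Y : S} (hY : Commute f Y) (hu : Commute f (u : S))
    (i j : Fin 2) : Commute f (siteY q kp km u Y i j) := by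
  have hu' := hu.units_inv_right
  fin_cases i <;> fin_cases j
  · exact hY.smul_right q⁻¹
  · exact hu'.smul_right kp
  · exact hu.smul_right km
  · exact hY.smul_right q

/-- Multiplying an intertwiner from the left by a series `f` that commutes with `X` and `Y` gives
an intertwiner. -/
theorem IsSeqIntertwiner.smul_matrix {X Y : S} {K : LaurentMatrix S}
    (h : IsSeqIntertwiner q kp km (LinearMap.mulLeft ℂ X) (LinearMap.mulRight ℂ X)
        (LinearMap.mulLeft ℂ Y) (LinearMap.mulRight ℂ Y) (fun n => (K 0 0).coeff n)
        (fun n => (K 0 1).coeff n) (fun n => (K 1 0).coeff n) (fun n => (K 1 1).coeff n))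
    {f : Laurent S} (hX : ∀ n, Commute (f.coeff n) X) (hY : ∀ n, Commute (f.coeff n) Y) :
    IsSeqIntertwiner q kp km (LinearMap.mulLeft ℂ X) (LinearMap.mulRight ℂ X)
        (LinearMap.mulLeft ℂ Y) (LinearMap.mulRight ℂ Y) (fun n => ((f • K) 0 0).coeff n)
        (fun n => ((f • K) 0 1).coeff n) (fun n => ((f • K) 1 0).coeff n)
        (fun n => ((f • K) 1 1).coeff n) := by
  obtain ⟨h1, h2⟩ := isSeqIntertwiner_iff.1 h
  have hC : ∀ {Z : S}, (∀ n, Commute (f.coeff n) Z) → Commute f (HahnSeries.C Z) := by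
    intro Z hZ
    ext n
    rw [coeff_mul_C, coeff_C_mul, (hZ n).eq]
  have hu : Commute f (((formalVar S)⁻¹ : (Laurent S)ˣ) : Laurent S) :=
    (formalVar_commute f).symm.units_inv_right
  have mv : ∀ {M N : LaurentMatrix S}, (∀ i j, Commute f (M i j)) → M * (f • N) = f • (M * N) := by
    intro M N hM
    ext1 i j
    simp only [Matrix.mul_apply, Matrix.smul_apply, smul_eq_mul, Finset.mul_sum, ← mul_assoc,
      (hM i _).eq]
  exact isSeqIntertwiner_iff.2
    ⟨by rw [Matrix.smul_mul, h1, mv (commute_siteX (hC hX) hu)],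
      by rw [Matrix.smul_mul, h2, mv (commute_siteY (hC hY) hu)]⟩

end Uniqueness

section Multiplier

/-- A Laurent series of order `0` with invertible leading coefficient is a unit. -/
theorem isUnit_of_coeff_zero {S : Type*} [Ring S] {f : Laurent S} (h : ∀ n < 0, f.coeff n = 0)
    (h0 : IsUnit (f.coeff 0)) : IsUnit f := by
  obtain ⟨u, hu⟩ := h0
  set g : PowerSeries S := PowerSeries.mk fun n => f.coeff n with hg
  have hf : HahnSeries.ofPowerSeries ℤ S g = f := by
    ext n
    rcases lt_or_ge n 0 with hn | hn
    · rw [h n hn]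
      apply HahnSeries.embDomain_of_notMem_range
      rintro ⟨m, hm⟩
      have : (m : ℤ) = n := hm
      omega
    · obtain ⟨m, rfl⟩ := Int.eq_ofNat_of_zero_le hn
      rw [HahnSeries.ofPowerSeries_apply_coeff, hg, PowerSeries.coeff_mk]
  have hc : PowerSeries.constantCoeff g = u := by
    rw [← PowerSeries.coeff_zero_eq_constantCoeff_apply, hg, PowerSeries.coeff_mk, hu]
    rfl
  rw [← hf]
  exact IsUnit.map _ ⟨⟨g, g.invOfUnit u, g.mul_invOfUnit u hc, g.invOfUnit_mul u hc⟩, rfl⟩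

/-- The coefficients of a product up to the sum of the lowest degrees of its factors. -/
theorem coeff_mul_of_le {S : Type*} [Ring S] {f g : Laurent S} {N : ℤ}
    (hf : ∀ n < N, f.coeff n = 0) (hg : ∀ n < 0, g.coeff n = 0) {n : ℤ} (hn : n ≤ N) :
    (f * g).coeff n = if n = N then f.coeff N * g.coeff 0 else 0 := by
  rw [HahnSeries.coeff_mul]
  have hle : ∀ ij ∈ Finset.antidiagonal f.isPWO_support g.isPWO_support n,
      N ≤ ij.1 ∧ 0 ≤ ij.2 ∧ ij.1 + ij.2 = n := by
    intro ij hij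
    rw [Finset.mem_antidiagonal] at hij
    refine ⟨?_, ?_, hij.2.2⟩
    · by_contra h
      exact hij.1 (hf _ (not_le.1 h))
    · by_contra h
      exact hij.2.1 (hg _ (not_le.1 h))
  split_ifs with h
  · subst h
    refine Finset.sum_eq_single (n, 0) (fun ij hij hne => ?_) fun hij => ?_
    · obtain ⟨h1, h2, h3⟩ := hle ij hij
      exact absurd (Prod.ext (by simp; omega) (by simp; omega)) hne
    · rw [Finset.mem_antidiagonal] at hij
      by_cases h1 : f.coeff n = 0
      · rw [h1, zero_mul]
      · by_cases h2 : g.coeff 0 = 0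
        · rw [h2, mul_zero]
        · exact absurd ⟨h1, h2, add_zero n⟩ hij
  · refine Finset.sum_eq_zero fun ij hij => ?_
    obtain ⟨h1, h2, h3⟩ := hle ij hij
    omega

variable {S : Type*} [Ring S] [Algebra ℂ S] {q kp km : ℂ}

/-- Every intertwiner is a left multiple of a given one whose upper right entry is invertible. The
multiplier is determined by the upper right entries; the lowest coefficient of an upper right entry
commutes with the generators, and subtracting the corresponding multiple exposes the next
coefficient of the multiplier. -/
theorem IsSeqIntertwiner.exists_eq_smul (hq' : q + q⁻¹ ≠ 0) (hkp : kp ≠ 0) (hkm : km ≠ 0) {X Y : S}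
    {K₀ K : LaurentMatrix S}
    (h₀ : IsSeqIntertwiner q kp km (LinearMap.mulLeft ℂ X) (LinearMap.mulRight ℂ X)
        (LinearMap.mulLeft ℂ Y) (LinearMap.mulRight ℂ Y) (fun n => (K₀ 0 0).coeff n)
        (fun n => (K₀ 0 1).coeff n) (fun n => (K₀ 1 0).coeff n) (fun n => (K₀ 1 1).coeff n))
    (h : IsSeqIntertwiner q kp km (LinearMap.mulLeft ℂ X) (LinearMap.mulRight ℂ X)
        (LinearMap.mulLeft ℂ Y) (LinearMap.mulRight ℂ Y) (fun n => (K 0 0).coeff n)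
        (fun n => (K 0 1).coeff n) (fun n => (K 1 0).coeff n) (fun n => (K 1 1).coeff n))
    (hneg : ∀ n < 0, (K₀ 0 1).coeff n = 0) {z : ℂ} (hz : z ≠ 0)
    (hzero : (K₀ 0 1).coeff 0 = z • 1) :
    ∃ f : Laurent S, (∀ n, Commute (f.coeff n) X ∧ Commute (f.coeff n) Y) ∧ K = f • K₀ := by
  obtain ⟨b, hb⟩ := isUnit_of_coeff_zero hneg (by
    rw [hzero, ← Algebra.algebraMap_eq_smul_one]
    exact (isUnit_iff_ne_zero.2 hz).map _)
  set f : Laurent S := K 0 1 * ((b⁻¹ : (Laurent S)ˣ) : Laurent S) with hf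
  have hfb : f * K₀ 0 1 = K 0 1 := by rw [← hb, hf, Units.inv_mul_cancel_right]
  have bound : ∀ K' : LaurentMatrix S, ∃ m : ℤ, (∀ n < m, (K' 0 0).coeff n = 0) ∧
      ∀ n < m, (K' 1 1).coeff n = 0 := by
    intro K'
    obtain ⟨m, hm⟩ := exists_forall_coeff_eq_zero fun i => K' i i
    exact ⟨m, hm 0, hm 1⟩
  obtain ⟨m, hm⟩ := exists_forall_coeff_eq_zero fun _ : Unit => f
  replace hm := hm ()
  have hcomm : ∀ k : ℕ, ∀ n < m + k, Commute (f.coeff n) X ∧ Commute (f.coeff n) Y := by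
    intro k
    induction k with
    | zero =>
      intro n hn
      rw [hm n (by simpa using hn)]
      exact ⟨Commute.zero_left _, Commute.zero_left _⟩
    | succ k ih =>
      intro n hn
      rcases lt_or_eq_of_le (show n ≤ m + k by push_cast at hn; omega) with hn' | rfl
      · exact ih n hn'
      -- `t` is the part of `f` of order less than `m + k`
      set t : Laurent S := ∑ j ∈ Finset.Ico m (m + k), HahnSeries.single j (f.coeff j) with ht
      have htc : ∀ n, t.coeff n = if n < m + k then f.coeff n else 0 := by
        intro n
        rw [ht, HahnSeries.coeff_sum]
        by_cases h1 : n ∈ Finset.Ico m (m + k)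
        · rw [Finset.sum_eq_single_of_mem n h1 fun j _ hj => HahnSeries.coeff_single_of_ne hj.symm,
            HahnSeries.coeff_single_same, if_pos (Finset.mem_Ico.1 h1).2]
        · rw [Finset.sum_eq_zero fun j hj => HahnSeries.coeff_single_of_ne
            fun e : n = j => h1 (by rw [e]; exact hj)]
          split_ifs with h2
          · rw [hm n (not_le.1 fun h3 => h1 (Finset.mem_Ico.2 ⟨h3, h2⟩))]
          · rfl
      have hcm : ∀ {Z : S}, (∀ n < m + k, Commute (f.coeff n) Z) → ∀ n, Commute (t.coeff n) Z := by
        intro Z hZ n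
        rw [htc]
        split_ifs with hn
        · exact hZ n hn
        · exact Commute.zero_left _
      have hs := h.sub (h₀.smul_matrix (f := t) (hcm fun n hn => (ih n hn).1)
        (hcm fun n hn => (ih n hn).2))
      obtain ⟨m', ha, hd⟩ := bound (K - t • K₀)
      have hr : ∀ n, ((f - t) * K₀ 0 1).coeff n = (K 0 1).coeff n - ((t • K₀) 0 1).coeff n := by
        intro n
        rw [sub_mul, hfb]
        rfl
      have hft : ∀ n < m + k, (f - t).coeff n = 0 := by
        intro n hn
        rw [HahnSeries.coeff_sub, htc, if_pos hn, sub_self]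
      have hprod : ∀ n ≤ m + k, ((f - t) * K₀ 0 1).coeff n =
          if n = m + k then z • f.coeff (m + k) else 0 := by
        intro n hn
        rw [coeff_mul_of_le hft hneg hn, hzero, HahnSeries.coeff_sub, htc,
          if_neg (lt_irrefl _), sub_zero, mul_smul_comm, mul_one]
      have hlow := hs.lowest hq' hkp hkm (m := m') (fun n hn => ha n hn) (fun n hn => hd n hn)
        (n₀ := m + k) (fun n hn => by
          change (K 0 1).coeff n - ((t • K₀) 0 1).coeff n = 0
          rw [← hr, hprod n hn.le, if_neg hn.ne])
      have hval : (K 0 1).coeff (m + k) - ((t • K₀) 0 1).coeff (m + k) = z • f.coeff (m + k) := by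
        rw [← hr, hprod _ le_rfl, if_pos rfl]
      obtain ⟨-, -, lX, lY⟩ := hlow
      have lX' : X * (z • f.coeff (m + k)) = (z • f.coeff (m + k)) * X := by rw [← hval]; exact lX
      have lY' : Y * (z • f.coeff (m + k)) = (z • f.coeff (m + k)) * Y := by rw [← hval]; exact lY
      rw [mul_smul_comm, smul_mul_assoc] at lX' lY'
      exact ⟨(smul_right_injective S hz lX').symm, (smul_right_injective S hz lY').symm⟩
  have hf' : ∀ n, Commute (f.coeff n) X ∧ Commute (f.coeff n) Y := fun n =>
    hcomm (n - m + 1).toNat n (by omega)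
  refine ⟨f, hf', ?_⟩
  have hs := h.sub (h₀.smul_matrix (f := f) (fun n => (hf' n).1) (fun n => (hf' n).2))
  obtain ⟨m', ha, hd⟩ := bound (K - f • K₀)
  have hb0 : (fun n => (K 0 1).coeff n) - (fun n => ((f • K₀) 0 1).coeff n) = 0 := by
    funext n
    change (K 0 1).coeff n - (f * K₀ 0 1).coeff n = 0
    rw [hfb, sub_self]
  obtain ⟨e1, e2, e3⟩ := hs.eq_zero hq' hkp hkm (m := m') (fun n hn => ha n hn)
    (fun n hn => hd n hn) hb0
  ext i j n
  fin_cases i <;> fin_cases j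
  · exact sub_eq_zero.1 (congrFun e1 n)
  · exact sub_eq_zero.1 (congrFun hb0 n)
  · exact sub_eq_zero.1 (congrFun e2 n)
  · exact sub_eq_zero.1 (congrFun e3 n)

end Multiplier

/-! ### The proposition for given parameters -/

namespace Params

variable (p : Params)

theorem q_add_inv_ne_zero : p.q + p.q⁻¹ ≠ 0 := by
  intro h
  have hq := p.q_ne_zero
  have h1 : p.q ^ 2 + 1 = 0 := by
    field_simp at h
    linear_combination h
  exact p.q_pow_ne_one 4 (by norm_num) (by linear_combination (p.q ^ 2 - 1) * h1)

theorem q_sub_inv_ne_zero : p.q - p.q⁻¹ ≠ 0 := by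
  intro h
  have hq := p.q_ne_zero
  field_simp at h
  exact p.q_pow_ne_one 2 (by norm_num) (by linear_combination h)

theorem rho_ne_zero : p.rho ≠ 0 :=
  mul_ne_zero (mul_ne_zero p.kp_ne_zero p.km_ne_zero) (pow_ne_zero 2 p.q_add_inv_ne_zero)

/-- The homomorphism from the `q`-Onsager algebra to `𝒜_q`. -/
theorem exists_toAq : ∃ ι : QOnsager p.q p.rho →ₐ[ℂ] Aq p.q p.rho,
    ι (QOnsager.A p.q p.rho) = Aq.gen p.q p.rho (CurGen.Wneg 0) ∧
      ι (QOnsager.Astar p.q p.rho) = Aq.gen p.q p.rho (CurGen.Wpos 0) :=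
  QOnsager.exists_algHom ((Aq.isCurrentBase _ _).dolanGrady p.q_add_inv_ne_zero)
    (((Aq.isCurrentBase _ _).swap (Aq.commute_Gt _ _)).dolanGrady p.q_add_inv_ne_zero)

variable {S : Type*} [Ring S] [Algebra ℂ S]

/-- Every representation of the `q`-Onsager algebra extends to `𝒜_q`. -/
theorem exists_extension (φ : QOnsager p.q p.rho →ₐ[ℂ] S) :
    ∃ Φ : Aq p.q p.rho →ₐ[ℂ] S,
      Φ (Aq.gen p.q p.rho (CurGen.Wneg 0)) = φ (QOnsager.A p.q p.rho) ∧
      Φ (Aq.gen p.q p.rho (CurGen.Wpos 0)) = φ (QOnsager.Astar p.q p.rho) := by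
  have h1 : DolanGrady p.q p.rho (φ (QOnsager.A p.q p.rho)) (φ (QOnsager.Astar p.q p.rho)) := by
    simpa only [DolanGrady, qComm, Ring.lie_def, map_sub, map_mul, map_smul] using
      congrArg φ (QOnsager.dolanGrady_left (q := p.q) (ρ := p.rho))
  have h2 : DolanGrady p.q p.rho (φ (QOnsager.Astar p.q p.rho)) (φ (QOnsager.A p.q p.rho)) := by
    simpa only [DolanGrady, qComm, Ring.lie_def, map_sub, map_mul, map_smul] using
      congrArg φ (QOnsager.dolanGrady_right (q := p.q) (ρ := p.rho))
  obtain ⟨Wn, Wp, G, Gt, hX, hY, H⟩ := exists_isCurrentBase p.q_ne_zero p.q_pow_ne_one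
    p.rho_ne_zero p.q_add_inv_ne_zero p.q_sub_inv_ne_zero h1 h2
  refine ⟨RingQuot.liftAlgHom ℂ ⟨FreeAlgebra.lift ℂ (curGenImage Wn Wp G Gt),
    fun x y h => H.curRel p.q_ne_zero p.q_add_inv_ne_zero p.q_sub_inv_ne_zero p.kp_ne_zero
      p.km_ne_zero h⟩, ?_, ?_⟩
  · rw [Aq.gen, RingQuot.liftAlgHom_mkAlgHom_apply, FreeAlgebra.lift_ι_apply, curGenImage, hX]
  · rw [Aq.gen, RingQuot.liftAlgHom_mkAlgHom_apply, FreeAlgebra.lift_ι_apply, curGenImage, hY]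

variable {φ : QOnsager p.q p.rho →ₐ[ℂ] S} {Φ : Aq p.q p.rho →ₐ[ℂ] S}

theorem isIntertwiner_iff_isSeqIntertwiner (K : LaurentMatrix S) :
    p.IsIntertwiner φ K ↔ IsSeqIntertwiner p.q p.kp p.km
      (LinearMap.mulLeft ℂ (φ (QOnsager.A p.q p.rho)))
      (LinearMap.mulRight ℂ (φ (QOnsager.A p.q p.rho)))
      (LinearMap.mulLeft ℂ (φ (QOnsager.Astar p.q p.rho)))
      (LinearMap.mulRight ℂ (φ (QOnsager.Astar p.q p.rho))) (fun n => (K 0 0).coeff n)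
      (fun n => (K 0 1).coeff n) (fun n => (K 1 0).coeff n) (fun n => (K 1 1).coeff n) :=
  (p.isIntertwiner_iff φ K).trans isSeqIntertwiner_iff.symm

theorem isIntertwiner_KMatrix
    (hA : Φ (Aq.gen p.q p.rho (CurGen.Wneg 0)) = φ (QOnsager.A p.q p.rho))
    (hAstar : Φ (Aq.gen p.q p.rho (CurGen.Wpos 0)) = φ (QOnsager.Astar p.q p.rho)) :
    p.IsIntertwiner φ (p.KMatrix Φ) := by
  rw [isIntertwiner_iff_isSeqIntertwiner, ← hA, ← hAstar, p.KMatrix_eq]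
  exact ((Aq.isCurrentBase p.q p.rho).map Φ).isSeqIntertwiner p.q_ne_zero p.q_add_inv_ne_zero
    p.q_sub_inv_ne_zero p.kp_ne_zero p.km_ne_zero

theorem reflectionEquation_KMatrix (Φ : Aq p.q p.rho →ₐ[ℂ] S) :
    ReflectionEquation p.q (p.KMatrix Φ) :=
  ((Aq.isCurrentBase p.q p.rho).map Φ).reflectionEquation p.q_ne_zero p.q_add_inv_ne_zero
    p.q_sub_inv_ne_zero p.kp_ne_zero p.km_ne_zero

/-- The currents start in degree two, so the upper right entry of `K(u)` begins with a non-zero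
scalar. -/
theorem coeff_KMatrix (Φ : Aq p.q p.rho →ₐ[ℂ] S) {n : ℤ} (hn : n < 2) :
    (p.KMatrix Φ 0 1).coeff n =
      (p.kp * (p.q + p.q⁻¹) / (p.q - p.q⁻¹)) • (if n = 0 then 1 else 0) := by
  rw [p.KMatrix_eq, coeff_curMatrix₀₁,
    coeff_current_of_neg p.q_ne_zero p.q_add_inv_ne_zero _ hn, smul_zero, zero_add]

theorem KMatrix_scalar_ne_zero : p.kp * (p.q + p.q⁻¹) / (p.q - p.q⁻¹) ≠ 0 :=
  div_ne_zero (mul_ne_zero p.kp_ne_zero p.q_add_inv_ne_zero) p.q_sub_inv_ne_zero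

theorem KMatrix_ne_zero [Nontrivial S] (Φ : Aq p.q p.rho →ₐ[ℂ] S) : p.KMatrix Φ ≠ 0 := by
  intro h
  have h1 := p.coeff_KMatrix Φ (n := 0) (by norm_num)
  rw [h, if_pos rfl] at h1
  exact smul_ne_zero p.KMatrix_scalar_ne_zero (one_ne_zero (α := S)) h1.symm

/-- The intertwiners are the multiples of `K(u)` by series that commute with the `q`-Onsager
algebra. -/
theorem isIntertwiner_iff_exists_smul
    (hA : Φ (Aq.gen p.q p.rho (CurGen.Wneg 0)) = φ (QOnsager.A p.q p.rho))
    (hAstar : Φ (Aq.gen p.q p.rho (CurGen.Wpos 0)) = φ (QOnsager.Astar p.q p.rho))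
    (K : LaurentMatrix S) :
    p.IsIntertwiner φ K ↔ ∃ f : Laurent S, (∀ n t, Commute (f.coeff n) (φ t)) ∧
      K = f • p.KMatrix Φ := by
  have h₀ := (p.isIntertwiner_iff_isSeqIntertwiner _).1 (p.isIntertwiner_KMatrix hA hAstar)
  rw [isIntertwiner_iff_isSeqIntertwiner]
  constructor
  · intro h
    obtain ⟨f, hf, rfl⟩ := h₀.exists_eq_smul p.q_add_inv_ne_zero p.kp_ne_zero p.km_ne_zero h
      (fun n hn => by rw [p.coeff_KMatrix Φ (by omega), if_neg hn.ne, smul_zero])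
      p.KMatrix_scalar_ne_zero (by rw [p.coeff_KMatrix Φ (by norm_num), if_pos rfl])
    refine ⟨f, fun n t => ?_, rfl⟩
    induction t using QOnsager.induction with
    | hA => exact (hf n).1
    | hAstar => exact (hf n).2
    | halg r => rw [AlgHom.commutes]; exact Algebra.commutes' r _ |>.symm
    | hadd x y hx hy => rw [map_add]; exact hx.add_right hy
    | hmul x y hx hy => rw [map_mul]; exact hx.mul_right hy
  · rintro ⟨f, hf, rfl⟩
    exact h₀.smul_matrix (fun n => hf n _) (fun n => hf n _)

/-- Scalar multiples of `K(u)` satisfy the reflection equation, since the coefficients of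
their upper right entry still commute. -/
theorem reflectionEquation_smul_KMatrix
    (hA : Φ (Aq.gen p.q p.rho (CurGen.Wneg 0)) = φ (QOnsager.A p.q p.rho))
    (hAstar : Φ (Aq.gen p.q p.rho (CurGen.Wpos 0)) = φ (QOnsager.Astar p.q p.rho))
    (c : Laurent ℂ) :
    ReflectionEquation p.q ((c.map (algebraMap ℂ S) : Laurent S) • p.KMatrix Φ) := by
  have hint := (p.isIntertwiner_iff_exists_smul hA hAstar _).2
    ⟨(c.map (algebraMap ℂ S) : Laurent S), fun n t => Algebra.commutes (c.coeff n) (φ t), rfl⟩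
  obtain ⟨hX, hY⟩ := (p.isIntertwiner_iff φ _).1 hint
  refine reflectionEquation_of_commute p.q_ne_zero p.q_add_inv_ne_zero p.kp_ne_zero p.km_ne_zero
    hX hY fun m n => ?_
  have hb : ∀ m n, Commute ((p.KMatrix Φ 0 1).coeff m) ((p.KMatrix Φ 0 1).coeff n) :=
    curMatrix₀₁_commute p.q_ne_zero p.q_add_inv_ne_zero
      ((Aq.isCurrentBase p.q p.rho).map Φ).G_G
  rw [Matrix.smul_apply, smul_eq_mul, HahnSeries.coeff_mul, HahnSeries.coeff_mul]
  refine Commute.sum_left _ _ _ fun i _ => Commute.sum_right _ _ _ fun j _ => ?_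
  have hc : ∀ k s, Commute ((c.map (algebraMap ℂ S) : Laurent S).coeff k) s := fun k s =>
    Algebra.commutes (c.coeff k) s
  exact ((hc _ _).mul_left (Commute.mul_right (hc _ _).symm (hb _ _)))

end Params

end QOns
end

theorem mainTheorem4 (p : QOns.Params) :
    ∃ ι : QOns.QOnsager p.q p.rho →ₐ[ℂ] QOns.Aq p.q p.rho,
      ι (QOns.QOnsager.A p.q p.rho) = QOns.Aq.gen p.q p.rho (QOns.CurGen.Wneg 0) ∧
      ι (QOns.QOnsager.Astar p.q p.rho) = QOns.Aq.gen p.q p.rho (QOns.CurGen.Wpos 0) ∧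
      ∀ (W : Type*) [AddCommGroup W] [Module ℂ W]
        (φ : QOns.QOnsager p.q p.rho →ₐ[ℂ] Module.End ℂ W),
        (∃ Φ : QOns.Aq p.q p.rho →ₐ[ℂ] Module.End ℂ W, Φ.comp ι = φ) ∧
        ∀ Φ : QOns.Aq p.q p.rho →ₐ[ℂ] Module.End ℂ W, Φ.comp ι = φ →
          p.IsIntertwiner φ (p.KMatrix Φ) ∧
          (Nontrivial W → p.KMatrix Φ ≠ 0) ∧
          QOns.ReflectionEquation p.q (p.KMatrix Φ) ∧
          (∀ K : QOns.LaurentMatrix (Module.End ℂ W),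
            p.IsIntertwiner φ K ↔
              ∃ f : QOns.Laurent (Module.End ℂ W),
                (∀ (n : ℤ) (t : QOns.QOnsager p.q p.rho), Commute (f.coeff n) (φ t)) ∧
                K = f • p.KMatrix Φ) ∧
          (QOns.IsIrreducible φ →
            ∀ K : QOns.LaurentMatrix (Module.End ℂ W),
              p.IsIntertwiner φ K ↔
                ∃ c : QOns.Laurent ℂ,
                  K = (c.map (algebraMap ℂ (Module.End ℂ W)) :
                    QOns.Laurent (Module.End ℂ W)) • p.KMatrix Φ) ∧
          (QOns.IsIrreducible φ →
            ∀ K : QOns.LaurentMatrix (Module.End ℂ W),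
              p.IsIntertwiner φ K → QOns.ReflectionEquation p.q K) := by
  obtain ⟨ι, hA, hAstar⟩ := p.exists_toAq
  refine ⟨ι, hA, hAstar, fun W _ _ φ => ⟨?_, fun Φ hΦ => ?_⟩⟩
  · obtain ⟨Φ, h1, h2⟩ := p.exists_extension φ
    refine ⟨Φ, QOns.QOnsager.hom_ext ?_ ?_⟩
    · rw [AlgHom.comp_apply, hA, h1]
    · rw [AlgHom.comp_apply, hAstar, h2]
  · have h1 : Φ (QOns.Aq.gen p.q p.rho (QOns.CurGen.Wneg 0)) = φ (QOns.QOnsager.A p.q p.rho) := by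
      rw [← hA, ← hΦ, AlgHom.comp_apply]
    have h2 : Φ (QOns.Aq.gen p.q p.rho (QOns.CurGen.Wpos 0)) =
        φ (QOns.QOnsager.Astar p.q p.rho) := by
      rw [← hAstar, ← hΦ, AlgHom.comp_apply]
    have key := p.isIntertwiner_iff_exists_smul h1 h2
    have scalar : QOns.IsIrreducible φ → ∀ K : QOns.LaurentMatrix (Module.End ℂ W),
        p.IsIntertwiner φ K → ∃ c : QOns.Laurent ℂ,
          K = (c.map (algebraMap ℂ (Module.End ℂ W)) :
            QOns.Laurent (Module.End ℂ W)) • p.KMatrix Φ := by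
      intro hirr K hK
      obtain ⟨f, hf, rfl⟩ := (key K).1 hK
      choose z hz using fun n => hirr.exists_eq_algebraMap (hf n)
      have hW := hirr.1
      -- `algebraMap` is injective because `W` is non-trivial
      refine ⟨⟨z, f.isPWO_support.mono fun n hn h0 => hn ?_⟩, ?_⟩
      · rw [hz n] at h0
        exact (algebraMap ℂ (Module.End ℂ W)).injective (h0.trans (map_zero _).symm)
      · congr 1
        ext1
        exact funext hz
    refine ⟨p.isIntertwiner_KMatrix h1 h2, fun _ => p.KMatrix_ne_zero Φ,
      p.reflectionEquation_KMatrix Φ, key, fun hirr K => ⟨scalar hirr K, ?_⟩, fun hirr K hK => ?_⟩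
    · rintro ⟨c, rfl⟩
      exact (key _).2 ⟨c.map (algebraMap ℂ (Module.End ℂ W)),
        fun n t => Algebra.commutes (c.coeff n) (φ t), rfl⟩
    · obtain ⟨c, rfl⟩ := scalar hirr K hK
      exact p.reflectionEquation_smul_KMatrix h1 h2 c
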